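/- **Model.** Let $J$ and $r_1,\dots,r_J$ be fixed, and let $(N,T)\to\infty$ jointly along an arbitrary path. For $i\le N$, $t\le T$ let $x_t=\Lambda^0_{z_t}f^0_t+e_t\in\mathbb R^N$, where $z_t\in\{1,\dots,J\}$ is the unobserved regime, $\Lambda^0_j=(\lambda^0_{j1},\dots,\lambda^0_{jN})'$ is a nonrandom $N\times r_j$ matrix, $f^0_t\in\mathbb R^{r_{z_t}}$, and the process $(z_t)$ is independent of the errors $(e_{it})$ (it need not be Markov; loadings, states, factors and errors may form triangular arrays). Write $1_{tj}=1_{z_t=j}$, $\delta_{NT}=\min(\sqrt N,\sqrt T)$, $M_A$ for the orthogonal projection onto the orthogonal complement of the column space of $A$, and let $M<\infty$ be a constant. **Assumptions.** (A1) $\frac1{Tq_j}\sum_t f^0_tf^{0\prime}_t1_{tj}\to_p\Sigma_{F_j}$, positive definite. For every $c>0$, the minimum, over all subsets $A$ (random or not) of $\{t\le T:z_t=j\}$ with $|A|\ge cTq_j$, of the smallest eigenvalue of $\frac1{|A|}\sum_{t\in A}f^0_tf^{0\prime}_t$ is bounded away from zero in probability. For some $\alpha>16$, $\mathbb E\|f_t^0\|^\alpha\le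 M$. (A2a) $\frac1N\Lambda_j^{0\prime}\Lambda^0_j\to\Sigma_{\Lambda_j}$, positive definite; $\|\lambda^0_{ji}\|\le M$. (A2b) For some $C>0$, with probability approaching one, $\frac1N\|M_{\Lambda^0_k}\Lambda^0_jf^0_t\|^2\ge C$ for all $j\ne k$ and all $t\le T$ with $z_t=j$. (A3) $\mathbb Ee_{it}=0$, $\mathbb E|e_{it}|^\alpha\le M$; $|\mathbb E e_{it}e_{kt}|\le\tau_{ik}$ with $\sum_k\tau_{ik}\le M$; $|\mathbb Ee_{it}e_{is}|\le\gamma_{ts}$ with $\sum_s\gamma_{ts}\le M$; $\mathbb E|T^{-1/2}\sum_t(e_{it}e_{kt}-\mathbb Ee_{it}e_{kt})1_{tj}|^2\le M$. (A4) $\frac1T\sum_t1_{tj}\to_pq_j\in(0,1)$. (A5a) For some $\beta\ge2$, $\mathbb E\|N^{-1/2}\sum_i\lambda^0_{ji}e_{it}\|^\beta\le M$. (A5b) $\mathbb E\|T^{-1/2}\sum_tf^0_te_{it}1_{tj}\|^2\le M$. (A6) $\Sigma_{\Lambda_j}^{1/2}\Sigma_{F_j}\Sigma_{\Lambda_j}^{1/2}=\Upsilon_jV_j\Upsilon_j'$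 with $\Upsilon_j$ orthogonal and $V_j$ diagonal with strictly decreasing diagonal. (A7) $\mathbb E\|(NT)^{-1/2}\sum_{k,t}\lambda^0_{jk}(e_{it}e_{kt}-\mathbb Ee_{it}e_{kt})1_{tj}\|^2\le M$; $\mathbb E\|(NT)^{-1/2}\sum_{i,t}(e_{it}e_{is}-\mathbb Ee_{it}e_{is})f^0_t1_{tj}\|^2\le M$; $\mathbb E\|(NT)^{-1/2}\sum_{k,t}\lambda^0_{jk}f_t^{0\prime}e_{kt}1_{tj}\|^2\le M$; $(Tq_j)^{-1/2}\sum_tf^0_te_{it}1_{tj}\to_d\mathcal N(0,\Phi_{ji})$ for each $i,j$; $N^{-1/2}\sum_i\lambda^0_{ji}e_{it}\to_d\mathcal N(0,\Gamma_{jt})$ for each $t,j$. (R) $T^{16/\alpha}/N\to0$ and $T^{2/\alpha+2/\beta}/N\to0$. **Estimator.** Fix a transition matrix $Q$ ($Q_{jk}=\Pr(z_t=j\mid z_{t-1}=k)$) and an initial distribution $\phi$, with all entries positive (not necessarily the true ones). Let $$l(\Lambda,\sigma^2)=\log\sum_{z_1,\dots,z_T}\phi_{z_1}\prod_{t\ge2}Q_{z_tz_{t-1}}\prod_tL(x_t\mid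 z_t),$$ with $L(\cdot\mid z_t=j)$ the $\mathcal N(0,\Lambda_j\Lambda_j'+\sigma^2I_N)$ density. Let $\tilde\sigma^2>0$ be any random variables that are bounded and bounded away from zero in probability, and let $\tilde\Lambda$ maximize $l(\cdot,\tilde\sigma^2)$, normalized so that $\tilde\Lambda_j'\tilde\Lambda_j$ is diagonal with non-increasing diagonal. Let $\tilde p_{tj|T}$ be the smoothed probability of $z_t=j$ given $x_1,\dots,x_T$ in this Markov quasi-model at $(\tilde\Lambda,\tilde\sigma^2,Q,\phi)$, and $\tilde f_t=\sum_j\tilde p_{tj|T}\tilde\Lambda_j'(\tilde\Lambda_j\tilde\Lambda_j'+\tilde\sigma^2I_N)^{-1}x_t$ (vectors of different lengths are padded by zeros here and in (vi)). **Theorem.** (i) Under A1, A2a, A3, A4, for each $j$ there is a (random) index $\kappa(j)$ with $\frac1N\|M_{\tilde\Lambda_{\kappa(j)}}\Lambda^0_j\|_F^2=O_p(\delta_{NT}^{-1/2})$. If A2b holds as well, $\kappa$ may be taken to be a permutation that preserves the numbers of factors, and for such a relabelling of the estimated regimes (after which $\tilde\Lambda_j,\tilde p_{tj|T}$ carry the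 label of the true regime $j$): (ii) if A5a holds, then for all $j$ and $\eta>0$, $|\tilde p_{tj|T}-1_{tj}|=o_p(N^{-\eta})$ for each $t$, and under (R) $\sup_{t\le T}|\tilde p_{tj|T}-1_{tj}|=o_p(N^{-\eta})$. If moreover A5b, A6 and (R) hold, there is a choice of the signs of the columns of the $\tilde\Lambda_j$ such that, for all $j$: (iii) $\bar W_j=\bigl(\frac{\tilde\Lambda_j'\tilde\Lambda_j}N+\frac{\tilde\sigma^2}NI\bigr)\bigl(\frac1T\sum_t\tilde p_{tj|T}\bigr)\to_pq_jV_j$ and $\bar H_j=\frac{\sum_tf^0_tf^{0\prime}_t1_{tj}}T\frac{\Lambda_j^{0\prime}\tilde\Lambda_j}N\bar W_j^{-1}\to_p\Sigma_{\Lambda_j}^{-1/2}\Upsilon_jV_j^{1/2}$; (iv) $\frac1N\|\tilde\Lambda_j-\Lambda^0_j\bar H_j\|_F^2=O_p(\delta_{NT}^{-2})$; (v) under A7 and $\sqrt T/N\to0$, for each $i$, $\sqrt{Tq_j}(\tilde\lambda_{ji}-\bar H_j'\lambda^0_{ji})\to_d\mathcal N(0,V_j^{-1/2}\Upsilon_j'\Sigma_{\Lambda_j}^{1/2}\Phi_{ji}\Sigma_{\Lambda_j}^{1/2}\Upsilon_jV_j^{-1/2})$;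 (vi) under A7 and $\sqrt N/T\to0$, $\frac1T\sum_t\|\tilde f_t-\bar H_{z_t}^{-1}f^0_t\|^2=O_p(\delta_{NT}^{-2})$, and for each $t$, $\sqrt N(\tilde f_t-\bar H_{z_t}^{-1}f^0_t)$ is asymptotically mixed normal: conditionally on $z_t=k$ the limit law is $\mathcal N(0,V_k^{-1/2}\Upsilon_k'\Sigma_{\Lambda_k}^{-1/2}\Gamma_{kt}\Sigma_{\Lambda_k}^{-1/2}\Upsilon_kV_k^{-1/2})$. -/

import Mathlib

open MeasureTheory ProbabilityTheory Filter Topology Matrix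
open scoped ENNReal NNReal BoundedContinuousFunction

noncomputable section

namespace RegimeSwitching

/-! ### Stochastic orders -/

/-- `X n = O_p(a n)` as `n → ∞`. -/
def IsBigOp {Ω : Type*} [MeasurableSpace Ω] (P : Measure Ω) (X : ℕ → Ω → ℝ) (a : ℕ → ℝ) : Prop :=
  ∀ ε : ℝ, 0 < ε → ∃ C : ℝ, 0 < C ∧
    ∀ᶠ n in atTop, P {ω | C * a n < |X n ω|} ≤ ENNReal.ofReal ε

/-- `X n = o_p(a n)` as `n → ∞`. -/
def IsLittleOp {Ω : Type*} [MeasurableSpace Ω] (P : Measure Ω) (X : ℕ → Ω → ℝ) (a : ℕ → ℝ) :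
    Prop :=
  ∀ c : ℝ, 0 < c → Tendsto (fun n => P {ω | c * a n < |X n ω|}) atTop (𝓝 0)

/-- The positive variables `X n` are bounded, and bounded away from zero, in probability. -/
def BoundedAwayInProb {Ω : Type*} [MeasurableSpace Ω] (P : Measure Ω) (X : ℕ → Ω → ℝ) : Prop :=
  ∀ ε : ℝ, 0 < ε → ∃ C : ℝ, 0 < C ∧
    ∀ᶠ n in atTop, P {ω | X n ω < C⁻¹ ∨ C < X n ω} ≤ ENNReal.ofReal ε

/-! ### Linear algebra -/

/-- The squared Frobenius norm. -/
def frobSq {m k : ℕ} (A : Matrix (Fin m) (Fin k) ℝ) : ℝ := ∑ i, ∑ l, A i l ^ 2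

/-- The column space of a matrix. -/
def colSpace {m k : ℕ} (A : Matrix (Fin m) (Fin k) ℝ) : Submodule ℝ (EuclideanSpace ℝ (Fin m)) :=
  LinearMap.range (Matrix.toEuclideanLin A)

/-- `M_A = I - P_A`, where `P_A` is the orthogonal projection onto the column space of `A`;
`P_A = A (Aᵀ A)⁻¹ Aᵀ` when `A` has full column rank. -/
def annihilator {m k : ℕ} (A : Matrix (Fin m) (Fin k) ℝ) : Matrix (Fin m) (Fin m) ℝ :=
  1 - (Matrix.toEuclideanCLM (𝕜 := ℝ)).symm (colSpace A).starProjection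

/-- The largest of the numbers of factors. -/
def maxRank {J : ℕ} (r : Fin J → ℕ) : ℕ := Finset.univ.sup r

/-- Extension of a vector by zero coordinates (used to add up estimated factors of regimes that
have different numbers of factors; the identity if all these numbers agree). -/
def pad {k : ℕ} (m : ℕ) (v : Fin k → ℝ) : EuclideanSpace ℝ (Fin m) :=
  WithLp.toLp 2 fun l => if h : l.val < k then v ⟨l.val, h⟩ else 0

/-- Extension of a square matrix by zero rows and columns. -/
def padMatrix {k : ℕ} (m : ℕ) (A : Matrix (Fin k) (Fin k) ℝ) : Matrix (Fin m) (Fin m) ℝ :=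
  Matrix.of fun a b =>
    if h : a.val < k ∧ b.val < k then A ⟨a.val, h.1⟩ ⟨b.val, h.2⟩ else 0

/-! ### The Gaussian quasi-likelihood with Markov states -/

/-- `Λ Λᵀ + σ² I`. -/
def sigmaMat {m k : ℕ} (A : Matrix (Fin m) (Fin k) ℝ) (s2 : ℝ) : Matrix (Fin m) (Fin m) ℝ :=
  A * Aᵀ + s2 • (1 : Matrix (Fin m) (Fin m) ℝ)

/-- The `N(0, Λ Λᵀ + σ² I)` density at `x`. -/
def density {m k : ℕ} (A : Matrix (Fin m) (Fin k) ℝ) (s2 : ℝ) (x : Fin m → ℝ) : ℝ :=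
  (2 * Real.pi) ^ (-(m : ℝ) / 2) * (sigmaMat A s2).det ^ (-(1 / 2) : ℝ) *
    Real.exp (-(1 / 2) * (x ⬝ᵥ ((sigmaMat A s2)⁻¹ *ᵥ x)))

/-- The working transition matrix `Q` (`Q j k` is the probability of moving from state `k` to state
`j`) and initial distribution `φ` used in the quasi-likelihood; all entries are positive. They need
not be the true ones. -/
structure MarkovParam (J : ℕ) where
  Q : Matrix (Fin J) (Fin J) ℝ
  φ : Fin J → ℝ
  Q_pos : ∀ j k, 0 < Q j k
  Q_sum : ∀ k, ∑ j, Q j k = 1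
  φ_pos : ∀ k, 0 < φ k
  φ_sum : ∑ k, φ k = 1

/-- `Pr(z_1, …, z_T | Q, φ)`. -/
def MarkovParam.pathProb {J : ℕ} (θ : MarkovParam J) {T : ℕ} (s : Fin T → Fin J) : ℝ :=
  ∏ t : Fin T, if 0 < t.val
    then θ.Q (s t) (s ⟨t.val - 1, lt_of_le_of_lt (Nat.sub_le _ _) t.isLt⟩)
    else θ.φ (s t)

/-- The quasi-likelihood of the observations together with a state path. -/
def MarkovParam.joint {J : ℕ} (θ : MarkovParam J) {r : Fin J → ℕ} {N T : ℕ}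
    (L : (j : Fin J) → Matrix (Fin N) (Fin (r j)) ℝ) (s2 : ℝ) (x : Fin T → Fin N → ℝ)
    (s : Fin T → Fin J) : ℝ :=
  (∏ t, density (L (s t)) s2 (x t)) * θ.pathProb s

/-- The quasi-log-likelihood `l(Λ, σ², Q, φ)`. -/
def MarkovParam.logLik {J : ℕ} (θ : MarkovParam J) {r : Fin J → ℕ} {N T : ℕ}
    (L : (j : Fin J) → Matrix (Fin N) (Fin (r j)) ℝ) (s2 : ℝ) (x : Fin T → Fin N → ℝ) : ℝ :=
  Real.log (∑ s : Fin T → Fin J, θ.joint L s2 x s)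

/-- The smoothed regime probability `Pr(z_t = j | x_1, …, x_T; Λ, σ², Q, φ)`. -/
def MarkovParam.smoothed {J : ℕ} (θ : MarkovParam J) {r : Fin J → ℕ} {N T : ℕ}
    (L : (j : Fin J) → Matrix (Fin N) (Fin (r j)) ℝ) (s2 : ℝ) (x : Fin T → Fin N → ℝ)
    (t : Fin T) (j : Fin J) : ℝ :=
  (∑ s : Fin T → Fin J, if s t = j then θ.joint L s2 x s else 0) /
    ∑ s : Fin T → Fin J, θ.joint L s2 x s

/-! ### The model -/

/-- A factor model with regime switching in the loadings, observed along a path `(N n, T n)` of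
sample sizes that both tend to infinity. Series are indexed by `i < N n` and dates by `t < T n`.
All quantities may depend on `n` (so that, e.g., structural breaks at a fraction of the sample are
covered); the case of fixed arrays is the one where they do not.
`factor n j t` is the vector of factors at date `t` when the regime is `j`: only its value for the
current regime `j = state n t ω` matters, and it has the dimension `r j` of that regime. -/
structure Panel (Ω : Type*) [MeasurableSpace Ω] {J : ℕ} (r : Fin J → ℕ) where
  N : ℕ → ℕ
  T : ℕ → ℕ
  loading : ℕ → (j : Fin J) → ℕ → EuclideanSpace ℝ (Fin (r j))
  state : ℕ → ℕ → Ω → Fin J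
  factor : ℕ → (j : Fin J) → ℕ → Ω → EuclideanSpace ℝ (Fin (r j))
  error : ℕ → ℕ → ℕ → Ω → ℝ
  tendsto_N : Tendsto N atTop atTop
  tendsto_T : Tendsto T atTop atTop
  measurable_state : ∀ n t, Measurable (state n t)
  measurable_factor : ∀ n j t, Measurable (factor n j t)
  measurable_error : ∀ n i t, Measurable (error n i t)

namespace Panel

variable {Ω : Type*} [MeasurableSpace Ω] {J : ℕ} {r : Fin J → ℕ}

/-- The `N × r_j` matrix of true loadings of regime `j`. -/
def L0 (D : Panel Ω r) (n : ℕ) (j : Fin J) : Matrix (Fin (D.N n)) (Fin (r j)) ℝ :=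
  Matrix.of fun i l => D.loading n j i l

/-- The observation `x_t = Λ_{z_t} f_t + e_t`. -/
def x (D : Panel Ω r) (n t : ℕ) (ω : Ω) : Fin (D.N n) → ℝ := fun i =>
  (D.L0 n (D.state n t ω) *ᵥ (D.factor n (D.state n t ω) t ω).ofLp) i + D.error n i t ω

/-- The whole sample `x_1, …, x_T`. -/
def obs (D : Panel Ω r) (n : ℕ) (ω : Ω) : Fin (D.T n) → Fin (D.N n) → ℝ := fun t => D.x n t ω

/-- The indicator of `z_t = j`. -/
def ind (D : Panel Ω r) (n : ℕ) (j : Fin J) (t : ℕ) (ω : Ω) : ℝ :=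
  if D.state n t ω = j then 1 else 0

/-- `δ_{NT} = min(√N, √T)`. -/
def δ (D : Panel Ω r) (n : ℕ) : ℝ := min (√(D.N n : ℝ)) (√(D.T n : ℝ))

/-! ### Assumptions -/

/-- The state process is independent of the errors. -/
def StateIndepError (D : Panel Ω r) (P : Measure Ω) : Prop :=
  ∀ n, IndepFun (fun ω (t : ℕ) => D.state n t ω) (fun ω (i t : ℕ) => D.error n i t ω) P

/-- Factors. The within-regime second moments converge; on any subset (random or not) of the dates
of regime `j` that is a non-negligible fraction of the sample, the smallest eigenvalue of the second
moment matrix of the factors is bounded away from zero in probability; moments of order `α` are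
bounded. -/
structure FactorAssumption (D : Panel Ω r) (P : Measure Ω) (q : Fin J → ℝ) (α : ℝ)
    (SigF : (j : Fin J) → Matrix (Fin (r j)) (Fin (r j)) ℝ) : Prop where
  posDef : ∀ j, (SigF j).PosDef
  secondMoment : ∀ j a b, TendstoInMeasure P
    (fun n ω => (1 / (D.T n * q j)) * ∑ t ∈ Finset.range (D.T n),
      D.factor n j t ω a * D.factor n j t ω b * D.ind n j t ω)
    atTop (fun _ => SigF j a b)
  subsamples : ∀ j, ∀ c : ℝ, 0 < c → ∀ ε : ℝ, 0 < ε → ∃ ρ : ℝ, 0 < ρ ∧ ∀ᶠ n in atTop,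
    P {ω | ∃ A : Finset ℕ, (∀ t ∈ A, t < D.T n ∧ D.state n t ω = j) ∧
        c * (D.T n * q j) ≤ A.card ∧
        ∃ v : EuclideanSpace ℝ (Fin (r j)), ‖v‖ = 1 ∧
          (1 / (A.card : ℝ)) * ∑ t ∈ A, inner ℝ v (D.factor n j t ω) ^ 2 < ρ}
      ≤ ENNReal.ofReal ε
  moment : ∃ M : ℝ≥0, ∀ n t, t < D.T n →
    ∫⁻ ω, ‖D.factor n (D.state n t ω) t ω‖ₑ ^ α ∂P ≤ M

/-- Loadings, first part: `Λ_jᵀ Λ_j / N` has a positive definite limit; bounded loadings. -/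
structure LoadingAssumption (D : Panel Ω r)
    (SigL : (j : Fin J) → Matrix (Fin (r j)) (Fin (r j)) ℝ) : Prop where
  posDef : ∀ j, (SigL j).PosDef
  gram : ∀ j a b, Tendsto (fun n => (1 / (D.N n : ℝ)) * ((D.L0 n j)ᵀ * D.L0 n j) a b)
    atTop (𝓝 (SigL j a b))
  bounded : ∃ M : ℝ, ∀ n j i, i < D.N n → ‖D.loading n j i‖ ≤ M

/-- Loadings, second part (identification of the regimes): with probability approaching one,
`min_t ‖M_{Λ_k} Λ_j f_t‖² / N ≥ C`, over the dates `t` of regime `j`, for all `j ≠ k`. -/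
def IdentificationAssumption (D : Panel Ω r) (P : Measure Ω) : Prop :=
  ∃ C : ℝ, 0 < C ∧ Tendsto (fun n => P {ω | ∃ j k : Fin J, j ≠ k ∧
    ∃ t, t < D.T n ∧ D.state n t ω = j ∧
      (1 / (D.N n : ℝ)) * ∑ i, ((annihilator (D.L0 n k) * D.L0 n j) *ᵥ
        (D.factor n j t ω).ofLp) i ^ 2 < C}) atTop (𝓝 0)

/-- Errors: bounded moments of order `α`, weak cross-sectional and serial dependence. -/
structure ErrorAssumption (D : Panel Ω r) (P : Measure Ω) (α : ℝ) : Prop where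
  mean_zero : ∀ n i t, i < D.N n → t < D.T n → ∫ ω, D.error n i t ω ∂P = 0
  moment : ∃ M : ℝ≥0, ∀ n i t, i < D.N n → t < D.T n → ∫⁻ ω, ‖D.error n i t ω‖ₑ ^ α ∂P ≤ M
  crossSection : ∃ M : ℝ, ∀ n, ∃ τ : ℕ → ℕ → ℝ,
    (∀ i k t, i < D.N n → k < D.N n → t < D.T n →
      |∫ ω, D.error n i t ω * D.error n k t ω ∂P| ≤ τ i k) ∧
    ∀ i, i < D.N n → ∑ k ∈ Finset.range (D.N n), τ i k ≤ M
  serial : ∃ M : ℝ, ∀ n, ∃ γ : ℕ → ℕ → ℝ,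
    (∀ i t s, i < D.N n → t < D.T n → s < D.T n →
      |∫ ω, D.error n i t ω * D.error n i s ω ∂P| ≤ γ t s) ∧
    ∀ t, t < D.T n → ∑ s ∈ Finset.range (D.T n), γ t s ≤ M
  products : ∃ M : ℝ≥0, ∀ n i k j, i < D.N n → k < D.N n →
    ∫⁻ ω, ‖(1 / √(D.T n : ℝ)) * ∑ t ∈ Finset.range (D.T n),
      (D.error n i t ω * D.error n k t ω - ∫ ω', D.error n i t ω' * D.error n k t ω' ∂P) *
        D.ind n j t ω‖ₑ ^ 2 ∂P ≤ M

/-- States: the frequency of regime `j` converges to `q j ∈ (0, 1)`. -/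
structure StateAssumption (D : Panel Ω r) (P : Measure Ω) (q : Fin J → ℝ) : Prop where
  pos : ∀ j, 0 < q j
  lt_one : ∀ j, q j < 1
  frequency : ∀ j, TendstoInMeasure P
    (fun n ω => (1 / (D.T n : ℝ)) * ∑ t ∈ Finset.range (D.T n), D.ind n j t ω)
    atTop (fun _ => q j)

/-- Moments, first part. -/
def LoadingErrorMoment (D : Panel Ω r) (P : Measure Ω) (β : ℝ) : Prop :=
  ∃ M : ℝ≥0, ∀ n j t, t < D.T n →
    ∫⁻ ω, ‖(1 / √(D.N n : ℝ)) • ∑ i ∈ Finset.range (D.N n),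
      D.error n i t ω • D.loading n j i‖ₑ ^ β ∂P ≤ M

/-- Moments, second part. -/
def FactorErrorMoment (D : Panel Ω r) (P : Measure Ω) : Prop :=
  ∃ M : ℝ≥0, ∀ n j i, i < D.N n →
    ∫⁻ ω, ‖(1 / √(D.T n : ℝ)) • ∑ t ∈ Finset.range (D.T n),
      (D.error n i t ω * D.ind n j t ω) • D.factor n j t ω‖ₑ ^ 2 ∂P ≤ M

/-- Further moment bounds and central limit theorems. `Φ j i` and `Γ j t` are the covariance
matrices in the two central limit theorems. -/
structure LimitAssumption (D : Panel Ω r) (P : Measure Ω) [IsProbabilityMeasure P] (q : Fin J → ℝ)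
    (Φ Γ : (j : Fin J) → ℕ → Matrix (Fin (r j)) (Fin (r j)) ℝ) : Prop where
  loadingProducts : ∃ M : ℝ≥0, ∀ n j i, i < D.N n →
    ∫⁻ ω, ‖(1 / √(D.N n * D.T n : ℝ)) •
      ∑ k ∈ Finset.range (D.N n), ∑ t ∈ Finset.range (D.T n),
        ((D.error n i t ω * D.error n k t ω - ∫ ω', D.error n i t ω' * D.error n k t ω' ∂P) *
          D.ind n j t ω) • D.loading n j k‖ₑ ^ 2 ∂P ≤ M
  factorProducts : ∃ M : ℝ≥0, ∀ n j s, s < D.T n →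
    ∫⁻ ω, ‖(1 / √(D.N n * D.T n : ℝ)) •
      ∑ i ∈ Finset.range (D.N n), ∑ t ∈ Finset.range (D.T n),
        ((D.error n i t ω * D.error n i s ω - ∫ ω', D.error n i t ω' * D.error n i s ω' ∂P) *
          D.ind n j t ω) • D.factor n j t ω‖ₑ ^ 2 ∂P ≤ M
  loadingFactor : ∃ M : ℝ≥0, ∀ n j a b,
    ∫⁻ ω, ‖(1 / √(D.N n * D.T n : ℝ)) *
      ∑ k ∈ Finset.range (D.N n), ∑ t ∈ Finset.range (D.T n),
        D.loading n j k a * D.factor n j t ω b * D.error n k t ω * D.ind n j t ω‖ₑ ^ 2 ∂P ≤ M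
  Φ_posSemidef : ∀ j i, (Φ j i).PosSemidef
  cltTime : ∀ j i, TendstoInDistribution
    (fun n ω => (1 / √(D.T n * q j)) • ∑ t ∈ Finset.range (D.T n),
      (D.error n i t ω * D.ind n j t ω) • D.factor n j t ω)
    atTop id (fun _ => P) (multivariateGaussian 0 (Φ j i))
  Γ_posSemidef : ∀ j t, (Γ j t).PosSemidef
  cltCross : ∀ j t, TendstoInDistribution
    (fun n ω => (1 / √(D.N n : ℝ)) • ∑ i ∈ Finset.range (D.N n),
      D.error n i t ω • D.loading n j i)
    atTop id (fun _ => P) (multivariateGaussian 0 (Γ j t))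

/-- `T^{16/α} / N → 0` and `T^{2/α + 2/β} / N → 0`. -/
def RateCondition (D : Panel Ω r) (α β : ℝ) : Prop :=
  Tendsto (fun n => (D.T n : ℝ) ^ (16 / α) / D.N n) atTop (𝓝 0) ∧
  Tendsto (fun n => (D.T n : ℝ) ^ (2 / α + 2 / β) / D.N n) atTop (𝓝 0)

/-! ### The estimator -/

/-- `(L, s2)` is the normalized maximum quasi-likelihood estimator with state dynamics: `L` maximizes
`l(·, s2, Q, φ)` over all loadings, `L_jᵀ L_j` is diagonal, and the columns of `L_j` are in
descending order of their norms. Here `s2` is any positive measurable variable; so a joint maximizer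
of `l(·, ·, Q, φ)` with `s2` restricted to an interval and the maximizer with `s2` fixed are both
covered. -/
structure IsMLE (D : Panel Ω r) (θ : MarkovParam J)
    (L : (n : ℕ) → Ω → (j : Fin J) → Matrix (Fin (D.N n)) (Fin (r j)) ℝ) (s2 : ℕ → Ω → ℝ) :
    Prop where
  measurable_loading : ∀ n j i l, Measurable fun ω => L n ω j i l
  measurable_s2 : ∀ n, Measurable (s2 n)
  s2_pos : ∀ n ω, 0 < s2 n ω
  isMax : ∀ n ω (A : (j : Fin J) → Matrix (Fin (D.N n)) (Fin (r j)) ℝ),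
    θ.logLik A (s2 n ω) (D.obs n ω) ≤ θ.logLik (L n ω) (s2 n ω) (D.obs n ω)
  diagonal : ∀ n ω j, ((L n ω j)ᵀ * L n ω j).IsDiag
  sorted : ∀ n ω j, Antitone fun l => ((L n ω j)ᵀ * L n ω j) l l

/-- The estimated smoothed probability of regime `j` at date `t` (zero if `t` is not a date of the
`n`-th sample). -/
def prob (D : Panel Ω r) (θ : MarkovParam J)
    (L : (n : ℕ) → Ω → (j : Fin J) → Matrix (Fin (D.N n)) (Fin (r j)) ℝ) (s2 : ℕ → Ω → ℝ)
    (n t : ℕ) (ω : Ω) (j : Fin J) : ℝ :=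
  if h : t < D.T n then θ.smoothed (L n ω) (s2 n ω) (D.obs n ω) ⟨t, h⟩ j else 0

end Panel

/-- A (sample dependent) relabelling of the regimes that preserves the numbers of factors. -/
structure Relabelling (Ω : Type*) [MeasurableSpace Ω] {J : ℕ} (r : Fin J → ℕ) where
  perm : ℕ → Ω → Equiv.Perm (Fin J)
  measurable_perm : ∀ n j, Measurable fun ω => perm n ω j
  rank_eq : ∀ n ω j, r (perm n ω j) = r j

/-- A (sample dependent) choice of signs for the columns of the loading matrices. -/
structure Signs (Ω : Type*) [MeasurableSpace Ω] {J : ℕ} (r : Fin J → ℕ) where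
  sign : ℕ → Ω → (j : Fin J) → Fin (r j) → ℝ
  measurable_sign : ∀ n j l, Measurable fun ω => sign n ω j l
  eq_one_or : ∀ n ω j l, sign n ω j l = 1 ∨ sign n ω j l = -1

namespace Panel

variable {Ω : Type*} [MeasurableSpace Ω] {J : ℕ} {r : Fin J → ℕ}

/-- The estimated loadings with regimes relabelled and signs of the columns chosen. -/
def aligned (D : Panel Ω r) (π : Relabelling Ω r) (ς : Signs Ω r)
    (L : (n : ℕ) → Ω → (j : Fin J) → Matrix (Fin (D.N n)) (Fin (r j)) ℝ) (n : ℕ) (ω : Ω)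
    (j : Fin J) : Matrix (Fin (D.N n)) (Fin (r j)) ℝ :=
  Matrix.of fun i l => ς.sign n ω j l * L n ω (π.perm n ω j) i (Fin.cast (π.rank_eq n ω j).symm l)

/-- `W_j = (Λ̃_jᵀ Λ̃_j / N + (σ̃² / N) I) (T⁻¹ ∑_t p̃_{tj})`. -/
def W (D : Panel Ω r) (L : (n : ℕ) → Ω → (j : Fin J) → Matrix (Fin (D.N n)) (Fin (r j)) ℝ)
    (s2 : ℕ → Ω → ℝ) (p : ℕ → ℕ → Ω → Fin J → ℝ) (n : ℕ) (ω : Ω) (j : Fin J) :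
    Matrix (Fin (r j)) (Fin (r j)) ℝ :=
  ((1 / (D.T n : ℝ)) * ∑ t ∈ Finset.range (D.T n), p n t ω j) •
    ((1 / (D.N n : ℝ)) • ((L n ω j)ᵀ * L n ω j) +
      (s2 n ω / D.N n) • (1 : Matrix (Fin (r j)) (Fin (r j)) ℝ))

/-- `H_j = (T⁻¹ ∑_t f_t f_tᵀ 1_{z_t = j}) (Λ_jᵀ Λ̃_j / N) W_j⁻¹`. -/
def H (D : Panel Ω r) (L : (n : ℕ) → Ω → (j : Fin J) → Matrix (Fin (D.N n)) (Fin (r j)) ℝ)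
    (s2 : ℕ → Ω → ℝ) (p : ℕ → ℕ → Ω → Fin J → ℝ) (n : ℕ) (ω : Ω) (j : Fin J) :
    Matrix (Fin (r j)) (Fin (r j)) ℝ :=
  ((1 / (D.T n : ℝ)) • ∑ t ∈ Finset.range (D.T n), D.ind n j t ω •
      Matrix.vecMulVec (D.factor n j t ω).ofLp (D.factor n j t ω).ofLp) *
    ((1 / (D.N n : ℝ)) • ((D.L0 n j)ᵀ * L n ω j)) * (D.W L s2 p n ω j)⁻¹

/-- The estimated factors `f̃_t = ∑_j p̃_{tj} Λ̃_jᵀ (Λ̃_j Λ̃_jᵀ + σ̃² I)⁻¹ x_t`. -/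
def estFactor (D : Panel Ω r)
    (L : (n : ℕ) → Ω → (j : Fin J) → Matrix (Fin (D.N n)) (Fin (r j)) ℝ)
    (s2 : ℕ → Ω → ℝ) (p : ℕ → ℕ → Ω → Fin J → ℝ) (n t : ℕ) (ω : Ω) :
    EuclideanSpace ℝ (Fin (maxRank r)) :=
  ∑ j, p n t ω j •
    pad (maxRank r) ((L n ω j)ᵀ *ᵥ ((sigmaMat (L n ω j) (s2 n ω))⁻¹ *ᵥ D.x n t ω))

/-- The estimation error `f̃_t - H_{z_t}⁻¹ f_t` of the factors. -/
def factorError (D : Panel Ω r)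
    (L : (n : ℕ) → Ω → (j : Fin J) → Matrix (Fin (D.N n)) (Fin (r j)) ℝ)
    (s2 : ℕ → Ω → ℝ) (p : ℕ → ℕ → Ω → Fin J → ℝ) (n t : ℕ) (ω : Ω) :
    EuclideanSpace ℝ (Fin (maxRank r)) :=
  D.estFactor L s2 p n t ω - pad (maxRank r)
    ((D.H L s2 p n ω (D.state n t ω))⁻¹ *ᵥ (D.factor n (D.state n t ω) t ω).ofLp)

/-- The estimation error `λ̃_{ji} - H_jᵀ λ_{ji}` of the loadings of series `i` (zero if the `n`-th
sample does not contain series `i`). -/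
def loadingError (D : Panel Ω r)
    (L : (n : ℕ) → Ω → (j : Fin J) → Matrix (Fin (D.N n)) (Fin (r j)) ℝ)
    (s2 : ℕ → Ω → ℝ) (p : ℕ → ℕ → Ω → Fin J → ℝ) (n : ℕ) (j : Fin J) (i : ℕ) (ω : Ω) :
    EuclideanSpace ℝ (Fin (r j)) :=
  if h : i < D.N n then
    WithLp.toLp 2 (L n ω j ⟨i, h⟩ - (D.H L s2 p n ω j)ᵀ *ᵥ (D.loading n j i).ofLp)
  else 0

end Panel

/-- The limit objects, for `SigF j = Σ_{F_j}` and `SigL j = Σ_{Λ_j}`: `root j = Σ_{Λ_j}^{1/2}`, the eigenvalues `v j` of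
`Σ_{Λ_j}^{1/2} Σ_{F_j} Σ_{Λ_j}^{1/2}`, which are distinct and in descending order, and corresponding
orthonormal eigenvectors, the columns of `Υ j`. -/
structure EigenData {J : ℕ} {r : Fin J → ℕ}
    (SigF SigL : (j : Fin J) → Matrix (Fin (r j)) (Fin (r j)) ℝ) where
  root : (j : Fin J) → Matrix (Fin (r j)) (Fin (r j)) ℝ
  v : (j : Fin J) → Fin (r j) → ℝ
  Υ : (j : Fin J) → Matrix (Fin (r j)) (Fin (r j)) ℝ
  root_posDef : ∀ j, (root j).PosDef
  root_sq : ∀ j, root j * root j = SigL j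
  v_strictAnti : ∀ j, StrictAnti (v j)
  orthonormal : ∀ j, (Υ j)ᵀ * Υ j = 1
  spectral : ∀ j, root j * SigF j * root j = Υ j * Matrix.diagonal (v j) * (Υ j)ᵀ

namespace EigenData

variable {J : ℕ} {r : Fin J → ℕ} {SigF SigL : (j : Fin J) → Matrix (Fin (r j)) (Fin (r j)) ℝ}

/-- `Σ_{Λ_j}^{-1/2} Υ_j V_j^{1/2}`. -/
def limitH (E : EigenData SigF SigL) (j : Fin J) : Matrix (Fin (r j)) (Fin (r j)) ℝ :=
  (E.root j)⁻¹ * E.Υ j * Matrix.diagonal fun l => √(E.v j l)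

/-- `V_j^{-1/2} Υ_jᵀ Σ_{Λ_j}^{1/2} Φ Σ_{Λ_j}^{1/2} Υ_j V_j^{-1/2}`. -/
def loadingCov (E : EigenData SigF SigL) (j : Fin J) (Φ : Matrix (Fin (r j)) (Fin (r j)) ℝ) :
    Matrix (Fin (r j)) (Fin (r j)) ℝ :=
  (Matrix.diagonal fun l => (√(E.v j l))⁻¹) * (E.Υ j)ᵀ * E.root j * Φ * E.root j * E.Υ j *
    Matrix.diagonal fun l => (√(E.v j l))⁻¹

/-- `V_j^{-1/2} Υ_jᵀ Σ_{Λ_j}^{-1/2} Γ Σ_{Λ_j}^{-1/2} Υ_j V_j^{-1/2}`. -/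
def factorCov (E : EigenData SigF SigL) (j : Fin J) (Γ : Matrix (Fin (r j)) (Fin (r j)) ℝ) :
    Matrix (Fin (r j)) (Fin (r j)) ℝ :=
  (Matrix.diagonal fun l => (√(E.v j l))⁻¹) * (E.Υ j)ᵀ * (E.root j)⁻¹ * Γ * (E.root j)⁻¹ * E.Υ j *
    Matrix.diagonal fun l => (√(E.v j l))⁻¹

end EigenData

/-- Convergence to a mixed normal distribution: the law of `Y n` given `z n = k` is asymptotically
`N(0, C k)`, for every value `k` of the discrete variable `z n` (in the form
`E[g(Y n) 1_{z n = k}] - Pr(z n = k) ∫ g dN(0, C k) → 0` for bounded continuous `g`). -/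
def TendstoMixedNormal {Ω : Type*} [MeasurableSpace Ω] (P : Measure Ω) {J m : ℕ}
    (Y : ℕ → Ω → EuclideanSpace ℝ (Fin m)) (z : ℕ → Ω → Fin J)
    (C : Fin J → Matrix (Fin m) (Fin m) ℝ) : Prop :=
  (∀ n, AEMeasurable (Y n) P) ∧
  ∀ (k : Fin J) (g : EuclideanSpace ℝ (Fin m) →ᵇ ℝ),
    Tendsto (fun n => (∫ ω in {ω | z n ω = k}, g (Y n ω) ∂P) -
      P.real {ω | z n ω = k} * ∫ y, g y ∂(multivariateGaussian 0 (C k))) atTop (𝓝 0)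

end RegimeSwitching

end

open RegimeSwitching

noncomputable section

namespace RegimeSwitching

/-! ### Frobenius and Euclidean norms -/

section Norms

variable {m n k : Type*} [Fintype m] [Fintype n] [Fintype k]

/-- The Frobenius norm. -/
def fn (A : Matrix m n ℝ) : ℝ := √(∑ i, ∑ j, A i j ^ 2)

/-- The Euclidean norm. -/
def vn (v : m → ℝ) : ℝ := √(v ⬝ᵥ v)

theorem fn_nonneg (A : Matrix m n ℝ) : 0 ≤ fn A := Real.sqrt_nonneg _

theorem vn_nonneg (v : m → ℝ) : 0 ≤ vn v := Real.sqrt_nonneg _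

theorem fn_sq (A : Matrix m n ℝ) : fn A ^ 2 = ∑ i, ∑ j, A i j ^ 2 :=
  Real.sq_sqrt (Finset.sum_nonneg fun _ _ => Finset.sum_nonneg fun _ _ => sq_nonneg _)

theorem dotProduct_self_nonneg' (v : m → ℝ) : 0 ≤ v ⬝ᵥ v :=
  Finset.sum_nonneg fun _ _ => mul_self_nonneg _

theorem vn_sq (v : m → ℝ) : vn v ^ 2 = v ⬝ᵥ v := Real.sq_sqrt (dotProduct_self_nonneg' v)

theorem fn_eq_norm (A : Matrix m n ℝ) :
    fn A = (Matrix.frobeniusNormedAddCommGroup (m := m) (n := n) (α := ℝ)).norm A := by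
  rw [Matrix.frobenius_norm_def, fn, Real.sqrt_eq_rpow]
  simp

theorem fn_add_le (A B : Matrix m n ℝ) : fn (A + B) ≤ fn A + fn B := by
  simp only [fn_eq_norm]
  exact @norm_add_le _ (Matrix.frobeniusNormedAddCommGroup.toSeminormedAddCommGroup.toSeminormedAddGroup) A B

theorem fn_mul_le (A : Matrix m n ℝ) (B : Matrix n k ℝ) : fn (A * B) ≤ fn A * fn B := by
  simp only [fn_eq_norm]
  exact Matrix.frobenius_norm_mul A B

theorem fn_transpose (A : Matrix m n ℝ) : fn Aᵀ = fn A := by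
  unfold fn
  rw [Finset.sum_comm]
  rfl

theorem fn_smul (c : ℝ) (A : Matrix m n ℝ) : fn (c • A) = |c| * fn A := by
  unfold fn
  rw [← Real.sqrt_sq_eq_abs, ← Real.sqrt_mul (sq_nonneg c)]
  simp [Finset.mul_sum, mul_pow]

theorem fn_zero : fn (0 : Matrix m n ℝ) = 0 := by simp [fn]

theorem fn_sum_le {ι : Type*} (s : Finset ι) (A : ι → Matrix m n ℝ) :
    fn (∑ i ∈ s, A i) ≤ ∑ i ∈ s, fn (A i) := by
  classical
  induction s using Finset.induction_on with
  | empty => simp [fn_zero]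
  | insert a s ha ih =>
    rw [Finset.sum_insert ha, Finset.sum_insert ha]
    exact (fn_add_le _ _).trans (by linarith)

theorem abs_le_fn (A : Matrix m n ℝ) (i : m) (j : n) : |A i j| ≤ fn A := by
  apply Real.abs_le_sqrt
  calc A i j ^ 2 ≤ ∑ j, A i j ^ 2 :=
        Finset.single_le_sum (f := fun j => A i j ^ 2) (fun _ _ => sq_nonneg _) (Finset.mem_univ j)
    _ ≤ _ := Finset.single_le_sum (f := fun i => ∑ j, A i j ^ 2)
        (fun _ _ => Finset.sum_nonneg fun _ _ => sq_nonneg _) (Finset.mem_univ i)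

theorem fn_le_sum_abs (A : Matrix m n ℝ) : fn A ≤ ∑ i, ∑ j, |A i j| := by
  refine Real.sqrt_le_iff.2 ⟨Finset.sum_nonneg fun _ _ => Finset.sum_nonneg fun _ _ => abs_nonneg _, ?_⟩
  calc ∑ i, ∑ j, A i j ^ 2 = ∑ i, ∑ j, |A i j| ^ 2 := by simp
    _ ≤ ∑ i, (∑ j, |A i j|) ^ 2 := Finset.sum_le_sum fun i _ => 
        Finset.sum_sq_le_sq_sum_of_nonneg fun j _ => abs_nonneg _
    _ ≤ _ := Finset.sum_sq_le_sq_sum_of_nonneg fun i _ => Finset.sum_nonneg fun _ _ => abs_nonneg _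

theorem fn_sq_trace (A : Matrix m n ℝ) : fn A ^ 2 = (Aᵀ * A).trace := by
  rw [fn_sq, Finset.sum_comm]
  simp [Matrix.trace, Matrix.mul_apply, sq]

theorem trace_transpose_mul_le (A B : Matrix m n ℝ) : |(Aᵀ * B).trace| ≤ fn A * fn B := by
  refine le_of_le_of_eq (Real.abs_le_sqrt ?_)
    (Real.sqrt_mul (Finset.sum_nonneg fun _ _ => Finset.sum_nonneg fun _ _ => sq_nonneg _) _)
  have : (Aᵀ * B).trace = ∑ p : m × n, A p.1 p.2 * B p.1 p.2 := by
    rw [Fintype.sum_prod_type, Finset.sum_comm]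
    simp [Matrix.trace, Matrix.mul_apply]
  rw [this, ← Fintype.sum_prod_type' fun i j => A i j ^ 2, ← Fintype.sum_prod_type' fun i j => B i j ^ 2]
  exact Finset.sum_mul_sq_le_sq_mul_sq _ _ _

theorem trace_mul_le (A : Matrix m n ℝ) (B : Matrix n m ℝ) : |(A * B).trace| ≤ fn A * fn B := by
  have := trace_transpose_mul_le Aᵀ B
  rwa [Matrix.transpose_transpose, fn_transpose] at this

/-- A bound through the Gram matrix. -/
theorem fn_mul_sq_le (A : Matrix m n ℝ) (B : Matrix n k ℝ) :
    fn (A * B) ^ 2 ≤ fn (Aᵀ * A) * fn B ^ 2 := by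
  have : fn (A * B) ^ 2 = ((Aᵀ * A) * (B * Bᵀ)).trace := by
    rw [fn_sq_trace, Matrix.transpose_mul, Matrix.mul_assoc, Matrix.trace_mul_comm]
    simp only [Matrix.mul_assoc]
  rw [this]
  refine (le_abs_self _).trans ((trace_mul_le _ _).trans ?_)
  have h := fn_mul_le B Bᵀ
  rw [fn_transpose] at h
  nlinarith [fn_nonneg (Aᵀ * A)]

theorem vn_eq_fn (v : m → ℝ) : vn v = fn (Matrix.replicateCol Unit v) := by
  simp [vn, fn, dotProduct, sq]

theorem vn_mulVec_le (A : Matrix m n ℝ) (v : n → ℝ) : vn (A *ᵥ v) ≤ fn A * vn v := by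
  rw [vn_eq_fn, vn_eq_fn, Matrix.replicateCol_mulVec]
  exact fn_mul_le _ _

theorem vn_mulVec_sq_le (A : Matrix m n ℝ) (v : n → ℝ) :
    vn (A *ᵥ v) ^ 2 ≤ fn (Aᵀ * A) * vn v ^ 2 := by
  rw [vn_eq_fn, vn_eq_fn, Matrix.replicateCol_mulVec]
  exact fn_mul_sq_le _ _

theorem vn_add_le (v w : m → ℝ) : vn (v + w) ≤ vn v + vn w := by
  rw [vn_eq_fn, vn_eq_fn, vn_eq_fn, Matrix.replicateCol_add]
  exact fn_add_le _ _

theorem vn_smul (c : ℝ) (v : m → ℝ) : vn (c • v) = |c| * vn v := by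
  rw [vn_eq_fn, vn_eq_fn, Matrix.replicateCol_smul, fn_smul]

theorem vn_neg (v : m → ℝ) : vn (-v) = vn v := by simp [vn]

theorem vn_zero : vn (0 : m → ℝ) = 0 := by simp [vn]

theorem vn_sub_le (v w : m → ℝ) : vn (v - w) ≤ vn v + vn w := by
  rw [sub_eq_add_neg, ← vn_neg w]
  exact vn_add_le _ _

theorem abs_dotProduct_le (v w : m → ℝ) : |v ⬝ᵥ w| ≤ vn v * vn w := by
  rw [vn, vn, ← Real.sqrt_mul (dotProduct_self_nonneg' v)]
  apply Real.abs_le_sqrt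
  have := Finset.sum_mul_sq_le_sq_mul_sq Finset.univ v w
  simpa [dotProduct, sq] using this

theorem vn_add_sq_le (v w : m → ℝ) : vn (v + w) ^ 2 ≤ 2 * vn v ^ 2 + 2 * vn w ^ 2 := by
  nlinarith [vn_add_le v w, vn_nonneg (v + w), sq_nonneg (vn v - vn w)]

theorem fn_add_sq_le (A B : Matrix m n ℝ) : fn (A + B) ^ 2 ≤ 2 * fn A ^ 2 + 2 * fn B ^ 2 := by
  nlinarith [fn_add_le A B, fn_nonneg (A + B), sq_nonneg (fn A - fn B)]

theorem vn_eq_norm (v : m → ℝ) : vn v = ‖WithLp.toLp 2 v‖ := by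
  rw [EuclideanSpace.norm_eq, vn]
  simp [dotProduct, sq]

theorem fn_sq_eq_sum_col (A : Matrix m n ℝ) : fn A ^ 2 = ∑ j, vn (fun i => A i j) ^ 2 := by
  rw [fn_sq, Finset.sum_comm]
  simp only [vn_sq, dotProduct]
  simp only [sq]

theorem fn_sq_eq_sum_row (A : Matrix m n ℝ) : fn A ^ 2 = ∑ i, vn (A i) ^ 2 := by
  rw [fn_sq]
  simp only [vn_sq, dotProduct]
  simp only [sq]

end Norms

theorem frobSq_eq {m k : ℕ} (A : Matrix (Fin m) (Fin k) ℝ) : frobSq A = fn A ^ 2 := (fn_sq A).symm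

/-! ### Log-determinants -/

section LogDet

variable {m n : Type*} [Fintype m] [Fintype n]

theorem log_det_le [DecidableEq m] {M : Matrix m m ℝ} (hM : M.PosDef) :
    Real.log M.det ≤ M.trace - Fintype.card m := by
  have h1 : M.det = ∏ i, hM.isHermitian.eigenvalues i := by
    simpa using hM.isHermitian.det_eq_prod_eigenvalues
  have h2 : M.trace = ∑ i, hM.isHermitian.eigenvalues i := by
    simpa using hM.isHermitian.trace_eq_sum_eigenvalues
  rw [h1, h2, Real.log_prod fun i _ => (hM.eigenvalues_pos i).ne']
  calc ∑ i, Real.log (hM.isHermitian.eigenvalues i)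
      ≤ ∑ i, (hM.isHermitian.eigenvalues i - 1) :=
        Finset.sum_le_sum fun i _ => Real.log_le_sub_one_of_pos (hM.eigenvalues_pos i)
    _ = _ := by simp [Finset.sum_sub_distrib]

theorem posSemidef_transpose_mul_self (A : Matrix m n ℝ) : (Aᵀ * A).PosSemidef := by
  have := Matrix.posSemidef_conjTranspose_mul_self A
  rwa [Matrix.conjTranspose_eq_transpose_of_trivial] at this

theorem posSemidef_self_mul_transpose (A : Matrix m n ℝ) : (A * Aᵀ).PosSemidef := by
  have := posSemidef_transpose_mul_self Aᵀ
  rwa [Matrix.transpose_transpose] at this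

theorem log_det_one_add_nonneg [DecidableEq m] {M : Matrix m m ℝ} (hM : M.PosSemidef) :
    0 ≤ Real.log (1 + M).det := by
  have hP : (1 + M).PosDef := Matrix.PosDef.add_posSemidef Matrix.PosDef.one hM
  have h1 : (1 + M).det = ∏ i, hP.isHermitian.eigenvalues i := by
    simpa using hP.isHermitian.det_eq_prod_eigenvalues
  rw [h1]
  refine Real.log_nonneg (Finset.one_le_prod fun i _ => ?_)
  have h := hP.isHermitian.eigenvalues_eq i
  have h2 := (Matrix.posSemidef_iff_dotProduct_mulVec.1 hM).2 ⇑(hP.isHermitian.eigenvectorBasis i)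
  have h3 : (hP.isHermitian.eigenvectorBasis i).ofLp ⬝ᵥ (hP.isHermitian.eigenvectorBasis i).ofLp
      = 1 := by
    have := hP.isHermitian.eigenvectorBasis.orthonormal.1 i
    rw [← sq_eq_sq₀ (norm_nonneg _) zero_le_one, EuclideanSpace.norm_sq_eq] at this
    simpa [dotProduct, sq] using this
  simp only [star_trivial, RCLike.re_to_real, Matrix.add_mulVec, Matrix.one_mulVec,
    dotProduct_add] at h h2
  rw [h]
  linarith

theorem log_det_one_add_le [DecidableEq m] {M : Matrix m m ℝ} (hM : M.PosSemidef) :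
    Real.log (1 + M).det ≤ Fintype.card m * Real.log (1 + M.trace) := by
  have hP : (1 + M).PosDef := Matrix.PosDef.add_posSemidef Matrix.PosDef.one hM
  rcases isEmpty_or_nonempty m with h | h
  · simp
  have ht : 0 ≤ M.trace := hM.trace_nonneg
  set c := 1 + M.trace with hc
  have hc0 : 0 < c := by linarith
  have h1 := log_det_le (hP.smul (inv_pos.2 hc0))
  rw [Matrix.det_smul, Real.log_mul (by positivity) hP.det_pos.ne', Real.log_pow, Real.log_inv,
    Matrix.trace_smul, Matrix.trace_add, Matrix.trace_one, smul_eq_mul] at h1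
  have hr : (1 : ℝ) ≤ Fintype.card m := by exact_mod_cast Fintype.card_pos
  have h2 : c⁻¹ * (Fintype.card m + M.trace) ≤ Fintype.card m := by
    rw [inv_mul_le_iff₀ hc0]; nlinarith
  linarith

end LogDet

/-! ### The Gaussian density -/

section Sigma

variable {m k : ℕ}

theorem sigmaMat_posDef (A : Matrix (Fin m) (Fin k) ℝ) {s2 : ℝ} (hs : 0 < s2) :
    (sigmaMat A s2).PosDef :=
  Matrix.PosDef.posSemidef_add (posSemidef_self_mul_transpose A) (Matrix.PosDef.one.smul hs)

theorem sigmaMat_mul_inv (A : Matrix (Fin m) (Fin k) ℝ) {s2 : ℝ} (hs : 0 < s2) :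
    sigmaMat A s2 * (sigmaMat A s2)⁻¹ = 1 :=
  Matrix.mul_nonsing_inv _ (sigmaMat_posDef A hs).det_pos.ne'.isUnit

theorem sigmaMat_inv_mul (A : Matrix (Fin m) (Fin k) ℝ) {s2 : ℝ} (hs : 0 < s2) :
    (sigmaMat A s2)⁻¹ * sigmaMat A s2 = 1 :=
  Matrix.nonsing_inv_mul _ (sigmaMat_posDef A hs).det_pos.ne'.isUnit

theorem sigmaMat_transpose (A : Matrix (Fin m) (Fin k) ℝ) (s2 : ℝ) :
    (sigmaMat A s2)ᵀ = sigmaMat A s2 := by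
  simp [sigmaMat]

theorem sigmaMat_inv_transpose (A : Matrix (Fin m) (Fin k) ℝ) (s2 : ℝ) :
    ((sigmaMat A s2)⁻¹)ᵀ = (sigmaMat A s2)⁻¹ := by
  rw [Matrix.transpose_nonsing_inv, sigmaMat_transpose]

/-- The fitted factors `Aᵀ Σ⁻¹ x`. -/
def fit (A : Matrix (Fin m) (Fin k) ℝ) (s2 : ℝ) (x : Fin m → ℝ) : Fin k → ℝ :=
  Aᵀ *ᵥ ((sigmaMat A s2)⁻¹ *ᵥ x)

theorem fit_residual (A : Matrix (Fin m) (Fin k) ℝ) {s2 : ℝ} (hs : 0 < s2) (x : Fin m → ℝ) :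
    x - A *ᵥ fit A s2 x = s2 • ((sigmaMat A s2)⁻¹ *ᵥ x) := by
  set y := (sigmaMat A s2)⁻¹ *ᵥ x with hy
  have hx : x = sigmaMat A s2 *ᵥ y := by
    rw [hy, Matrix.mulVec_mulVec, sigmaMat_mul_inv A hs, Matrix.one_mulVec]
  rw [fit, ← hy]
  conv_lhs => rw [hx]
  simp [sigmaMat, Matrix.add_mulVec, Matrix.smul_mulVec, ← Matrix.mulVec_mulVec]

theorem quadForm_add (A : Matrix (Fin m) (Fin k) ℝ) {s2 : ℝ} (hs : 0 < s2) (x : Fin m → ℝ)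
    (d : Fin k → ℝ) :
    vn (x - A *ᵥ (fit A s2 x + d)) ^ 2 / s2 + vn (fit A s2 x + d) ^ 2 =
      x ⬝ᵥ ((sigmaMat A s2)⁻¹ *ᵥ x) + (vn (A *ᵥ d) ^ 2 / s2 + vn d ^ 2) := by
  have h1 := fit_residual A hs x
  set y := (sigmaMat A s2)⁻¹ *ᵥ x with hy
  set h := fit A s2 x with hh
  have hhy : h = Aᵀ *ᵥ y := rfl
  have h2 : x - A *ᵥ (h + d) = s2 • y - A *ᵥ d := by
    rw [Matrix.mulVec_add, ← h1]; abel
  have h3 : x = A *ᵥ h + s2 • y := by rw [← h1]; abel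
  have h4 : ∀ w : Fin k → ℝ, (A *ᵥ w) ⬝ᵥ y = w ⬝ᵥ h := fun w => by
    rw [hhy, dotProduct_comm, Matrix.dotProduct_mulVec, ← Matrix.mulVec_transpose, dotProduct_comm]
  have h5 : x ⬝ᵥ y = h ⬝ᵥ h + s2 * (y ⬝ᵥ y) := by
    conv_lhs => rw [h3]
    rw [add_dotProduct, h4, smul_dotProduct, smul_eq_mul]
  rw [h5, h2]
  simp only [vn_sq, sub_dotProduct, dotProduct_sub, add_dotProduct, dotProduct_add,
    smul_dotProduct, dotProduct_smul, smul_eq_mul]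
  rw [dotProduct_comm y (A *ᵥ d), h4 d, dotProduct_comm h d]
  field_simp
  ring

theorem quadForm_le (A : Matrix (Fin m) (Fin k) ℝ) {s2 : ℝ} (hs : 0 < s2) (x : Fin m → ℝ)
    (g : Fin k → ℝ) :
    x ⬝ᵥ ((sigmaMat A s2)⁻¹ *ᵥ x) ≤ vn (x - A *ᵥ g) ^ 2 / s2 + vn g ^ 2 := by
  have := quadForm_add A hs x (g - fit A s2 x)
  rw [add_sub_cancel] at this
  rw [this]
  have : 0 ≤ vn (A *ᵥ (g - fit A s2 x)) ^ 2 / s2 := by positivity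
  nlinarith [sq_nonneg (vn (g - fit A s2 x))]

theorem quadForm_eq (A : Matrix (Fin m) (Fin k) ℝ) {s2 : ℝ} (hs : 0 < s2) (x : Fin m → ℝ) :
    x ⬝ᵥ ((sigmaMat A s2)⁻¹ *ᵥ x) = vn (x - A *ᵥ fit A s2 x) ^ 2 / s2 + vn (fit A s2 x) ^ 2 := by
  have := quadForm_add A hs x 0
  simpa [vn_zero] using this.symm

theorem quadForm_ge (A : Matrix (Fin m) (Fin k) ℝ) {s2 : ℝ} (hs : 0 < s2) (x : Fin m → ℝ)
    {M : Matrix (Fin m) (Fin m) ℝ} (hM : ∀ v, vn (M *ᵥ v) ≤ vn v) (hMA : M * A = 0) :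
    vn (M *ᵥ x) ^ 2 / s2 ≤ x ⬝ᵥ ((sigmaMat A s2)⁻¹ *ᵥ x) := by
  rw [quadForm_eq A hs]
  have h1 : M *ᵥ x = M *ᵥ (x - A *ᵥ fit A s2 x) := by
    rw [Matrix.mulVec_sub, Matrix.mulVec_mulVec, hMA, Matrix.zero_mulVec, sub_zero]
  have h2 : vn (M *ᵥ x) ^ 2 ≤ vn (x - A *ᵥ fit A s2 x) ^ 2 := by
    rw [h1]
    exact pow_le_pow_left₀ (vn_nonneg _) (hM _) 2
  have := div_le_div_of_nonneg_right h2 hs.le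
  nlinarith [sq_nonneg (vn (fit A s2 x))]

theorem log_det_sigmaMat (A : Matrix (Fin m) (Fin k) ℝ) {s2 : ℝ} (hs : 0 < s2) :
    Real.log (sigmaMat A s2).det = m * Real.log s2 + Real.log (1 + s2⁻¹ • (Aᵀ * A)).det := by
  have h : sigmaMat A s2 = s2 • (1 + (s2⁻¹ • A) * Aᵀ) := by
    rw [smul_add, Matrix.smul_mul, smul_smul, mul_inv_cancel₀ hs.ne', one_smul, sigmaMat, add_comm]
  have h2 : (1 + s2⁻¹ • (Aᵀ * A)).PosDef := Matrix.PosDef.add_posSemidef Matrix.PosDef.one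
    ((posSemidef_transpose_mul_self A).smul (inv_pos.2 hs).le)
  rw [h, Matrix.det_smul, Matrix.det_one_add_mul_comm, Matrix.mul_smul, Fintype.card_fin,
    Real.log_mul (by positivity) h2.det_pos.ne', Real.log_pow]

theorem log_det_sigmaMat_ge (A : Matrix (Fin m) (Fin k) ℝ) {s2 : ℝ} (hs : 0 < s2) :
    m * Real.log s2 ≤ Real.log (sigmaMat A s2).det := by
  rw [log_det_sigmaMat A hs]
  have := log_det_one_add_nonneg ((posSemidef_transpose_mul_self A).smul (inv_pos.2 hs).le)
  linarith

theorem log_det_sigmaMat_le (A : Matrix (Fin m) (Fin k) ℝ) {s2 : ℝ} (hs : 0 < s2) :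
    Real.log (sigmaMat A s2).det ≤ m * Real.log s2 + k * Real.log (1 + fn A ^ 2 / s2) := by
  rw [log_det_sigmaMat A hs]
  have := log_det_one_add_le ((posSemidef_transpose_mul_self A).smul (inv_pos.2 hs).le)
  rw [Matrix.trace_smul, ← fn_sq_trace, Fintype.card_fin, smul_eq_mul, inv_mul_eq_div] at this
  linarith

theorem density_pos (A : Matrix (Fin m) (Fin k) ℝ) {s2 : ℝ} (hs : 0 < s2) (x : Fin m → ℝ) :
    0 < density A s2 x := by
  have := (sigmaMat_posDef A hs).det_pos
  unfold density
  positivity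

theorem log_density (A : Matrix (Fin m) (Fin k) ℝ) {s2 : ℝ} (hs : 0 < s2) (x : Fin m → ℝ) :
    -2 * Real.log (density A s2 x) = m * Real.log (2 * Real.pi) +
      Real.log (sigmaMat A s2).det + x ⬝ᵥ ((sigmaMat A s2)⁻¹ *ᵥ x) := by
  have := (sigmaMat_posDef A hs).det_pos
  unfold density
  rw [Real.log_mul (by positivity) (by positivity), Real.log_mul (by positivity) (by positivity),
    Real.log_exp, Real.log_rpow (by positivity), Real.log_rpow this]
  ring

open scoped MatrixOrder in
/-- The tangent of the log-determinant lies above it. -/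
theorem log_det_sigmaMat_sub_le (A B : Matrix (Fin m) (Fin k) ℝ) {s2 : ℝ} (hs : 0 < s2) :
    Real.log (sigmaMat B s2).det - Real.log (sigmaMat A s2).det ≤
      ((sigmaMat A s2)⁻¹ * (B * Bᵀ - A * Aᵀ)).trace := by
  have hA := sigmaMat_posDef A hs
  have hB := sigmaMat_posDef B hs
  obtain ⟨C, hC⟩ : ∃ C : Matrix (Fin m) (Fin m) ℝ, (sigmaMat A s2)⁻¹ = Cᵀ * C := by
    obtain ⟨C, hC⟩ := CStarAlgebra.nonneg_iff_eq_star_mul_self.mp hA.inv.posSemidef.nonneg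
    exact ⟨C, by rw [hC, Matrix.star_eq_conjTranspose, Matrix.conjTranspose_eq_transpose_of_trivial]⟩
  have hCu : IsUnit C := by
    rw [Matrix.isUnit_iff_isUnit_det]
    have := hA.inv.det_pos
    rw [hC, Matrix.det_mul, Matrix.det_transpose] at this
    exact (mul_self_pos.1 this).isUnit
  have hP : (C * sigmaMat B s2 * Cᵀ).PosDef := by
    have := hB.mul_mul_conjTranspose_same (B := C) (Matrix.vecMul_injective_of_isUnit hCu)
    rwa [Matrix.conjTranspose_eq_transpose_of_trivial] at this
  have h1 := log_det_le hP
  have h2 : Real.log (C * sigmaMat B s2 * Cᵀ).det =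
      Real.log (sigmaMat B s2).det - Real.log (sigmaMat A s2).det := by
    have : (C * sigmaMat B s2 * Cᵀ).det = (sigmaMat A s2)⁻¹.det * (sigmaMat B s2).det := by
      rw [hC]; simp only [Matrix.det_mul, Matrix.det_transpose]; ring
    rw [this, Real.log_mul hA.inv.det_pos.ne' hB.det_pos.ne', Matrix.det_nonsing_inv,
      Ring.inverse_eq_inv', Real.log_inv]
    ring
  have h3 : (C * sigmaMat B s2 * Cᵀ).trace = ((sigmaMat A s2)⁻¹ * sigmaMat B s2).trace := by
    rw [Matrix.trace_mul_comm, ← Matrix.mul_assoc, hC]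
  have h4 : sigmaMat B s2 = sigmaMat A s2 + (B * Bᵀ - A * Aᵀ) := by
    simp only [sigmaMat]; abel
  rw [h2, h3, h4, Matrix.mul_add, sigmaMat_inv_mul A hs, Matrix.trace_add, Matrix.trace_one] at h1
  rw [← h4] at h1
  linarith

/-- The push-through identity. -/
theorem transpose_mul_sigmaMat_inv (A : Matrix (Fin m) (Fin k) ℝ) {s2 : ℝ} (hs : 0 < s2) :
    (Aᵀ * A + s2 • (1 : Matrix (Fin k) (Fin k) ℝ)) * (Aᵀ * (sigmaMat A s2)⁻¹) = Aᵀ := by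
  have : (Aᵀ * A + s2 • (1 : Matrix (Fin k) (Fin k) ℝ)) * Aᵀ = Aᵀ * sigmaMat A s2 := by
    simp [sigmaMat, Matrix.add_mul, Matrix.mul_add, Matrix.mul_assoc]
  rw [← Matrix.mul_assoc, this, Matrix.mul_assoc, sigmaMat_mul_inv A hs, Matrix.mul_one]

end Sigma

/-! ### The quasi-likelihood -/

theorem exists_pos_le_of_finite {ι : Type*} [Finite ι] {f : ι → ℝ} (hf : ∀ i, 0 < f i) :
    ∃ c, 0 < c ∧ ∀ i, c ≤ f i := by
  have h : ∀ᶠ c in 𝓝[>] (0 : ℝ), ∀ i, c ≤ f i :=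
    eventually_all.2 fun i => (eventually_nhdsWithin_of_eventually_nhds
      ((eventually_lt_nhds (hf i)).mono fun _ h => h.le))
  obtain ⟨c, hc, h0⟩ := (h.and self_mem_nhdsWithin).exists
  exact ⟨c, h0, hc⟩

namespace MarkovParam

variable {J : ℕ} (θ : MarkovParam J) {T : ℕ}

theorem Q_le_one (j k : Fin J) : θ.Q j k ≤ 1 := by
  rw [← θ.Q_sum k]
  exact Finset.single_le_sum (f := fun j => θ.Q j k) (fun i _ => (θ.Q_pos i k).le) (Finset.mem_univ j)

theorem φ_le_one (k : Fin J) : θ.φ k ≤ 1 := by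
  rw [← θ.φ_sum]
  exact Finset.single_le_sum (f := θ.φ) (fun i _ => (θ.φ_pos i).le) (Finset.mem_univ k)

/-- The factor of date `t` in the probability of a path. -/
def step (s : Fin T → Fin J) (t : Fin T) : ℝ :=
  if 0 < t.val
    then θ.Q (s t) (s ⟨t.val - 1, lt_of_le_of_lt (Nat.sub_le _ _) t.isLt⟩)
    else θ.φ (s t)

theorem pathProb_eq (s : Fin T → Fin J) : θ.pathProb s = ∏ t, θ.step s t := rfl

theorem step_pos (s : Fin T → Fin J) (t : Fin T) : 0 < θ.step s t := by
  unfold step; split_ifs; exacts [θ.Q_pos _ _, θ.φ_pos _]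

theorem step_le_one (s : Fin T → Fin J) (t : Fin T) : θ.step s t ≤ 1 := by
  unfold step; split_ifs; exacts [θ.Q_le_one _ _, θ.φ_le_one _]

theorem pathProb_pos (s : Fin T → Fin J) : 0 < θ.pathProb s :=
  Finset.prod_pos fun t _ => θ.step_pos s t

theorem pathProb_le_one (s : Fin T → Fin J) : θ.pathProb s ≤ 1 :=
  Finset.prod_le_one (fun t _ => (θ.step_pos s t).le) fun t _ => θ.step_le_one s t

theorem exists_step_ge : ∃ c, 0 < c ∧ c ≤ 1 ∧
    ∀ (T : ℕ) (s : Fin T → Fin J) (t : Fin T), c ≤ θ.step s t := by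
  obtain ⟨c1, h1, h1'⟩ := exists_pos_le_of_finite (f := fun p : Fin J × Fin J => θ.Q p.1 p.2)
    fun _ => θ.Q_pos _ _
  obtain ⟨c2, h2, h2'⟩ := exists_pos_le_of_finite θ.φ_pos
  refine ⟨min 1 (min c1 c2), by positivity, min_le_left _ _, fun T s t => ?_⟩
  refine (min_le_right _ _).trans ?_
  unfold step
  split_ifs
  exacts [(min_le_left _ _).trans (h1' (_, _)), (min_le_right _ _).trans (h2' _)]

/-- A lower bound of the working initial and transition probabilities. -/
def lower : ℝ := θ.exists_step_ge.choose

theorem lower_pos : 0 < θ.lower := θ.exists_step_ge.choose_spec.1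

theorem lower_le_one : θ.lower ≤ 1 := θ.exists_step_ge.choose_spec.2.1

theorem lower_le_step (s : Fin T → Fin J) (t : Fin T) : θ.lower ≤ θ.step s t :=
  θ.exists_step_ge.choose_spec.2.2 T s t

theorem lower_pow_le_pathProb (s : Fin T → Fin J) : θ.lower ^ T ≤ θ.pathProb s := by
  have := Finset.prod_le_prod (s := Finset.univ) (fun t _ => θ.lower_pos.le)
    fun t _ => θ.lower_le_step s t
  simpa [pathProb_eq] using this

theorem pathProb_le_update (s : Fin T → Fin J) (t : Fin T) (j : Fin J) :
    θ.pathProb s ≤ (θ.lower⁻¹) ^ 2 * θ.pathProb (Function.update s t j) := by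
  set K := θ.lower⁻¹
  have hK : 1 ≤ K := (one_le_inv₀ θ.lower_pos).2 θ.lower_le_one
  have hK0 : 0 ≤ K := zero_le_one.trans hK
  have h1 : ∀ u, θ.step s u ≤ ((if u = t then K else 1) * (if u.val = t.val + 1 then K else 1)) *
      θ.step (Function.update s t j) u := by
    intro u
    have hp := θ.step_pos (Function.update s t j) u
    have hbig : θ.step s u ≤ K * θ.step (Function.update s t j) u := by
      calc θ.step s u ≤ 1 := θ.step_le_one _ _
        _ = K * θ.lower := (inv_mul_cancel₀ θ.lower_pos.ne').symm
        _ ≤ _ := mul_le_mul_of_nonneg_left (θ.lower_le_step _ _) hK0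
    by_cases hu : u = t
    · have : u.val ≠ t.val + 1 := by rw [hu]; omega
      simpa [hu] using (hu ▸ hbig)
    · by_cases hv : u.val = t.val + 1
      · simpa [hu, hv] using hbig
      · have : θ.step (Function.update s t j) u = θ.step s u := by
          unfold step
          split_ifs with h0
          · rw [Function.update_of_ne hu, Function.update_of_ne]
            intro h
            have := congrArg Fin.val h
            simp only at this
            omega
          · rw [Function.update_of_ne hu]
        simp [hu, hv, this]
  rw [pathProb_eq, pathProb_eq]
  refine (Finset.prod_le_prod (fun u _ => (θ.step_pos s u).le) fun u _ => h1 u).trans ?_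
  rw [Finset.prod_mul_distrib, Finset.prod_mul_distrib, sq]
  refine mul_le_mul_of_nonneg_right ?_ (θ.pathProb_pos _).le
  refine mul_le_mul (by simp) ?_ (Finset.prod_nonneg fun u _ => by split_ifs <;> positivity) hK0
  rw [Finset.prod_ite, Finset.prod_const, Finset.prod_const_one, mul_one]
  have hc : (Finset.univ.filter fun u : Fin T => u.val = t.val + 1).card ≤ 1 :=
    Finset.card_le_one.2 fun a ha b hb => Fin.ext (by simp at ha hb; omega)
  calc K ^ _ ≤ K ^ 1 := pow_le_pow_right₀ hK hc
    _ = K := pow_one K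

variable {r : Fin J → ℕ} {N : ℕ} (L : (j : Fin J) → Matrix (Fin N) (Fin (r j)) ℝ) {s2 : ℝ}
  (hs : 0 < s2) (x : Fin T → Fin N → ℝ)

/-- The quasi-likelihood of the sample. -/
def total (s2 : ℝ) : ℝ := ∑ s : Fin T → Fin J, θ.joint L s2 x s

include hs in
theorem joint_pos (s : Fin T → Fin J) : 0 < θ.joint L s2 x s :=
  mul_pos (Finset.prod_pos fun t _ => density_pos _ hs _) (θ.pathProb_pos s)

include θ in
theorem nonempty_path : Nonempty (Fin T → Fin J) := by
  rcases isEmpty_or_nonempty (Fin J) with h | h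
  · have := θ.φ_sum
    simp at this
  · infer_instance

include hs in
theorem total_pos : 0 < θ.total L x s2 :=
  haveI := θ.nonempty_path (T := T)
  Finset.sum_pos (fun s _ => θ.joint_pos L hs x s) Finset.univ_nonempty

include hs in
theorem smoothed_nonneg (t : Fin T) (j : Fin J) : 0 ≤ θ.smoothed L s2 x t j :=
  div_nonneg (Finset.sum_nonneg fun s _ => by
    split_ifs; exacts [(θ.joint_pos L hs x s).le, le_rfl]) (θ.total_pos L hs x).le

include hs in
theorem sum_smoothed (t : Fin T) : ∑ j, θ.smoothed L s2 x t j = 1 := by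
  unfold smoothed
  rw [← Finset.sum_div, Finset.sum_comm]
  simp only [Finset.sum_ite_eq, Finset.mem_univ, if_true]
  exact div_self (θ.total_pos L hs x).ne'

include hs in
theorem smoothed_le_one (t : Fin T) (j : Fin J) : θ.smoothed L s2 x t j ≤ 1 := by
  rw [← θ.sum_smoothed L hs x t]
  exact Finset.single_le_sum (f := fun j => θ.smoothed L s2 x t j)
    (fun i _ => θ.smoothed_nonneg L hs x t i) (Finset.mem_univ j)

include hs in
/-- Changing the regime at one date. -/
theorem smoothed_mul_density_le (t : Fin T) (j k : Fin J) :
    θ.smoothed L s2 x t k * density (L j) s2 (x t) ≤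
      (θ.lower⁻¹) ^ 2 * density (L k) s2 (x t) * θ.smoothed L s2 x t j := by
  have hT := θ.total_pos L hs x
  have key : ∀ s : Fin T → Fin J, s t = k → θ.joint L s2 x s * density (L j) s2 (x t) ≤
      (θ.lower⁻¹) ^ 2 * density (L k) s2 (x t) * θ.joint L s2 x (Function.update s t j) := by
    intro s hst
    unfold joint
    rw [← Finset.mul_prod_erase _ _ (Finset.mem_univ t),
      ← Finset.mul_prod_erase _ (fun u => density (L (Function.update s t j u)) s2 (x u))
        (Finset.mem_univ t), hst, Function.update_self]
    have : ∏ u ∈ Finset.univ.erase t, density (L (Function.update s t j u)) s2 (x u) =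
        ∏ u ∈ Finset.univ.erase t, density (L (s u)) s2 (x u) :=
      Finset.prod_congr rfl fun u hu => by rw [Function.update_of_ne (Finset.ne_of_mem_erase hu)]
    rw [this]
    have h0 : 0 < ∏ u ∈ Finset.univ.erase t, density (L (s u)) s2 (x u) :=
      Finset.prod_pos fun u _ => density_pos _ hs _
    have h1 := density_pos (L k) hs (x t)
    have h2 := density_pos (L j) hs (x t)
    have h3 := θ.pathProb_le_update s t j
    generalize ∏ u ∈ Finset.univ.erase t, density (L (s u)) s2 (x u) = q at *
    generalize density (L k) s2 (x t) = a at *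
    generalize density (L j) s2 (x t) = b at *
    generalize θ.pathProb s = c at *
    generalize θ.pathProb (Function.update s t j) = d at *
    calc a * q * c * b = (a * q * b) * c := by ring
      _ ≤ (a * q * b) * ((θ.lower⁻¹) ^ 2 * d) := mul_le_mul_of_nonneg_left h3 (by positivity)
      _ = _ := by ring
  have hsum : (∑ s : Fin T → Fin J, if s t = k then θ.joint L s2 x s else 0) *
      density (L j) s2 (x t) ≤ (θ.lower⁻¹) ^ 2 * density (L k) s2 (x t) *
      ∑ s : Fin T → Fin J, if s t = j then θ.joint L s2 x s else 0 := by
    rw [← Finset.sum_filter, ← Finset.sum_filter, Finset.sum_mul]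
    refine (Finset.sum_le_sum fun s hs' => key s (Finset.mem_filter.1 hs').2).trans (le_of_eq ?_)
    rw [← Finset.mul_sum]
    congr 1
    refine Finset.sum_nbij' (fun s => Function.update s t j) (fun s => Function.update s t k)
      ?_ ?_ ?_ ?_ ?_
    · intro s _; simp
    · intro s _; simp
    · intro s hs'
      simp only [Function.update_idem]
      rw [← (Finset.mem_filter.1 hs').2, Function.update_eq_self]
    · intro s hs'
      simp only [Function.update_idem]
      rw [← (Finset.mem_filter.1 hs').2, Function.update_eq_self]
    · intro s _; rfl
  unfold smoothed
  rw [div_mul_eq_mul_div, mul_div_assoc']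
  exact div_le_div_of_nonneg_right hsum hT.le

include hs in
theorem smoothed_ge_of_max (t : Fin T) (j : Fin J)
    (hj : ∀ k, density (L k) s2 (x t) ≤ density (L j) s2 (x t)) :
    (J * (θ.lower⁻¹) ^ 2)⁻¹ ≤ θ.smoothed L s2 x t j := by
  have hd := density_pos (L j) hs (x t)
  have hl := θ.lower_pos
  have h0 := θ.smoothed_nonneg L hs x t j
  have h1 : ∀ k, θ.smoothed L s2 x t k ≤ (θ.lower⁻¹) ^ 2 * θ.smoothed L s2 x t j := by
    intro k
    have := θ.smoothed_mul_density_le L hs x t j k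
    have h2 : (θ.lower⁻¹) ^ 2 * density (L k) s2 (x t) * θ.smoothed L s2 x t j ≤
        (θ.lower⁻¹) ^ 2 * density (L j) s2 (x t) * θ.smoothed L s2 x t j :=
      mul_le_mul_of_nonneg_right (mul_le_mul_of_nonneg_left (hj k) (by positivity)) h0
    refine le_of_mul_le_mul_right ?_ hd
    linarith
  have h2 := Finset.sum_le_sum fun k (_ : k ∈ Finset.univ) => h1 k
  rw [θ.sum_smoothed L hs x t, Finset.sum_const, Finset.card_univ, Fintype.card_fin,
    nsmul_eq_mul] at h2
  have hJ : (0 : ℝ) < J := by exact_mod_cast Fin.pos j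
  rw [inv_le_iff_one_le_mul₀ (by positivity)]
  linarith

include hs in
theorem logLik_le (j : Fin T → Fin J)
    (hj : ∀ t k, density (L k) s2 (x t) ≤ density (L (j t)) s2 (x t)) :
    θ.logLik L s2 x ≤ ∑ t, Real.log (density (L (j t)) s2 (x t)) + T * Real.log J := by
  rcases Nat.eq_zero_or_pos T with rfl | hT
  · have h1 : θ.total L x s2 ≤ 1 := by
      unfold total
      rw [Fintype.sum_unique]
      simpa [joint] using θ.pathProb_le_one _
    have h2 : θ.logLik L s2 x ≤ 0 := Real.log_nonpos (θ.total_pos L hs x).le h1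
    simpa using h2
  have hJ : (0 : ℝ) < J := by exact_mod_cast Fin.pos (j ⟨0, hT⟩)
  have h1 : θ.total L x s2 ≤ (J : ℝ) ^ T * ∏ t, density (L (j t)) s2 (x t) := by
    have : ∀ s : Fin T → Fin J, θ.joint L s2 x s ≤ ∏ t, density (L (j t)) s2 (x t) := by
      intro s
      refine (mul_le_of_le_one_right (Finset.prod_nonneg fun t _ => (density_pos _ hs _).le)
        (θ.pathProb_le_one s)).trans ?_
      exact Finset.prod_le_prod (fun t _ => (density_pos _ hs _).le) fun t _ => hj t _
    refine (Finset.sum_le_sum fun s _ => this s).trans (le_of_eq ?_)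
    simp
  calc θ.logLik L s2 x ≤ Real.log ((J : ℝ) ^ T * ∏ t, density (L (j t)) s2 (x t)) :=
        Real.log_le_log (θ.total_pos L hs x) h1
    _ = _ := by
      rw [Real.log_mul (by positivity) (Finset.prod_pos fun t _ => density_pos _ hs _).ne',
        Real.log_pow, Real.log_prod fun t _ => (density_pos _ hs _).ne']
      ring

include hs in
theorem le_logLik (z : Fin T → Fin J) :
    ∑ t, Real.log (density (L (z t)) s2 (x t)) + T * Real.log θ.lower ≤ θ.logLik L s2 x := by
  have hl := θ.lower_pos
  have h1 : (∏ t, density (L (z t)) s2 (x t)) * θ.lower ^ T ≤ θ.total L x s2 :=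
    (mul_le_mul_of_nonneg_left (θ.lower_pow_le_pathProb z)
      (Finset.prod_nonneg fun t _ => (density_pos _ hs _).le)).trans
    (Finset.single_le_sum (f := fun s => θ.joint L s2 x s)
      (fun s _ => (θ.joint_pos L hs x s).le) (Finset.mem_univ z))
  have h0 : 0 < ∏ t, density (L (z t)) s2 (x t) := Finset.prod_pos fun t _ => density_pos _ hs _
  calc _ = Real.log ((∏ t, density (L (z t)) s2 (x t)) * θ.lower ^ T) := by
        rw [Real.log_mul h0.ne' (by positivity), Real.log_pow,
          Real.log_prod fun t _ => (density_pos _ hs _).ne']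
    _ ≤ _ := Real.log_le_log (by positivity) h1

include hs in
/-- The improvement of the expected complete log-likelihood is at most that of the
log-likelihood. -/
theorem sum_smoothed_log_le (A : (j : Fin J) → Matrix (Fin N) (Fin (r j)) ℝ) :
    ∑ t, ∑ k, θ.smoothed L s2 x t k *
      (Real.log (density (A k) s2 (x t)) - Real.log (density (L k) s2 (x t))) ≤
      θ.logLik A s2 x - θ.logLik L s2 x := by
  set D : Fin T → Fin J → ℝ := fun t k =>
    Real.log (density (A k) s2 (x t)) - Real.log (density (L k) s2 (x t)) with hD
  set Z := θ.total L x s2 with hZ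
  set Y := θ.total A x s2 with hY
  have hZ0 : 0 < Z := θ.total_pos L hs x
  have hY0 : 0 < Y := θ.total_pos A hs x
  have h1 : ∑ t, ∑ k, θ.smoothed L s2 x t k * D t k =
      ∑ s : Fin T → Fin J, θ.joint L s2 x s / Z * ∑ t, D t (s t) := by
    have : ∀ t, ∑ k, θ.smoothed L s2 x t k * D t k =
        ∑ s : Fin T → Fin J, θ.joint L s2 x s / Z * D t (s t) := by
      intro t
      unfold smoothed
      simp only [Finset.sum_div, Finset.sum_mul]
      rw [Finset.sum_comm]
      refine Finset.sum_congr rfl fun s _ => ?_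
      rw [Finset.sum_eq_single (s t)]
      · simp [hZ, total]
      · intro b _ hb; simp [hb.symm]
      · simp
    simp only [this, Finset.mul_sum]
    rw [Finset.sum_comm]
  have h2 : ∀ s : Fin T → Fin J, ∑ t, D t (s t) =
      Real.log (θ.joint A s2 x s / θ.joint L s2 x s) := by
    intro s
    have e1 : ∀ B : (j : Fin J) → Matrix (Fin N) (Fin (r j)) ℝ, Real.log (θ.joint B s2 x s) =
        ∑ t, Real.log (density (B (s t)) s2 (x t)) + Real.log (θ.pathProb s) := fun B => by
      unfold joint
      rw [Real.log_mul (Finset.prod_pos fun t _ => density_pos _ hs _).ne' (θ.pathProb_pos s).ne',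
        Real.log_prod fun t _ => (density_pos _ hs _).ne']
    rw [Real.log_div (θ.joint_pos A hs x s).ne' (θ.joint_pos L hs x s).ne', e1, e1, hD,
      Finset.sum_sub_distrib]
    ring
  have h3 : ∀ s : Fin T → Fin J, θ.joint L s2 x s / Z * ∑ t, D t (s t) ≤
      θ.joint A s2 x s / Y - θ.joint L s2 x s / Z + θ.joint L s2 x s / Z * Real.log (Y / Z) := by
    intro s
    have hA := θ.joint_pos A hs x s
    have hL := θ.joint_pos L hs x s
    have := Real.log_le_sub_one_of_pos
      (show 0 < θ.joint A s2 x s / θ.joint L s2 x s / (Y / Z) by positivity)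
    rw [Real.log_div (by positivity) (by positivity)] at this
    rw [h2]
    calc _ ≤ θ.joint L s2 x s / Z *
          (θ.joint A s2 x s / θ.joint L s2 x s / (Y / Z) - 1 + Real.log (Y / Z)) :=
          mul_le_mul_of_nonneg_left (by linarith) (by positivity)
      _ = _ := by field_simp
  rw [h1]
  refine (Finset.sum_le_sum fun s _ => h3 s).trans (le_of_eq ?_)
  rw [Finset.sum_add_distrib, Finset.sum_sub_distrib, ← Finset.sum_mul, ← Finset.sum_div,
    ← Finset.sum_div]
  change Y / Y - Z / Z + Z / Z * _ = Real.log Y - Real.log Z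
  rw [div_self hY0.ne', div_self hZ0.ne', Real.log_div hY0.ne' hZ0.ne']
  ring

end MarkovParam

/-! ### First-order conditions -/

theorem eq_zero_of_forall_quadratic_nonneg {a b : ℝ} (h : ∀ ε : ℝ, 0 ≤ a * ε + b * ε ^ 2) :
    a = 0 := by
  by_contra ha
  have hb : 0 < |b| + 1 := by positivity
  have := h (-a / (|b| + 1))
  have h2 : a * (-a / (|b| + 1)) + b * (-a / (|b| + 1)) ^ 2 =
      (a / (|b| + 1)) ^ 2 * (b - (|b| + 1)) := by field_simp; ring
  rw [h2] at this
  have h3 : 0 < (a / (|b| + 1)) ^ 2 := by positivity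
  nlinarith [le_abs_self b]

theorem weighted_foc {m k T : ℕ} (L : Matrix (Fin m) (Fin k) ℝ) {s2 : ℝ} (hs : 0 < s2)
    (x : Fin T → Fin m → ℝ) (p : Fin T → ℝ) (hp : ∀ t, 0 ≤ p t)
    (hmax : ∀ A : Matrix (Fin m) (Fin k) ℝ,
      ∑ t, p t * (Real.log (density A s2 (x t)) - Real.log (density L s2 (x t))) ≤ 0) :
    ∑ t, p t • (Matrix.vecMulVec (x t) (x t) * L) =
      (∑ t, p t) • (L * (Lᵀ * L + s2 • (1 : Matrix (Fin k) (Fin k) ℝ))) := by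
  set S := (sigmaMat L s2)⁻¹ with hS
  have hSt : Sᵀ = S := sigmaMat_inv_transpose L s2
  set g : Fin T → Fin k → ℝ := fun t => fit L s2 (x t) with hg
  set y : Fin T → Fin m → ℝ := fun t => S *ᵥ x t with hy
  have hdir : ∀ B : Matrix (Fin m) (Fin k) ℝ,
      (∑ t, p t) * (S * L * Bᵀ).trace - ∑ t, p t * (y t ⬝ᵥ (B *ᵥ g t)) = 0 := by
    intro B
    have h2 : 2 * ((∑ t, p t) * (S * L * Bᵀ).trace - ∑ t, p t * (y t ⬝ᵥ (B *ᵥ g t))) = 0 := by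
      apply eq_zero_of_forall_quadratic_nonneg
        (b := (∑ t, p t) * (S * (B * Bᵀ)).trace + ∑ t, p t * (vn (B *ᵥ g t) ^ 2 / s2))
      intro ε
      have hm := hmax (L + ε • B)
      have hdet := log_det_sigmaMat_sub_le L (L + ε • B) hs
      have htr : (S * ((L + ε • B) * (L + ε • B)ᵀ - L * Lᵀ)).trace =
          2 * ε * (S * L * Bᵀ).trace + ε ^ 2 * (S * (B * Bᵀ)).trace := by
        have e1 : (L + ε • B) * (L + ε • B)ᵀ - L * Lᵀ =
            ε • (L * Bᵀ) + ε • (B * Lᵀ) + ε ^ 2 • (B * Bᵀ) := by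
          simp only [Matrix.transpose_add, Matrix.transpose_smul, Matrix.add_mul, Matrix.mul_add,
            Matrix.smul_mul, Matrix.mul_smul, smul_smul, sq, smul_add]
          abel
        have e2 : (S * (B * Lᵀ)).trace = (S * L * Bᵀ).trace := by
          rw [← Matrix.trace_transpose, Matrix.transpose_mul, Matrix.transpose_mul,
            Matrix.transpose_transpose, hSt, Matrix.trace_mul_comm, Matrix.mul_assoc]
        rw [e1]
        simp only [Matrix.mul_add, Matrix.mul_smul, Matrix.trace_add, Matrix.trace_smul,
          smul_eq_mul, e2]
        rw [Matrix.mul_assoc]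
        ring
      have hquad : ∀ t, x t ⬝ᵥ ((sigmaMat (L + ε • B) s2)⁻¹ *ᵥ x t) - x t ⬝ᵥ (S *ᵥ x t) ≤
          -2 * ε * (y t ⬝ᵥ (B *ᵥ g t)) + ε ^ 2 * (vn (B *ᵥ g t) ^ 2 / s2) := by
        intro t
        have q1 := quadForm_le (L + ε • B) hs (x t) (g t)
        have q2 := quadForm_eq L hs (x t)
        have q3 := fit_residual L hs (x t)
        have q4 : x t - (L + ε • B) *ᵥ g t = s2 • y t - ε • (B *ᵥ g t) := by
          rw [Matrix.add_mulVec, ← sub_sub, Matrix.smul_mulVec]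
          exact congrArg (· - _) q3
        have q5 : vn (x t - L *ᵥ fit L s2 (x t)) ^ 2 = s2 ^ 2 * (y t ⬝ᵥ y t) := by
          rw [q3, vn_smul, mul_pow, sq_abs, vn_sq]
        rw [q5] at q2
        rw [q4] at q1
        have q6 : vn (s2 • y t - ε • (B *ᵥ g t)) ^ 2 = s2 ^ 2 * (y t ⬝ᵥ y t) -
            2 * s2 * ε * (y t ⬝ᵥ (B *ᵥ g t)) + ε ^ 2 * vn (B *ᵥ g t) ^ 2 := by
          simp only [vn_sq, sub_dotProduct, dotProduct_sub, smul_dotProduct, dotProduct_smul,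
            smul_eq_mul]
          rw [dotProduct_comm (B *ᵥ g t) (y t)]
          ring
        rw [q6] at q1
        rw [q2]
        have : (s2 ^ 2 * (y t ⬝ᵥ y t) - 2 * s2 * ε * (y t ⬝ᵥ (B *ᵥ g t)) +
            ε ^ 2 * vn (B *ᵥ g t) ^ 2) / s2 = s2 ^ 2 * (y t ⬝ᵥ y t) / s2 -
            2 * ε * (y t ⬝ᵥ (B *ᵥ g t)) + ε ^ 2 * (vn (B *ᵥ g t) ^ 2 / s2) := by
          field_simp
        linarith
      have hterm : ∀ t, p t * (2 * ε * (S * L * Bᵀ).trace + ε ^ 2 * (S * (B * Bᵀ)).trace +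
          (-2 * ε * (y t ⬝ᵥ (B *ᵥ g t)) + ε ^ 2 * (vn (B *ᵥ g t) ^ 2 / s2))) ≥
          -2 * (p t * (Real.log (density (L + ε • B) s2 (x t)) -
            Real.log (density L s2 (x t)))) := by
        intro t
        have l1 := log_density (L + ε • B) hs (x t)
        have l2 := log_density L hs (x t)
        have := hquad t
        rw [htr] at hdet
        have := mul_le_mul_of_nonneg_left (show -2 * (Real.log (density (L + ε • B) s2 (x t)) -
            Real.log (density L s2 (x t))) ≤ 2 * ε * (S * L * Bᵀ).trace +
            ε ^ 2 * (S * (B * Bᵀ)).trace + (-2 * ε * (y t ⬝ᵥ (B *ᵥ g t)) +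
            ε ^ 2 * (vn (B *ᵥ g t) ^ 2 / s2)) by linarith) (hp t)
        linarith
      have hsum := Finset.sum_le_sum fun t (_ : t ∈ Finset.univ) => hterm t
      rw [← Finset.mul_sum] at hsum
      have hexp : ∑ t, p t * (2 * ε * (S * L * Bᵀ).trace + ε ^ 2 * (S * (B * Bᵀ)).trace +
          (-2 * ε * (y t ⬝ᵥ (B *ᵥ g t)) + ε ^ 2 * (vn (B *ᵥ g t) ^ 2 / s2))) =
          2 * ((∑ t, p t) * (S * L * Bᵀ).trace - ∑ t, p t * (y t ⬝ᵥ (B *ᵥ g t))) * ε +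
          ((∑ t, p t) * (S * (B * Bᵀ)).trace + ∑ t, p t * (vn (B *ᵥ g t) ^ 2 / s2)) * ε ^ 2 := by
        simp only [Finset.sum_mul, Finset.mul_sum, ← Finset.sum_add_distrib,
          ← Finset.sum_sub_distrib]
        refine Finset.sum_congr rfl fun t _ => ?_
        ring
      rw [← hexp]
      linarith
    linarith
  have hSL : (∑ t, p t) • (S * L) = ∑ t, p t • Matrix.vecMulVec (y t) (g t) := by
    ext i l
    have := hdir (Matrix.single i l 1)
    have e1 : (S * L * (Matrix.single i l (1 : ℝ))ᵀ).trace = (S * L) i l := by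
      rw [Matrix.transpose_single, Matrix.trace_mul_single]
      simp
    have e2 : ∀ t, y t ⬝ᵥ ((Matrix.single i l (1 : ℝ)) *ᵥ g t) = y t i * g t l := by
      intro t
      rw [Matrix.single_mulVec]
      simp [dotProduct, Function.update_apply]
    simp only [e1, e2] at this
    simp only [Matrix.smul_apply, smul_eq_mul, Matrix.sum_apply, Matrix.vecMulVec_apply]
    linarith
  have hBL : S * L * (Lᵀ * L + s2 • (1 : Matrix (Fin k) (Fin k) ℝ)) = L := by
    have := congrArg Matrix.transpose (transpose_mul_sigmaMat_inv L hs)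
    simpa [Matrix.transpose_mul, ← hS, hSt, Matrix.mul_assoc] using this
  have hL2 : (∑ t, p t) • L = ∑ t, p t • (Matrix.vecMulVec (x t) (x t) * (S * L)) := by
    have := congrArg (fun X => sigmaMat L s2 * X) hSL
    simp only [Matrix.mul_smul, Matrix.mul_sum, ← Matrix.mul_assoc, sigmaMat_mul_inv L hs, hS] at this
    rw [Matrix.one_mul] at this
    rw [this]
    refine Finset.sum_congr rfl fun t _ => ?_
    congr 1
    rw [Matrix.mul_vecMulVec, Matrix.vecMulVec_mul]
    have e1 : sigmaMat L s2 *ᵥ y t = x t := by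
      rw [hy]; simp only [hS, Matrix.mulVec_mulVec, sigmaMat_mul_inv L hs, Matrix.one_mulVec]
    have e2 : g t = x t ᵥ* (S * L) := by
      rw [hg]
      simp only [fit]
      rw [← hS, Matrix.mulVec_mulVec, ← Matrix.vecMul_transpose, Matrix.transpose_mul, hSt, Matrix.transpose_transpose]
    rw [e1, e2]
  calc ∑ t, p t • (Matrix.vecMulVec (x t) (x t) * L)
      = (∑ t, p t • (Matrix.vecMulVec (x t) (x t) * (S * L))) *
          (Lᵀ * L + s2 • (1 : Matrix (Fin k) (Fin k) ℝ)) := by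
        rw [Matrix.sum_mul]
        refine Finset.sum_congr rfl fun t _ => ?_
        rw [Matrix.smul_mul, Matrix.mul_assoc, hBL]
    _ = _ := by rw [← hL2, Matrix.smul_mul]

/-! ### Projections -/

/-- Matrices of orthogonal projections. -/
structure IsProjMat {m : Type*} [Fintype m] (P : Matrix m m ℝ) : Prop where
  symm : Pᵀ = P
  idem : P * P = P

namespace IsProjMat

variable {m : Type*} [Fintype m] [DecidableEq m] {P Q : Matrix m m ℝ}

theorem compl (hP : IsProjMat P) : IsProjMat (1 - P) where
  symm := by rw [Matrix.transpose_sub, Matrix.transpose_one, hP.symm]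
  idem := by simp [Matrix.sub_mul, Matrix.mul_sub, hP.idem]

omit [DecidableEq m] in
theorem dotProduct_mulVec (hP : IsProjMat P) (v w : m → ℝ) : (P *ᵥ v) ⬝ᵥ w = v ⬝ᵥ (P *ᵥ w) := by
  rw [Matrix.dotProduct_mulVec, ← Matrix.mulVec_transpose, hP.symm]

omit [DecidableEq m] in
theorem vn_sq (hP : IsProjMat P) (v : m → ℝ) : vn (P *ᵥ v) ^ 2 = v ⬝ᵥ (P *ᵥ v) := by
  rw [RegimeSwitching.vn_sq, hP.dotProduct_mulVec, Matrix.mulVec_mulVec, hP.idem]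

theorem vn_sq_compl (hP : IsProjMat P) (v : m → ℝ) :
    vn ((1 - P) *ᵥ v) ^ 2 = vn v ^ 2 - vn (P *ᵥ v) ^ 2 := by
  rw [hP.compl.vn_sq, hP.vn_sq, RegimeSwitching.vn_sq, Matrix.sub_mulVec, Matrix.one_mulVec,
    dotProduct_sub]

theorem vn_compl_le (hP : IsProjMat P) (v : m → ℝ) : vn ((1 - P) *ᵥ v) ≤ vn v :=
  abs_le_of_sq_le_sq' (by rw [hP.vn_sq_compl]; nlinarith [sq_nonneg (vn (P *ᵥ v))]) (vn_nonneg v) |>.2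

theorem vn_le (hP : IsProjMat P) (v : m → ℝ) : vn (P *ᵥ v) ≤ vn v := by
  have := hP.compl.vn_compl_le v
  rwa [sub_sub_cancel] at this

omit [DecidableEq m] in
theorem fn_sq (hP : IsProjMat P) : fn P ^ 2 = P.trace := by
  rw [fn_sq_trace, hP.symm, hP.idem]

theorem fn_sq_compl_mul (hP : IsProjMat P) (hQ : IsProjMat Q) :
    fn ((1 - P) * Q) ^ 2 = Q.trace - (P * Q).trace := by
  rw [fn_sq_trace, Matrix.transpose_mul, hQ.symm, hP.compl.symm, Matrix.mul_assoc,
    ← Matrix.mul_assoc (1 - P), hP.compl.idem, Matrix.trace_mul_comm, Matrix.mul_assoc, hQ.idem,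
    Matrix.sub_mul, Matrix.one_mul, Matrix.trace_sub]

theorem trace_mul_le_left (hP : IsProjMat P) (hQ : IsProjMat Q) : (P * Q).trace ≤ P.trace := by
  have := hQ.fn_sq_compl_mul hP
  rw [Matrix.trace_mul_comm Q P] at this
  nlinarith [sq_nonneg (fn ((1 - Q) * P))]

/-- Two subspaces of the same dimension are close if one is nearly contained in the other. -/
theorem fn_sub_sq_le (hP : IsProjMat P) (hQ : IsProjMat Q) (h : P.trace ≤ Q.trace) :
    fn (P - Q) ^ 2 ≤ 2 * fn ((1 - P) * Q) ^ 2 := by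
  have h1 : fn (P - Q) ^ 2 = P.trace + Q.trace - 2 * (P * Q).trace := by
    rw [fn_sq_trace, Matrix.transpose_sub, hP.symm, hQ.symm]
    simp only [Matrix.sub_mul, Matrix.mul_sub, hP.idem, hQ.idem, Matrix.trace_sub]
    rw [Matrix.trace_mul_comm Q P]
    ring
  rw [h1, hP.fn_sq_compl_mul hQ]
  linarith

end IsProjMat

section Proj

variable {m k : ℕ}

/-- The orthogonal projection onto the column space. -/
def projMat (A : Matrix (Fin m) (Fin k) ℝ) : Matrix (Fin m) (Fin m) ℝ :=
  (Matrix.toEuclideanCLM (𝕜 := ℝ)).symm (colSpace A).starProjection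

theorem annihilator_eq (A : Matrix (Fin m) (Fin k) ℝ) : annihilator A = 1 - projMat A := rfl

theorem toEuclideanCLM_projMat (A : Matrix (Fin m) (Fin k) ℝ) :
    Matrix.toEuclideanCLM (𝕜 := ℝ) (projMat A) = (colSpace A).starProjection :=
  StarAlgEquiv.apply_symm_apply _ _

theorem isProjMat_projMat (A : Matrix (Fin m) (Fin k) ℝ) : IsProjMat (projMat A) where
  symm := by
    have h : star (projMat A) = projMat A := by
      apply (Matrix.toEuclideanCLM (n := Fin m) (𝕜 := ℝ)).injective
      change Matrix.toEuclideanCLM (𝕜 := ℝ) (star (projMat A)) = Matrix.toEuclideanCLM (𝕜 := ℝ) (projMat A)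
      rw [map_star, toEuclideanCLM_projMat]
      exact (isSelfAdjoint_starProjection _).star_eq
    rwa [Matrix.star_eq_conjTranspose, Matrix.conjTranspose_eq_transpose_of_trivial] at h
  idem := by
    apply (Matrix.toEuclideanCLM (n := Fin m) (𝕜 := ℝ)).injective
    change Matrix.toEuclideanCLM (𝕜 := ℝ) (projMat A * projMat A) =
      Matrix.toEuclideanCLM (𝕜 := ℝ) (projMat A)
    rw [map_mul, toEuclideanCLM_projMat]
    exact (colSpace A).isIdempotentElem_starProjection

theorem projMat_mulVec (A : Matrix (Fin m) (Fin k) ℝ) (v : Fin m → ℝ) :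
    projMat A *ᵥ v = ((colSpace A).starProjection (WithLp.toLp 2 v)).ofLp := by
  rw [← toEuclideanCLM_projMat]
  simp

theorem projMat_mul_self (A : Matrix (Fin m) (Fin k) ℝ) : projMat A * A = A := by
  rw [← Matrix.mulVec_injective.eq_iff]
  funext g
  rw [← Matrix.mulVec_mulVec, projMat_mulVec]
  have : WithLp.toLp 2 (A *ᵥ g) ∈ colSpace A := ⟨WithLp.toLp 2 g, by simp⟩
  rw [Submodule.starProjection_eq_self_iff.2 this]

theorem exists_projMat_eq (A : Matrix (Fin m) (Fin k) ℝ) :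
    ∃ G : Matrix (Fin k) (Fin m) ℝ, projMat A = A * G := by
  have h : ∀ i : Fin m, ∃ g : Fin k → ℝ, A *ᵥ g = projMat A *ᵥ Pi.single i 1 := by
    intro i
    obtain ⟨g, hg⟩ : (colSpace A).starProjection (WithLp.toLp 2 (Pi.single i 1)) ∈ colSpace A :=
      Submodule.starProjection_apply_mem _ _
    refine ⟨g.ofLp, ?_⟩
    rw [projMat_mulVec, ← hg]
    simp
  choose g hg using h
  refine ⟨Matrix.of fun l i => g i l, ?_⟩
  ext a i
  have := congrFun (hg i) a
  rw [Matrix.mulVec_single_one] at this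
  simpa [Matrix.mul_apply, Matrix.mulVec, dotProduct] using this.symm

theorem projMat_eq (A : Matrix (Fin m) (Fin k) ℝ) {Q : Matrix (Fin m) (Fin m) ℝ}
    {G : Matrix (Fin k) (Fin m) ℝ} (hQ : Qᵀ = Q) (hQA : Q * A = A) (hG : Q = A * G) :
    projMat A = Q := by
  obtain ⟨G', hG'⟩ := exists_projMat_eq A
  have h1 : Q * projMat A = projMat A := by rw [hG', ← Matrix.mul_assoc, hQA]
  have h2 : projMat A * Q = Q := by rw [hG, ← Matrix.mul_assoc, projMat_mul_self]
  have := congrArg Matrix.transpose h1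
  rw [Matrix.transpose_mul, hQ, (isProjMat_projMat A).symm, h2] at this
  exact this.symm

theorem projMat_eq_of_isUnit {A : Matrix (Fin m) (Fin k) ℝ} (h : IsUnit (Aᵀ * A).det) :
    projMat A = A * (Aᵀ * A)⁻¹ * Aᵀ := by
  refine projMat_eq A (G := (Aᵀ * A)⁻¹ * Aᵀ) ?_ ?_ (Matrix.mul_assoc _ _ _)
  · simp [Matrix.transpose_mul, Matrix.transpose_nonsing_inv, Matrix.mul_assoc]
  · rw [Matrix.mul_assoc, Matrix.mul_assoc, Matrix.nonsing_inv_mul _ h, Matrix.mul_one]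

theorem trace_projMat_of_isUnit {A : Matrix (Fin m) (Fin k) ℝ} (h : IsUnit (Aᵀ * A).det) :
    (projMat A).trace = k := by
  rw [projMat_eq_of_isUnit h, Matrix.trace_mul_comm, ← Matrix.mul_assoc, Matrix.mul_nonsing_inv _ h]
  simp

theorem projMat_eq_of_isDiag {A : Matrix (Fin m) (Fin k) ℝ} (h : (Aᵀ * A).IsDiag) :
    projMat A = A * Matrix.diagonal (fun l => ((Aᵀ * A) l l)⁻¹) * Aᵀ := by
  have hd : Aᵀ * A = Matrix.diagonal (fun l => (Aᵀ * A) l l) := h.diagonal_diag.symm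
  have hcol : ∀ l, (Aᵀ * A) l l = 0 → ∀ i, A i l = 0 := by
    intro l hl i
    rw [Matrix.mul_apply] at hl
    have := (Finset.sum_eq_zero_iff_of_nonneg fun i _ => mul_self_nonneg (A i l)).1 hl i
      (Finset.mem_univ i)
    exact mul_self_eq_zero.1 this
  refine projMat_eq A (G := Matrix.diagonal (fun l => ((Aᵀ * A) l l)⁻¹) * Aᵀ) ?_ ?_
    (Matrix.mul_assoc _ _ _)
  · simp [Matrix.transpose_mul, Matrix.mul_assoc]
  · rw [Matrix.mul_assoc]
    conv_lhs => rw [hd]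
    rw [Matrix.mul_assoc, Matrix.diagonal_mul_diagonal]
    ext i l
    rw [Matrix.mul_diagonal]
    by_cases h0 : (Aᵀ * A) l l = 0
    · simp [hcol l h0 i]
    · simp only [Matrix.diagonal_apply_eq] at *
      rw [inv_mul_cancel₀ h0, mul_one]

theorem trace_projMat_of_isDiag {A : Matrix (Fin m) (Fin k) ℝ} (h : (Aᵀ * A).IsDiag) :
    (projMat A).trace = ∑ l, ((Aᵀ * A) l l)⁻¹ * (Aᵀ * A) l l := by
  rw [projMat_eq_of_isDiag h, Matrix.trace_mul_comm, ← Matrix.mul_assoc]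
  have hd : Aᵀ * A = Matrix.diagonal (fun l => (Aᵀ * A) l l) := h.diagonal_diag.symm
  conv_lhs => rw [hd]
  rw [Matrix.diagonal_mul_diagonal, Matrix.trace_diagonal]
  simp [mul_comm]

theorem trace_projMat_le_of_isDiag {A : Matrix (Fin m) (Fin k) ℝ} (h : (Aᵀ * A).IsDiag) :
    (projMat A).trace ≤ k := by
  rw [trace_projMat_of_isDiag h]
  calc _ ≤ ∑ l : Fin k, (1 : ℝ) := Finset.sum_le_sum fun l _ => inv_mul_le_one
    _ = k := by simp

theorem diag_pos_of_trace_projMat {A : Matrix (Fin m) (Fin k) ℝ} (h : (Aᵀ * A).IsDiag)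
    (ht : (k : ℝ) - 1 < (projMat A).trace) (l : Fin k) : 0 < (Aᵀ * A) l l := by
  have h0 : 0 ≤ (Aᵀ * A) l l := by
    rw [Matrix.mul_apply]; exact Finset.sum_nonneg fun i _ => mul_self_nonneg _
  refine h0.lt_of_ne fun h1 => ?_
  rw [trace_projMat_of_isDiag h, ← Finset.add_sum_erase _ _ (Finset.mem_univ l), ← h1] at ht
  have : ∑ l' ∈ Finset.univ.erase l, ((Aᵀ * A) l' l')⁻¹ * (Aᵀ * A) l' l' ≤
      ∑ l' ∈ Finset.univ.erase l, (1 : ℝ) := Finset.sum_le_sum fun l _ => inv_mul_le_one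
  rw [Finset.sum_const, Finset.card_erase_of_mem (Finset.mem_univ l), Finset.card_univ,
    Fintype.card_fin, nsmul_eq_mul, mul_one, Nat.cast_sub (Fin.pos l)] at this
  simp at ht this
  linarith

/-- The trace of a projection bounds its action on the errors. -/
theorem fn_proj_mul_sq_le {T : ℕ} {P : Matrix (Fin m) (Fin m) ℝ} (hP : IsProjMat P)
    (E : Matrix (Fin m) (Fin T) ℝ) : fn (P * E) ^ 2 ≤ fn (E * Eᵀ) * P.trace := by
  have := fn_mul_sq_le Eᵀ P
  rw [Matrix.transpose_transpose, hP.fn_sq] at this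
  rwa [← fn_transpose, Matrix.transpose_mul, hP.symm]

end Proj

/-! ### A matching argument -/

/-- A map of a finite set to itself that does not decrease `r` and is injective among the points at
which it preserves `r` (against all others) is injective and preserves `r`. -/
theorem matching {J : ℕ} (r : Fin J → ℕ) (κ : Fin J → Fin J) (h1 : ∀ j, r j ≤ r (κ j))
    (h2 : ∀ j j', κ j = κ j' → r j = r (κ j) → j = j') :
    Function.Injective κ ∧ ∀ j, r (κ j) = r j := by
  have key : ∀ d : ℕ, ∀ j, maxRank r - r j = d → r (κ j) = r j := by
    intro d
    induction d using Nat.strong_induction_on with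
    | _ d ih =>
      intro j hj
      by_contra hne
      have hle : ∀ k, r k ≤ maxRank r := fun k => Finset.le_sup (Finset.mem_univ k)
      have hlt : r j < r (κ j) := lt_of_le_of_ne (h1 j) (Ne.symm hne)
      -- `κ` permutes the indices of larger `r`
      set S := Finset.univ.filter fun k => r j < r k with hS
      have hmem : ∀ k, k ∈ S ↔ r j < r k := fun k => by simp [hS]
      have hr : ∀ k ∈ S, r (κ k) = r k := fun k hk =>
        ih (maxRank r - r k) (by have := hle k; have := (hmem k).1 hk; omega) k rfl
      have hmaps : ∀ k ∈ S, κ k ∈ S := fun k hk => by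
        rw [hmem, hr k hk]; exact (hmem k).1 hk
      have hinj : Set.InjOn κ S := fun a ha b _ hab => h2 a b hab (hr a ha).symm
      obtain ⟨k, hk, hkj⟩ := Finset.surj_on_of_inj_on_of_card_le (s := S) (t := S) (fun a _ => κ a)
        (fun a ha => hmaps a ha) (fun a b ha hb hab => hinj ha hb hab) le_rfl (κ j)
        ((hmem _).2 hlt)
      have := h2 k j hkj.symm (hr k hk).symm
      rw [this, hmem] at hk
      exact lt_irrefl _ hk
  have hr : ∀ j, r (κ j) = r j := fun j => key _ j rfl
  exact ⟨fun a b hab => h2 a b hab (hr a).symm, hr⟩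

/-! ### The sample inequality -/

section Sample

variable {J : ℕ} (θ : MarkovParam J) {r : Fin J → ℕ} {N T : ℕ}

theorem sum_quadForm_le (L L0 : (j : Fin J) → Matrix (Fin N) (Fin (r j)) ℝ) {s2 : ℝ} (hs : 0 < s2)
    (x : Fin T → Fin N → ℝ) (z jt : Fin T → Fin J)
    (hmax : θ.logLik L0 s2 x ≤ θ.logLik L s2 x)
    (hjt : ∀ t k, density (L k) s2 (x t) ≤ density (L (jt t)) s2 (x t))
    (f : (t : Fin T) → Fin (r (z t)) → ℝ) :
    ∑ t, vn (annihilator (L (jt t)) *ᵥ x t) ^ 2 ≤ ∑ t, vn (x t - L0 (z t) *ᵥ f t) ^ 2 +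
      s2 * ∑ t, (vn (f t) ^ 2 + r (z t) * Real.log (1 + fn (L0 (z t)) ^ 2 / s2) +
        2 * (Real.log J - Real.log θ.lower)) := by
  have h1 := (θ.le_logLik L0 hs x z).trans (hmax.trans (θ.logLik_le L hs x jt hjt))
  have h2 : ∀ t, vn (annihilator (L (jt t)) *ᵥ x t) ^ 2 / s2 + 2 * Real.log (density (L (jt t)) s2 (x t))
      ≤ -(N * Real.log (2 * Real.pi)) - N * Real.log s2 := by
    intro t
    have a1 := log_density (L (jt t)) hs (x t)
    have a2 := log_det_sigmaMat_ge (L (jt t)) hs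
    have a3 := quadForm_ge (L (jt t)) hs (x t) (isProjMat_projMat (L (jt t))).vn_compl_le
      (by rw [Matrix.sub_mul, Matrix.one_mul, projMat_mul_self, sub_self])
    rw [annihilator_eq]
    linarith
  have h3 : ∀ t, -(N * Real.log (2 * Real.pi)) - N * Real.log s2 ≤
      2 * Real.log (density (L0 (z t)) s2 (x t)) + (vn (x t - L0 (z t) *ᵥ f t) ^ 2 / s2 +
        vn (f t) ^ 2 + r (z t) * Real.log (1 + fn (L0 (z t)) ^ 2 / s2)) := by
    intro t
    have a1 := log_density (L0 (z t)) hs (x t)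
    have a2 := log_det_sigmaMat_le (L0 (z t)) hs
    have a3 := quadForm_le (L0 (z t)) hs (x t) (f t)
    linarith
  have h4 := Finset.sum_le_sum fun t (_ : t ∈ Finset.univ) => (h2 t).trans (h3 t)
  rw [Finset.sum_add_distrib, Finset.sum_add_distrib, ← Finset.mul_sum, ← Finset.mul_sum] at h4
  have h5 : ∑ t, vn (annihilator (L (jt t)) *ᵥ x t) ^ 2 / s2 ≤
      ∑ t, vn (x t - L0 (z t) *ᵥ f t) ^ 2 / s2 +
      ∑ t, (vn (f t) ^ 2 + r (z t) * Real.log (1 + fn (L0 (z t)) ^ 2 / s2) +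
        2 * (Real.log J - Real.log θ.lower)) := by
    simp only [Finset.sum_add_distrib, Finset.sum_const, Finset.card_univ, Fintype.card_fin,
      nsmul_eq_mul] at h4 ⊢
    linarith
  rw [← Finset.sum_div, ← Finset.sum_div] at h5
  have h6 := mul_le_mul_of_nonneg_left h5 hs.le
  rw [mul_add, mul_div_cancel₀ _ hs.ne', mul_div_cancel₀ _ hs.ne'] at h6
  exact h6

theorem vn_compl_signal_le {m : ℕ} {P P0 : Matrix (Fin m) (Fin m) ℝ} (hP : IsProjMat P)
    (hP0 : IsProjMat P0) (g e : Fin m → ℝ) (hg : P0 *ᵥ g = g) :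
    vn ((1 - P) *ᵥ g) ^ 2 ≤ vn ((1 - P) *ᵥ (g + e)) ^ 2 - vn e ^ 2 + vn (P *ᵥ e) ^ 2 +
      2 * (vn g * vn (P0 *ᵥ e)) + 2 * (vn g * vn (P *ᵥ e)) := by
  have h1 : vn ((1 - P) *ᵥ (g + e)) ^ 2 = vn ((1 - P) *ᵥ g) ^ 2 +
      2 * (g ⬝ᵥ e - g ⬝ᵥ (P *ᵥ e)) + vn ((1 - P) *ᵥ e) ^ 2 := by
    rw [hP.compl.vn_sq, hP.compl.vn_sq, hP.compl.vn_sq]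
    have : e ⬝ᵥ ((1 - P) *ᵥ g) = g ⬝ᵥ ((1 - P) *ᵥ e) := by
      rw [dotProduct_comm, hP.compl.dotProduct_mulVec]
    rw [Matrix.mulVec_add, dotProduct_add, add_dotProduct, add_dotProduct, this, Matrix.sub_mulVec,
      Matrix.one_mulVec, dotProduct_sub]
    simp only [Matrix.sub_mulVec, Matrix.one_mulVec, dotProduct_sub]
    ring
  have h2 : g ⬝ᵥ e = g ⬝ᵥ (P0 *ᵥ e) := by rw [← hP0.dotProduct_mulVec, hg]
  have h3 := (abs_le.1 (abs_dotProduct_le g (P0 *ᵥ e))).1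
  have h4 := (abs_le.1 (abs_dotProduct_le g (P *ᵥ e))).2
  rw [h1, hP.vn_sq_compl e, h2]
  linarith

end Sample

/-! ### Stochastic orders as filters -/

section Filters

variable {Ω : Type*} [MeasurableSpace Ω] {P : Measure Ω}

/-- The filter of events that have probability tending to one. -/
def whp (P : Measure Ω) : Filter (ℕ × Ω) where
  sets := {S | Tendsto (fun n => P {ω | (n, ω) ∉ S}) atTop (𝓝 0)}
  univ_sets := by simp
  sets_of_superset := fun {S S'} hS h =>
    tendsto_of_tendsto_of_tendsto_of_le_of_le tendsto_const_nhds hS (fun _ => zero_le)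
      fun n => measure_mono fun ω hω h' => hω (h h')
  inter_sets := fun {S S'} hS hS' => by
    refine tendsto_of_tendsto_of_tendsto_of_le_of_le tendsto_const_nhds
      (by simpa using Tendsto.add hS hS') (fun _ => zero_le) fun n => ?_
    refine (measure_mono ?_).trans (measure_union_le _ _)
    intro ω hω
    by_contra h
    simp only [Set.mem_union, Set.mem_ofPred_eq, not_or, not_not] at h
    exact hω ⟨h.1, h.2⟩

theorem eventually_whp {S : ℕ × Ω → Prop} :
    (∀ᶠ p in whp P, S p) ↔ Tendsto (fun n => P {ω | ¬ S (n, ω)}) atTop (𝓝 0) := Iff.rfl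

theorem tendsto_fst_whp : Tendsto Prod.fst (whp P) atTop := by
  intro S hS
  refine eventually_whp.2 ?_
  refine tendsto_const_nhds.congr' ?_
  filter_upwards [hS] with n hn
  have : {ω : Ω | ¬ (n, ω).1 ∈ S} = ∅ := by ext; simpa using hn
  change _ = P {ω : Ω | ¬ (n, ω).1 ∈ S}
  rw [this, measure_empty]

/-- `Q` holds along the events of probability tending to one, inside events whose probability is
eventually at least `1 - ε`, for every `ε > 0`. -/
def Often (P : Measure Ω) (Q : Filter (ℕ × Ω) → Prop) : Prop :=
  ∀ ε : ℝ, 0 < ε → ∃ G : Set (ℕ × Ω),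
    (∀ᶠ n in atTop, P {ω | (n, ω) ∉ G} ≤ ENNReal.ofReal ε) ∧ ∀ l ≤ whp P ⊓ 𝓟 G, Q l

namespace Often

variable {Q Q' : Filter (ℕ × Ω) → Prop}

theorem of_whp (h : ∀ l ≤ whp P, Q l) : Often P Q := fun ε _ =>
  ⟨Set.univ, by simp, fun l hl => h l (hl.trans inf_le_left)⟩

theorem mono (h : Often P Q) (hQ : ∀ l ≤ whp P, Q l → Q' l) : Often P Q' := fun ε hε => by
  obtain ⟨G, hG, h⟩ := h ε hε
  exact ⟨G, hG, fun l hl => hQ l (hl.trans inf_le_left) (h l hl)⟩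

theorem and (h : Often P Q) (h' : Often P Q') : Often P fun l => Q l ∧ Q' l := fun ε hε => by
  obtain ⟨G, hG, h⟩ := h (ε / 2) (by positivity)
  obtain ⟨G', hG', h'⟩ := h' (ε / 2) (by positivity)
  refine ⟨G ∩ G', ?_, fun l hl => ⟨h l (hl.trans ?_), h' l (hl.trans ?_)⟩⟩
  · filter_upwards [hG, hG'] with n h1 h2
    calc P {ω | (n, ω) ∉ G ∩ G'} ≤ P ({ω | (n, ω) ∉ G} ∪ {ω | (n, ω) ∉ G'}) :=
          measure_mono fun ω hω => by
            by_contra h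
            simp only [Set.mem_union, Set.mem_ofPred_eq, not_or, not_not] at h
            exact hω ⟨h.1, h.2⟩
      _ ≤ _ := (measure_union_le _ _).trans (add_le_add h1 h2)
      _ = ENNReal.ofReal ε := by
        rw [← ENNReal.ofReal_add (by positivity) (by positivity), add_halves]
  · exact inf_le_inf_left _ (by simp)
  · exact inf_le_inf_left _ (by simp)

theorem forall_fin {J : ℕ} {Q : Fin J → Filter (ℕ × Ω) → Prop} (h : ∀ i, Often P (Q i)) :
    Often P fun l => ∀ i, Q i l := by
  induction J with
  | zero => exact of_whp fun l _ i => i.elim0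
  | succ J ih =>
    refine ((h 0).and (ih fun i => h i.succ)).mono fun l _ hl i => ?_
    exact Fin.cases hl.1 hl.2 i

end Often

theorem eventually_whp_of_often {S : ℕ × Ω → Prop} (h : Often P fun l => ∀ᶠ p in l, S p) :
    ∀ᶠ p in whp P, S p := by
  rw [eventually_whp, ENNReal.tendsto_nhds_zero]
  intro ε hε
  obtain ⟨δ, hδ, hδε⟩ : ∃ δ : ℝ, 0 < δ ∧ ENNReal.ofReal δ + ENNReal.ofReal δ ≤ ε := by
    rcases eq_or_ne ε ⊤ with rfl | hε'
    · exact ⟨1, one_pos, le_top⟩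
    · refine ⟨ε.toReal / 2, half_pos (ENNReal.toReal_pos hε.ne' hε'), ?_⟩
      rw [← ENNReal.ofReal_add (by positivity) (by positivity), add_halves, ENNReal.ofReal_toReal hε']
  obtain ⟨G, hG, h⟩ := h δ hδ
  have h1 : ∀ᶠ p in whp P ⊓ 𝓟 G, S p := h _ le_rfl
  rw [eventually_inf_principal, eventually_whp, ENNReal.tendsto_nhds_zero] at h1
  filter_upwards [hG, h1 (ENNReal.ofReal δ) (by simpa using hδ)] with n h2 h3
  refine le_trans ?_ hδε
  refine (measure_mono ?_).trans ((measure_union_le _ _).trans (add_le_add h2 h3))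
  intro ω hω
  by_cases hg : (n, ω) ∈ G
  · exact Or.inr fun h => hω (h hg)
  · exact Or.inl hg

theorem tendsto_whp_of_often {E : Type*} [TopologicalSpace E] {X : ℕ × Ω → E} {c : E}
    (h : Often P fun l => Tendsto X l (𝓝 c)) : Tendsto X (whp P) (𝓝 c) := fun _ hS =>
  eventually_whp_of_often (h.mono fun _ _ hl => hl hS)

theorem tendstoInMeasure_iff_whp {E : Type*} [SeminormedAddCommGroup E] {X : ℕ → Ω → E} {c : E} :
    TendstoInMeasure P X atTop (fun _ => c) ↔ Tendsto (fun p : ℕ × Ω => X p.1 p.2) (whp P) (𝓝 c) := by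
  rw [tendstoInMeasure_iff_norm, Metric.tendsto_nhds]
  refine forall₂_congr fun ε _ => ?_
  rw [eventually_whp]
  simp [dist_eq_norm, not_lt]

theorem IsBigOp.of_often {X : ℕ → Ω → ℝ} {a : ℕ → ℝ} (ha : ∀ n, 0 ≤ a n)
    (h : Often P fun l => ∃ C, ∀ᶠ p in l, |X p.1 p.2| ≤ C * a p.1) : IsBigOp P X a := by
  intro ε hε
  obtain ⟨G, hG, h⟩ := h (ε / 2) (by positivity)
  obtain ⟨C, hC⟩ := h _ le_rfl
  refine ⟨max C 1, by positivity, ?_⟩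
  rw [eventually_inf_principal, eventually_whp, ENNReal.tendsto_nhds_zero] at hC
  filter_upwards [hG, hC (ENNReal.ofReal (ε / 2)) (by simpa using hε)] with n h2 h3
  have h4 := add_le_add h2 h3
  rw [← ENNReal.ofReal_add (by positivity) (by positivity), add_halves] at h4
  refine (measure_mono ?_).trans ((measure_union_le _ _).trans h4)
  intro ω hω
  by_cases hg : (n, ω) ∈ G
  · refine Or.inr fun h => ?_
    have h5 := h hg
    have h6 : C * a n ≤ max C 1 * a n := mul_le_mul_of_nonneg_right (le_max_left _ _) (ha n)
    exact absurd (h5.trans h6) (not_le.2 hω)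
  · exact Or.inl hg

theorem isLittleOp_iff_whp {X : ℕ → Ω → ℝ} {a : ℕ → ℝ} :
    IsLittleOp P X a ↔ ∀ c : ℝ, 0 < c → ∀ᶠ p in whp P, |X p.1 p.2| ≤ c * a p.1 := by
  refine forall₂_congr fun c _ => ?_
  rw [eventually_whp]
  simp [not_le]

theorem Often.of_boundedAway {X : ℕ → Ω → ℝ} (h : BoundedAwayInProb P X) :
    Often P fun l => ∃ c C, 0 < c ∧ ∀ᶠ p in l, c ≤ X p.1 p.2 ∧ X p.1 p.2 ≤ C := by
  intro ε hε
  obtain ⟨C, hC, h⟩ := h ε hε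
  refine ⟨{p | C⁻¹ ≤ X p.1 p.2 ∧ X p.1 p.2 ≤ C}, ?_, fun l hl => ⟨C⁻¹, C, inv_pos.2 hC, ?_⟩⟩
  · filter_upwards [h] with n hn
    refine (measure_mono fun ω hω => ?_).trans hn
    by_contra h'
    simp only [Set.mem_ofPred_eq, not_or, not_lt] at h'
    exact hω h'
  · exact hl (mem_inf_of_right (mem_principal_self _))

theorem Often.of_lintegral [IsProbabilityMeasure P] {X : ℕ → Ω → ℝ≥0∞}
    (hX : ∀ᶠ n in atTop, Measurable (X n))
    {M : ℝ≥0} (h : ∀ᶠ n in atTop, ∫⁻ ω, X n ω ∂P ≤ M) :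
    Often P fun l => ∃ C : ℝ≥0, ∀ᶠ p in l, X p.1 p.2 ≤ C := by
  intro ε hε
  set C : ℝ≥0 := (M + 1) / ε.toNNReal with hC
  have hC0 : 0 < C := div_pos (by positivity) (Real.toNNReal_pos.2 hε)
  refine ⟨{p | X p.1 p.2 ≤ C}, ?_, fun l hl => ⟨C, ?_⟩⟩
  · filter_upwards [hX, h] with n hm hn
    have h1 := mul_meas_ge_le_lintegral₀ (μ := P) hm.aemeasurable C
    have h2 : P {ω | ¬ X n ω ≤ C} ≤ P {ω | (C : ℝ≥0∞) ≤ X n ω} :=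
      measure_mono fun ω hω => (not_le.1 hω).le
    refine h2.trans ?_
    have h3 : (C : ℝ≥0∞) * P {ω | (C : ℝ≥0∞) ≤ X n ω} ≤ M + 1 := (h1.trans hn).trans (by simp)
    have h4 : (M : ℝ≥0∞) + 1 = C * ENNReal.ofReal ε := by
      rw [ENNReal.ofReal, ← ENNReal.coe_mul, hC, div_mul_cancel₀ _ (Real.toNNReal_pos.2 hε).ne']
      simp
    rw [h4] at h3
    exact (ENNReal.mul_le_mul_iff_right (by simpa using hC0.ne') ENNReal.coe_ne_top).1 h3
  · exact hl (mem_inf_of_right (mem_principal_self _))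

/-- Markov's inequality for nonnegative real variables with bounded means. -/
theorem Often.of_lintegral_real [IsProbabilityMeasure P] {X : ℕ → Ω → ℝ}
    (hX : ∀ᶠ n in atTop, Measurable (X n))
    {M : ℝ≥0} (h : ∀ᶠ n in atTop, ∫⁻ ω, ENNReal.ofReal (X n ω) ∂P ≤ M) :
    Often P fun l => ∃ C : ℝ, 0 ≤ C ∧ ∀ᶠ p in l, X p.1 p.2 ≤ C := by
  refine (Often.of_lintegral (hX.mono fun n hn => hn.ennreal_ofReal) h).mono fun l _ hl => ?_
  obtain ⟨C, hC⟩ := hl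
  refine ⟨C, C.2, hC.mono fun p hp => ?_⟩
  by_contra h'
  rw [not_le] at h'
  have h2 := (ENNReal.toReal_mono ENNReal.coe_ne_top hp)
  rw [ENNReal.toReal_ofReal (C.2.trans h'.le), ENNReal.coe_toReal] at h2
  linarith

theorem eventually_fst {l : Filter (ℕ × Ω)} (hl : l ≤ whp P) {S : ℕ → Prop}
    (h : ∀ᶠ n in atTop, S n) : ∀ᶠ p in l, S p.1 :=
  (tendsto_fst_whp.mono_left hl).eventually h

end Filters

/-! ### Bounds of means -/

section MeanLE

variable {Ω : Type*} [MeasurableSpace Ω] {P : Measure Ω}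

/-- The mean of the positive part of `X` is at most `M`. -/
def MeanLE (P : Measure Ω) (X : Ω → ℝ) (M : ℝ) : Prop :=
  ∫⁻ ω, ENNReal.ofReal (X ω) ∂P ≤ ENNReal.ofReal M

namespace MeanLE

variable {X Y : Ω → ℝ} {M M' : ℝ}

theorem mono (h : MeanLE P Y M) (hX : ∀ ω, X ω ≤ Y ω) (hM : M ≤ M') : MeanLE P X M' :=
  (lintegral_mono fun ω => ENNReal.ofReal_le_ofReal (hX ω)).trans
    (h.trans (ENNReal.ofReal_le_ofReal hM))

theorem add (hX : MeanLE P X M) (hY : MeanLE P Y M') (hm : Measurable X) (hM : 0 ≤ M)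
    (hM' : 0 ≤ M') : MeanLE P (fun ω => X ω + Y ω) (M + M') := by
  unfold MeanLE
  rw [ENNReal.ofReal_add hM hM']
  refine le_trans (lintegral_mono fun ω => ENNReal.ofReal_add_le) ?_
  rw [lintegral_add_left hm.ennreal_ofReal]
  exact add_le_add hX hY

theorem const_mul (hX : MeanLE P X M) {c : ℝ} (hc : 0 ≤ c) :
    MeanLE P (fun ω => c * X ω) (c * M) := by
  unfold MeanLE
  simp only [ENNReal.ofReal_mul hc]
  rw [lintegral_const_mul' _ _ ENNReal.ofReal_ne_top]
  exact mul_le_mul_right hX _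

theorem const [IsProbabilityMeasure P] (M : ℝ) : MeanLE P (fun _ => M) M := by
  simp [MeanLE]

theorem sum {ι : Type*} {s : Finset ι} {X : ι → Ω → ℝ} {M : ι → ℝ}
    (hX : ∀ i ∈ s, MeanLE P (X i) (M i)) (hm : ∀ i, Measurable (X i)) (hM : ∀ i ∈ s, 0 ≤ M i) :
    MeanLE P (fun ω => ∑ i ∈ s, X i ω) (∑ i ∈ s, M i) := by
  classical
  induction s using Finset.induction_on with
  | empty => simp [MeanLE]
  | insert a s ha ih =>
    simp only [Finset.sum_insert ha]
    exact add (hX a (Finset.mem_insert_self a s))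
      (ih (fun i hi => hX i (Finset.mem_insert_of_mem hi))
        fun i hi => hM i (Finset.mem_insert_of_mem hi)) (hm a) (hM a (Finset.mem_insert_self a s))
      (Finset.sum_nonneg fun i hi => hM i (Finset.mem_insert_of_mem hi))

theorem of_enorm_sq {E : Type*} [SeminormedAddCommGroup E] {Z : Ω → E} {M : ℝ≥0}
    (h : ∫⁻ ω, ‖Z ω‖ₑ ^ 2 ∂P ≤ M) : MeanLE P (fun ω => ‖Z ω‖ ^ 2) M := by
  unfold MeanLE
  rw [ENNReal.ofReal_coe_nnreal]
  refine le_trans (le_of_eq (lintegral_congr fun ω => ?_)) h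
  rw [ENNReal.ofReal_pow (norm_nonneg _), ofReal_norm]

theorem of_enorm_rpow {E : Type*} [SeminormedAddCommGroup E] {Z : Ω → E} {M : ℝ≥0} {α : ℝ}
    (hα : 0 ≤ α) (h : ∫⁻ ω, ‖Z ω‖ₑ ^ α ∂P ≤ M) : MeanLE P (fun ω => ‖Z ω‖ ^ α) M := by
  unfold MeanLE
  rw [ENNReal.ofReal_coe_nnreal]
  refine le_trans (le_of_eq (lintegral_congr fun ω => ?_)) h
  rw [← ENNReal.ofReal_rpow_of_nonneg (norm_nonneg _) hα, ofReal_norm]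

theorem sq_of_rpow [IsProbabilityMeasure P] (h0 : ∀ ω, 0 ≤ X ω) {α : ℝ} (hα : 2 ≤ α)
    (hM : 0 ≤ M) (h : MeanLE P (fun ω => X ω ^ α) M) : MeanLE P (fun ω => X ω ^ 2) (1 + M) := by
  refine ((const 1).add h measurable_const zero_le_one hM).mono (fun ω => ?_) le_rfl
  have hp := Real.rpow_nonneg (h0 ω) α
  rcases le_total (X ω) 1 with h1 | h1
  · have : X ω ^ 2 ≤ 1 := pow_le_one₀ (h0 ω) h1
    linarith
  · have : X ω ^ (2 : ℝ) ≤ X ω ^ α := Real.rpow_le_rpow_of_exponent_le h1 hα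
    rw [Real.rpow_two] at this
    linarith

end MeanLE

theorem Often.of_meanLE [IsProbabilityMeasure P] {X : ℕ → Ω → ℝ} {a : ℕ → ℝ} {M : ℝ}
    (ha : ∀ᶠ n in atTop, 0 < a n) (hX : ∀ n, Measurable (X n))
    (h : ∀ᶠ n in atTop, MeanLE P (X n) (M * a n)) :
    Often P fun l => ∃ C : ℝ, 0 ≤ C ∧ ∀ᶠ p in l, X p.1 p.2 ≤ C * a p.1 := by
  have h1 := Often.of_lintegral_real (P := P) (X := fun n ω => (a n)⁻¹ * X n ω) (M := M.toNNReal)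
    (Eventually.of_forall fun n => (hX n).const_mul _) (by
      filter_upwards [ha, h] with n hn h
      have := h.const_mul (inv_pos.2 hn).le
      unfold MeanLE at this
      rwa [mul_comm M, inv_mul_cancel_left₀ hn.ne'] at this)
  refine h1.mono fun l hl h2 => ?_
  obtain ⟨C, hC, h2⟩ := h2
  refine ⟨C, hC, ?_⟩
  filter_upwards [h2, eventually_fst hl ha] with p h3 h4
  rwa [inv_mul_le_iff₀ h4, mul_comm] at h3

end MeanLE

/-! ### Sample matrices -/

namespace Panel

variable {Ω : Type*} [MeasurableSpace Ω] {J : ℕ} {r : Fin J → ℕ} (D : Panel Ω r)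

/-- The errors of the dates of regime `j`. -/
def EM (n : ℕ) (j : Fin J) (ω : Ω) : Matrix (Fin (D.N n)) (Fin (D.T n)) ℝ :=
  Matrix.of fun i t => D.error n i t ω * D.ind n j t ω

/-- The factors of the dates of regime `j`. -/
def FM (n : ℕ) (j : Fin J) (ω : Ω) : Matrix (Fin (D.T n)) (Fin (r j)) ℝ :=
  Matrix.of fun t l => D.factor n j t ω l * D.ind n j t ω

/-- The error vector of a date. -/
def err (n t : ℕ) (ω : Ω) : Fin (D.N n) → ℝ := fun i => D.error n i t ω

theorem ind_mul_self (n : ℕ) (j : Fin J) (t : ℕ) (ω : Ω) :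
    D.ind n j t ω * D.ind n j t ω = D.ind n j t ω := by
  unfold ind; split_ifs <;> simp

theorem ind_nonneg (n : ℕ) (j : Fin J) (t : ℕ) (ω : Ω) : 0 ≤ D.ind n j t ω := by
  unfold ind; split_ifs <;> simp

theorem ind_le_one (n : ℕ) (j : Fin J) (t : ℕ) (ω : Ω) : D.ind n j t ω ≤ 1 := by
  unfold ind; split_ifs <;> simp

theorem sum_ind (n t : ℕ) (ω : Ω) : ∑ j, D.ind n j t ω = 1 := by simp [ind]

theorem measurable_ind (n : ℕ) (j : Fin J) (t : ℕ) : Measurable (D.ind n j t) :=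
  Measurable.ite (D.measurable_state n t (measurableSet_singleton j)) measurable_const
    measurable_const

theorem measurable_factor_apply (n : ℕ) (j : Fin J) (t : ℕ) (l : Fin (r j)) :
    Measurable fun ω => D.factor n j t ω l := by
  have := D.measurable_factor n j t
  fun_prop

/-- The norm of the current factors. -/
def fnorm (n t : ℕ) (ω : Ω) : ℝ := ‖D.factor n (D.state n t ω) t ω‖

theorem fnorm_nonneg (n t : ℕ) (ω : Ω) : 0 ≤ D.fnorm n t ω := norm_nonneg _

theorem fnorm_eq (n t : ℕ) (ω : Ω) :
    D.fnorm n t ω = ∑ j, D.ind n j t ω * ‖D.factor n j t ω‖ := by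
  simp [ind, fnorm]

theorem measurable_fnorm (n t : ℕ) : Measurable (D.fnorm n t) := by
  have h : D.fnorm n t = fun ω => ∑ j, D.ind n j t ω * ‖D.factor n j t ω‖ :=
    funext fun ω => D.fnorm_eq n t ω
  rw [h]
  have := D.measurable_ind n
  have := D.measurable_factor n
  fun_prop

theorem eventually_N_pos : ∀ᶠ n in atTop, 0 < (D.N n : ℝ) :=
  (D.tendsto_N.eventually_gt_atTop 0).mono fun n hn => by exact_mod_cast hn

theorem eventually_T_pos : ∀ᶠ n in atTop, 0 < (D.T n : ℝ) :=
  (D.tendsto_T.eventually_gt_atTop 0).mono fun n hn => by exact_mod_cast hn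

theorem δ_sq_le_N (n : ℕ) : D.δ n ^ 2 ≤ D.N n := by
  have h : 0 ≤ D.δ n := le_min (Real.sqrt_nonneg _) (Real.sqrt_nonneg _)
  calc D.δ n ^ 2 ≤ √(D.N n : ℝ) ^ 2 := pow_le_pow_left₀ h (min_le_left _ _) 2
    _ = _ := Real.sq_sqrt (Nat.cast_nonneg _)

theorem δ_sq_le_T (n : ℕ) : D.δ n ^ 2 ≤ D.T n := by
  have h : 0 ≤ D.δ n := le_min (Real.sqrt_nonneg _) (Real.sqrt_nonneg _)
  calc D.δ n ^ 2 ≤ √(D.T n : ℝ) ^ 2 := pow_le_pow_left₀ h (min_le_right _ _) 2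
    _ = _ := Real.sq_sqrt (Nat.cast_nonneg _)

theorem eventually_δ_pos : ∀ᶠ n in atTop, 0 < D.δ n := by
  filter_upwards [D.eventually_N_pos, D.eventually_T_pos] with n h1 h2
  exact lt_min (Real.sqrt_pos.2 h1) (Real.sqrt_pos.2 h2)

theorem EM_mul_transpose_apply (n : ℕ) (j : Fin J) (ω : Ω) (i k : Fin (D.N n)) :
    (D.EM n j ω * (D.EM n j ω)ᵀ) i k =
      ∑ t ∈ Finset.range (D.T n), D.error n i t ω * D.error n k t ω * D.ind n j t ω := by
  rw [Finset.sum_range, Matrix.mul_apply]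
  refine Finset.sum_congr rfl fun t _ => ?_
  simp only [EM, Matrix.of_apply, Matrix.transpose_apply]
  rw [mul_mul_mul_comm, ind_mul_self]

theorem FM_transpose_mul_apply (n : ℕ) (j : Fin J) (ω : Ω) (a b : Fin (r j)) :
    ((D.FM n j ω)ᵀ * D.FM n j ω) a b =
      ∑ t ∈ Finset.range (D.T n), D.factor n j t ω a * D.factor n j t ω b * D.ind n j t ω := by
  rw [Finset.sum_range, Matrix.mul_apply]
  refine Finset.sum_congr rfl fun t _ => ?_
  simp only [FM, Matrix.of_apply, Matrix.transpose_apply]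
  rw [mul_mul_mul_comm, ind_mul_self]

section Bounds

variable {D} {P : Measure Ω} [IsProbabilityMeasure P] {α β : ℝ}

theorem meanLE_error_sq (hα : 2 ≤ α) (he : D.ErrorAssumption P α) :
    ∃ M : ℝ, 0 ≤ M ∧ ∀ n i t, i < D.N n → t < D.T n →
      MeanLE P (fun ω => D.error n i t ω ^ 2) M := by
  obtain ⟨M, hM⟩ := he.moment
  refine ⟨1 + M, by positivity, fun n i t hi ht => ?_⟩
  have := (MeanLE.of_enorm_rpow (by linarith) (hM n i t hi ht)).sq_of_rpow
    (fun ω => norm_nonneg _) hα M.2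
  simpa using this

theorem often_errors (hα : 2 ≤ α) (he : D.ErrorAssumption P α) :
    Often P fun l => ∃ C : ℝ, 0 ≤ C ∧ ∀ᶠ p : ℕ × Ω in l,
      ∑ t ∈ Finset.range (D.T p.1), vn (D.err p.1 t p.2) ^ 2 ≤ C * (D.N p.1 * D.T p.1) := by
  obtain ⟨M, hM0, hM⟩ := meanLE_error_sq hα he
  have hme := D.measurable_error
  have heq : ∀ n t ω, vn (D.err n t ω) ^ 2 = ∑ i : Fin (D.N n), D.error n i t ω ^ 2 := by
    intro n t ω
    rw [vn_sq]
    simp [dotProduct, err, sq]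
  simp only [heq]
  refine Often.of_meanLE (X := fun n ω => ∑ t ∈ Finset.range (D.T n), ∑ i : Fin (D.N n),
    D.error n i t ω ^ 2) (a := fun n => D.N n * D.T n) (M := M) ?_ (fun n => by fun_prop)
    (Eventually.of_forall fun n => ?_)
  · filter_upwards [D.eventually_N_pos, D.eventually_T_pos] with n h1 h2 using by positivity
  · refine (MeanLE.sum (M := fun _ => ∑ i : Fin (D.N n), M) (fun t ht => MeanLE.sum (fun i _ =>
      hM n i t i.2 (Finset.mem_range.1 ht)) (fun i => by fun_prop) fun _ _ => hM0)
      (fun t => by fun_prop) fun _ _ => by positivity).mono (fun ω => le_rfl) ?_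
    simp
    linarith

/-- Second moments of the sums of products of the errors of two series. -/
theorem meanLE_products (he : D.ErrorAssumption P α) :
    ∃ M : ℝ, 0 ≤ M ∧ ∀ n, 0 < D.T n → ∃ τ : ℕ → ℕ → ℝ, (∀ i k, i < D.N n → k < D.N n → 0 ≤ τ i k) ∧
      (∀ i, i < D.N n → ∑ k ∈ Finset.range (D.N n), τ i k ≤ M) ∧
      (∀ i k j ω, i < D.N n → k < D.N n → |∑ t ∈ Finset.range (D.T n),
        (∫ ω', D.error n i t ω' * D.error n k t ω' ∂P) * D.ind n j t ω| ≤ D.T n * τ i k) ∧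
      ∀ i k j, i < D.N n → k < D.N n → MeanLE P (fun ω => (∑ t ∈ Finset.range (D.T n),
        D.error n i t ω * D.error n k t ω * D.ind n j t ω) ^ 2)
        (2 * D.T n * M + 2 * (D.T n * τ i k) ^ 2) := by
  obtain ⟨M1, h1⟩ := he.crossSection
  obtain ⟨M2, h2⟩ := he.products
  refine ⟨max M1 M2, le_max_of_le_right M2.2, fun n hT => ?_⟩
  obtain ⟨τ, hτ, hτs⟩ := h1 n
  have hT' : (0 : ℝ) < D.T n := by exact_mod_cast hT
  have hτ0 : ∀ i k, i < D.N n → k < D.N n → 0 ≤ τ i k := fun i k hi hk =>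
    (abs_nonneg _).trans (hτ i k 0 hi hk hT)
  have hR : ∀ i k j ω, i < D.N n → k < D.N n → |∑ t ∈ Finset.range (D.T n),
        (∫ ω', D.error n i t ω' * D.error n k t ω' ∂P) * D.ind n j t ω| ≤ D.T n * τ i k := by
    intro i k j ω hi hk
    refine (Finset.abs_sum_le_sum_abs _ _).trans ?_
    calc _ ≤ ∑ t ∈ Finset.range (D.T n), τ i k := Finset.sum_le_sum fun t ht => by
          rw [abs_mul, abs_of_nonneg (D.ind_nonneg n j t ω)]
          have := hτ i k t hi hk (Finset.mem_range.1 ht)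
          have h3 := D.ind_le_one n j t ω
          have h4 := D.ind_nonneg n j t ω
          nlinarith [abs_nonneg (∫ ω', D.error n i t ω' * D.error n k t ω' ∂P)]
      _ = _ := by simp
  refine ⟨τ, hτ0, fun i hi => (hτs i hi).trans (le_max_left _ _), hR, fun i k j hi hk => ?_⟩
  set S : Ω → ℝ := fun ω => ∑ t ∈ Finset.range (D.T n),
      (D.error n i t ω * D.error n k t ω - ∫ ω', D.error n i t ω' * D.error n k t ω' ∂P) *
        D.ind n j t ω with hS
  have hb := (MeanLE.of_enorm_sq (h2 n i k j hi hk)).const_mul (c := 2 * D.T n) (by positivity)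
  have hc := hb.add (MeanLE.const (P := P) (2 * (D.T n * τ i k) ^ 2)) (by
    have := D.measurable_error
    have := D.measurable_ind n j
    fun_prop) (by positivity) (by positivity)
  refine hc.mono (fun ω => ?_) (by gcongr; exact le_max_right _ _)
  have hsplit : ∑ t ∈ Finset.range (D.T n), D.error n i t ω * D.error n k t ω * D.ind n j t ω =
      S ω + ∑ t ∈ Finset.range (D.T n),
        (∫ ω', D.error n i t ω' * D.error n k t ω' ∂P) * D.ind n j t ω := by
    rw [hS, ← Finset.sum_add_distrib]
    exact Finset.sum_congr rfl fun t _ => by ring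
  rw [hsplit]
  have h3 := sq_le_sq' (neg_le_of_abs_le (hR i k j ω hi hk)) (le_of_abs_le (hR i k j ω hi hk))
  have h4 : 2 * (D.T n : ℝ) * ‖1 / √(D.T n : ℝ) * S ω‖ ^ 2 = 2 * S ω ^ 2 := by
    rw [Real.norm_eq_abs, sq_abs, mul_pow, div_pow, one_pow, Real.sq_sqrt hT'.le]
    field_simp
  change _ ≤ 2 * (D.T n : ℝ) * ‖1 / √(D.T n : ℝ) * S ω‖ ^ 2 + _
  rw [h4]
  nlinarith [sq_nonneg (S ω - ∑ t ∈ Finset.range (D.T n),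
        (∫ ω', D.error n i t ω' * D.error n k t ω' ∂P) * D.ind n j t ω)]

theorem often_row_products (he : D.ErrorAssumption P α) (j : Fin J) (i : ℕ) :
    Often P fun l => ∃ C : ℝ, 0 ≤ C ∧ ∀ᶠ p : ℕ × Ω in l,
      ∑ k ∈ Finset.range (D.N p.1), (∑ t ∈ Finset.range (D.T p.1),
        D.error p.1 i t p.2 * D.error p.1 k t p.2 * D.ind p.1 j t p.2) ^ 2 ≤
      C * (D.N p.1 * D.T p.1 + D.T p.1 ^ 2) := by
  obtain ⟨M, hM0, hM⟩ := meanLE_products he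
  have h1 := D.measurable_error
  have h2 := D.measurable_ind
  refine Often.of_meanLE (X := fun n ω => ∑ k ∈ Finset.range (D.N n), (∑ t ∈ Finset.range (D.T n),
        D.error n i t ω * D.error n k t ω * D.ind n j t ω) ^ 2)
    (a := fun n => D.N n * D.T n + D.T n ^ 2) (M := 2 * M + 2 * M ^ 2) ?_
    (fun n => by fun_prop) ?_
  · filter_upwards [D.eventually_N_pos, D.eventually_T_pos] with n h1 h2 using by positivity
  · filter_upwards [D.tendsto_N.eventually_gt_atTop i, D.tendsto_T.eventually_gt_atTop 0]
      with n hi hT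
    obtain ⟨τ, hτ0, hτs, -, hm⟩ := hM n hT
    refine (MeanLE.sum (fun k hk => hm i k j hi (Finset.mem_range.1 hk))
      (fun k => by fun_prop) fun k _ => by positivity).mono (fun ω => le_rfl) ?_
    have h3 : ∑ k ∈ Finset.range (D.N n), τ i k ^ 2 ≤ M ^ 2 :=
      (Finset.sum_sq_le_sq_sum_of_nonneg fun k hk => hτ0 i k hi (Finset.mem_range.1 hk)).trans
        (pow_le_pow_left₀ (Finset.sum_nonneg fun k hk => hτ0 i k hi (Finset.mem_range.1 hk))
          (hτs i hi) 2)
    rw [Finset.sum_add_distrib, Finset.sum_const, Finset.card_range, nsmul_eq_mul, ← Finset.mul_sum]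
    simp only [mul_pow]
    rw [← Finset.mul_sum]
    have hT' : (0 : ℝ) < D.T n := by exact_mod_cast hT
    have h5 := mul_le_mul_of_nonneg_left h3 (sq_nonneg (D.T n : ℝ))
    have h6 : 0 ≤ (D.N n : ℝ) * D.T n * M ^ 2 := by positivity
    have h7 : 0 ≤ (D.T n : ℝ) ^ 2 * M := by positivity
    nlinarith

theorem often_EE (he : D.ErrorAssumption P α) (j : Fin J) :
    Often P fun l => ∃ C : ℝ, 0 ≤ C ∧ ∀ᶠ p : ℕ × Ω in l,
      fn (D.EM p.1 j p.2 * (D.EM p.1 j p.2)ᵀ) ^ 2 ≤ C * (D.N p.1 * D.T p.1 / D.δ p.1) ^ 2 := by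
  obtain ⟨M, hM0, hM⟩ := meanLE_products he
  have h1 := D.measurable_error
  have h2 := D.measurable_ind
  simp only [fn_sq, EM_mul_transpose_apply]
  refine Often.of_meanLE (X := fun n ω => ∑ i : Fin (D.N n), ∑ k : Fin (D.N n),
      (∑ t ∈ Finset.range (D.T n),
        D.error n i t ω * D.error n k t ω * D.ind n j t ω) ^ 2)
    (a := fun n => (D.N n * D.T n / D.δ n) ^ 2) (M := 2 * M + 2 * M ^ 2) ?_
    (fun n => by fun_prop) ?_
  · filter_upwards [D.eventually_N_pos, D.eventually_T_pos, D.eventually_δ_pos] with n h1 h2 h3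
      using by positivity
  · filter_upwards [D.tendsto_T.eventually_gt_atTop 0, D.eventually_δ_pos] with n hT hδ
    obtain ⟨τ, hτ0, hτs, -, hm⟩ := hM n hT
    refine (MeanLE.sum (fun (i : Fin (D.N n)) _ => MeanLE.sum (fun (k : Fin (D.N n)) _ =>
      hm i k j i.2 k.2)
      (fun k => by fun_prop) fun k _ => by positivity) (fun i => by fun_prop)
      fun i _ => Finset.sum_nonneg fun k _ => by positivity).mono (fun ω => le_rfl) ?_
    have h3 : ∀ i : Fin (D.N n), ∑ k : Fin (D.N n), τ i k ^ 2 ≤ M ^ 2 := fun i => by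
      have hs := hτs i i.2
      rw [Finset.sum_range] at hs
      exact (Finset.sum_sq_le_sq_sum_of_nonneg fun (k : Fin (D.N n)) _ => hτ0 i k i.2 k.2).trans
        (pow_le_pow_left₀ (Finset.sum_nonneg fun (k : Fin (D.N n)) _ => hτ0 i k i.2 k.2) hs 2)
    have h4 : ∀ i : Fin (D.N n), ∑ k : Fin (D.N n), (2 * D.T n * M + 2 * (D.T n * τ i k) ^ 2) ≤
        2 * D.N n * D.T n * M + 2 * D.T n ^ 2 * M ^ 2 := fun i => by
      rw [Finset.sum_add_distrib, Finset.sum_const, Finset.card_univ, Fintype.card_fin,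
        nsmul_eq_mul, ← Finset.mul_sum]
      simp only [mul_pow]
      rw [← Finset.mul_sum]
      have := mul_le_mul_of_nonneg_left (h3 i) (sq_nonneg (D.T n : ℝ))
      nlinarith
    refine (Finset.sum_le_sum fun i _ => h4 i).trans ?_
    rw [Finset.sum_const, Finset.card_univ, Fintype.card_fin, nsmul_eq_mul, div_pow]
    rw [mul_div_assoc', le_div_iff₀ (by positivity)]
    have hN := D.δ_sq_le_N n
    have hT2 := D.δ_sq_le_T n
    have hd : 0 ≤ D.δ n ^ 2 := sq_nonneg _
    have e1 : (D.N n : ℝ) * (2 * D.N n * D.T n * M) * D.δ n ^ 2 ≤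
        (D.N n : ℝ) * (2 * D.N n * D.T n * M) * D.T n :=
      mul_le_mul_of_nonneg_left hT2 (by positivity)
    have e2 : (D.N n : ℝ) * (2 * D.T n ^ 2 * M ^ 2) * D.δ n ^ 2 ≤
        (D.N n : ℝ) * (2 * D.T n ^ 2 * M ^ 2) * D.N n :=
      mul_le_mul_of_nonneg_left hN (by positivity)
    nlinarith

omit [IsProbabilityMeasure P] in
theorem meanLE_sq_of_norm_smul {E : Type*} [SeminormedAddCommGroup E] [NormedSpace ℝ E]
    {Z : Ω → E} {c : ℝ} (hc : 0 < c) {M : ℝ} (h : MeanLE P (fun ω => ‖(1 / √c) • Z ω‖ ^ 2) M) :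
    MeanLE P (fun ω => ‖Z ω‖ ^ 2) (c * M) := by
  refine (h.const_mul hc.le).mono (fun ω => le_of_eq ?_) le_rfl
  rw [norm_smul, mul_pow, Real.norm_eq_abs, sq_abs, div_pow, Real.sq_sqrt hc.le]
  field_simp

omit [IsProbabilityMeasure P] in
theorem EM_mul_FM_row (n : ℕ) (j : Fin J) (ω : Ω) (i : Fin (D.N n)) :
    vn ((D.EM n j ω * D.FM n j ω) i) ^ 2 = ‖∑ t ∈ Finset.range (D.T n),
      (D.error n i t ω * D.ind n j t ω) • D.factor n j t ω‖ ^ 2 := by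
  rw [vn_eq_norm]
  congr 2
  ext l
  rw [Finset.sum_range]
  simp only [Matrix.mul_apply, EM, FM, Matrix.of_apply, WithLp.ofLp_sum, Finset.sum_apply,
    PiLp.smul_apply, smul_eq_mul]
  refine Finset.sum_congr rfl fun t _ => ?_
  rw [mul_mul_mul_comm, ind_mul_self]
  ring

theorem often_EF (h : D.FactorErrorMoment P) (j : Fin J) :
    Often P fun l => ∃ C : ℝ, 0 ≤ C ∧ ∀ᶠ p : ℕ × Ω in l,
      fn (D.EM p.1 j p.2 * D.FM p.1 j p.2) ^ 2 ≤ C * (D.N p.1 * D.T p.1) := by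
  obtain ⟨M, hM⟩ := h
  have h1 := D.measurable_error
  have h2 := D.measurable_ind
  have h3 := D.measurable_factor
  simp only [fn_sq_eq_sum_row, EM_mul_FM_row]
  refine Often.of_meanLE (X := fun n ω => ∑ i : Fin (D.N n), ‖∑ t ∈ Finset.range (D.T n),
      (D.error n i t ω * D.ind n j t ω) • D.factor n j t ω‖ ^ 2)
    (a := fun n => D.N n * D.T n) (M := M) ?_ (fun n => by fun_prop) ?_
  · filter_upwards [D.eventually_N_pos, D.eventually_T_pos] with n h1 h2 using by positivity
  · filter_upwards [D.eventually_T_pos] with n hT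
    refine (MeanLE.sum (M := fun _ => D.T n * M) (fun (i : Fin (D.N n)) _ => meanLE_sq_of_norm_smul hT
      (MeanLE.of_enorm_sq (hM n j i i.2)))
      (fun k => by fun_prop) fun k _ => by positivity).mono (fun ω => le_rfl) ?_
    simp
    linarith

/-- The norm of `Λ_jᵀ e_t`. -/
theorem vn_loading_err (D : Panel Ω r) (n : ℕ) (j : Fin J) (t : ℕ) (ω : Ω) :
    vn ((D.L0 n j)ᵀ *ᵥ D.err n t ω) =
      ‖∑ i ∈ Finset.range (D.N n), D.error n i t ω • D.loading n j i‖ := by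
  rw [vn_eq_norm]
  congr 1
  ext l
  rw [Finset.sum_range]
  simp [Matrix.mulVec, dotProduct, L0, err, mul_comm]

theorem often_loading_errors (hβ : 2 ≤ β) (h : D.LoadingErrorMoment P β) (j : Fin J) :
    Often P fun l => ∃ C : ℝ, 0 ≤ C ∧ ∀ᶠ p : ℕ × Ω in l,
      ∑ t ∈ Finset.range (D.T p.1), vn ((D.L0 p.1 j)ᵀ *ᵥ D.err p.1 t p.2) ^ 2 ≤
        C * (D.N p.1 * D.T p.1) := by
  obtain ⟨M, hM⟩ := h
  have h1 := D.measurable_error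
  simp only [vn_loading_err]
  refine Often.of_meanLE (X := fun n ω => ∑ t ∈ Finset.range (D.T n),
      ‖∑ i ∈ Finset.range (D.N n), D.error n i t ω • D.loading n j i‖ ^ 2)
    (a := fun n => D.N n * D.T n) (M := 1 + M) ?_ (fun n => by fun_prop) ?_
  · filter_upwards [D.eventually_N_pos, D.eventually_T_pos] with n h1 h2 using by positivity
  · filter_upwards [D.eventually_N_pos] with n hN
    refine (MeanLE.sum (M := fun _ => D.N n * (1 + M)) (fun t ht => meanLE_sq_of_norm_smul hN
      ((MeanLE.of_enorm_rpow (by linarith) (hM n j t (Finset.mem_range.1 ht))).sq_of_rpow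
        (fun ω => norm_nonneg _) hβ M.2))
      (fun k => by fun_prop) fun k _ => by positivity).mono (fun ω => le_rfl) ?_
    simp
    linarith

/-- Maxima over a set of dates. -/
theorem often_max {X : ℕ → ℕ → Ω → ℝ} {M γ : ℝ} (hγ : 0 < γ) (hM : 0 ≤ M)
    (h0 : ∀ n t ω, 0 ≤ X n t ω) (hX : ∀ n t, Measurable (X n t)) (S : ℕ → Finset ℕ)
    (hS : ∀ᶠ n in atTop, (S n).Nonempty)
    (h : ∀ᶠ n in atTop, ∀ t ∈ S n, MeanLE P (fun ω => X n t ω ^ γ) M) :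
    Often P fun l => ∃ C : ℝ, 0 ≤ C ∧ ∀ᶠ p : ℕ × Ω in l,
      ∀ t ∈ S p.1, X p.1 t p.2 ≤ C * ((S p.1).card : ℝ) ^ (1 / γ) := by
  have h1 := Often.of_meanLE (P := P) (X := fun n ω => ∑ t ∈ S n, X n t ω ^ γ)
    (a := fun n => ((S n).card : ℝ)) (M := M)
    (hS.mono fun n hn => by exact_mod_cast hn.card_pos) (fun n => by fun_prop)
    (h.mono fun n hn => (MeanLE.sum hn (fun t => by fun_prop) fun _ _ => hM).mono
      (fun _ => le_rfl) (by simp [mul_comm]))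
  refine h1.mono fun l _ h2 => ?_
  obtain ⟨C, hC, h2⟩ := h2
  refine ⟨C ^ (1 / γ), by positivity, h2.mono fun p hp t ht => ?_⟩
  have h3 : X p.1 t p.2 ^ γ ≤ C * (S p.1).card :=
    (Finset.single_le_sum (f := fun t => X p.1 t p.2 ^ γ)
      (fun t _ => Real.rpow_nonneg (h0 _ _ _) _) ht).trans hp
  rw [← Real.mul_rpow hC (Nat.cast_nonneg _)]
  calc X p.1 t p.2 = (X p.1 t p.2 ^ γ) ^ (1 / γ) := by
        rw [← Real.rpow_mul (h0 _ _ _), mul_one_div_cancel hγ.ne', Real.rpow_one]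
    _ ≤ _ := Real.rpow_le_rpow (Real.rpow_nonneg (h0 _ _ _) _) h3 (by positivity)

end Bounds

variable {Ω : Type*} [MeasurableSpace Ω] {J : ℕ} {r : Fin J → ℕ} {D : Panel Ω r}
  {P : Measure Ω} [IsProbabilityMeasure P] {α β : ℝ} {q : Fin J → ℝ}
  {SigF SigL : (j : Fin J) → Matrix (Fin (r j)) (Fin (r j)) ℝ}
  {Φ Γ : (j : Fin J) → ℕ → Matrix (Fin (r j)) (Fin (r j)) ℝ}

theorem often_loadingFactor (h : D.LimitAssumption P q Φ Γ) (j : Fin J) :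
    Often P fun l => ∃ C : ℝ, 0 ≤ C ∧ ∀ᶠ p : ℕ × Ω in l,
      fn ((D.L0 p.1 j)ᵀ * (D.EM p.1 j p.2 * D.FM p.1 j p.2)) ^ 2 ≤ C * (D.N p.1 * D.T p.1) := by
  obtain ⟨M, hM⟩ := h.loadingFactor
  have h1 := D.measurable_error
  have h2 := D.measurable_ind
  have h3 := D.measurable_factor_apply
  have heq : ∀ n ω (a b : Fin (r j)), ((D.L0 n j)ᵀ * (D.EM n j ω * D.FM n j ω)) a b =
      ∑ k ∈ Finset.range (D.N n), ∑ t ∈ Finset.range (D.T n),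
        D.loading n j k a * D.factor n j t ω b * D.error n k t ω * D.ind n j t ω := by
    intro n ω a b
    rw [Matrix.mul_apply, Finset.sum_range]
    refine Finset.sum_congr rfl fun k _ => ?_
    rw [Matrix.mul_apply, Finset.mul_sum, Finset.sum_range]
    refine Finset.sum_congr rfl fun t _ => ?_
    simp only [Matrix.transpose_apply, L0, EM, FM, Matrix.of_apply]
    calc _ = D.loading n j k a * D.factor n j t ω b * D.error n k t ω *
        (D.ind n j t ω * D.ind n j t ω) := by ring
      _ = _ := by rw [ind_mul_self]
  have hm : ∀ n (a b : Fin (r j)), Measurable fun ω => (∑ k ∈ Finset.range (D.N n),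
      ∑ t ∈ Finset.range (D.T n),
        D.loading n j k a * D.factor n j t ω b * D.error n k t ω * D.ind n j t ω) ^ 2 :=
    fun n a b => (Finset.measurable_sum _ fun k _ => Finset.measurable_sum _ fun t _ =>
      (((h3 n j t b).const_mul _).mul (h1 n k t)).mul (h2 n j t)).pow_const 2
  simp only [fn_sq, heq]
  refine Often.of_meanLE (X := fun n ω => ∑ a : Fin (r j), ∑ b : Fin (r j),
      (∑ k ∈ Finset.range (D.N n), ∑ t ∈ Finset.range (D.T n),
        D.loading n j k a * D.factor n j t ω b * D.error n k t ω * D.ind n j t ω) ^ 2)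
    (a := fun n => D.N n * D.T n) (M := r j * (r j * M)) ?_
    (fun n => Finset.measurable_sum _ fun a _ => Finset.measurable_sum _ fun b _ => hm n a b) ?_
  · filter_upwards [D.eventually_N_pos, D.eventually_T_pos] with n h1 h2 using by positivity
  · filter_upwards [D.eventually_N_pos, D.eventually_T_pos] with n hN hT
    refine (MeanLE.sum (M := fun _ => ∑ b : Fin (r j), (D.N n * D.T n * M : ℝ))
      (fun (a : Fin (r j)) _ => MeanLE.sum (fun (b : Fin (r j)) _ => ?_)
      (fun b => hm n a b) fun b _ => by positivity)
      (fun a => Finset.measurable_sum _ fun b _ => hm n a b) fun a _ => by positivity).mono (fun ω => le_rfl) ?_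
    · have := meanLE_sq_of_norm_smul (c := (D.N n * D.T n : ℝ)) (by positivity)
        (MeanLE.of_enorm_sq (hM n j a b))
      simpa using this
    · simp
      linarith

theorem often_loading_row (hΛ : D.LoadingAssumption SigL) (he : D.ErrorAssumption P α)
    (h : D.LimitAssumption P q Φ Γ) (j : Fin J) (i : ℕ) :
    Often P fun l => ∃ C : ℝ, 0 ≤ C ∧ ∀ᶠ p : ℕ × Ω in l,
      ‖∑ k ∈ Finset.range (D.N p.1), ∑ t ∈ Finset.range (D.T p.1),
        (D.error p.1 i t p.2 * D.error p.1 k t p.2 * D.ind p.1 j t p.2) • D.loading p.1 j k‖ ^ 2 ≤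
        C * (D.N p.1 * D.T p.1 + D.T p.1 ^ 2) := by
  obtain ⟨M, hM⟩ := h.loadingProducts
  obtain ⟨B, hB⟩ := hΛ.bounded
  obtain ⟨M', hM0, hM'⟩ := meanLE_products he
  have h1 := D.measurable_error
  have h2 := D.measurable_ind
  refine Often.of_meanLE (X := fun n ω => ‖∑ k ∈ Finset.range (D.N n),
      ∑ t ∈ Finset.range (D.T n),
        (D.error n i t ω * D.error n k t ω * D.ind n j t ω) • D.loading n j k‖ ^ 2)
    (a := fun n => D.N n * D.T n + D.T n ^ 2) (M := 2 * M + 2 * (M' * B) ^ 2) ?_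
    (fun n => by fun_prop) ?_
  · filter_upwards [D.eventually_N_pos, D.eventually_T_pos] with n h1 h2 using by positivity
  · filter_upwards [D.tendsto_N.eventually_gt_atTop i, D.tendsto_T.eventually_gt_atTop 0,
      D.eventually_N_pos, D.eventually_T_pos] with n hi hT hN' hT'
    obtain ⟨τ, hτ0, hτs, hR, -⟩ := hM' n hT
    have hb := (meanLE_sq_of_norm_smul (c := (D.N n * D.T n : ℝ)) (by positivity)
        (MeanLE.of_enorm_sq (hM n j i hi))).const_mul (c := 2) (by norm_num)
    have hB0 : 0 ≤ B := (norm_nonneg _).trans (hB n j i hi)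
    refine (hb.add (MeanLE.const (2 * (D.T n * (M' * B)) ^ 2)) (by fun_prop) (by positivity)
      (by positivity)).mono (fun ω => ?_) ?_
    · set S := ∑ k ∈ Finset.range (D.N n), ∑ t ∈ Finset.range (D.T n),
        ((D.error n i t ω * D.error n k t ω - ∫ ω', D.error n i t ω' * D.error n k t ω' ∂P) *
          D.ind n j t ω) • D.loading n j k
      set R := ∑ k ∈ Finset.range (D.N n), (∑ t ∈ Finset.range (D.T n),
        (∫ ω', D.error n i t ω' * D.error n k t ω' ∂P) * D.ind n j t ω) • D.loading n j k with hRdef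
      have hsplit : ∑ k ∈ Finset.range (D.N n), ∑ t ∈ Finset.range (D.T n),
          (D.error n i t ω * D.error n k t ω * D.ind n j t ω) • D.loading n j k = S + R := by
        rw [← Finset.sum_add_distrib]
        refine Finset.sum_congr rfl fun k _ => ?_
        rw [Finset.sum_smul, ← Finset.sum_add_distrib]
        refine Finset.sum_congr rfl fun t _ => ?_
        rw [← add_smul]
        congr 1
        ring
      have hRle : ‖R‖ ≤ D.T n * (M' * B) := by
        refine (norm_sum_le _ _).trans ?_
        calc _ ≤ ∑ k ∈ Finset.range (D.N n), D.T n * τ i k * B := by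
              refine Finset.sum_le_sum fun k hk => ?_
              rw [norm_smul]
              have hk' := Finset.mem_range.1 hk
              exact mul_le_mul (hR i k j ω hi hk') (hB n j k hk') (norm_nonneg _)
                (mul_nonneg hT'.le (hτ0 i k hi hk'))
          _ = D.T n * ((∑ k ∈ Finset.range (D.N n), τ i k) * B) := by
              rw [← Finset.sum_mul, ← Finset.mul_sum, mul_assoc]
          _ ≤ _ := by gcongr; exact hτs i hi
      have h3 := norm_add_le S R
      have h4 : ‖S + R‖ ^ 2 ≤ (‖S‖ + ‖R‖) ^ 2 := pow_le_pow_left₀ (norm_nonneg _) h3 2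
      have h5 : ‖R‖ ^ 2 ≤ (D.T n * (M' * B)) ^ 2 := pow_le_pow_left₀ (norm_nonneg _) hRle 2
      rw [hsplit]
      nlinarith [sq_nonneg (‖S‖ - ‖R‖)]
    · have e1 : 0 ≤ (D.N n : ℝ) * D.T n * (M' * B) ^ 2 := by positivity
      have e2 : 0 ≤ (D.T n : ℝ) ^ 2 * M := by positivity
      have e3 : 0 ≤ (D.T n : ℝ) ^ 2 * (M' * B) ^ 2 := by positivity
      nlinarith

omit [IsProbabilityMeasure P] in
theorem meanLE_fnorm_rpow (hα : 0 ≤ α) (hF : D.FactorAssumption P q α SigF) :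
    ∃ M : ℝ, 0 ≤ M ∧ ∀ n t, t < D.T n → MeanLE P (fun ω => D.fnorm n t ω ^ α) M := by
  obtain ⟨M, hM⟩ := hF.moment
  refine ⟨M, M.2, fun n t ht => ?_⟩
  unfold MeanLE
  rw [ENNReal.ofReal_coe_nnreal]
  refine le_trans (le_of_eq (lintegral_congr fun ω => ?_)) (hM n t ht)
  rw [← ENNReal.ofReal_rpow_of_nonneg (D.fnorm_nonneg n t ω) hα, fnorm, ofReal_norm]

omit [IsProbabilityMeasure P] in
theorem ind_mul_norm_le (D : Panel Ω r) (n : ℕ) (j : Fin J) (t : ℕ) (ω : Ω) :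
    D.ind n j t ω * ‖D.factor n j t ω‖ ≤ D.fnorm n t ω := by
  rw [fnorm_eq]
  exact Finset.single_le_sum (f := fun j => D.ind n j t ω * ‖D.factor n j t ω‖)
    (fun j _ => mul_nonneg (D.ind_nonneg n j t ω) (norm_nonneg _)) (Finset.mem_univ j)

theorem often_factor_products (hα : 2 ≤ α) (hF : D.FactorAssumption P q α SigF)
    (he : D.ErrorAssumption P α) (h : D.LimitAssumption P q Φ Γ) (j : Fin J) (s : ℕ) :
    Often P fun l => ∃ C : ℝ, 0 ≤ C ∧ ∀ᶠ p : ℕ × Ω in l,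
      ‖∑ t ∈ Finset.range (D.T p.1), ((∑ i ∈ Finset.range (D.N p.1),
        D.error p.1 i t p.2 * D.error p.1 i s p.2) * D.ind p.1 j t p.2) • D.factor p.1 j t p.2‖ ≤
        C * (√(D.N p.1 * D.T p.1) + D.N p.1) := by
  obtain ⟨M, hM⟩ := h.factorProducts
  obtain ⟨Mf, hMf0, hMf⟩ := meanLE_fnorm_rpow (by linarith) hF
  obtain ⟨M', hM'⟩ := he.serial
  have h1 := D.measurable_error
  have h2 := D.measurable_ind
  have h3 := D.measurable_factor
  have h4 := D.measurable_fnorm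
  refine Often.of_meanLE (X := fun n ω => ‖∑ t ∈ Finset.range (D.T n),
      ((∑ i ∈ Finset.range (D.N n), D.error n i t ω * D.error n i s ω) * D.ind n j t ω) •
        D.factor n j t ω‖)
    (a := fun n => √(D.N n * D.T n) + D.N n) (M := (1 + M) + M' * (2 + Mf)) ?_
    (fun n => by fun_prop) ?_
  · filter_upwards [D.eventually_N_pos, D.eventually_T_pos] with n h1 h2 using by positivity
  · filter_upwards [D.tendsto_T.eventually_gt_atTop s, D.eventually_N_pos, D.eventually_T_pos]
      with n hs hN hT
    obtain ⟨γ, hγ, hγs⟩ := hM' n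
    have hN0 : 0 < D.N n := by exact_mod_cast hN
    have hγ0 : ∀ t, t < D.T n → 0 ≤ γ s t := fun t ht =>
      (abs_nonneg _).trans (hγ 0 s t hN0 hs ht)
    have hM'0 : 0 ≤ M' := (Finset.sum_nonneg fun t ht => hγ0 t (Finset.mem_range.1 ht)).trans
      (hγs s hs)
    have hc : (0 : ℝ) < D.N n * D.T n := by positivity
    have hsq := Real.sq_sqrt hc.le
    have hsp := Real.sqrt_pos.2 hc
    -- the centred part
    set S : Ω → EuclideanSpace ℝ (Fin (r j)) := fun ω => ∑ i ∈ Finset.range (D.N n),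
      ∑ t ∈ Finset.range (D.T n),
        ((D.error n i t ω * D.error n i s ω - ∫ ω', D.error n i t ω' * D.error n i s ω' ∂P) *
          D.ind n j t ω) • D.factor n j t ω with hS
    have hSm : Measurable S := by fun_prop
    have hb : MeanLE P (fun ω => ‖S ω‖) (√(D.N n * D.T n) * (1 + M)) := by
      have hz := (MeanLE.const (P := P) 1).add (MeanLE.of_enorm_sq (hM n j s hs)) measurable_const
        zero_le_one M.2
      refine (hz.const_mul hsp.le).mono (fun ω => ?_) le_rfl
      rw [norm_smul, mul_pow, Real.norm_eq_abs, sq_abs, div_pow, hsq]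
      change ‖S ω‖ ≤ √(D.N n * D.T n) * (1 + 1 ^ 2 / (D.N n * D.T n) * ‖S ω‖ ^ 2)
      conv_rhs => rw [← hsq, Real.sqrt_sq hsp.le]
      have h5 : ∀ y : ℝ, 0 < y → ∀ x, 0 ≤ x → x ≤ y * (1 + 1 ^ 2 / y ^ 2 * x ^ 2) := by
        intro y hy x hx
        have h6 : y * (1 + 1 ^ 2 / y ^ 2 * x ^ 2) - x = y * ((1 - x / y) ^ 2 + x / y) := by
          field_simp
          ring
        have h7 : 0 ≤ y * ((1 - x / y) ^ 2 + x / y) := by positivity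
        linarith
      exact h5 _ hsp _ (norm_nonneg _)
    -- the means
    have hR : MeanLE P (fun ω => ∑ t ∈ Finset.range (D.T n), (D.N n * γ s t) * D.fnorm n t ω)
        (D.N n * (M' * (2 + Mf))) := by
      refine (MeanLE.sum (M := fun t => (D.N n * γ s t) * (2 + Mf)) (fun t ht => ?_)
        (fun t => by fun_prop) fun t ht => ?_).mono (fun ω => le_rfl) ?_
      · refine MeanLE.const_mul ?_ (mul_nonneg hN.le (hγ0 t (Finset.mem_range.1 ht)))
        have hz := (MeanLE.const (P := P) 1).add ((hMf n t (Finset.mem_range.1 ht)).sq_of_rpow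
          (D.fnorm_nonneg n t) hα hMf0) measurable_const zero_le_one (by positivity)
        refine hz.mono (fun ω => ?_) (by linarith)
        nlinarith [sq_nonneg (D.fnorm n t ω - 1)]
      · have := hγ0 t (Finset.mem_range.1 ht)
        positivity
      · rw [← Finset.sum_mul, ← Finset.mul_sum, mul_assoc]
        gcongr
        exact hγs s hs
    refine (hb.add hR (by fun_prop) (by positivity) (by positivity)).mono (fun ω => ?_) ?_
    · have hsplit : ∑ t ∈ Finset.range (D.T n),
          ((∑ i ∈ Finset.range (D.N n), D.error n i t ω * D.error n i s ω) * D.ind n j t ω) •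
            D.factor n j t ω = S ω + ∑ t ∈ Finset.range (D.T n), ((∑ i ∈ Finset.range (D.N n),
              ∫ ω', D.error n i t ω' * D.error n i s ω' ∂P) * D.ind n j t ω) •
                D.factor n j t ω := by
        rw [hS]
        simp only
        rw [Finset.sum_comm (s := Finset.range (D.N n)), ← Finset.sum_add_distrib]
        refine Finset.sum_congr rfl fun t _ => ?_
        rw [← Finset.sum_smul, ← add_smul, ← Finset.sum_mul, ← add_mul, ← Finset.sum_add_distrib]
        simp
      rw [hsplit]
      refine (norm_add_le _ _).trans (add_le_add le_rfl ((norm_sum_le _ _).trans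
        (Finset.sum_le_sum fun t ht => ?_)))
      have ht' := Finset.mem_range.1 ht
      rw [norm_smul, Real.norm_eq_abs, abs_mul, abs_of_nonneg (D.ind_nonneg n j t ω), mul_assoc]
      refine mul_le_mul ?_ (D.ind_mul_norm_le n j t ω)
        (mul_nonneg (D.ind_nonneg n j t ω) (norm_nonneg _))
        (mul_nonneg hN.le (hγ0 t ht'))
      refine (Finset.abs_sum_le_sum_abs _ _).trans ?_
      calc _ ≤ ∑ i ∈ Finset.range (D.N n), γ s t := Finset.sum_le_sum fun i hi => by
            have := hγ i s t (Finset.mem_range.1 hi) hs ht'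
            simpa only [mul_comm] using this
        _ = _ := by simp
    · have e1 : 0 ≤ (D.N n : ℝ) * (1 + M) := by positivity
      have e2 : 0 ≤ √(D.N n * D.T n : ℝ) * (M' * (2 + Mf)) := by positivity
      nlinarith

end Panel

/-! ### Selections -/

/-- The first index at which a function is largest. -/
def argmax {J : ℕ} [Nonempty (Fin J)] (f : Fin J → ℝ) : Fin J :=
  (Finset.univ.filter fun k => ∀ k', f k' ≤ f k).min' (by
    obtain ⟨k, hk⟩ := Finite.exists_max f
    exact ⟨k, by simpa using hk⟩)

theorem le_argmax {J : ℕ} [Nonempty (Fin J)] (f : Fin J → ℝ) (k : Fin J) : f k ≤ f (argmax f) := by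
  have := Finset.min'_mem (Finset.univ.filter fun k => ∀ k', f k' ≤ f k) (by
    obtain ⟨k, hk⟩ := Finite.exists_max f
    exact ⟨k, by simpa using hk⟩)
  exact (Finset.mem_filter.1 this).2 k

theorem argmax_eq_iff {J : ℕ} [Nonempty (Fin J)] (f : Fin J → ℝ) (k : Fin J) :
    argmax f = k ↔ (∀ k', f k' ≤ f k) ∧ ∀ i, i < k → ∃ k', f i < f k' := by
  constructor
  · rintro rfl
    refine ⟨le_argmax f, fun i hi => ?_⟩
    by_contra! h
    exact absurd hi (not_lt.2 (Finset.min'_le _ _ (by simpa using h)))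
  · rintro ⟨h1, h2⟩
    refine le_antisymm (Finset.min'_le _ _ (by simpa using h1)) ?_
    by_contra! h
    obtain ⟨k', hk'⟩ := h2 _ h
    exact absurd (le_argmax f k') (not_le.2 hk')

theorem measurable_argmax {Ω : Type*} [MeasurableSpace Ω] {J : ℕ} [Nonempty (Fin J)]
    {f : Fin J → Ω → ℝ} (hf : ∀ k, Measurable (f k)) :
    Measurable fun ω => argmax fun k => f k ω := by
  refine measurable_to_countable' fun k => ?_
  have : (fun ω => argmax fun k => f k ω) ⁻¹' {k} =
      (⋂ k', {ω | f k' ω ≤ f k ω}) ∩ ⋂ i, ⋂ (_ : i < k), ⋃ k', {ω | f i ω < f k' ω} := by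
    ext ω
    simp [argmax_eq_iff]
  rw [this]
  refine (MeasurableSet.iInter fun k' => measurableSet_le (hf k') (hf k)).inter
    (MeasurableSet.iInter fun i => MeasurableSet.iInter fun _ => MeasurableSet.iUnion fun k' =>
      measurableSet_lt (hf i) (hf k'))

theorem log_one_add_le_sqrt {y : ℝ} (hy : 0 ≤ y) : Real.log (1 + y) ≤ 2 * √(1 + y) := by
  have h1 : 0 < √(1 + y) := Real.sqrt_pos.2 (by linarith)
  have h2 : Real.log (1 + y) = 2 * Real.log √(1 + y) := by
    conv_lhs => rw [← Real.sq_sqrt (show 0 ≤ 1 + y by linarith)]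
    rw [Real.log_pow]; norm_num
  have := Real.log_le_sub_one_of_pos h1
  linarith

namespace Panel

variable {Ω : Type*} [MeasurableSpace Ω] {J : ℕ} {r : Fin J → ℕ} (D : Panel Ω r)
  (L : (n : ℕ) → Ω → (j : Fin J) → Matrix (Fin (D.N n)) (Fin (r j)) ℝ) (s2 : ℕ → Ω → ℝ)

/-- The estimated regime with the largest density at a date. -/
def best [Nonempty (Fin J)] (n t : ℕ) (ω : Ω) : Fin J :=
  argmax fun k => density (L n ω k) (s2 n ω) (D.x n t ω)

/-- The number of dates of regime `j` at which regime `k` has the largest estimated density. -/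
def count [Nonempty (Fin J)] (n : ℕ) (ω : Ω) (j k : Fin J) : ℝ :=
  ∑ t ∈ Finset.range (D.T n), D.ind n j t ω * if D.best L s2 n t ω = k then 1 else 0

/-- The estimated regime that is matched to regime `j`. -/
def slot [Nonempty (Fin J)] (n : ℕ) (ω : Ω) (j : Fin J) : Fin J :=
  argmax fun k => D.count L s2 n ω j k

/-- The current factors. -/
def fac (n t : ℕ) (ω : Ω) : Fin (r (D.state n t ω)) → ℝ :=
  (D.factor n (D.state n t ω) t ω).ofLp

/-- The common component. -/
def sig (n t : ℕ) (ω : Ω) : Fin (D.N n) → ℝ := D.L0 n (D.state n t ω) *ᵥ D.fac n t ω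

theorem x_eq (n t : ℕ) (ω : Ω) : D.x n t ω = D.sig n t ω + D.err n t ω := rfl

theorem vn_fac (n t : ℕ) (ω : Ω) : vn (D.fac n t ω) = D.fnorm n t ω := vn_eq_norm _

theorem vn_sig_le (n t : ℕ) (ω : Ω) :
    vn (D.sig n t ω) ≤ fn (D.L0 n (D.state n t ω)) * D.fnorm n t ω := by
  rw [← vn_fac]; exact vn_mulVec_le _ _

theorem sum_vn_proj_err (n : ℕ) (j : Fin J) (ω : Ω) (P : Matrix (Fin (D.N n)) (Fin (D.N n)) ℝ) :
    ∑ t : Fin (D.T n), D.ind n j t ω * vn (P *ᵥ D.err n t ω) ^ 2 = fn (P * D.EM n j ω) ^ 2 := by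
  rw [fn_sq_eq_sum_col]
  refine Finset.sum_congr rfl fun t _ => ?_
  have : (fun i => (P * D.EM n j ω) i t) = D.ind n j t ω • (P *ᵥ D.err n t ω) := by
    funext i
    simp only [Matrix.mul_apply, EM, Matrix.of_apply, Pi.smul_apply, Matrix.mulVec, dotProduct,
      smul_eq_mul, Finset.mul_sum, err]
    exact Finset.sum_congr rfl fun k _ => by ring
  rw [this, vn_smul, mul_pow, sq_abs, sq (D.ind n j t ω), ind_mul_self]

theorem sum_vn_proj_err_le {n : ℕ} {ω : Ω} {P : Fin J → Matrix (Fin (D.N n)) (Fin (D.N n)) ℝ}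
    (hP : ∀ k, IsProjMat (P k)) {B R : ℝ} (hR : ∀ k, (P k).trace ≤ R) (hB : 0 ≤ B)
    (hE : ∀ j, fn (D.EM n j ω * (D.EM n j ω)ᵀ) ≤ B) (jt : Fin (D.T n) → Fin J) :
    ∑ t : Fin (D.T n), vn (P (jt t) *ᵥ D.err n t ω) ^ 2 ≤ J * (J * (B * R)) := by
  calc ∑ t : Fin (D.T n), vn (P (jt t) *ᵥ D.err n t ω) ^ 2
      ≤ ∑ t : Fin (D.T n), ∑ k, ∑ j, D.ind n j t ω * vn (P k *ᵥ D.err n t ω) ^ 2 := by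
        refine Finset.sum_le_sum fun t _ => ?_
        have : ∀ k, ∑ j, D.ind n j t ω * vn (P k *ᵥ D.err n t ω) ^ 2 =
            vn (P k *ᵥ D.err n t ω) ^ 2 := fun k => by rw [← Finset.sum_mul, sum_ind, one_mul]
        simp only [this]
        exact Finset.single_le_sum (f := fun k => vn (P k *ᵥ D.err n t ω) ^ 2)
          (fun k _ => sq_nonneg _) (Finset.mem_univ (jt t))
    _ = ∑ k, ∑ j, fn (P k * D.EM n j ω) ^ 2 := by
        rw [Finset.sum_comm]
        refine Finset.sum_congr rfl fun k _ => ?_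
        rw [Finset.sum_comm]
        exact Finset.sum_congr rfl fun j _ => D.sum_vn_proj_err n j ω (P k)
    _ ≤ ∑ k : Fin J, ∑ j : Fin J, B * R := by
        refine Finset.sum_le_sum fun k _ => Finset.sum_le_sum fun j _ => ?_
        have h0 : 0 ≤ (P k).trace := by rw [← (hP k).fn_sq]; positivity
        exact (fn_proj_mul_sq_le (hP k) _).trans (mul_le_mul (hE j) (hR k) h0 hB)
    _ = _ := by simp

variable {D L s2}

set_option maxHeartbeats 1000000 in
/-- The estimated loadings fit the common components. -/
theorem exists_sum_signal_le [Nonempty (Fin J)] {θ : MarkovParam J} (hL : D.IsMLE θ L s2)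
    {c C CF CΛ CE : ℝ} (hc : 0 < c) (hCF : 0 ≤ CF) (hCΛ : 0 ≤ CΛ) (hCE : 0 ≤ CE) :
    ∃ K : ℝ, 0 ≤ K ∧ ∀ n ω, c ≤ s2 n ω → s2 n ω ≤ C → 1 ≤ D.δ n →
      ∑ t : Fin (D.T n), D.fnorm n t ω ^ 2 ≤ CF * D.T n →
      (∀ j, fn (D.L0 n j) ^ 2 ≤ CΛ * D.N n) →
      (∀ j, fn (D.EM n j ω * (D.EM n j ω)ᵀ) ≤ CE * (D.N n * D.T n / D.δ n)) →
      (∀ j, (projMat (D.L0 n j)).trace ≤ r j) →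
      ∑ t : Fin (D.T n), vn (annihilator (L n ω (D.best L s2 n t ω)) *ᵥ D.sig n t ω) ^ 2 ≤
        K * (D.N n * D.T n / √(D.δ n)) := by
  set R : ℝ := ((maxRank r : ℕ) : ℝ) with hR
  have hRr : ∀ j, (r j : ℝ) ≤ R := fun j => by
    rw [hR]; exact_mod_cast Finset.le_sup (f := r) (Finset.mem_univ j)
  have hR0 : 0 ≤ R := Nat.cast_nonneg _
  set K1 : ℝ := |C| * (CF + R * (2 * √(1 + CΛ / c)) + |2 * (Real.log J - Real.log θ.lower)|) with hK1
  set K2 : ℝ := J * (J * (CE * R)) with hK2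
  have hK1' : 0 ≤ K1 := by positivity
  have hK2' : 0 ≤ K2 := by positivity
  refine ⟨K1 + K2 + 4 * (√(CΛ * CF) * √K2), by positivity, ?_⟩
  intro n ω h1 h2 hδ hF hΛ hE hT0
  have hs : 0 < s2 n ω := hL.s2_pos n ω
  have hδ0 : 0 < D.δ n := by linarith
  have hN : (1 : ℝ) ≤ D.N n := by nlinarith [D.δ_sq_le_N n]
  have hT : (1 : ℝ) ≤ D.T n := by nlinarith [D.δ_sq_le_T n]
  have hN0 : (0 : ℝ) < D.N n := by linarith
  have hT1 : (0 : ℝ) < D.T n := by linarith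
  have hsδ : 1 ≤ √(D.δ n) := Real.one_le_sqrt.2 hδ
  have hsδ2 : √(D.δ n) ≤ D.δ n := by
    rw [Real.sqrt_le_left hδ0.le]; nlinarith
  set X := (D.N n : ℝ) * D.T n / √(D.δ n) with hX
  have hX0 : 0 ≤ X := by positivity
  have hXδ : (D.N n : ℝ) * D.T n / D.δ n ≤ X :=
    div_le_div_of_nonneg_left (by positivity) (by linarith) hsδ2
  -- the likelihood comparison
  have hq := sum_quadForm_le θ (L n ω) (D.L0 n) hs (D.obs n ω) (fun t => D.state n t ω)
    (fun t => D.best L s2 n t ω) (hL.isMax n ω _)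
    (fun t k => le_argmax (fun k => density (L n ω k) (s2 n ω) (D.x n t ω)) k)
    (fun t => D.fac n t ω)
  have hres : ∀ t : Fin (D.T n), D.obs n ω t - D.L0 n (D.state n t ω) *ᵥ D.fac n t ω =
      D.err n t ω := fun t => by
    change D.sig n t ω + D.err n t ω - D.sig n t ω = _
    abel
  simp only [hres] at hq
  have hpen : s2 n ω * ∑ t : Fin (D.T n), (vn (D.fac n t ω) ^ 2 + r (D.state n t ω) *
      Real.log (1 + fn (D.L0 n (D.state n t ω)) ^ 2 / s2 n ω) +
      2 * (Real.log J - Real.log θ.lower)) ≤ K1 * X := by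
    have hlog : ∀ j, (r j : ℝ) * Real.log (1 + fn (D.L0 n j) ^ 2 / s2 n ω) ≤
        R * (2 * √(1 + CΛ / c)) * √(D.N n) := by
      intro j
      have hy : 0 ≤ fn (D.L0 n j) ^ 2 / s2 n ω := by positivity
      have e1 : 1 + fn (D.L0 n j) ^ 2 / s2 n ω ≤ (1 + CΛ / c) * D.N n := by
        have : fn (D.L0 n j) ^ 2 / s2 n ω ≤ CΛ * D.N n / c :=
          div_le_div₀ (by positivity) (hΛ j) hc h1
        have e2 : CΛ * D.N n / c = CΛ / c * D.N n := by ring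
        rw [add_mul, one_mul, ← e2]
        linarith
      have e3 := Real.sqrt_le_sqrt e1
      rw [Real.sqrt_mul (by positivity)] at e3
      have e4 := log_one_add_le_sqrt hy
      calc (r j : ℝ) * Real.log (1 + fn (D.L0 n j) ^ 2 / s2 n ω)
          ≤ R * (2 * (√(1 + CΛ / c) * √(D.N n))) :=
            mul_le_mul (hRr j) (by linarith) (Real.log_nonneg (by linarith)) hR0
        _ = _ := by ring
    have hsN : 1 ≤ √(D.N n : ℝ) := Real.one_le_sqrt.2 hN
    have e5 : ∑ t : Fin (D.T n), (vn (D.fac n t ω) ^ 2 + r (D.state n t ω) *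
        Real.log (1 + fn (D.L0 n (D.state n t ω)) ^ 2 / s2 n ω) +
        2 * (Real.log J - Real.log θ.lower)) ≤ (CF + R * (2 * √(1 + CΛ / c)) +
          |2 * (Real.log J - Real.log θ.lower)|) * (D.T n * √(D.N n)) := by
      simp only [vn_fac]
      rw [Finset.sum_add_distrib, Finset.sum_add_distrib]
      have a1 : CF * D.T n ≤ CF * (D.T n * √(D.N n)) := by
        have : (D.T n : ℝ) * 1 ≤ D.T n * √(D.N n) := by gcongr
        exact mul_le_mul_of_nonneg_left (by linarith) hCF
      have a2 : ∑ t : Fin (D.T n), (r (D.state n t ω) : ℝ) *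
          Real.log (1 + fn (D.L0 n (D.state n t ω)) ^ 2 / s2 n ω) ≤
          R * (2 * √(1 + CΛ / c)) * (D.T n * √(D.N n)) := by
        refine (Finset.sum_le_sum fun (t : Fin (D.T n)) _ => hlog (D.state n t ω)).trans (le_of_eq ?_)
        simp; ring
      have a3 : ∑ t : Fin (D.T n), 2 * (Real.log J - Real.log θ.lower) ≤
          |2 * (Real.log J - Real.log θ.lower)| * (D.T n * √(D.N n)) := by
        rw [Finset.sum_const, Finset.card_univ, Fintype.card_fin, nsmul_eq_mul]
        have b1 := le_abs_self (2 * (Real.log J - Real.log θ.lower))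
        have b2 := abs_nonneg (2 * (Real.log J - Real.log θ.lower))
        have b3 : (D.T n : ℝ) * 1 ≤ D.T n * √(D.N n) := by gcongr
        nlinarith
      linarith
    have e6 : (D.T n : ℝ) * √(D.N n) ≤ X := by
      refine le_trans ?_ hXδ
      rw [le_div_iff₀ hδ0]
      have : D.δ n ≤ √(D.N n : ℝ) := min_le_left _ _
      calc (D.T n : ℝ) * √(D.N n) * D.δ n ≤ D.T n * √(D.N n) * √(D.N n) := by gcongr
        _ = D.N n * D.T n := by rw [mul_assoc, Real.mul_self_sqrt hN0.le]; ring
    have hCs : s2 n ω ≤ |C| := h2.trans (le_abs_self C)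
    calc _ ≤ s2 n ω * ((CF + R * (2 * √(1 + CΛ / c)) +
          |2 * (Real.log J - Real.log θ.lower)|) * (D.T n * √(D.N n))) :=
          mul_le_mul_of_nonneg_left e5 hs.le
      _ ≤ |C| * ((CF + R * (2 * √(1 + CΛ / c)) +
          |2 * (Real.log J - Real.log θ.lower)|) * X) := by gcongr
      _ = K1 * X := by rw [hK1]; ring
  -- the errors
  have hb := D.sum_vn_proj_err_le (ω := ω) (P := fun k => projMat (L n ω k)) (R := R)
    (fun k => isProjMat_projMat _)
    (fun k => (trace_projMat_le_of_isDiag (hL.diagonal n ω k)).trans (hRr k)) (by positivity) hE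
    (fun t => D.best L s2 n t ω)
  have hb0 := D.sum_vn_proj_err_le (ω := ω) (P := fun k => projMat (D.L0 n k)) (R := R)
    (fun k => isProjMat_projMat _) (fun k => (hT0 k).trans (hRr k)) (by positivity) hE
    (fun t => D.state n t ω)
  have hBX : (J : ℝ) * (J * (CE * (D.N n * D.T n / D.δ n) * R)) = K2 * (D.N n * D.T n / D.δ n) := by
    rw [hK2]; ring
  rw [hBX] at hb hb0
  have ha : ∑ t : Fin (D.T n), vn (D.sig n t ω) ^ 2 ≤ CΛ * CF * (D.N n * D.T n) := by
    calc _ ≤ ∑ t : Fin (D.T n), CΛ * D.N n * D.fnorm n t ω ^ 2 := by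
          refine Finset.sum_le_sum fun t _ => ?_
          have := pow_le_pow_left₀ (vn_nonneg _) (D.vn_sig_le n t ω) 2
          rw [mul_pow] at this
          exact this.trans (mul_le_mul_of_nonneg_right (hΛ _) (sq_nonneg _))
      _ = CΛ * D.N n * ∑ t : Fin (D.T n), D.fnorm n t ω ^ 2 := by rw [Finset.mul_sum]
      _ ≤ CΛ * D.N n * (CF * D.T n) := by gcongr
      _ = _ := by ring
  have hcs : ∀ b : Fin (D.T n) → ℝ, ∑ t, b t ^ 2 ≤ K2 * (D.N n * D.T n / D.δ n) →
      ∑ t : Fin (D.T n), vn (D.sig n t ω) * b t ≤ √(CΛ * CF) * √K2 * X := by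
    intro b hb
    refine (Real.sum_mul_le_sqrt_mul_sqrt _ _ _).trans ?_
    calc _ ≤ √(CΛ * CF * (D.N n * D.T n)) * √(K2 * (D.N n * D.T n / D.δ n)) :=
          mul_le_mul (Real.sqrt_le_sqrt ha) (Real.sqrt_le_sqrt hb) (Real.sqrt_nonneg _)
            (Real.sqrt_nonneg _)
      _ = √(CΛ * CF) * √K2 * X := by
        have e1 : √((D.N n : ℝ) * D.T n) * √((D.N n : ℝ) * D.T n) = D.N n * D.T n :=
          Real.mul_self_sqrt (by positivity)
        rw [Real.sqrt_mul (by positivity), Real.sqrt_mul hK2', Real.sqrt_div (by positivity), hX]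
        calc _ = √(CΛ * CF) * √K2 * (√((D.N n : ℝ) * D.T n) * √((D.N n : ℝ) * D.T n) /
              √(D.δ n)) := by ring
          _ = _ := by rw [e1]
  have h3 := hcs _ hb
  have h4 := hcs _ hb0
  have hsig : ∀ t : Fin (D.T n), _ := fun t => vn_compl_signal_le
    (isProjMat_projMat (L n ω (D.best L s2 n t ω)))
    (isProjMat_projMat (D.L0 n (D.state n t ω))) (D.sig n t ω) (D.err n t ω)
    (by rw [sig, Matrix.mulVec_mulVec, projMat_mul_self])
  have hsum := Finset.sum_le_sum fun t (_ : t ∈ Finset.univ) => hsig t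
  simp only [Finset.sum_add_distrib, Finset.sum_sub_distrib, ← Finset.mul_sum] at hsum
  have hq' : ∑ t : Fin (D.T n), vn ((1 - projMat (L n ω (D.best L s2 n t ω))) *ᵥ
      (D.sig n t ω + D.err n t ω)) ^ 2 ≤ ∑ t : Fin (D.T n), vn (D.err n t ω) ^ 2 + K1 * X :=
    hq.trans (by linarith)
  have hK2X : K2 * (D.N n * D.T n / D.δ n) ≤ K2 * X := mul_le_mul_of_nonneg_left hXδ hK2'
  simp only [annihilator_eq]
  nlinarith

end Panel

variable {Ω : Type*} [MeasurableSpace Ω] {J : ℕ} {r : Fin J → ℕ} {D : Panel Ω r}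
  {L : (n : ℕ) → Ω → (j : Fin J) → Matrix (Fin (D.N n)) (Fin (r j)) ℝ} {s2 : ℕ → Ω → ℝ}
  {p : ℕ → ℕ → Ω → Fin J → ℝ}
  {P : Measure Ω} {α β : ℝ} {q : Fin J → ℝ} {θ : MarkovParam J}
  {SigF SigL : (j : Fin J) → Matrix (Fin (r j)) (Fin (r j)) ℝ} {l : Filter (ℕ × Ω)}
  {Φ Γ : (j : Fin J) → ℕ → Matrix (Fin (r j)) (Fin (r j)) ℝ}

theorem exists_bound_forall {ι α : Type*} [Fintype ι] {l : Filter α} {X : ι → α → ℝ} {a : α → ℝ}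
    (ha : ∀ᶠ p in l, 0 ≤ a p) (h : ∀ j, ∃ C, 0 ≤ C ∧ ∀ᶠ p in l, X j p ≤ C * a p) :
    ∃ C, 0 ≤ C ∧ ∀ᶠ p in l, ∀ j, X j p ≤ C * a p := by
  choose C hC h using h
  refine ⟨∑ j, C j, Finset.sum_nonneg fun j _ => hC j, ?_⟩
  filter_upwards [eventually_all.2 h, ha] with p hp hap j
  exact (hp j).trans (mul_le_mul_of_nonneg_right
    (Finset.single_le_sum (fun j _ => hC j) (Finset.mem_univ j)) hap)

theorem fn_sq_eq_trace {m n : Type*} [Fintype m] [Fintype n] (A : Matrix m n ℝ) :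
    fn A ^ 2 = (Aᵀ * A).trace := by
  rw [fn_sq, Finset.sum_comm]
  simp [Matrix.trace, Matrix.mul_apply, sq]

theorem inner_eq_dotProduct {k : ℕ} (v w : EuclideanSpace ℝ (Fin k)) :
    inner ℝ v w = v.ofLp ⬝ᵥ w.ofLp := by
  simp [PiLp.inner_apply, dotProduct, mul_comm]

namespace Panel

/-- The consequences of the moment and frequency assumptions along a filter of events. -/
structure Basic (D : Panel Ω r) (s2 : ℕ → Ω → ℝ) (P : Measure Ω) (q : Fin J → ℝ)
    (SigF : (j : Fin J) → Matrix (Fin (r j)) (Fin (r j)) ℝ) (l : Filter (ℕ × Ω)) : Prop where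
  le : l ≤ whp P
  s2_bdd : ∃ c C, 0 < c ∧ ∀ᶠ p : ℕ × Ω in l, c ≤ s2 p.1 p.2 ∧ s2 p.1 p.2 ≤ C
  gramF : ∀ j, Tendsto (fun p : ℕ × Ω => (1 / (D.T p.1 : ℝ)) •
    ((D.FM p.1 j p.2)ᵀ * D.FM p.1 j p.2)) l (𝓝 (q j • SigF j))
  freq : ∀ j, Tendsto (fun p : ℕ × Ω => (1 / (D.T p.1 : ℝ)) *
    ∑ t ∈ Finset.range (D.T p.1), D.ind p.1 j t p.2) l (𝓝 (q j))
  sub : ∀ j, ∃ ρ, 0 < ρ ∧ ∀ᶠ p : ℕ × Ω in l, ∀ A : Finset ℕ,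
    (∀ t ∈ A, t < D.T p.1 ∧ D.state p.1 t p.2 = j) → 1 / (2 * J) * (D.T p.1 * q j) ≤ A.card →
    ∀ v, ρ * A.card * vn v ^ 2 ≤ ∑ t ∈ A, (v ⬝ᵥ (D.factor p.1 j t p.2).ofLp) ^ 2
  EE : ∃ C, 0 ≤ C ∧ ∀ᶠ p : ℕ × Ω in l, ∀ j, fn (D.EM p.1 j p.2 * (D.EM p.1 j p.2)ᵀ) ≤
    C * (D.N p.1 * D.T p.1 / D.δ p.1)
  err : ∃ C, 0 ≤ C ∧ ∀ᶠ p : ℕ × Ω in l,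
    ∑ t ∈ Finset.range (D.T p.1), vn (D.err p.1 t p.2) ^ 2 ≤ C * (D.N p.1 * D.T p.1)

theorem often_subsamples [IsProbabilityMeasure P] (hF : D.FactorAssumption P q α SigF) {c : ℝ}
    (hc : 0 < c) (j : Fin J) :
    Often P fun l => ∃ ρ, 0 < ρ ∧ ∀ᶠ p : ℕ × Ω in l, ∀ A : Finset ℕ,
      (∀ t ∈ A, t < D.T p.1 ∧ D.state p.1 t p.2 = j) → c * (D.T p.1 * q j) ≤ A.card →
      ∀ v, ρ * A.card * vn v ^ 2 ≤ ∑ t ∈ A, (v ⬝ᵥ (D.factor p.1 j t p.2).ofLp) ^ 2 := by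
  intro ε hε
  obtain ⟨ρ, hρ, h⟩ := hF.subsamples j c hc ε hε
  refine ⟨{p | ¬ ∃ A : Finset ℕ, (∀ t ∈ A, t < D.T p.1 ∧ D.state p.1 t p.2 = j) ∧
        c * (D.T p.1 * q j) ≤ A.card ∧
        ∃ v : EuclideanSpace ℝ (Fin (r j)), ‖v‖ = 1 ∧
          (1 / (A.card : ℝ)) * ∑ t ∈ A, inner ℝ v (D.factor p.1 j t p.2) ^ 2 < ρ}, ?_,
    fun l hl => ⟨ρ, hρ, ?_⟩⟩
  · simpa using h
  · filter_upwards [hl (mem_inf_of_right (mem_principal_self _))] with p hp A hA hc v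
    push Not at hp
    rcases eq_or_ne v 0 with rfl | hv
    · simp [vn_zero]
    rcases A.eq_empty_or_nonempty with rfl | hne
    · simp
    have hcard : (0 : ℝ) < A.card := by exact_mod_cast hne.card_pos
    set w : EuclideanSpace ℝ (Fin (r j)) := WithLp.toLp 2 v with hw
    have hw0 : w ≠ 0 := by
      intro h; apply hv; have := congrArg WithLp.ofLp h; simpa [hw] using this
    have hwn : 0 < ‖w‖ := norm_pos_iff.2 hw0
    have h1 := hp A hA hc (‖w‖⁻¹ • w) (by rw [norm_smul, norm_inv, norm_norm, inv_mul_cancel₀ hwn.ne'])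
    have h2 : ∀ t, inner ℝ (‖w‖⁻¹ • w) (D.factor p.1 j t p.2) ^ 2 =
        (‖w‖ ^ 2)⁻¹ * (v ⬝ᵥ (D.factor p.1 j t p.2).ofLp) ^ 2 := fun t => by
      rw [real_inner_smul_left, inner_eq_dotProduct, mul_pow, inv_pow]
    simp only [h2, ← Finset.mul_sum] at h1
    rw [vn_eq_norm]
    change ρ * A.card * ‖w‖ ^ 2 ≤ _
    have h3 : 1 / (A.card : ℝ) * ((‖w‖ ^ 2)⁻¹ *
        ∑ t ∈ A, (v ⬝ᵥ (D.factor p.1 j t p.2).ofLp) ^ 2) =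
        (∑ t ∈ A, (v ⬝ᵥ (D.factor p.1 j t p.2).ofLp) ^ 2) / (A.card * ‖w‖ ^ 2) := by
      field_simp
    rw [h3, le_div_iff₀ (by positivity)] at h1
    linarith

theorem often_basic [IsProbabilityMeasure P] (hJ : 0 < J) (hα : 2 ≤ α) (hs2 : BoundedAwayInProb P s2)
    (hF : D.FactorAssumption P q α SigF) (he : D.ErrorAssumption P α)
    (hz : D.StateAssumption P q) : Often P fun l => D.Basic s2 P q SigF l := by
  have hJ' : (0 : ℝ) < J := by exact_mod_cast hJ
  refine ((((Often.of_boundedAway hs2).and (Often.forall_fin fun j =>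
    often_subsamples (c := 1 / (2 * J)) hF (by positivity) j)).and
    (Often.forall_fin fun j => often_EE he j)).and (often_errors hα he)).mono ?_
  rintro l hl ⟨⟨⟨h1, h2⟩, h3⟩, h4⟩
  have hδ := eventually_fst hl D.eventually_δ_pos
  refine ⟨hl, h1, fun j => ?_, fun j => ?_, h2, exists_bound_forall ?_ fun j => ?_, h4⟩
  · refine tendsto_pi_nhds.2 fun a => tendsto_pi_nhds.2 fun b => ?_
    have h := (tendstoInMeasure_iff_whp.1 (hF.secondMoment j a b)).mono_left hl
    refine (h.const_mul (q j)).congr fun p => ?_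
    rw [Matrix.smul_apply, FM_transpose_mul_apply, smul_eq_mul]
    have := (hz.pos j).ne'
    rw [← mul_assoc]
    congr 1
    rw [mul_one_div, mul_comm, div_mul_eq_div_div, div_self this]
  · exact (tendstoInMeasure_iff_whp.1 (hz.frequency j)).mono_left hl
  · exact hδ.mono fun p hp => by positivity
  · obtain ⟨C, hC, h⟩ := h3 j
    refine ⟨√C, Real.sqrt_nonneg _, ?_⟩
    filter_upwards [h, hδ] with p hp hδ
    refine (sq_le_sq₀ (fn_nonneg _) (by positivity)).1 ?_
    rwa [mul_pow, Real.sq_sqrt hC]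

theorem tendsto_gramL (hΛ : D.LoadingAssumption SigL) (j : Fin J) :
    Tendsto (fun n => (1 / (D.N n : ℝ)) • ((D.L0 n j)ᵀ * D.L0 n j)) atTop (𝓝 (SigL j)) :=
  tendsto_pi_nhds.2 fun a => tendsto_pi_nhds.2 fun b => hΛ.gram j a b

theorem exists_fn_L0_le (hΛ : D.LoadingAssumption SigL) :
    ∃ C, 0 ≤ C ∧ ∀ n j, fn (D.L0 n j) ^ 2 ≤ C * D.N n := by
  obtain ⟨M, hM⟩ := hΛ.bounded
  refine ⟨M ^ 2, sq_nonneg M, fun n j => ?_⟩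
  rw [fn_sq_eq_sum_row]
  calc _ ≤ ∑ i : Fin (D.N n), M ^ 2 := by
        refine Finset.sum_le_sum fun i _ => ?_
        have : vn (D.L0 n j i) = ‖D.loading n j i‖ := vn_eq_norm _
        rw [this]
        exact pow_le_pow_left₀ (norm_nonneg _) (hM n j i i.2) 2
    _ = _ := by simp [mul_comm]

theorem eventually_isUnit_det_L0 (hΛ : D.LoadingAssumption SigL) :
    ∀ᶠ n in atTop, ∀ j, IsUnit ((D.L0 n j)ᵀ * D.L0 n j).det := by
  refine eventually_all.2 fun j => ?_
  have h1 : Tendsto (fun n => ((1 / (D.N n : ℝ)) • ((D.L0 n j)ᵀ * D.L0 n j)).det) atTop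
      (𝓝 (SigL j).det) := (continuous_id.matrix_det.tendsto _).comp (tendsto_gramL hΛ j)
  filter_upwards [h1.eventually_ne (hΛ.posDef j).det_pos.ne'] with n hn
  rw [Matrix.det_smul] at hn
  exact (right_ne_zero_of_mul hn).isUnit

theorem sum_fnorm_sq (n : ℕ) (ω : Ω) :
    ∑ t : Fin (D.T n), D.fnorm n t ω ^ 2 = ∑ j, ((D.FM n j ω)ᵀ * D.FM n j ω).trace := by
  have h : ∀ j, ((D.FM n j ω)ᵀ * D.FM n j ω).trace =
      ∑ t : Fin (D.T n), D.ind n j t ω * ‖D.factor n j t ω‖ ^ 2 := fun j => by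
    rw [← fn_sq_eq_trace, fn_sq_eq_sum_row]
    refine Finset.sum_congr rfl fun t _ => ?_
    have : D.FM n j ω t = D.ind n j t ω • (D.factor n j t ω).ofLp := by
      funext a; simp [FM, mul_comm]
    rw [this, vn_smul, vn_eq_norm, mul_pow, sq_abs, sq (D.ind n j t ω), ind_mul_self]
  simp only [h]
  rw [Finset.sum_comm]
  refine Finset.sum_congr rfl fun t _ => ?_
  simp [ind, fnorm]

theorem count_eq_card [Nonempty (Fin J)] (n : ℕ) (ω : Ω) (j k : Fin J) :
    D.count L s2 n ω j k = (((Finset.range (D.T n)).filter fun t =>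
      D.state n t ω = j ∧ D.best L s2 n t ω = k).card : ℝ) := by
  rw [count, Finset.card_filter]
  push_cast
  refine Finset.sum_congr rfl fun t _ => ?_
  by_cases h1 : D.state n t ω = j <;> by_cases h2 : D.best L s2 n t ω = k <;> simp [ind, h1, h2]

theorem sum_ind_le_count [Nonempty (Fin J)] (n : ℕ) (ω : Ω) (j : Fin J) :
    ∑ t ∈ Finset.range (D.T n), D.ind n j t ω ≤ J * D.count L s2 n ω j (D.slot L s2 n ω j) := by
  have e1 : ∑ t ∈ Finset.range (D.T n), D.ind n j t ω = ∑ k', D.count L s2 n ω j k' := by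
    unfold count
    rw [Finset.sum_comm]
    refine Finset.sum_congr rfl fun t _ => ?_
    rw [← Finset.mul_sum]; simp
  rw [e1]
  refine (Finset.sum_le_sum fun k' _ =>
    le_argmax (fun k => D.count L s2 n ω j k) k').trans (le_of_eq ?_)
  rw [Finset.sum_const, Finset.card_univ, Fintype.card_fin, nsmul_eq_mul]
  rfl

namespace Basic

variable {l : Filter (ℕ × Ω)}

theorem eventually_δ (h : D.Basic s2 P q SigF l) : ∀ᶠ p : ℕ × Ω in l, 1 ≤ D.δ p.1 := by
  refine eventually_fst (S := fun n => 1 ≤ D.δ n) h.le ?_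
  filter_upwards [D.tendsto_N.eventually_ge_atTop 1, D.tendsto_T.eventually_ge_atTop 1] with n h1 h2
  exact le_min (Real.one_le_sqrt.2 (by exact_mod_cast h1)) (Real.one_le_sqrt.2 (by exact_mod_cast h2))

theorem eventually_N_pos (h : D.Basic s2 P q SigF l) : ∀ᶠ p : ℕ × Ω in l, 0 < (D.N p.1 : ℝ) :=
  eventually_fst h.le D.eventually_N_pos

theorem eventually_T_pos (h : D.Basic s2 P q SigF l) : ∀ᶠ p : ℕ × Ω in l, 0 < (D.T p.1 : ℝ) :=
  eventually_fst h.le D.eventually_T_pos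

theorem exists_sum_fnorm_le (h : D.Basic s2 P q SigF l) :
    ∃ C, 0 ≤ C ∧ ∀ᶠ p : ℕ × Ω in l, ∑ t : Fin (D.T p.1), D.fnorm p.1 t p.2 ^ 2 ≤ C * D.T p.1 := by
  have h1 : Tendsto (fun p : ℕ × Ω => ∑ j, ((1 / (D.T p.1 : ℝ)) •
      ((D.FM p.1 j p.2)ᵀ * D.FM p.1 j p.2)).trace) l (𝓝 (∑ j, (q j • SigF j).trace)) :=
    tendsto_finsetSum _ fun j _ => (continuous_id.matrix_trace.tendsto _).comp (h.gramF j)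
  refine ⟨|∑ j, (q j • SigF j).trace| + 1, by positivity, ?_⟩
  have h2 : ∑ j, (q j • SigF j).trace < |∑ j, (q j • SigF j).trace| + 1 :=
    lt_of_le_of_lt (le_abs_self _) (by linarith)
  filter_upwards [h1.eventually_lt_const h2, h.eventually_T_pos] with p hp hT
  rw [sum_fnorm_sq]
  have e : ∑ j, ((1 / (D.T p.1 : ℝ)) • ((D.FM p.1 j p.2)ᵀ * D.FM p.1 j p.2)).trace =
      (D.T p.1 : ℝ)⁻¹ * ∑ j, ((D.FM p.1 j p.2)ᵀ * D.FM p.1 j p.2).trace := by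
    simp only [Matrix.trace_smul, smul_eq_mul, ← Finset.mul_sum, one_div]
  rw [e, inv_mul_lt_iff₀ hT] at hp
  linarith

theorem exists_slot_bound [Nonempty (Fin J)] {θ : MarkovParam J} (h : D.Basic s2 P q SigF l)
    (hq : ∀ j, 0 < q j) (hL : D.IsMLE θ L s2) (hΛ : D.LoadingAssumption SigL) :
    ∃ C, 0 ≤ C ∧ ∀ᶠ p : ℕ × Ω in l, ∀ j,
      fn (annihilator (L p.1 p.2 (D.slot L s2 p.1 p.2 j)) * D.L0 p.1 j) ^ 2 ≤
        C * (D.N p.1 / √(D.δ p.1)) := by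
  obtain ⟨c, C, hc, hs⟩ := h.s2_bdd
  obtain ⟨CF, hCF, hF⟩ := h.exists_sum_fnorm_le
  obtain ⟨CΛ, hCΛ, hΛ'⟩ := exists_fn_L0_le hΛ
  obtain ⟨CE, hCE, hE⟩ := h.EE
  obtain ⟨K, hK, hsig⟩ := exists_sum_signal_le hL (C := C) hc hCF hCΛ hCE
  have hJ : (0 : ℝ) < J := by
    have := Fin.pos_iff_nonempty.2 (inferInstance : Nonempty (Fin J)); exact_mod_cast this
  refine exists_bound_forall (h.eventually_δ.mono fun p hp => by positivity) fun j => ?_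
  obtain ⟨ρ, hρ, hsub⟩ := h.sub j
  have hqj := hq j
  refine ⟨K / (ρ * (1 / (2 * J) * q j)), by positivity, ?_⟩
  filter_upwards [hs, hF, hE, hsub, h.eventually_δ, h.eventually_T_pos, h.eventually_N_pos,
    eventually_fst h.le (eventually_isUnit_det_L0 hΛ),
    (h.freq j).eventually_const_lt (half_lt_self hqj)] with p h1 h2 h3 h4 h5 hT hN h6 h7
  have h8 := hsig p.1 p.2 h1.1 h1.2 h5 h2 (hΛ' p.1) h3
    (fun j => (trace_projMat_of_isUnit (h6 j)).le)
  set k := D.slot L s2 p.1 p.2 j with hk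
  set A : Finset ℕ := (Finset.range (D.T p.1)).filter fun t =>
    D.state p.1 t p.2 = j ∧ D.best L s2 p.1 t p.2 = k with hA
  have hcount : ∑ t ∈ Finset.range (D.T p.1), D.ind p.1 j t p.2 ≤ J * A.card := by
    rw [hA, ← D.count_eq_card]
    exact D.sum_ind_le_count p.1 p.2 j
  have hc2 : 1 / (2 * J) * (D.T p.1 * q j) ≤ A.card := by
    rw [one_div, inv_mul_eq_div, lt_div_iff₀ hT] at h7
    rw [one_div, inv_mul_le_iff₀ (by positivity)]
    linarith
  have hA1 : ∀ t ∈ A, t < D.T p.1 ∧ D.state p.1 t p.2 = j := fun t ht => by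
    rw [hA, Finset.mem_filter, Finset.mem_range] at ht
    exact ⟨ht.1, ht.2.1⟩
  set B := annihilator (L p.1 p.2 k) * D.L0 p.1 j with hB
  have h9 : ρ * A.card * fn B ^ 2 ≤ K * (D.N p.1 * D.T p.1 / √(D.δ p.1)) := by
    calc ρ * A.card * fn B ^ 2 = ∑ i, ρ * A.card * vn (B i) ^ 2 := by
          rw [fn_sq_eq_sum_row, Finset.mul_sum]
      _ ≤ ∑ i, ∑ t ∈ A, (B i ⬝ᵥ (D.factor p.1 j t p.2).ofLp) ^ 2 :=
          Finset.sum_le_sum fun i _ => h4 A hA1 hc2 (B i)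
      _ = ∑ t ∈ A, vn (annihilator (L p.1 p.2 (D.best L s2 p.1 t p.2)) *ᵥ
            D.sig p.1 t p.2) ^ 2 := by
          rw [Finset.sum_comm]
          refine Finset.sum_congr rfl fun t ht => ?_
          rw [hA, Finset.mem_filter] at ht
          obtain ⟨_, ht1, ht2⟩ := ht
          have e : D.sig p.1 t p.2 = D.L0 p.1 j *ᵥ (D.factor p.1 j t p.2).ofLp := by
            unfold sig fac; rw [ht1]
          rw [ht2, e, Matrix.mulVec_mulVec, ← hB, vn_sq]
          simp only [dotProduct, Matrix.mulVec, sq]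
      _ ≤ ∑ t ∈ Finset.range (D.T p.1), vn (annihilator (L p.1 p.2 (D.best L s2 p.1 t p.2)) *ᵥ
            D.sig p.1 t p.2) ^ 2 :=
          Finset.sum_le_sum_of_subset_of_nonneg (Finset.filter_subset _ _) fun _ _ _ => sq_nonneg _
      _ ≤ _ := by rwa [Finset.sum_range]
  have h10 : ρ * (1 / (2 * J) * (D.T p.1 * q j)) * fn B ^ 2 ≤ ρ * A.card * fn B ^ 2 := by gcongr
  have h11 := h10.trans h9
  rw [div_mul_eq_mul_div, le_div_iff₀ (by positivity)]
  have h12 : (fn B ^ 2 * (ρ * (1 / (2 * J) * q j))) * D.T p.1 ≤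
      (K * (D.N p.1 / √(D.δ p.1))) * D.T p.1 := by
    calc _ = ρ * (1 / (2 * J) * (D.T p.1 * q j)) * fn B ^ 2 := by ring
      _ ≤ _ := h11
      _ = _ := by ring
  exact le_of_mul_le_mul_right h12 hT

end Basic

end Panel

/-! ### Measurability -/

section Measurability

variable {Ω : Type*} [MeasurableSpace Ω] {m k n : ℕ}

theorem measurable_matrix_mul {A : Ω → Matrix (Fin m) (Fin k) ℝ} {B : Ω → Matrix (Fin k) (Fin n) ℝ}
    (hA : ∀ i j, Measurable fun ω => A ω i j) (hB : ∀ i j, Measurable fun ω => B ω i j) (i j) :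
    Measurable fun ω => (A ω * B ω) i j := by
  simp only [Matrix.mul_apply]
  exact Finset.measurable_sum _ fun a _ => (hA i a).mul (hB a j)

theorem measurable_mulVec {A : Ω → Matrix (Fin m) (Fin k) ℝ} {v : Ω → Fin k → ℝ}
    (hA : ∀ i j, Measurable fun ω => A ω i j) (hv : ∀ i, Measurable fun ω => v ω i) (i) :
    Measurable fun ω => (A ω *ᵥ v ω) i := by
  simp only [Matrix.mulVec, dotProduct]
  exact Finset.measurable_sum _ fun a _ => (hA i a).mul (hv a)

theorem measurable_det {A : Ω → Matrix (Fin m) (Fin m) ℝ}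
    (hA : ∀ i j, Measurable fun ω => A ω i j) : Measurable fun ω => (A ω).det := by
  simp only [Matrix.det_apply]
  exact Finset.measurable_sum _ fun σ _ =>
    (Finset.measurable_prod _ fun i _ => hA _ _).const_smul _

theorem measurable_inv_apply {A : Ω → Matrix (Fin m) (Fin m) ℝ}
    (hA : ∀ i j, Measurable fun ω => A ω i j) (i j) : Measurable fun ω => (A ω)⁻¹ i j := by
  simp only [Matrix.inv_def, Matrix.smul_apply, smul_eq_mul, Ring.inverse_eq_inv',
    Matrix.adjugate_apply]
  refine (measurable_det hA).inv.mul (measurable_det fun a b => ?_)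
  simp only [Matrix.updateRow_apply]
  split_ifs
  · exact measurable_const
  · exact hA a b

theorem measurable_sigmaMat_apply {A : Ω → Matrix (Fin m) (Fin k) ℝ} {s : Ω → ℝ}
    (hA : ∀ i j, Measurable fun ω => A ω i j) (hs : Measurable s) (i j) :
    Measurable fun ω => sigmaMat (A ω) (s ω) i j := by
  simp only [sigmaMat, Matrix.add_apply, Matrix.smul_apply, smul_eq_mul]
  exact (measurable_matrix_mul hA (fun a b => hA b a) i j).add (hs.mul_const _)

theorem measurable_density {A : Ω → Matrix (Fin m) (Fin k) ℝ} {s : Ω → ℝ} {x : Ω → Fin m → ℝ}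
    (hA : ∀ i j, Measurable fun ω => A ω i j) (hs : Measurable s)
    (hx : ∀ i, Measurable fun ω => x ω i) :
    Measurable fun ω => density (A ω) (s ω) (x ω) := by
  have h1 := measurable_sigmaMat_apply hA hs
  have h2 := measurable_mulVec (measurable_inv_apply h1) hx
  have h3 : Measurable fun ω => x ω ⬝ᵥ ((sigmaMat (A ω) (s ω))⁻¹ *ᵥ x ω) := by
    simp only [dotProduct]
    exact Finset.measurable_sum _ fun i _ => (hx i).mul (h2 i)
  exact (((measurable_det h1).pow_const _).const_mul _).mul (h3.const_mul _).exp

end Measurability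

namespace Panel

theorem measurable_x (D : Panel Ω r) (n t : ℕ) (i : Fin (D.N n)) :
    Measurable fun ω => D.x n t ω i := by
  have h : ∀ ω, D.x n t ω i = ∑ j, D.ind n j t ω * (D.L0 n j *ᵥ (D.factor n j t ω).ofLp) i +
      D.error n i t ω := fun ω => by simp [ind, x]
  simp only [h]
  refine (Finset.measurable_sum _ fun j _ => (D.measurable_ind n j t).mul ?_).add
    (D.measurable_error n i t)
  exact measurable_mulVec (A := fun _ => D.L0 n j) (v := fun ω => (D.factor n j t ω).ofLp)
    (fun _ _ => measurable_const) (D.measurable_factor_apply n j t) i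

theorem measurable_density_x (hL : D.IsMLE θ L s2) (n t : ℕ) (k : Fin J) :
    Measurable fun ω => density (L n ω k) (s2 n ω) (D.x n t ω) :=
  measurable_density (hL.measurable_loading n k) (hL.measurable_s2 n) (D.measurable_x n t)

theorem measurable_slot [Nonempty (Fin J)] (hL : D.IsMLE θ L s2) (n : ℕ) (j : Fin J) :
    Measurable fun ω => D.slot L s2 n ω j := by
  refine measurable_argmax fun k => ?_
  refine Finset.measurable_sum _ fun t _ => (D.measurable_ind n j t).mul ?_
  exact Measurable.ite (measurable_argmax (measurable_density_x hL n t)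
    (measurableSet_singleton k)) measurable_const measurable_const

theorem measurable_prob (hL : D.IsMLE θ L s2) (n t : ℕ) (j : Fin J) :
    Measurable fun ω => D.prob θ L s2 n t ω j := by
  unfold prob
  split_ifs with h
  · have hj : ∀ s : Fin (D.T n) → Fin J,
        Measurable fun ω => θ.joint (L n ω) (s2 n ω) (D.obs n ω) s := fun s =>
      (Finset.measurable_prod _ fun (t' : Fin (D.T n)) _ => measurable_density_x hL n t' (s t')).mul_const _
    refine (Finset.measurable_sum _ fun s _ => ?_).div (Finset.measurable_sum _ fun s _ => hj s)
    split_ifs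
    · exact hj s
    · exact measurable_const
  · exact measurable_const

/-! ### The relabelling -/

/-- The slots of the regimes are different and have the right numbers of factors. -/
def Matched (r : Fin J → ℕ) (κ : Fin J → Fin J) : Prop :=
  Function.Injective κ ∧ ∀ j, r (κ j) = r j

open scoped Classical in
/-- The slots as a relabelling, where they form one. -/
def slotPerm (r : Fin J → ℕ) (κ : Fin J → Fin J) : Equiv.Perm (Fin J) :=
  if h : Matched r κ then Equiv.ofBijective κ (Finite.injective_iff_bijective.1 h.1)
  else Equiv.refl _

theorem slotPerm_apply {κ : Fin J → Fin J} (h : Matched r κ) (j : Fin J) :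
    slotPerm r κ j = κ j := by simp [slotPerm, h]

/-- The relabelling of the estimated regimes. -/
def relabel [Nonempty (Fin J)] (hL : D.IsMLE θ L s2) : Relabelling Ω r where
  perm n ω := slotPerm r (D.slot L s2 n ω)
  measurable_perm n j := by
    have h1 : Measurable fun ω => D.slot L s2 n ω := measurable_pi_iff.2 fun j => measurable_slot hL n j
    have h2 : Measurable fun κ : Fin J → Fin J => slotPerm r κ j := Measurable.of_discrete
    exact h2.comp h1
  rank_eq n ω j := by
    by_cases h : Matched r (D.slot L s2 n ω)
    · rw [slotPerm_apply h]; exact h.2 j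
    · simp [slotPerm, h]

theorem tendsto_δ (D : Panel Ω r) : Tendsto D.δ atTop atTop := by
  have hN := (Real.tendsto_sqrt_atTop.comp (tendsto_natCast_atTop_atTop.comp D.tendsto_N))
  have hT := (Real.tendsto_sqrt_atTop.comp (tendsto_natCast_atTop_atTop.comp D.tendsto_T))
  exact tendsto_atTop.2 fun b =>
    (hN.eventually_ge_atTop b).mp ((hT.eventually_ge_atTop b).mono fun n h1 h2 => le_min h2 h1)

theorem eventually_projMat_L0 (hΛ : D.LoadingAssumption SigL) :
    ∃ C, 0 ≤ C ∧ ∀ᶠ n in atTop, ∀ j, ∃ B : Matrix (Fin (r j)) (Fin (D.N n)) ℝ,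
      projMat (D.L0 n j) = D.L0 n j * B ∧ fn B ^ 2 ≤ C * (1 / D.N n) := by
  have h1 : ∀ j, Tendsto (fun n => ((1 / (D.N n : ℝ)) • ((D.L0 n j)ᵀ * D.L0 n j))⁻¹.trace) atTop
      (𝓝 (SigL j)⁻¹.trace) := fun j => by
    have hd := (hΛ.posDef j).det_pos.ne'
    have hi : ContinuousAt (fun A : Matrix (Fin (r j)) (Fin (r j)) ℝ => A⁻¹.trace) (SigL j) := by
      simp only [Matrix.inv_def, Ring.inverse_eq_inv']
      exact continuous_id.matrix_trace.continuousAt.comp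
        (((continuous_id.matrix_det.continuousAt).inv₀ hd).smul
          continuous_id.matrix_adjugate.continuousAt)
    exact hi.tendsto.comp (tendsto_gramL hΛ j)
  refine ⟨∑ j, (|(SigL j)⁻¹.trace| + 1), Finset.sum_nonneg fun j _ => by positivity, ?_⟩
  filter_upwards [eventually_isUnit_det_L0 hΛ, D.eventually_N_pos, eventually_all.2 fun j =>
    (h1 j).eventually_lt_const (lt_of_le_of_lt (le_abs_self _) (lt_add_one |(SigL j)⁻¹.trace|))]
    with n hu hN ht j
  refine ⟨((D.L0 n j)ᵀ * D.L0 n j)⁻¹ * (D.L0 n j)ᵀ, ?_, ?_⟩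
  · rw [projMat_eq_of_isUnit (hu j), Matrix.mul_assoc]
  · set G := (D.L0 n j)ᵀ * D.L0 n j with hG
    have hGs : Gᵀ = G := by rw [hG]; simp
    have e1 : fn (G⁻¹ * (D.L0 n j)ᵀ) ^ 2 = G⁻¹.trace := by
      rw [← fn_transpose, fn_sq_eq_trace, Matrix.transpose_transpose, Matrix.transpose_mul,
        Matrix.transpose_transpose, Matrix.mul_assoc, ← Matrix.mul_assoc (D.L0 n j)ᵀ, ← hG,
        Matrix.transpose_nonsing_inv, hGs, Matrix.mul_nonsing_inv _ (hu j), Matrix.mul_one]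
    have e2 : ((1 / (D.N n : ℝ)) • G)⁻¹ = (D.N n : ℝ) • G⁻¹ := by
      refine Matrix.inv_eq_right_inv ?_
      rw [Matrix.smul_mul, Matrix.mul_smul, smul_smul, Matrix.mul_nonsing_inv _ (hu j),
        one_div, inv_mul_cancel₀ hN.ne', one_smul]
    have e3 := ht j
    rw [e2, Matrix.trace_smul, smul_eq_mul] at e3
    rw [e1, mul_one_div, le_div_iff₀ hN, mul_comm]
    exact e3.le.trans (Finset.single_le_sum (f := fun j => |(SigL j)⁻¹.trace| + 1)
      (fun j _ => by positivity) (Finset.mem_univ j))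

/-- The regimes are separated by the loadings of the other regimes, at dates of bounded factors. -/
def Separated (D : Panel Ω r) (l : Filter (ℕ × Ω)) : Prop :=
  ∃ C, 0 < C ∧ ∀ᶠ p : ℕ × Ω in l, ∀ j k, j ≠ k → ∀ t < D.T p.1, D.state p.1 t p.2 = j →
    C * D.N p.1 ≤ vn ((annihilator (D.L0 p.1 k) * D.L0 p.1 j) *ᵥ (D.factor p.1 j t p.2).ofLp) ^ 2

theorem separated_of_identification (h : D.IdentificationAssumption P) {l : Filter (ℕ × Ω)}
    (hl : l ≤ whp P) : D.Separated l := by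
  obtain ⟨C, hC, h⟩ := h
  refine ⟨C, hC, ?_⟩
  have h1 : ∀ᶠ p in whp P, ¬ ∃ j k : Fin J, j ≠ k ∧ ∃ t, t < D.T p.1 ∧ D.state p.1 t p.2 = j ∧
      (1 / (D.N p.1 : ℝ)) * ∑ i, ((annihilator (D.L0 p.1 k) * D.L0 p.1 j) *ᵥ
        (D.factor p.1 j t p.2).ofLp) i ^ 2 < C := by
    rw [eventually_whp]; simpa using h
  filter_upwards [hl h1, eventually_fst hl D.eventually_N_pos] with p hp hN j k hjk t ht hj
  push Not at hp
  have := hp j k hjk t ht hj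
  rw [one_div, inv_mul_eq_div, le_div_iff₀ hN] at this
  rw [vn_sq]
  simpa only [dotProduct, sq] using this

namespace Basic

variable {l : Filter (ℕ × Ω)}

theorem exists_separation (h : D.Basic s2 P q SigF l) (hq : ∀ j, 0 < q j) (hs : D.Separated l) :
    ∃ c, 0 < c ∧ ∀ᶠ p : ℕ × Ω in l, ∀ j k, j ≠ k →
      c * D.N p.1 ≤ fn (annihilator (D.L0 p.1 k) * D.L0 p.1 j) ^ 2 := by
  obtain ⟨CF, hCF, hF⟩ := h.exists_sum_fnorm_le
  obtain ⟨C, hC, hs⟩ := hs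
  obtain ⟨q0, hq0, hqq⟩ := exists_pos_le_of_finite hq
  refine ⟨C / (2 * (CF + 1) / q0), by positivity, ?_⟩
  filter_upwards [hs, hF, h.eventually_T_pos, eventually_all.2 fun j =>
    (h.freq j).eventually_const_lt (half_lt_self (hq j))] with p h1 h2 hT h3 j k hjk
  obtain ⟨t, ht, htj, htf⟩ : ∃ t < D.T p.1, D.state p.1 t p.2 = j ∧
      D.fnorm p.1 t p.2 ^ 2 ≤ 2 * (CF + 1) / q0 := by
    by_contra! hno
    have e1 : 2 * (CF + 1) / q0 * ∑ t ∈ Finset.range (D.T p.1), D.ind p.1 j t p.2 ≤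
        ∑ t ∈ Finset.range (D.T p.1), D.fnorm p.1 t p.2 ^ 2 := by
      rw [Finset.mul_sum]
      refine Finset.sum_le_sum fun t ht => ?_
      unfold ind
      split_ifs with hj
      · rw [mul_one]; exact (hno t (Finset.mem_range.1 ht) hj).le
      · rw [mul_zero]; positivity
    rw [Finset.sum_range (fun t => D.fnorm p.1 t p.2 ^ 2)] at e1
    have e2 := h3 j
    rw [one_div, inv_mul_eq_div, lt_div_iff₀ hT] at e2
    have e3 : 2 * (CF + 1) / q0 * (q0 / 2 * D.T p.1) ≤
        2 * (CF + 1) / q0 * ∑ t ∈ Finset.range (D.T p.1), D.ind p.1 j t p.2 := by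
      refine mul_le_mul_of_nonneg_left (le_trans ?_ e2.le) (by positivity)
      have := hqq j
      gcongr
    have e4 : 2 * (CF + 1) / q0 * (q0 / 2 * D.T p.1) = (CF + 1) * D.T p.1 := by field_simp
    linarith
  have h5 := h1 j k hjk t ht htj
  have h6 := pow_le_pow_left₀ (vn_nonneg _)
    (vn_mulVec_le (annihilator (D.L0 p.1 k) * D.L0 p.1 j) (D.factor p.1 j t p.2).ofLp) 2
  rw [mul_pow] at h6
  have h7 : vn (D.factor p.1 j t p.2).ofLp = D.fnorm p.1 t p.2 := by
    rw [vn_eq_norm, fnorm, htj]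
  rw [h7] at h6
  have hB : 0 < 2 * (CF + 1) / q0 := by positivity
  rw [div_mul_eq_mul_div, div_le_iff₀ hB]
  exact h5.trans (h6.trans (mul_le_mul_of_nonneg_left htf (sq_nonneg _)))

/-- The spaces of the true loadings are nearly contained in the estimated spaces. -/
theorem eventually_fn_compl_le [Nonempty (Fin J)] (h : D.Basic s2 P q SigF l)
    (hq : ∀ j, 0 < q j) (hL : D.IsMLE θ L s2) (hΛ : D.LoadingAssumption SigL) {ε : ℝ} (hε : 0 < ε) :
    ∀ᶠ p : ℕ × Ω in l, ∀ j,
      fn (annihilator (L p.1 p.2 (D.slot L s2 p.1 p.2 j)) * D.L0 p.1 j) ^ 2 ≤ ε * D.N p.1 ∧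
      fn (annihilator (L p.1 p.2 (D.slot L s2 p.1 p.2 j)) * projMat (D.L0 p.1 j)) ^ 2 ≤ ε := by
  obtain ⟨C, hC, h1⟩ := h.exists_slot_bound hq hL hΛ
  obtain ⟨C', hC', h2⟩ := eventually_projMat_L0 hΛ
  have hδ : Tendsto (fun n => 1 / √(D.δ n)) atTop (𝓝 0) := by
    exact ((Real.tendsto_sqrt_atTop.comp D.tendsto_δ).inv_tendsto_atTop).congr fun n => by simp
  set η := ε / (C + C * C' + 1) with hη
  have hη0 : 0 < η := by positivity
  filter_upwards [h1, eventually_fst h.le h2, h.eventually_N_pos,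
    eventually_fst h.le (hδ.eventually_lt_const hη0)] with p h3 h4 hN h5 j
  have h6 := h3 j
  have e1 : C * (D.N p.1 / √(D.δ p.1)) ≤ C * η * D.N p.1 := by
    have : (D.N p.1 : ℝ) / √(D.δ p.1) = 1 / √(D.δ p.1) * D.N p.1 := by ring
    rw [this, mul_assoc]
    gcongr
  have e2 : C * η ≤ ε := by
    rw [hη, mul_div_assoc', div_le_iff₀ (by positivity)]
    nlinarith [mul_nonneg hC hC']
  refine ⟨(h6.trans e1).trans (by gcongr), ?_⟩
  obtain ⟨B, hB1, hB2⟩ := h4 j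
  rw [hB1, ← Matrix.mul_assoc]
  have h7 := pow_le_pow_left₀ (fn_nonneg _) (fn_mul_le
    (annihilator (L p.1 p.2 (D.slot L s2 p.1 p.2 j)) * D.L0 p.1 j) B) 2
  rw [mul_pow] at h7
  refine h7.trans ?_
  calc _ ≤ C * η * D.N p.1 * (C' * (1 / D.N p.1)) :=
        mul_le_mul (h6.trans e1) hB2 (sq_nonneg _) (by positivity)
    _ = C * C' * η := by field_simp
    _ ≤ ε := by
      rw [hη, mul_div_assoc', div_le_iff₀ (by positivity)]
      nlinarith [mul_nonneg hC hC']

theorem eventually_matched [Nonempty (Fin J)] (h : D.Basic s2 P q SigF l)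
    (hq : ∀ j, 0 < q j) (hL : D.IsMLE θ L s2) (hΛ : D.LoadingAssumption SigL) (hs : D.Separated l) :
    ∀ᶠ p : ℕ × Ω in l, Matched r (D.slot L s2 p.1 p.2) := by
  obtain ⟨c, hc, hsep⟩ := h.exists_separation hq hs
  obtain ⟨CΛ, hCΛ, hΛ'⟩ := exists_fn_L0_le hΛ
  set ε := min (1 / 2) (c / (8 * (1 + 2 * CΛ))) with hε
  have hε0 : 0 < ε := by positivity
  have hε1 : ε ≤ 1 / 2 := min_le_left _ _
  have hε2 : 8 * (1 + 2 * CΛ) * ε ≤ c := by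
    have : ε ≤ c / (8 * (1 + 2 * CΛ)) := min_le_right _ _
    rw [le_div_iff₀ (by positivity)] at this
    linarith
  filter_upwards [h.eventually_fn_compl_le hq hL hΛ hε0, hsep, h.eventually_N_pos,
    eventually_fst h.le (eventually_isUnit_det_L0 hΛ)] with p h1 h2 hN hu
  set κ := D.slot L s2 p.1 p.2 with hκ
  have htr : ∀ j, (r j : ℝ) - (projMat (L p.1 p.2 (κ j))).trace ≤ ε := fun j => by
    have e1 := (h1 j).2
    rw [annihilator_eq, (isProjMat_projMat _).fn_sq_compl_mul (isProjMat_projMat _),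
      trace_projMat_of_isUnit (hu j)] at e1
    have e2 := (isProjMat_projMat (L p.1 p.2 (κ j))).trace_mul_le_left
      (isProjMat_projMat (D.L0 p.1 j))
    linarith
  refine matching r κ (fun j => ?_) fun j j' hjj hr => ?_
  · have e2 := trace_projMat_le_of_isDiag (hL.diagonal p.1 p.2 (κ j))
    have e3 : (r j : ℝ) < r (κ j) + 1 := by linarith [htr j]
    have e4 : r j < r (κ j) + 1 := by exact_mod_cast e3
    omega
  · by_contra hne
    have e1 := (isProjMat_projMat (L p.1 p.2 (κ j))).fn_sub_sq_le
      (isProjMat_projMat (D.L0 p.1 j)) (by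
        rw [trace_projMat_of_isUnit (hu j), hr]
        exact trace_projMat_le_of_isDiag (hL.diagonal p.1 p.2 (κ j)))
    have e2 := (h1 j).2
    rw [annihilator_eq] at e2
    have e3 := (h1 j').1
    rw [← hjj] at e3
    have e4 : annihilator (D.L0 p.1 j) * D.L0 p.1 j' = annihilator (L p.1 p.2 (κ j)) * D.L0 p.1 j' +
        (projMat (L p.1 p.2 (κ j)) - projMat (D.L0 p.1 j)) * D.L0 p.1 j' := by
      simp only [annihilator_eq, Matrix.sub_mul]; abel
    have e5 := h2 j' j (Ne.symm hne)
    rw [e4] at e5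
    have e6 := pow_le_pow_left₀ (fn_nonneg _) (fn_mul_le
      (projMat (L p.1 p.2 (κ j)) - projMat (D.L0 p.1 j)) (D.L0 p.1 j')) 2
    rw [mul_pow] at e6
    have e7 : fn (projMat (L p.1 p.2 (κ j)) - projMat (D.L0 p.1 j)) ^ 2 * fn (D.L0 p.1 j') ^ 2 ≤
        2 * ε * (CΛ * D.N p.1) :=
      mul_le_mul (e1.trans (by linarith)) (hΛ' p.1 j') (sq_nonneg _) (by positivity)
    have e8 := fn_add_sq_le (annihilator (L p.1 p.2 (κ j)) * D.L0 p.1 j')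
      ((projMat (L p.1 p.2 (κ j)) - projMat (D.L0 p.1 j)) * D.L0 p.1 j')
    have e9 : c * D.N p.1 ≤ 2 * (1 + 2 * CΛ) * ε * D.N p.1 := by nlinarith
    have e10 : 0 < 6 * (1 + 2 * CΛ) * ε * D.N p.1 := by positivity
    have e11 := mul_le_mul_of_nonneg_right hε2 hN.le
    linarith

end Basic

end Panel

/-! ### First order conditions -/

theorem dotProduct_sq_le {n : Type*} [Fintype n] (v w : n → ℝ) :
    (v ⬝ᵥ w) ^ 2 ≤ vn v ^ 2 * vn w ^ 2 := by
  rw [← mul_pow, ← sq_abs]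
  exact pow_le_pow_left₀ (abs_nonneg _) (abs_dotProduct_le v w) 2

theorem sum_sq_dotProduct_col {m k T : ℕ} {A : Matrix (Fin m) (Fin k) ℝ} {s2 : ℝ}
    {x : Fin T → Fin m → ℝ} {p : Fin T → ℝ} (hA : (Aᵀ * A).IsDiag)
    (h : ∑ t, p t • (vecMulVec (x t) (x t) * A) =
      (∑ t, p t) • (A * (Aᵀ * A + s2 • (1 : Matrix (Fin k) (Fin k) ℝ)))) (l : Fin k) :
    ∑ t, p t * (x t ⬝ᵥ fun i => A i l) ^ 2 =
      (∑ t, p t) * ((Aᵀ * A) l l * ((Aᵀ * A) l l + s2)) := by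
  have h1 : (Aᵀ * ∑ t, p t • (vecMulVec (x t) (x t) * A)) l l =
      (Aᵀ * ((∑ t, p t) • (A * (Aᵀ * A + s2 • (1 : Matrix (Fin k) (Fin k) ℝ))))) l l := by rw [h]
  simp only [Matrix.mul_sum, Matrix.mul_smul, Matrix.sum_apply, Matrix.smul_apply,
    smul_eq_mul] at h1
  have h2 : ∀ t, (Aᵀ * (vecMulVec (x t) (x t) * A)) l l = (x t ⬝ᵥ fun i => A i l) ^ 2 := fun t => by
    rw [Matrix.vecMulVec_mul, Matrix.mul_vecMulVec, Matrix.vecMulVec_apply, sq]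
    congr 1
    rw [Matrix.mulVec_transpose]
    rfl
  simp only [h2] at h1
  rw [h1, ← Matrix.mul_assoc]
  congr 1
  generalize hG : Aᵀ * A = G at hA
  rw [← hA.diagonal_diag]
  simp

namespace Panel

theorem IsMLE.foc (hL : D.IsMLE θ L s2) (n : ℕ) (ω : Ω) (k : Fin J) :
    ∑ t : Fin (D.T n), D.prob θ L s2 n t ω k • (vecMulVec (D.x n t ω) (D.x n t ω) * L n ω k) =
      (∑ t : Fin (D.T n), D.prob θ L s2 n t ω k) • (L n ω k * ((L n ω k)ᵀ * L n ω k +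
        s2 n ω • (1 : Matrix (Fin (r k)) (Fin (r k)) ℝ))) := by
  have hs := hL.s2_pos n ω
  have hp : ∀ t : Fin (D.T n), D.prob θ L s2 n t ω k =
      θ.smoothed (L n ω) (s2 n ω) (D.obs n ω) t k := fun t => by simp [prob]
  simp only [hp]
  refine weighted_foc (L n ω k) hs (D.obs n ω) _ (fun t => θ.smoothed_nonneg _ hs _ t k) fun A => ?_
  have h1 := θ.sum_smoothed_log_le (L n ω) hs (D.obs n ω) (Function.update (L n ω) k A)
  have h2 := hL.isMax n ω (Function.update (L n ω) k A)
  refine le_trans (le_of_eq (Finset.sum_congr rfl fun t _ => ?_)) (h1.trans (by linarith))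
  rw [Finset.sum_eq_single k]
  · simp
  · intro k' _ hk'
    rw [Function.update_of_ne hk', sub_self, mul_zero]
  · simp

theorem prob_nonneg (hL : D.IsMLE θ L s2) (n t : ℕ) (ω : Ω) (k : Fin J) :
    0 ≤ D.prob θ L s2 n t ω k := by
  unfold prob
  split_ifs
  · exact θ.smoothed_nonneg _ (hL.s2_pos n ω) _ _ _
  · exact le_rfl

theorem prob_le_one (hL : D.IsMLE θ L s2) (n t : ℕ) (ω : Ω) (k : Fin J) :
    D.prob θ L s2 n t ω k ≤ 1 := by
  unfold prob
  split_ifs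
  · exact θ.smoothed_le_one _ (hL.s2_pos n ω) _ _ _
  · exact zero_le_one

/-- The dates of a regime at which the matched estimated regime has the largest density. -/
def slotDates [Nonempty (Fin J)] (D : Panel Ω r)
    (L : (n : ℕ) → Ω → (j : Fin J) → Matrix (Fin (D.N n)) (Fin (r j)) ℝ) (s2 : ℕ → Ω → ℝ)
    (n : ℕ) (ω : Ω) (j : Fin J) : Finset ℕ :=
  (Finset.range (D.T n)).filter fun t =>
    D.state n t ω = j ∧ D.best L s2 n t ω = D.slot L s2 n ω j

theorem le_prob_of_mem_slotDates [Nonempty (Fin J)] (hL : D.IsMLE θ L s2) {n t : ℕ} {ω : Ω}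
    {j : Fin J} (ht : t ∈ D.slotDates L s2 n ω j) :
    (J * (θ.lower⁻¹) ^ 2)⁻¹ ≤ D.prob θ L s2 n t ω (D.slot L s2 n ω j) := by
  rw [slotDates, Finset.mem_filter, Finset.mem_range] at ht
  obtain ⟨h1, -, h2⟩ := ht
  rw [prob, dif_pos h1]
  refine θ.smoothed_ge_of_max _ (hL.s2_pos n ω) _ _ _ fun k => ?_
  rw [← h2]
  exact le_argmax (fun k => density (L n ω k) (s2 n ω) (D.x n t ω)) k

theorem sum_sq_dotProduct_err (n : ℕ) (ω : Ω) (u : Fin (D.N n) → ℝ) :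
    ∑ t : Fin (D.T n), (D.err n t ω ⬝ᵥ u) ^ 2 = ∑ j, vn ((D.EM n j ω)ᵀ *ᵥ u) ^ 2 := by
  simp only [vn_sq, dotProduct]
  rw [Finset.sum_comm]
  refine Finset.sum_congr rfl fun t _ => ?_
  have : ∀ j, ((D.EM n j ω)ᵀ *ᵥ u) t = D.ind n j t ω * (∑ i, D.err n t ω i * u i) := fun j => by
    simp only [Matrix.mulVec, dotProduct, EM, Matrix.transpose_apply, Matrix.of_apply, err,
      Finset.mul_sum]
    exact Finset.sum_congr rfl fun i _ => by ring
  simp only [this]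
  simp only [mul_mul_mul_comm, ind_mul_self, ← Finset.sum_mul, sum_ind, one_mul, sq]

namespace Basic

variable {l : Filter (ℕ × Ω)}

theorem eventually_card_slotDates [Nonempty (Fin J)] (h : D.Basic s2 P q SigF l)
    (hq : ∀ j, 0 < q j) (L : (n : ℕ) → Ω → (j : Fin J) → Matrix (Fin (D.N n)) (Fin (r j)) ℝ) :
    ∀ᶠ p : ℕ × Ω in l, ∀ j,
      1 / (2 * J) * (D.T p.1 * q j) ≤ (D.slotDates L s2 p.1 p.2 j).card := by
  have hJ : (0 : ℝ) < J := by
    have := Fin.pos_iff_nonempty.2 (inferInstance : Nonempty (Fin J)); exact_mod_cast this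
  filter_upwards [h.eventually_T_pos, eventually_all.2 fun j =>
    (h.freq j).eventually_const_lt (half_lt_self (hq j))] with p hT h7 j
  have h8 := h7 j
  have h9 := D.sum_ind_le_count (L := L) (s2 := s2) p.1 p.2 j
  rw [count_eq_card] at h9
  rw [one_div, inv_mul_eq_div, lt_div_iff₀ hT] at h8
  rw [one_div, inv_mul_le_iff₀ (by positivity)]
  change _ ≤ 2 * (J : ℝ) * _
  have h10 : ∑ t ∈ Finset.range (D.T p.1), D.ind p.1 j t p.2 ≤
      J * ((D.slotDates L s2 p.1 p.2 j).card : ℝ) := h9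
  linarith

theorem exists_sum_x_le (h : D.Basic s2 P q SigF l) (hΛ : D.LoadingAssumption SigL) :
    ∃ C, 0 ≤ C ∧ ∀ᶠ p : ℕ × Ω in l,
      ∑ t : Fin (D.T p.1), vn (D.x p.1 t p.2) ^ 2 ≤ C * (D.N p.1 * D.T p.1) := by
  obtain ⟨CF, hCF, hF⟩ := h.exists_sum_fnorm_le
  obtain ⟨CΛ, hCΛ, hΛ'⟩ := exists_fn_L0_le hΛ
  obtain ⟨CE, hCE, hE⟩ := h.err
  refine ⟨2 * (CΛ * CF) + 2 * CE, by positivity, ?_⟩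
  filter_upwards [hF, hE] with p h1 h2
  rw [Finset.sum_range] at h2
  have h3 : ∀ t : Fin (D.T p.1), vn (D.x p.1 t p.2) ^ 2 ≤
      2 * (CΛ * D.N p.1) * D.fnorm p.1 t p.2 ^ 2 + 2 * vn (D.err p.1 t p.2) ^ 2 := fun t => by
    rw [x_eq]
    have e1 := vn_add_sq_le (D.sig p.1 t p.2) (D.err p.1 t p.2)
    have e2 := pow_le_pow_left₀ (vn_nonneg _) (D.vn_sig_le p.1 t p.2) 2
    rw [mul_pow] at e2
    have e3 := mul_le_mul_of_nonneg_right (hΛ' p.1 (D.state p.1 t p.2))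
      (sq_nonneg (D.fnorm p.1 t p.2))
    linarith
  refine (Finset.sum_le_sum fun t _ => h3 t).trans ?_
  rw [Finset.sum_add_distrib, ← Finset.mul_sum, ← Finset.mul_sum]
  have e4 := mul_le_mul_of_nonneg_left h1 (show 0 ≤ 2 * (CΛ * D.N p.1) by positivity)
  calc _ ≤ 2 * (CΛ * D.N p.1) * (CF * D.T p.1) + 2 * (CE * (D.N p.1 * D.T p.1)) := by linarith
    _ = _ := by ring

end Basic

/-- The estimator along a filter of events along which the regimes are identified. -/
structure Estim [Nonempty (Fin J)] (D : Panel Ω r)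
    (L : (n : ℕ) → Ω → (j : Fin J) → Matrix (Fin (D.N n)) (Fin (r j)) ℝ) (s2 : ℕ → Ω → ℝ)
    (P : Measure Ω) (q : Fin J → ℝ) (SigF : (j : Fin J) → Matrix (Fin (r j)) (Fin (r j)) ℝ)
    (l : Filter (ℕ × Ω)) : Prop extends D.Basic s2 P q SigF l where
  sep : D.Separated l
  matched : ∀ᶠ p : ℕ × Ω in l, Matched r (D.slot L s2 p.1 p.2)
  close : ∃ C, 0 ≤ C ∧ ∀ᶠ p : ℕ × Ω in l, ∀ j,
    fn (projMat (L p.1 p.2 (D.slot L s2 p.1 p.2 j)) - projMat (D.L0 p.1 j)) ^ 2 ≤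
      C * (1 / √(D.δ p.1))
  diag : ∃ c C, 0 < c ∧ ∀ᶠ p : ℕ × Ω in l, ∀ j i,
    c * D.N p.1 ≤ ((L p.1 p.2 (D.slot L s2 p.1 p.2 j))ᵀ * L p.1 p.2 (D.slot L s2 p.1 p.2 j)) i i ∧
    ((L p.1 p.2 (D.slot L s2 p.1 p.2 j))ᵀ * L p.1 p.2 (D.slot L s2 p.1 p.2 j)) i i ≤ C * D.N p.1

namespace Basic

variable {l : Filter (ℕ × Ω)}

theorem exists_close [Nonempty (Fin J)] (h : D.Basic s2 P q SigF l)
    (hq : ∀ j, 0 < q j) (hL : D.IsMLE θ L s2) (hΛ : D.LoadingAssumption SigL)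
    (hm : ∀ᶠ p : ℕ × Ω in l, Matched r (D.slot L s2 p.1 p.2)) :
    ∃ C, 0 ≤ C ∧ ∀ᶠ p : ℕ × Ω in l, ∀ j,
      fn (projMat (L p.1 p.2 (D.slot L s2 p.1 p.2 j)) - projMat (D.L0 p.1 j)) ^ 2 ≤
        C * (1 / √(D.δ p.1)) := by
  obtain ⟨C, hC, h1⟩ := h.exists_slot_bound hq hL hΛ
  obtain ⟨C', hC', h2⟩ := eventually_projMat_L0 hΛ
  refine ⟨2 * (C * C'), by positivity, ?_⟩
  filter_upwards [h1, eventually_fst h.le h2, h.eventually_N_pos,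
    eventually_fst h.le (eventually_isUnit_det_L0 hΛ), hm] with p h3 h4 hN hu hm j
  obtain ⟨B, hB1, hB2⟩ := h4 j
  have e1 := (isProjMat_projMat (L p.1 p.2 (D.slot L s2 p.1 p.2 j))).fn_sub_sq_le
    (isProjMat_projMat (D.L0 p.1 j)) (by
      rw [trace_projMat_of_isUnit (hu j), ← hm.2 j]
      exact trace_projMat_le_of_isDiag (hL.diagonal p.1 p.2 _))
  refine e1.trans ?_
  rw [hB1, ← Matrix.mul_assoc, ← annihilator_eq]
  have h7 := pow_le_pow_left₀ (fn_nonneg _) (fn_mul_le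
    (annihilator (L p.1 p.2 (D.slot L s2 p.1 p.2 j)) * D.L0 p.1 j) B) 2
  rw [mul_pow] at h7
  calc _ ≤ 2 * (C * (D.N p.1 / √(D.δ p.1)) * (C' * (1 / D.N p.1))) :=
        mul_le_mul_of_nonneg_left (h7.trans (mul_le_mul (h3 j) hB2 (sq_nonneg _) (by positivity)))
          zero_le_two
    _ = _ := by field_simp

theorem diag_upper [Nonempty (Fin J)] (h : D.Basic s2 P q SigF l)
    (hq : ∀ j, 0 < q j) (hL : D.IsMLE θ L s2) (hΛ : D.LoadingAssumption SigL) :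
    ∃ C, 0 ≤ C ∧ ∀ᶠ p : ℕ × Ω in l, ∀ j i,
      ((L p.1 p.2 (D.slot L s2 p.1 p.2 j))ᵀ * L p.1 p.2 (D.slot L s2 p.1 p.2 j)) i i ≤
        C * D.N p.1 := by
  obtain ⟨CX, hCX, hX⟩ := h.exists_sum_x_le hΛ
  have hJ : (0 : ℝ) < J := by
    have := Fin.pos_iff_nonempty.2 (inferInstance : Nonempty (Fin J)); exact_mod_cast this
  obtain ⟨q0, hq0, hqq⟩ := exists_pos_le_of_finite hq
  have hl := θ.lower_pos
  set c0 := (J * (θ.lower⁻¹) ^ 2)⁻¹ with hc0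
  have hc0' : 0 < c0 := by positivity
  refine ⟨CX / (c0 * (1 / (2 * J) * q0)), by positivity, ?_⟩
  filter_upwards [hX, h.eventually_T_pos, h.eventually_card_slotDates hq L] with p h1 hT h2 j
  generalize hk : D.slot L s2 p.1 p.2 j = k
  intro i
  set G := (L p.1 p.2 k)ᵀ * L p.1 p.2 k with hG
  have hs := hL.s2_pos p.1 p.2
  have e1 := sum_sq_dotProduct_col (hL.diagonal p.1 p.2 k) (hL.foc p.1 p.2 k) i
  have hd : G i i = vn (fun a => L p.1 p.2 k a i) ^ 2 := by
    rw [vn_sq, hG, Matrix.mul_apply]; rfl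
  have hd0 : 0 ≤ G i i := by rw [hd]; positivity
  set Pp := ∑ t : Fin (D.T p.1), D.prob θ L s2 p.1 t p.2 k with hPp
  have e2 : c0 * (1 / (2 * J) * q0) * D.T p.1 ≤ Pp := by
    rw [hPp, ← Finset.sum_range (fun t => D.prob θ L s2 p.1 t p.2 k)]
    calc c0 * (1 / (2 * J) * q0) * D.T p.1 = c0 * (1 / (2 * J) * (D.T p.1 * q0)) := by ring
      _ ≤ c0 * (1 / (2 * J) * (D.T p.1 * q j)) := by
          have := hqq j
          gcongr
      _ ≤ c0 * (D.slotDates L s2 p.1 p.2 j).card := mul_le_mul_of_nonneg_left (h2 j) hc0'.le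
      _ = ∑ t ∈ D.slotDates L s2 p.1 p.2 j, c0 := by simp [mul_comm]
      _ ≤ ∑ t ∈ D.slotDates L s2 p.1 p.2 j, D.prob θ L s2 p.1 t p.2 k :=
          Finset.sum_le_sum fun t ht => hk ▸ le_prob_of_mem_slotDates hL ht
      _ ≤ _ := Finset.sum_le_sum_of_subset_of_nonneg (Finset.filter_subset _ _)
          fun t _ _ => prob_nonneg hL p.1 t p.2 k
  have e3 : Pp * (G i i * (G i i + s2 p.1 p.2)) ≤ CX * (D.N p.1 * D.T p.1) * G i i := by
    rw [← e1]
    calc _ ≤ ∑ t : Fin (D.T p.1), vn (D.x p.1 t p.2) ^ 2 * G i i := by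
          refine Finset.sum_le_sum fun t _ => ?_
          rw [hd]
          have := dotProduct_sq_le (D.x p.1 t p.2) (fun a => L p.1 p.2 k a i)
          have h3 := prob_le_one hL p.1 t p.2 k
          have h4 := prob_nonneg hL p.1 t p.2 k
          calc _ ≤ 1 * (D.x p.1 t p.2 ⬝ᵥ fun a => L p.1 p.2 k a i) ^ 2 := by gcongr
            _ ≤ _ := by rwa [one_mul]
      _ = (∑ t : Fin (D.T p.1), vn (D.x p.1 t p.2) ^ 2) * G i i := by rw [Finset.sum_mul]
      _ ≤ _ := mul_le_mul_of_nonneg_right h1 hd0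
  rcases hd0.eq_or_lt with h0 | h0
  · rw [← h0]; positivity
  · rw [div_mul_eq_mul_div, le_div_iff₀ (by positivity)]
    have e4 : Pp * (G i i + s2 p.1 p.2) ≤ CX * (D.N p.1 * D.T p.1) := by
      refine le_of_mul_le_mul_right ?_ h0
      calc _ = Pp * (G i i * (G i i + s2 p.1 p.2)) := by ring
        _ ≤ _ := e3
    have e5 : c0 * (1 / (2 * J) * q0) * D.T p.1 * G i i ≤ Pp * (G i i + s2 p.1 p.2) := by
      refine mul_le_mul e2 (by linarith) hd0 (le_trans (by positivity) e2)
    refine le_of_mul_le_mul_right ?_ hT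
    calc _ = c0 * (1 / (2 * J) * q0) * D.T p.1 * G i i := by ring
      _ ≤ _ := e5.trans e4
      _ = _ := by ring

end Basic

end Panel

theorem vn_sq_le_of_proj_close {m k : ℕ} {Q : Matrix (Fin m) (Fin m) ℝ}
    {A : Matrix (Fin m) (Fin k) ℝ} {B : Matrix (Fin k) (Fin m) ℝ} (hB : projMat A = A * B)
    (hQ : fn (Q - projMat A) ^ 2 ≤ 1 / 4) {w : Fin m → ℝ} (hw : Q *ᵥ w = w) :
    vn w ^ 2 ≤ 4 * fn B ^ 2 * vn (Aᵀ *ᵥ w) ^ 2 := by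
  have h1 : projMat A *ᵥ w = Bᵀ *ᵥ (Aᵀ *ᵥ w) := by
    rw [← (isProjMat_projMat A).symm, hB, Matrix.transpose_mul, Matrix.mulVec_mulVec]
  have h2 : w = (Q - projMat A) *ᵥ w + Bᵀ *ᵥ (Aᵀ *ᵥ w) := by
    rw [← h1, Matrix.sub_mulVec, hw, sub_add_cancel]
  have h3 := vn_add_le ((Q - projMat A) *ᵥ w) (Bᵀ *ᵥ (Aᵀ *ᵥ w))
  rw [← h2] at h3
  have h4 := vn_mulVec_le (Q - projMat A) w
  have h5 := vn_mulVec_le Bᵀ (Aᵀ *ᵥ w)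
  rw [fn_transpose] at h5
  have h6 : fn (Q - projMat A) ≤ 1 / 2 := by
    rw [← sq_le_sq₀ (fn_nonneg _) (by norm_num)]; linarith
  have h7 := mul_le_mul_of_nonneg_right h6 (vn_nonneg w)
  have h8 : vn w ≤ 2 * (fn B * vn (Aᵀ *ᵥ w)) := by linarith
  have := pow_le_pow_left₀ (vn_nonneg w) h8 2
  linarith

namespace Panel

theorem tendsto_inv_sqrt_δ (D : Panel Ω r) : Tendsto (fun n => 1 / √(D.δ n)) atTop (𝓝 0) :=
  ((Real.tendsto_sqrt_atTop.comp D.tendsto_δ).inv_tendsto_atTop).congr fun n => by simp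

theorem tendsto_inv_δ (D : Panel Ω r) : Tendsto (fun n => 1 / D.δ n) atTop (𝓝 0) :=
  D.tendsto_δ.inv_tendsto_atTop.congr fun n => by simp

theorem tendsto_N_real (D : Panel Ω r) : Tendsto (fun n => (D.N n : ℝ)) atTop atTop :=
  tendsto_natCast_atTop_atTop.comp D.tendsto_N

theorem tendsto_T_real (D : Panel Ω r) : Tendsto (fun n => (D.T n : ℝ)) atTop atTop :=
  tendsto_natCast_atTop_atTop.comp D.tendsto_T

namespace Basic

variable {l : Filter (ℕ × Ω)}

theorem diag_lower [Nonempty (Fin J)] (h : D.Basic s2 P q SigF l)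
    (hq : ∀ j, 0 < q j) (hL : D.IsMLE θ L s2) (hΛ : D.LoadingAssumption SigL)
    (hm : ∀ᶠ p : ℕ × Ω in l, Matched r (D.slot L s2 p.1 p.2)) (j : Fin J) :
    ∃ c, 0 < c ∧ ∀ᶠ p : ℕ × Ω in l, ∀ i,
      c * D.N p.1 ≤
        ((L p.1 p.2 (D.slot L s2 p.1 p.2 j))ᵀ * L p.1 p.2 (D.slot L s2 p.1 p.2 j)) i i := by
  obtain ⟨C1, hC1, hclose⟩ := h.exists_close hq hL hΛ hm
  obtain ⟨C2, hC2, hB⟩ := eventually_projMat_L0 hΛ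
  obtain ⟨c3, C3, -, hs2⟩ := h.s2_bdd
  obtain ⟨CE, hCE, hE⟩ := h.EE
  obtain ⟨ρ, hρ, hsub⟩ := h.sub j
  have hJ : (0 : ℝ) < J := by
    have := Fin.pos_iff_nonempty.2 (inferInstance : Nonempty (Fin J)); exact_mod_cast this
  have hl := θ.lower_pos
  set c0 := (J * (θ.lower⁻¹) ^ 2)⁻¹ with hc0
  have hc0' : 0 < c0 := by positivity
  have hqj := hq j
  set K := ρ * q j / (16 * J * (C2 + 1)) with hK
  have hK0 : 0 < K := by positivity
  refine ⟨c0 * K / 4, by positivity, ?_⟩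
  have ev1 : ∀ᶠ n in atTop, C1 * (1 / √(D.δ n)) ≤ 1 / 4 := by
    have := D.tendsto_inv_sqrt_δ.const_mul C1
    rw [mul_zero] at this
    exact (this.eventually_lt_const (by norm_num : (0 : ℝ) < 1 / 4)).mono fun n hn => hn.le
  have ev2 : ∀ᶠ n in atTop, J * CE * (1 / D.δ n) ≤ K / 2 := by
    have := D.tendsto_inv_δ.const_mul (J * CE)
    rw [mul_zero] at this
    exact (this.eventually_lt_const (half_pos hK0)).mono fun n hn => hn.le
  have ev3 : ∀ᶠ n in atTop, C3 ≤ c0 * K / 4 * D.N n :=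
    (D.tendsto_N_real.const_mul_atTop (by positivity)).eventually_ge_atTop C3
  filter_upwards [hclose, eventually_fst h.le hB, hs2, hE, hsub, h.eventually_T_pos,
    h.eventually_N_pos, h.eventually_card_slotDates hq L, eventually_fst h.le ev1,
    eventually_fst h.le ev2, eventually_fst h.le ev3, eventually_fst h.le (eventually_isUnit_det_L0 hΛ),
    h.eventually_fn_compl_le hq hL hΛ (ε := 1 / 2) (by norm_num), hm]
    with p h1 h2 h3 h4 h5 hT hN h6 h7 h8 h9 hu h10 h11
  obtain ⟨B, hB1, hB2⟩ := h2 j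
  replace h1 := (h1 j).trans h7
  replace h6 := h6 j
  replace h10 := (h10 j).2
  replace h11 := h11.2 j
  generalize hk : D.slot L s2 p.1 p.2 j = k at *
  intro i
  set G := (L p.1 p.2 k)ᵀ * L p.1 p.2 k with hG
  set w : Fin (D.N p.1) → ℝ := fun a => L p.1 p.2 k a i with hw
  have hd : G i i = vn w ^ 2 := by
    rw [vn_sq, hG, Matrix.mul_apply]; rfl
  have hd0 : 0 < G i i := by
    refine diag_pos_of_trace_projMat (hL.diagonal p.1 p.2 k) ?_ i
    rw [annihilator_eq, (isProjMat_projMat _).fn_sq_compl_mul (isProjMat_projMat _),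
      trace_projMat_of_isUnit (hu j)] at h10
    have e2 := (isProjMat_projMat (L p.1 p.2 k)).trace_mul_le_left
      (isProjMat_projMat (D.L0 p.1 j))
    have e3 : (r k : ℝ) = r j := by exact_mod_cast h11
    linarith
  have hPw : projMat (L p.1 p.2 k) *ᵥ w = w := by
    funext a
    exact congrFun (congrFun (projMat_mul_self (L p.1 p.2 k)) a) i
  have hL0w := vn_sq_le_of_proj_close hB1 h1 hPw
  have e1 := sum_sq_dotProduct_col (hL.diagonal p.1 p.2 k) (hL.foc p.1 p.2 k) i
  rw [← hG, ← hw] at e1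
  set A := D.slotDates L s2 p.1 p.2 j with hA
  have hAsub : ∀ t ∈ A, t < D.T p.1 ∧ D.state p.1 t p.2 = j := fun t ht => by
    rw [hA, slotDates, Finset.mem_filter, Finset.mem_range] at ht
    exact ⟨ht.1, ht.2.1⟩
  have e2 := h5 A hAsub h6 ((D.L0 p.1 j)ᵀ *ᵥ w)
  have e3 : ∑ t ∈ A, (((D.L0 p.1 j)ᵀ *ᵥ w) ⬝ᵥ (D.factor p.1 j t p.2).ofLp) ^ 2 ≤
      ∑ t ∈ A, (2 * (D.x p.1 t p.2 ⬝ᵥ w) ^ 2 + 2 * (D.err p.1 t p.2 ⬝ᵥ w) ^ 2) := by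
    refine Finset.sum_le_sum fun t ht => ?_
    have ht2 := (hAsub t ht).2
    have : ((D.L0 p.1 j)ᵀ *ᵥ w) ⬝ᵥ (D.factor p.1 j t p.2).ofLp =
        D.x p.1 t p.2 ⬝ᵥ w - D.err p.1 t p.2 ⬝ᵥ w := by
      have hx : D.x p.1 t p.2 = D.L0 p.1 j *ᵥ (D.factor p.1 j t p.2).ofLp + D.err p.1 t p.2 := by
        rw [x_eq, sig, fac, ht2]
      rw [hx, add_dotProduct, add_sub_cancel_right, Matrix.mulVec_transpose,
        ← Matrix.dotProduct_mulVec, dotProduct_comm]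
    rw [this]
    nlinarith [sq_nonneg (D.x p.1 t p.2 ⬝ᵥ w + D.err p.1 t p.2 ⬝ᵥ w)]
  rw [Finset.sum_add_distrib, ← Finset.mul_sum, ← Finset.mul_sum] at e3
  have e4 : ∑ t ∈ A, (D.err p.1 t p.2 ⬝ᵥ w) ^ 2 ≤ J * CE * (D.N p.1 * D.T p.1 / D.δ p.1) * G i i := by
    calc _ ≤ ∑ t ∈ Finset.range (D.T p.1), (D.err p.1 t p.2 ⬝ᵥ w) ^ 2 :=
          Finset.sum_le_sum_of_subset_of_nonneg (Finset.filter_subset _ _) fun _ _ _ => sq_nonneg _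
      _ = ∑ j, vn ((D.EM p.1 j p.2)ᵀ *ᵥ w) ^ 2 := by
          rw [Finset.sum_range]; exact sum_sq_dotProduct_err p.1 p.2 w
      _ ≤ ∑ j : Fin J, CE * (D.N p.1 * D.T p.1 / D.δ p.1) * G i i := by
          refine Finset.sum_le_sum fun j' _ => ?_
          have := vn_mulVec_sq_le (D.EM p.1 j' p.2)ᵀ w
          rw [Matrix.transpose_transpose, ← hd] at this
          exact this.trans (mul_le_mul_of_nonneg_right (h4 j') hd0.le)
      _ = _ := by simp; ring
  have e5 : c0 * ∑ t ∈ A, (D.x p.1 t p.2 ⬝ᵥ w) ^ 2 ≤ D.T p.1 * (G i i * (G i i + s2 p.1 p.2)) := by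
    have hPp : ∑ t : Fin (D.T p.1), D.prob θ L s2 p.1 t p.2 k ≤ D.T p.1 := by
      refine (Finset.sum_le_sum fun (t : Fin (D.T p.1)) _ => prob_le_one hL p.1 t p.2 k).trans (le_of_eq ?_)
      simp
    have hs := hL.s2_pos p.1 p.2
    refine le_trans ?_ (mul_le_mul_of_nonneg_right hPp (by positivity))
    rw [← e1, ← Finset.sum_range (fun t => D.prob θ L s2 p.1 t p.2 k * (D.x p.1 t p.2 ⬝ᵥ w) ^ 2),
      Finset.mul_sum]
    calc _ ≤ ∑ t ∈ A, D.prob θ L s2 p.1 t p.2 k * (D.x p.1 t p.2 ⬝ᵥ w) ^ 2 :=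
          Finset.sum_le_sum fun t ht => mul_le_mul_of_nonneg_right
            (hk ▸ le_prob_of_mem_slotDates hL ht) (sq_nonneg _)
      _ ≤ _ := Finset.sum_le_sum_of_subset_of_nonneg (Finset.filter_subset _ _)
          fun t _ _ => mul_nonneg (prob_nonneg hL p.1 t p.2 k) (sq_nonneg _)
  -- combine
  have e6 : K * (D.N p.1 * D.T p.1) * G i i ≤
      ρ * A.card * vn ((D.L0 p.1 j)ᵀ *ᵥ w) ^ 2 / 2 := by
    have f1 : G i i ≤ 4 * ((C2 + 1) * (1 / D.N p.1)) * vn ((D.L0 p.1 j)ᵀ *ᵥ w) ^ 2 := by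
      rw [hd]
      refine hL0w.trans ?_
      gcongr
      exact hB2.trans (by gcongr; linarith)
    have f2 : ρ * (1 / (2 * J) * (D.T p.1 * q j)) ≤ ρ * A.card := mul_le_mul_of_nonneg_left h6 hρ.le
    calc K * (D.N p.1 * D.T p.1) * G i i
        ≤ K * (D.N p.1 * D.T p.1) *
          (4 * ((C2 + 1) * (1 / D.N p.1)) * vn ((D.L0 p.1 j)ᵀ *ᵥ w) ^ 2) := by gcongr
      _ = ρ * (1 / (2 * J) * (D.T p.1 * q j)) * vn ((D.L0 p.1 j)ᵀ *ᵥ w) ^ 2 / 2 := by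
          rw [hK]; field_simp; ring
      _ ≤ _ := by gcongr
  have e7 : J * CE * (D.N p.1 * D.T p.1 / D.δ p.1) * G i i ≤
      K / 2 * (D.N p.1 * D.T p.1) * G i i := by
    have : J * CE * (D.N p.1 * D.T p.1 / D.δ p.1) =
      J * CE * (1 / D.δ p.1) * (D.N p.1 * D.T p.1) := by ring
    rw [this]
    gcongr
  have e8 : K / 2 * (D.N p.1 * D.T p.1) * G i i ≤ ∑ t ∈ A, (D.x p.1 t p.2 ⬝ᵥ w) ^ 2 := by
    linarith
  have e9 : c0 * (K / 2 * (D.N p.1 * D.T p.1) * G i i) ≤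
      D.T p.1 * (G i i * (G i i + s2 p.1 p.2)) :=
    (mul_le_mul_of_nonneg_left e8 hc0'.le).trans e5
  have e10 : c0 * (K / 2 * D.N p.1) ≤ G i i + s2 p.1 p.2 := by
    refine le_of_mul_le_mul_right ?_ (mul_pos hT hd0)
    calc _ = c0 * (K / 2 * (D.N p.1 * D.T p.1) * G i i) := by ring
      _ ≤ _ := e9
      _ = _ := by ring
  linarith [h3.2]

theorem estim [Nonempty (Fin J)] (h : D.Basic s2 P q SigF l)
    (hq : ∀ j, 0 < q j) (hL : D.IsMLE θ L s2) (hΛ : D.LoadingAssumption SigL)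
    (hs : D.Separated l) : D.Estim L s2 P q SigF l := by
  have hm := h.eventually_matched hq hL hΛ hs
  refine ⟨h, hs, hm, h.exists_close hq hL hΛ hm, ?_⟩
  obtain ⟨C, hC, h1⟩ := h.diag_upper hq hL hΛ
  choose c hc h2 using fun j => h.diag_lower hq hL hΛ hm j
  obtain ⟨c', hc', h3⟩ := exists_pos_le_of_finite hc
  refine ⟨c', C, hc', ?_⟩
  filter_upwards [h1, eventually_all.2 h2] with p h4 h5 j i
  exact ⟨(mul_le_mul_of_nonneg_right (h3 j) (Nat.cast_nonneg _)).trans (h5 j i), h4 j i⟩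

end Basic

end Panel

/-! ### The smoothed probabilities -/

theorem vn_sq_le_of_isDiag {m k : ℕ} {A : Matrix (Fin m) (Fin k) ℝ} (hA : (Aᵀ * A).IsDiag) {d : ℝ}
    (hd : ∀ i, d ≤ (Aᵀ * A) i i) (g : Fin k → ℝ) : d * vn g ^ 2 ≤ vn (A *ᵥ g) ^ 2 := by
  have h1 : vn (A *ᵥ g) ^ 2 = ∑ i, (Aᵀ * A) i i * (g i * g i) := by
    rw [vn_sq, Matrix.dotProduct_mulVec, Matrix.vecMul_mulVec]
    generalize Aᵀ * A = G at hA
    rw [← hA.diagonal_diag]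
    simp only [dotProduct, Matrix.vecMul_diagonal, Matrix.diagonal_apply_eq]
    exact Finset.sum_congr rfl fun i _ => by ring
  rw [h1, vn_sq, dotProduct, Finset.mul_sum]
  exact Finset.sum_le_sum fun i _ => mul_le_mul_of_nonneg_right (hd i) (mul_self_nonneg _)

/-- At a date of a regime, the estimated density of the regime dominates that of another regime. -/
theorem log_density_sub_le {m kj kk : ℕ} {A : Matrix (Fin m) (Fin kj) ℝ}
    (B : Matrix (Fin m) (Fin kk) ℝ) {s2 d F G H : ℝ} (hs : 0 < s2) (hA : (Aᵀ * A).IsDiag)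
    (hd0 : 0 < d) (hd : ∀ i, d ≤ (Aᵀ * A) i i) {PA PB : Matrix (Fin m) (Fin m) ℝ}
    {g e : Fin m → ℝ} (hg : PA *ᵥ g = g) (hF : vn g ≤ F) (hGA : vn (projMat A *ᵥ e) ≤ G)
    (hGB : vn (projMat B *ᵥ e) ≤ G) (hHA : vn ((projMat A - PA) *ᵥ g) ≤ H)
    (hHB : vn ((projMat B - PB) *ᵥ g) ≤ H) :
    2 * (Real.log (density B s2 (g + e)) - Real.log (density A s2 (g + e))) ≤
      kj * Real.log (1 + fn A ^ 2 / s2) +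
      (2 * H ^ 2 + 4 * (F * G) + G ^ 2 - vn ((1 - PB) *ᵥ g) ^ 2 / 2) / s2 + vn (g + e) ^ 2 / d := by
  have hQA := isProjMat_projMat A
  have hQB := isProjMat_projMat B
  set QA := projMat A with hQAd
  set QB := projMat B with hQBd
  obtain ⟨K, hK⟩ := exists_projMat_eq A
  have l1 := log_density A hs (g + e)
  have l2 := log_density B hs (g + e)
  have l3 := log_det_sigmaMat_ge B hs
  have l4 := log_det_sigmaMat_le A hs
  have l5 := quadForm_ge B hs (g + e) (M := 1 - QB) hQB.vn_compl_le
    (by rw [Matrix.sub_mul, Matrix.one_mul, hQBd, projMat_mul_self, sub_self])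
  have l6 := quadForm_le A hs (g + e) (K *ᵥ (g + e))
  have l7 : A *ᵥ (K *ᵥ (g + e)) = QA *ᵥ (g + e) := by rw [Matrix.mulVec_mulVec, ← hK]
  have l8 : vn (K *ᵥ (g + e)) ^ 2 ≤ vn (g + e) ^ 2 / d := by
    rw [le_div_iff₀ hd0, mul_comm]
    refine (vn_sq_le_of_isDiag hA hd _).trans ?_
    rw [l7]
    exact pow_le_pow_left₀ (vn_nonneg _) (hQA.vn_le _) 2
  have l9 : g + e - A *ᵥ (K *ᵥ (g + e)) = (1 - QA) *ᵥ (g + e) := by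
    rw [l7, Matrix.sub_mulVec, Matrix.one_mulVec]
  rw [l9] at l6
  have key : vn ((1 - QA) *ᵥ (g + e)) ^ 2 - vn ((1 - QB) *ᵥ (g + e)) ^ 2 ≤
      2 * H ^ 2 + 4 * (F * G) + G ^ 2 - vn ((1 - PB) *ᵥ g) ^ 2 / 2 := by
    have exp : ∀ {Q : Matrix (Fin m) (Fin m) ℝ}, IsProjMat Q → vn ((1 - Q) *ᵥ (g + e)) ^ 2 =
        vn ((1 - Q) *ᵥ g) ^ 2 + 2 * (g ⬝ᵥ e) - 2 * (g ⬝ᵥ (Q *ᵥ e)) + vn e ^ 2 -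
          vn (Q *ᵥ e) ^ 2 := fun {Q} hQ => by
      have a1 := hQ.vn_sq_compl e
      have a2 : vn ((1 - Q) *ᵥ (g + e)) ^ 2 = vn ((1 - Q) *ᵥ g) ^ 2 +
          2 * (g ⬝ᵥ ((1 - Q) *ᵥ e)) + vn ((1 - Q) *ᵥ e) ^ 2 := by
        rw [← hQ.compl.dotProduct_mulVec, hQ.compl.vn_sq (g + e), hQ.compl.vn_sq g,
          hQ.compl.vn_sq e, Matrix.mulVec_add, add_dotProduct, dotProduct_add, dotProduct_add,
          ← hQ.compl.dotProduct_mulVec g e, dotProduct_comm e]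
        ring
      have a3 : g ⬝ᵥ ((1 - Q) *ᵥ e) = g ⬝ᵥ e - g ⬝ᵥ (Q *ᵥ e) := by
        rw [Matrix.sub_mulVec, Matrix.one_mulVec, dotProduct_sub]
      rw [a2, a1, a3]
      ring
    rw [exp hQA, exp hQB]
    have b1 : vn ((1 - QA) *ᵥ g) ≤ H := by
      have : (1 - QA) *ᵥ g = -((QA - PA) *ᵥ g) := by
        rw [Matrix.sub_mulVec, Matrix.sub_mulVec, hg, Matrix.one_mulVec, neg_sub]
      rw [this, vn_neg]; exact hHA
    have b2 : vn ((1 - PB) *ᵥ g) ≤ vn ((1 - QB) *ᵥ g) + H := by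
      have : (1 - PB) *ᵥ g = (1 - QB) *ᵥ g + (QB - PB) *ᵥ g := by
        rw [← Matrix.add_mulVec]; congr 1; abel
      rw [this]
      exact (vn_add_le _ _).trans (add_le_add le_rfl hHB)
    have c1 := vn_nonneg ((1 - QA) *ᵥ g)
    have c2 := vn_nonneg ((1 - QB) *ᵥ g)
    have c3 := vn_nonneg ((1 - PB) *ᵥ g)
    have c4 := vn_nonneg (QB *ᵥ e)
    have c5 := vn_nonneg g
    have b3 : vn ((1 - QA) *ᵥ g) ^ 2 ≤ H ^ 2 := pow_le_pow_left₀ c1 b1 2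
    have b4 : vn (QB *ᵥ e) ^ 2 ≤ G ^ 2 := pow_le_pow_left₀ c4 hGB 2
    have b5 := (abs_le.1 ((abs_dotProduct_le g (QB *ᵥ e)).trans
      (mul_le_mul hF hGB c4 (c5.trans hF)))).2
    have b6 := (abs_le.1 ((abs_dotProduct_le g (QA *ᵥ e)).trans
      (mul_le_mul hF hGA (vn_nonneg _) (c5.trans hF)))).1
    have b7 : vn ((1 - PB) *ᵥ g) ^ 2 ≤ 2 * vn ((1 - QB) *ᵥ g) ^ 2 + 2 * H ^ 2 := by
      nlinarith [pow_le_pow_left₀ c3 b2 2, sq_nonneg (vn ((1 - QB) *ᵥ g) - H)]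
    nlinarith [sq_nonneg (vn (QA *ᵥ e))]
  have key2 := div_le_div_of_nonneg_right key hs.le
  rw [sub_div] at key2
  linarith

theorem gap_basic {z a b u : ℝ} (hu : 1 ≤ u) (ha : 0 ≤ a) (hb : 0 ≤ b)
    (hz : z = u * (a * u + b)) : a * u ≤ z ∧ b ≤ z := by
  have h1 : 0 ≤ a * u := by positivity
  constructor <;> nlinarith

theorem gap_add {x y s q b : ℝ} (hx : 0 ≤ x) (hy : 0 ≤ y) (hs : 0 ≤ s) (hq : 0 ≤ q) (hb : 0 ≤ b) :
    x * (s * b) + y * (s * q) ≤ (x + y) * (s * (q + b)) := by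
  have h1 : 0 ≤ x * (s * q) := by positivity
  have h2 : 0 ≤ y * (s * b) := by positivity
  nlinarith

theorem sqrt_le_sq {δ N : ℝ} (hδ : 1 ≤ δ) (h : δ ^ 2 ≤ N) : √δ ≤ N ^ 2 := by
  have h1 : √δ ≤ δ := by
    rw [Real.sqrt_le_left (by linarith)]; nlinarith
  have h2 : δ ≤ δ ^ 2 := by nlinarith
  have h3 : N ≤ N ^ 2 := by nlinarith
  linarith

theorem gap_total {K z N c : ℝ} (hK : 0 ≤ K) (hN : 0 ≤ N) (hz : 0 ≤ z)
    (h : z < c / (2 * (K + 1))) : K * (z * N) ≤ c / 2 * N := by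
  rw [lt_div_iff₀ (by positivity)] at h
  have h1 : K * z ≤ c / 2 := by nlinarith
  calc _ = K * z * N := by ring
    _ ≤ _ := by gcongr

theorem gap_bound {KF KG KH z N a b u sN s2 cs Cs csep V : ℝ} (hcs : 0 < cs) (hs1 : cs ≤ s2)
    (hs2 : s2 ≤ Cs) (hcsep : 0 ≤ csep) (hN : 0 ≤ N) (hKF : 0 ≤ KF) (hKG : 0 ≤ KG) (ha : 0 ≤ a)
    (hb : 0 ≤ b) (hu : 1 ≤ u) (hsN2 : sN ^ 2 = N) (hzd : z = u * (a * u + b)) (z1 : z ≤ 1)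
    (hV : csep * N ≤ V) :
    (2 * (KH * (sN * (a * u))) ^ 2 + 4 * (KF * (sN * u) * (KG * (sN * (a * u + b)))) +
      (KG * (sN * (a * u + b))) ^ 2 - V / 2) / s2 ≤
      (2 * KH ^ 2 + 4 * (KF * KG) + KG ^ 2) / cs * (z * N) - csep / (2 * (|Cs| + 1)) * N := by
  have hs : 0 < s2 := hcs.trans_le hs1
  have hau0 : 0 ≤ a * u := by positivity
  have hauz : a * u + b ≤ z := by rw [hzd]; nlinarith
  have hau : a * u ≤ z := by linarith
  have hz0 : 0 ≤ z := hau0.trans hau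
  have g1 : (KH * (sN * (a * u))) ^ 2 ≤ KH ^ 2 * (z * N) := by
    have : (a * u) ^ 2 ≤ z := by
      have : 0 ≤ a * u := by positivity
      nlinarith
    calc _ = KH ^ 2 * ((a * u) ^ 2 * N) := by rw [← hsN2]; ring
      _ ≤ _ := by gcongr
  have g2 : KF * (sN * u) * (KG * (sN * (a * u + b))) = KF * KG * (z * N) := by
    rw [← hsN2, hzd]; ring
  have g3 : (KG * (sN * (a * u + b))) ^ 2 ≤ KG ^ 2 * (z * N) := by
    have : (a * u + b) ^ 2 ≤ z := by
      have h0 : 0 ≤ a * u + b := by positivity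
      have h1 : a * u + b ≤ z := by rw [hzd]; nlinarith
      nlinarith
    calc _ = KG ^ 2 * ((a * u + b) ^ 2 * N) := by rw [← hsN2]; ring
      _ ≤ _ := by gcongr
  rw [sub_div]
  refine sub_le_sub ?_ ?_
  · rw [g2]
    calc _ ≤ ((2 * KH ^ 2 + 4 * (KF * KG) + KG ^ 2) * (z * N)) / s2 :=
          div_le_div_of_nonneg_right (by linarith) hs.le
      _ ≤ ((2 * KH ^ 2 + 4 * (KF * KG) + KG ^ 2) * (z * N)) / cs := by
          gcongr
      _ = _ := by ring
  · rw [le_div_iff₀ hs]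
    have g4 : s2 ≤ |Cs| + 1 := by linarith [hs2, le_abs_self Cs]
    calc _ ≤ csep / (2 * (|Cs| + 1)) * N * (|Cs| + 1) := by gcongr
      _ = csep * N / 2 := by field_simp
      _ ≤ _ := by linarith

namespace Panel

/-- Bounds on the factors and errors of a set of dates. -/
structure DateBound (D : Panel Ω r) (S : ℕ → Finset ℕ) (u w : ℕ → ℝ) (l : Filter (ℕ × Ω)) :
    Prop where
  factor : ∃ C, 0 ≤ C ∧ ∀ᶠ p : ℕ × Ω in l, ∀ t ∈ S p.1, D.fnorm p.1 t p.2 ≤ C * u p.1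
  err : ∃ C, 0 ≤ C ∧ ∀ᶠ p : ℕ × Ω in l, ∀ t ∈ S p.1, vn (D.err p.1 t p.2) ≤ C * (√(D.N p.1) * u p.1)
  loading : ∃ C, 0 ≤ C ∧ ∀ᶠ p : ℕ × Ω in l, ∀ t ∈ S p.1, ∀ j,
    vn ((D.L0 p.1 j)ᵀ *ᵥ D.err p.1 t p.2) ≤ C * (√(D.N p.1) * w p.1)

namespace Estim

variable {l : Filter (ℕ × Ω)} [Nonempty (Fin J)]

set_option maxHeartbeats 1000000 in
theorem exists_log_density_gap (h : D.Estim L s2 P q SigF l) (hL : D.IsMLE θ L s2)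
    (hΛ : D.LoadingAssumption SigL) {S : ℕ → Finset ℕ} (hS : ∀ n, S n ⊆ Finset.range (D.T n))
    {u w : ℕ → ℝ} (hu : ∀ᶠ n in atTop, 1 ≤ u n) (hw : ∀ᶠ n in atTop, 1 ≤ w n)
    (hb : D.DateBound S u w l)
    (hz : Tendsto (fun n => u n * (√(1 / √(D.δ n)) * u n + w n / √(D.N n))) atTop (𝓝 0)) :
    ∃ c, 0 < c ∧ ∀ᶠ p : ℕ × Ω in l, ∀ t ∈ S p.1, ∀ k, k ≠ D.state p.1 t p.2 →
      Real.log (density (L p.1 p.2 (D.slot L s2 p.1 p.2 k)) (s2 p.1 p.2) (D.x p.1 t p.2)) -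
      Real.log (density (L p.1 p.2 (D.slot L s2 p.1 p.2 (D.state p.1 t p.2))) (s2 p.1 p.2)
        (D.x p.1 t p.2)) ≤ -(c * D.N p.1) := by
  obtain ⟨Cf, hCf, h1⟩ := hb.factor
  obtain ⟨Ce, hCe, h2⟩ := hb.err
  obtain ⟨Cw, hCw, h3⟩ := hb.loading
  obtain ⟨C1, hC1, h4⟩ := h.close
  obtain ⟨C2, hC2, h5⟩ := eventually_projMat_L0 hΛ
  obtain ⟨cs, Cs, hcs, h6⟩ := h.s2_bdd
  obtain ⟨cd, Cd, hcd, h7⟩ := h.diag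
  obtain ⟨csep, hcsep, h8⟩ := h.sep
  obtain ⟨CΛ, hCΛ, h9⟩ := exists_fn_L0_le hΛ
  set R : ℝ := ((maxRank r : ℕ) : ℝ) with hR
  have hRr : ∀ j, (r j : ℝ) ≤ R := fun j => by
    rw [hR]; exact_mod_cast Finset.le_sup (f := r) (Finset.mem_univ j)
  have hR0 : 0 ≤ R := Nat.cast_nonneg _
  set KF := √CΛ * Cf with hKF
  set KG := √C2 * Cw + √C1 * Ce with hKG
  set KH := √C1 * KF with hKH
  set KD := R * (2 * √(1 + R * |Cd| / cs)) with hKD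
  set KX := (KF + Ce) ^ 2 / cd with hKX
  have hKF0 : 0 ≤ KF := by positivity
  have hKG0 : 0 ≤ KG := by positivity
  have hKH0 : 0 ≤ KH := by positivity
  set K := KD + (2 * KH ^ 2 + 4 * (KF * KG) + KG ^ 2) / cs + KX with hK
  have hK0 : 0 ≤ K := by positivity
  set c := csep / (2 * (|Cs| + 1)) with hc
  have hc0 : 0 < c := by positivity
  refine ⟨c / 4, by positivity, ?_⟩
  have hz0 : ∀ᶠ n in atTop, u n * (√(1 / √(D.δ n)) * u n + w n / √(D.N n)) < c / (2 * (K + 1)) :=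
    hz.eventually_lt_const (by positivity)
  have hz1 : ∀ᶠ n in atTop, u n * (√(1 / √(D.δ n)) * u n + w n / √(D.N n)) < 1 :=
    hz.eventually_lt_const one_pos
  filter_upwards [h1, h2, h3, h4, eventually_fst h.le h5, h6, h7, h8, h.matched,
    eventually_fst h.le hu, eventually_fst h.le hw, eventually_fst h.le hz0,
    eventually_fst h.le hz1, h.eventually_N_pos, h.eventually_δ]
    with p f1 f2 f3 f4 f5 f6 f7 f8 hm u1 w1 z0 z1 hN hδ t ht k hk
  obtain ⟨n, ω⟩ := p
  simp only at *
  set z := u n * (√(1 / √(D.δ n)) * u n + w n / √(D.N n)) with hzd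
  set a := √(1 / √(D.δ n)) with ha
  set b := w n / √(D.N n) with hbd
  set sN := √(D.N n : ℝ) with hsN
  have hsN0 : 0 < sN := Real.sqrt_pos.2 hN
  have hsN2 : sN ^ 2 = D.N n := Real.sq_sqrt hN.le
  have hN1 : (1 : ℝ) ≤ D.N n := by
    have : 0 < D.N n := by exact_mod_cast hN
    exact_mod_cast this
  have ha0 : 0 ≤ a := Real.sqrt_nonneg _
  have hb0 : 0 < b := by positivity
  have hwb : w n = sN * b := by rw [hbd]; field_simp
  obtain ⟨hau, hbz⟩ := gap_basic u1 ha0 hb0.le hzd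
  have hz00 : 0 ≤ z := hb0.le.trans hbz
  generalize hj : D.state n t ω = j at *
  have htT : t < D.T n := Finset.mem_range.1 (hS n ht)
  have hproj : ∀ k, fn (projMat (L n ω (D.slot L s2 n ω k)) - projMat (D.L0 n k)) ≤ √C1 * a := by
    intro k
    rw [ha, ← Real.sqrt_mul hC1]
    exact Real.le_sqrt_of_sq_le (f4 k)
  have hsig : vn (D.sig n t ω) ≤ KF * (sN * u n) := by
    have e1 : fn (D.L0 n (D.state n t ω)) ≤ √CΛ * sN := by
      rw [hsN, ← Real.sqrt_mul hCΛ]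
      exact Real.le_sqrt_of_sq_le (h9 n _)
    calc _ ≤ √CΛ * sN * (Cf * u n) := (D.vn_sig_le n t ω).trans
          (mul_le_mul e1 (f1 t ht) (D.fnorm_nonneg n t ω) (by positivity))
      _ = _ := by rw [hKF]; ring
  have hG : ∀ k, vn (projMat (L n ω (D.slot L s2 n ω k)) *ᵥ D.err n t ω) ≤
      KG * (sN * (a * u n + b)) := by
    intro k
    obtain ⟨B, hB1, hB2⟩ := f5 k
    have e1 : projMat (L n ω (D.slot L s2 n ω k)) *ᵥ D.err n t ω = Bᵀ *ᵥ ((D.L0 n k)ᵀ *ᵥ D.err n t ω) +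
        (projMat (L n ω (D.slot L s2 n ω k)) - projMat (D.L0 n k)) *ᵥ D.err n t ω := by
      rw [Matrix.mulVec_mulVec, ← Matrix.transpose_mul, ← hB1, (isProjMat_projMat _).symm,
        ← Matrix.add_mulVec, add_sub_cancel]
    have e2 : fn B ≤ √C2 / sN := by
      rw [hsN, ← Real.sqrt_div hC2]
      exact Real.le_sqrt_of_sq_le (hB2.trans (le_of_eq (by ring)))
    rw [e1]
    refine (vn_add_le _ _).trans ?_
    have e3 : vn (Bᵀ *ᵥ ((D.L0 n k)ᵀ *ᵥ D.err n t ω)) ≤ √C2 / sN * (Cw * (sN * w n)) :=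
      (vn_mulVec_le Bᵀ ((D.L0 n k)ᵀ *ᵥ D.err n t ω)).trans
        (mul_le_mul (by rwa [fn_transpose]) (f3 t ht k) (vn_nonneg _) (by positivity))
    have e4 := (vn_mulVec_le (projMat (L n ω (D.slot L s2 n ω k)) - projMat (D.L0 n k))
      (D.err n t ω)).trans (mul_le_mul (hproj k) (f2 t ht) (vn_nonneg _) (by positivity))
    have e5 : √C2 / sN * (Cw * (sN * w n)) = √C2 * Cw * (sN * b) := by
      rw [hwb]; field_simp
    have e6 : √C1 * a * (Ce * (sN * u n)) = √C1 * Ce * (sN * (a * u n)) := by ring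
    rw [e5] at e3
    rw [e6] at e4
    exact (add_le_add e3 e4).trans (gap_add (by positivity) (by positivity) hsN0.le
      (by positivity) hb0.le)
  have hH : ∀ k, vn ((projMat (L n ω (D.slot L s2 n ω k)) - projMat (D.L0 n k)) *ᵥ D.sig n t ω) ≤
      KH * (sN * (a * u n)) := fun k => by
    calc _ ≤ √C1 * a * (KF * (sN * u n)) := (vn_mulVec_le _ _).trans
          (mul_le_mul (hproj k) hsig (vn_nonneg _) (by positivity))
      _ = _ := by rw [hKH]; ring
  have hs := hL.s2_pos n ω
  have hsige : D.sig n t ω = D.L0 n j *ᵥ (D.factor n j t ω).ofLp := by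
    unfold sig fac; rw [hj]
  have hmain := log_density_sub_le (L n ω (D.slot L s2 n ω k)) hs
    (hL.diagonal n ω (D.slot L s2 n ω j)) (show 0 < cd * D.N n by positivity)
    (fun i => (f7 j i).1) (PA := projMat (D.L0 n j)) (PB := projMat (D.L0 n k))
    (g := D.sig n t ω) (e := D.err n t ω)
    (by rw [hsige, Matrix.mulVec_mulVec, projMat_mul_self]) hsig (hG j) (hG k) (hH j) (hH k)
  rw [← x_eq] at hmain
  have hsepk : csep * D.N n ≤ vn ((1 - projMat (D.L0 n k)) *ᵥ D.sig n t ω) ^ 2 := by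
    have := f8 j k (Ne.symm hk) t htT hj
    rw [annihilator_eq, ← Matrix.mulVec_mulVec] at this
    rwa [hsige]
  have hlogd : (r (D.slot L s2 n ω j) : ℝ) *
      Real.log (1 + fn (L n ω (D.slot L s2 n ω j)) ^ 2 / s2 n ω) ≤ KD * (z * D.N n) := by
    have e0 : fn (L n ω (D.slot L s2 n ω j)) ^ 2 ≤ R * |Cd| * D.N n := by
      rw [fn_sq_eq_trace, Matrix.trace]
      calc _ ≤ ∑ i : Fin (r (D.slot L s2 n ω j)), |Cd| * D.N n :=
            Finset.sum_le_sum fun i _ => (f7 j i).2.trans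
              (mul_le_mul_of_nonneg_right (le_abs_self Cd) hN.le)
        _ = r (D.slot L s2 n ω j) * (|Cd| * D.N n) := by simp
        _ ≤ R * (|Cd| * D.N n) := mul_le_mul_of_nonneg_right (hRr _) (by positivity)
        _ = _ := by ring
    have hy : 0 ≤ fn (L n ω (D.slot L s2 n ω j)) ^ 2 / s2 n ω := by positivity
    have e1 : 1 + fn (L n ω (D.slot L s2 n ω j)) ^ 2 / s2 n ω ≤ (1 + R * |Cd| / cs) * D.N n := by
      have := div_le_div₀ (by positivity) e0 hcs f6.1
      have e2 : R * |Cd| * D.N n / cs = R * |Cd| / cs * D.N n := by ring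
      rw [add_mul, one_mul, ← e2]
      linarith
    have e3 := Real.sqrt_le_sqrt e1
    rw [Real.sqrt_mul (by positivity)] at e3
    have e4 := log_one_add_le_sqrt hy
    have e5 : sN ≤ z * D.N n := by
      rw [← hsN2, sq, ← mul_assoc]
      refine le_mul_of_one_le_left hsN0.le ?_
      calc 1 ≤ w n := w1
        _ = sN * b := hwb
        _ ≤ sN * z := by gcongr
        _ = z * sN := mul_comm _ _
    calc _ ≤ R * (2 * (√(1 + R * |Cd| / cs) * sN)) :=
          mul_le_mul (hRr _) (by linarith) (Real.log_nonneg (by linarith)) hR0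
      _ = KD * sN := by rw [hKD]; ring
      _ ≤ _ := mul_le_mul_of_nonneg_left e5 (by positivity)
  have hX : vn (D.x n t ω) ^ 2 / (cd * D.N n) ≤ KX * (z * D.N n) := by
    have e1 : vn (D.x n t ω) ≤ (KF + Ce) * (sN * u n) := by
      rw [x_eq]
      exact (vn_add_le _ _).trans (by linarith [f2 t ht])
    have e2 := pow_le_pow_left₀ (vn_nonneg _) e1 2
    have e3 : u n ^ 2 ≤ z * D.N n := by
      have : 1 ≤ a * D.N n := by
        rw [ha]
        have g1 : 1 / (D.N n : ℝ) ≤ √(1 / √(D.δ n)) := by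
          refine Real.le_sqrt_of_sq_le ?_
          have g2 : √(D.δ n) ≤ D.N n ^ 2 := sqrt_le_sq hδ (D.δ_sq_le_N n)
          rw [div_pow, one_pow]
          exact one_div_le_one_div_of_le (by positivity) g2
        rwa [div_le_iff₀ hN] at g1
      have g4 : u n * (a * u n) ≤ z := by
        rw [hzd]; gcongr; linarith
      calc u n ^ 2 = u n ^ 2 * 1 := by ring
        _ ≤ u n ^ 2 * (a * D.N n) := by gcongr
        _ = u n * (a * u n) * D.N n := by ring
        _ ≤ _ := by gcongr
    rw [div_le_iff₀ (by positivity)]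
    calc _ ≤ ((KF + Ce) * (sN * u n)) ^ 2 := e2
      _ = (KF + Ce) ^ 2 * D.N n * u n ^ 2 := by rw [mul_pow, mul_pow, hsN2]; ring
      _ ≤ (KF + Ce) ^ 2 * D.N n * (z * D.N n) := by gcongr
      _ = _ := by rw [hKX]; field_simp
  have hmid : (2 * (KH * (sN * (a * u n))) ^ 2 + 4 * (KF * (sN * u n) * (KG * (sN * (a * u n + b)))) +
      (KG * (sN * (a * u n + b))) ^ 2 - vn ((1 - projMat (D.L0 n k)) *ᵥ D.sig n t ω) ^ 2 / 2) /
      s2 n ω ≤ (2 * KH ^ 2 + 4 * (KF * KG) + KG ^ 2) / cs * (z * D.N n) - c * D.N n := by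
    exact gap_bound hcs f6.1 f6.2 hcsep.le hN.le hKF0 hKG0 ha0 hb0.le u1 hsN2 hzd z1.le hsepk
  have htot : K * (z * D.N n) ≤ c / 2 * D.N n := gap_total hK0 hN.le hz00 z0
  have hKexp : K * (z * D.N n) = KD * (z * D.N n) + (2 * KH ^ 2 + 4 * (KF * KG) + KG ^ 2) / cs *
      (z * D.N n) + KX * (z * D.N n) := by rw [hK]; ring
  linarith

end Estim

theorem prob_le_of_log_density (hL : D.IsMLE θ L s2) {n t : ℕ} (ht : t < D.T n) {ω : Ω}
    {k j : Fin J} {c : ℝ} (h : Real.log (density (L n ω k) (s2 n ω) (D.x n t ω)) -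
      Real.log (density (L n ω j) (s2 n ω) (D.x n t ω)) ≤ c) :
    D.prob θ L s2 n t ω k ≤ (θ.lower⁻¹) ^ 2 * Real.exp c := by
  have hs := hL.s2_pos n ω
  have h1 := θ.smoothed_mul_density_le (L n ω) hs (D.obs n ω) ⟨t, ht⟩ j k
  have hj := density_pos (L n ω j) hs (D.x n t ω)
  have hk := density_pos (L n ω k) hs (D.x n t ω)
  have h2 := θ.smoothed_le_one (L n ω) hs (D.obs n ω) ⟨t, ht⟩ j
  rw [prob, dif_pos ht]
  have h3 : density (L n ω k) (s2 n ω) (D.x n t ω) ≤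
      Real.exp c * density (L n ω j) (s2 n ω) (D.x n t ω) := by
    rw [← Real.log_le_log_iff hk (by positivity), Real.log_mul (Real.exp_pos _).ne' hj.ne',
      Real.log_exp]
    linarith
  have hl : 0 ≤ (θ.lower⁻¹) ^ 2 := sq_nonneg _
  refine le_of_mul_le_mul_right ?_ hj
  calc _ ≤ (θ.lower⁻¹) ^ 2 * density (L n ω k) (s2 n ω) (D.x n t ω) *
        θ.smoothed (L n ω) (s2 n ω) (D.obs n ω) ⟨t, ht⟩ j := h1
    _ ≤ (θ.lower⁻¹) ^ 2 * density (L n ω k) (s2 n ω) (D.x n t ω) * 1 :=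
        mul_le_mul_of_nonneg_left h2 (mul_nonneg hl hk.le)
    _ ≤ (θ.lower⁻¹) ^ 2 * (Real.exp c * density (L n ω j) (s2 n ω) (D.x n t ω)) := by
        rw [mul_one]; exact mul_le_mul_of_nonneg_left h3 hl
    _ = _ := by ring

theorem sum_prob (hL : D.IsMLE θ L s2) {n t : ℕ} (ht : t < D.T n) (ω : Ω) :
    ∑ k, D.prob θ L s2 n t ω k = 1 := by
  simp only [prob, dif_pos ht]
  exact θ.sum_smoothed _ (hL.s2_pos n ω) _ _

theorem abs_prob_sub_ind_le [Nonempty (Fin J)] (hL : D.IsMLE θ L s2) {n t : ℕ} (ht : t < D.T n)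
    {ω : Ω} {κ : Fin J → Fin J} (hκ : Function.Injective κ) {B : ℝ} (hB : 0 ≤ B)
    (h : ∀ k, k ≠ D.state n t ω → D.prob θ L s2 n t ω (κ k) ≤ B) (j : Fin J) :
    |D.prob θ L s2 n t ω (κ j) - D.ind n j t ω| ≤ J * B := by
  have hJ : (1 : ℝ) ≤ J := by
    have := Fin.pos_iff_nonempty.2 (inferInstance : Nonempty (Fin J)); exact_mod_cast this
  have h0 := fun k => prob_nonneg hL n t ω k
  by_cases hj : D.state n t ω = j
  · have h1 : ∑ k, D.prob θ L s2 n t ω (κ k) = 1 := by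
      rw [← sum_prob hL ht ω]
      exact (Equiv.ofBijective κ (Finite.injective_iff_bijective.1 hκ)).sum_comp
        (fun k => D.prob θ L s2 n t ω k)
    rw [← Finset.add_sum_erase _ _ (Finset.mem_univ j)] at h1
    have h2 : ∑ k ∈ Finset.univ.erase j, D.prob θ L s2 n t ω (κ k) ≤ J * B := by
      calc _ ≤ ∑ k ∈ Finset.univ.erase j, B := Finset.sum_le_sum fun k hk =>
            h k (by rw [hj]; exact (Finset.mem_erase.1 hk).1)
        _ ≤ ∑ k : Fin J, B := Finset.sum_le_sum_of_subset_of_nonneg (Finset.erase_subset _ _)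
            fun _ _ _ => hB
        _ = _ := by simp
    have h3 : 0 ≤ ∑ k ∈ Finset.univ.erase j, D.prob θ L s2 n t ω (κ k) :=
      Finset.sum_nonneg fun k _ => h0 _
    rw [ind, if_pos hj, abs_le]
    constructor <;> linarith
  · rw [ind, if_neg hj, sub_zero, abs_of_nonneg (h0 _)]
    have := h j (Ne.symm hj)
    nlinarith

theorem Estim.exists_prob_bound [Nonempty (Fin J)] {l : Filter (ℕ × Ω)}
    (h : D.Estim L s2 P q SigF l) (hL : D.IsMLE θ L s2)
    (hΛ : D.LoadingAssumption SigL) {S : ℕ → Finset ℕ} (hS : ∀ n, S n ⊆ Finset.range (D.T n))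
    {u w : ℕ → ℝ} (hu : ∀ᶠ n in atTop, 1 ≤ u n) (hw : ∀ᶠ n in atTop, 1 ≤ w n)
    (hb : D.DateBound S u w l)
    (hz : Tendsto (fun n => u n * (√(1 / √(D.δ n)) * u n + w n / √(D.N n))) atTop (𝓝 0)) :
    ∃ c C, 0 < c ∧ 0 ≤ C ∧ ∀ᶠ p : ℕ × Ω in l, ∀ t ∈ S p.1, ∀ j,
      |D.prob θ L s2 p.1 t p.2 (D.slot L s2 p.1 p.2 j) - D.ind p.1 j t p.2| ≤
        C * Real.exp (-(c * D.N p.1)) := by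
  obtain ⟨c, hc, h1⟩ := h.exists_log_density_gap hL hΛ hS hu hw hb hz
  refine ⟨c, J * (θ.lower⁻¹) ^ 2, hc, by positivity, ?_⟩
  filter_upwards [h1, h.matched] with p h2 hm t ht j
  have htT := Finset.mem_range.1 (hS p.1 ht)
  rw [mul_assoc]
  exact abs_prob_sub_ind_le hL htT hm.1 (by positivity)
    (fun k hk => prob_le_of_log_density hL htT (h2 t ht k hk)) j

/-! ### Uniform bounds over sets of dates -/

theorem meanLE_err_rpow [IsProbabilityMeasure P] (hα : 2 ≤ α) (he : D.ErrorAssumption P α) :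
    ∃ M : ℝ, 0 ≤ M ∧ ∀ n t, 0 < D.N n → t < D.T n →
      MeanLE P (fun ω => (vn (D.err n t ω) / √(D.N n)) ^ α) M := by
  obtain ⟨M, hM⟩ := he.moment
  have hme := D.measurable_error
  refine ⟨M, M.2, fun n t hN ht => ?_⟩
  have hN' : (0 : ℝ) < D.N n := by exact_mod_cast hN
  have h1 : MeanLE P (fun ω => ∑ i : Fin (D.N n), (1 / (D.N n : ℝ)) * ‖D.error n i t ω‖ ^ α)
      (∑ i : Fin (D.N n), (1 / (D.N n : ℝ)) * M) :=
    MeanLE.sum (fun i _ => (MeanLE.of_enorm_rpow (by linarith) (hM n i t i.2 ht)).const_mul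
      (by positivity)) (fun i => by fun_prop) (fun i _ => by positivity)
  refine h1.mono (fun ω => ?_) (by simp [hN'.ne'])
  have h2 := Real.rpow_arith_mean_le_arith_mean_rpow Finset.univ
    (fun _ : Fin (D.N n) => 1 / (D.N n : ℝ)) (fun i => ‖D.error n i t ω‖ ^ 2)
    (fun _ _ => by positivity) (by simp [hN'.ne']) (fun _ _ => by positivity)
    (show 1 ≤ α / 2 by linarith)
  have h3 : ∀ x : ℝ, 0 ≤ x → (x ^ 2) ^ (α / 2) = x ^ α := fun x hx => by
    rw [← Real.rpow_natCast, ← Real.rpow_mul hx]; congr 1; push_cast; ring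
  have h4 : ∑ i : Fin (D.N n), 1 / (D.N n : ℝ) * ‖D.error n i t ω‖ ^ 2 =
      (vn (D.err n t ω) / √(D.N n)) ^ 2 := by
    rw [div_pow, Real.sq_sqrt hN'.le, vn_sq, ← Finset.mul_sum, one_div, inv_mul_eq_div]
    congr 1
    simp only [dotProduct, err, Real.norm_eq_abs, sq_abs]
    exact Finset.sum_congr rfl fun i _ => by ring
  rw [h4, h3 _ (div_nonneg (vn_nonneg _) (Real.sqrt_nonneg _))] at h2
  refine h2.trans (le_of_eq (Finset.sum_congr rfl fun i _ => ?_))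
  rw [h3 _ (norm_nonneg _)]

theorem often_dateBound [IsProbabilityMeasure P] (hα : 2 ≤ α) (hβ : 2 ≤ β)
    (hF : D.FactorAssumption P q α SigF) (he : D.ErrorAssumption P α)
    (hA : D.LoadingErrorMoment P β) {S : ℕ → Finset ℕ} (hS : ∀ n, S n ⊆ Finset.range (D.T n))
    (hne : ∀ᶠ n in atTop, (S n).Nonempty) :
    Often P fun l => D.DateBound S (fun n => ((S n).card : ℝ) ^ (1 / α))
      (fun n => ((S n).card : ℝ) ^ (1 / β)) l := by
  obtain ⟨M1, hM1, h1⟩ := meanLE_fnorm_rpow (by linarith : 0 ≤ α) hF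
  obtain ⟨M2, hM2, h2⟩ := meanLE_err_rpow hα he
  obtain ⟨M3, h3⟩ := hA
  have hme := D.measurable_error
  have hmem : ∀ {n t}, t ∈ S n → t < D.T n := fun ht => Finset.mem_range.1 (hS _ ht)
  have o1 := often_max (P := P) (X := fun n t ω => D.fnorm n t ω) (γ := α) (by linarith) hM1
    (fun n t ω => D.fnorm_nonneg n t ω) (fun n t => D.measurable_fnorm n t) S hne
    (Eventually.of_forall fun n t ht => h1 n t (hmem ht))
  have hv : ∀ n t, Measurable fun ω => vn (D.err n t ω) := fun n t => by
    unfold vn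
    simp only [dotProduct, err]
    fun_prop
  have o2 := often_max (P := P) (X := fun n t ω => vn (D.err n t ω) / √(D.N n)) (γ := α)
    (by linarith) hM2 (fun n t ω => div_nonneg (vn_nonneg _) (Real.sqrt_nonneg _))
    (fun n t => (hv n t).div_const _) S hne
    (D.eventually_N_pos.mono fun n hn t ht => h2 n t (by exact_mod_cast hn) (hmem ht))
  have o3 := Often.forall_fin fun j => often_max (P := P) (X := fun n t ω =>
      ‖(1 / √(D.N n : ℝ)) • ∑ i ∈ Finset.range (D.N n), D.error n i t ω • D.loading n j i‖)
    (γ := β) (by linarith) M3.2 (fun n t ω => norm_nonneg _) (fun n t => by fun_prop) S hne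
    (Eventually.of_forall fun n t ht => MeanLE.of_enorm_rpow (by linarith) (h3 n j t (hmem ht)))
  refine ((o1.and o2).and o3).mono ?_
  rintro l hl ⟨⟨a1, C2, hC2, a2⟩, a3⟩
  have hN := eventually_fst hl D.eventually_N_pos
  refine ⟨a1, ⟨C2, hC2, ?_⟩, ?_⟩
  · filter_upwards [a2, hN] with p hp hN t ht
    have := hp t ht
    rw [div_le_iff₀ (Real.sqrt_pos.2 hN)] at this
    exact this.trans (le_of_eq (by ring))
  · choose C hC a3 using a3
    refine ⟨∑ j, C j, Finset.sum_nonneg fun j _ => hC j, ?_⟩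
    filter_upwards [eventually_all.2 a3, hN] with p hp hN t ht j
    have h4 := hp j t ht
    have hs := Real.sqrt_pos.2 hN
    rw [norm_smul, norm_div, norm_one, Real.norm_of_nonneg hs.le, one_div, inv_mul_le_iff₀ hs] at h4
    rw [vn_loading_err]
    have h5 : C j ≤ ∑ j, C j := Finset.single_le_sum (fun j _ => hC j) (Finset.mem_univ j)
    calc _ ≤ √(D.N p.1 : ℝ) * (C j * ((S p.1).card : ℝ) ^ (1 / β)) := h4
      _ = C j * (√(D.N p.1 : ℝ) * ((S p.1).card : ℝ) ^ (1 / β)) := by ring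
      _ ≤ _ := mul_le_mul_of_nonneg_right h5 (by positivity)

theorem rate_of_card_eq_one {S : ℕ → Finset ℕ} (hS : ∀ᶠ n in atTop, (S n).card = 1) (a b : ℝ) :
    Tendsto (fun n => ((S n).card : ℝ) ^ a * (√(1 / √(D.δ n)) * ((S n).card : ℝ) ^ a +
      ((S n).card : ℝ) ^ b / √(D.N n))) atTop (𝓝 0) := by
  have h1 : Tendsto (fun n => √(1 / √(D.δ n)) + 1 / √(D.N n)) atTop (𝓝 0) := by
    have e1 := (Real.continuous_sqrt.tendsto 0).comp D.tendsto_inv_sqrt_δ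
    have e2 : Tendsto (fun n => 1 / √(D.N n : ℝ)) atTop (𝓝 0) :=
      ((Real.tendsto_sqrt_atTop.comp D.tendsto_N_real).inv_tendsto_atTop).congr fun n => by simp
    rw [Real.sqrt_zero] at e1
    simpa using e1.add e2
  refine h1.congr' ?_
  filter_upwards [hS] with n hn
  simp [hn]

theorem rate_of_rateCondition (hα : 16 < α) (hβ : 2 ≤ β) (hR : D.RateCondition α β) :
    Tendsto (fun n => (D.T n : ℝ) ^ (1 / α) * (√(1 / √(D.δ n)) * (D.T n : ℝ) ^ (1 / α) +
      (D.T n : ℝ) ^ (1 / β) / √(D.N n))) atTop (𝓝 0) := by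
  have hα0 : 0 < α := by linarith
  have e1 : Tendsto (fun n => ((D.T n : ℝ) ^ (16 / α) / D.N n) ^ (1 / 8 : ℝ)) atTop (𝓝 0) := by
    simpa using hR.1.rpow_const (p := 1 / 8) (Or.inr (by norm_num))
  have e2 : Tendsto (fun n => (D.T n : ℝ) ^ (2 / α - 1 / 8)) atTop (𝓝 0) := by
    have h0 : 0 < 1 / 8 - 2 / α := by
      rw [sub_pos, div_lt_iff₀ hα0]; linarith
    have := (tendsto_rpow_neg_atTop h0).comp D.tendsto_T_real
    refine this.congr fun n => ?_
    simp
  have e3 : Tendsto (fun n => √((D.T n : ℝ) ^ (2 / α + 2 / β) / D.N n)) atTop (𝓝 0) := by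
    have := (Real.continuous_sqrt.tendsto 0).comp hR.2
    rw [Real.sqrt_zero] at this
    exact this
  have e4 := (e1.add e2).add e3
  simp only [add_zero] at e4
  refine squeeze_zero' ?_ ?_ e4
  · exact Eventually.of_forall fun n => by positivity
  filter_upwards [D.eventually_N_pos, D.eventually_T_pos] with n hN hT
  have hsq : ∀ x : ℝ, 0 < x → √(1 / √√x) = x ^ (-(1 / 8) : ℝ) := fun x hx => by
    simp only [Real.sqrt_eq_rpow, one_div]
    rw [← Real.rpow_neg_one, ← Real.rpow_mul hx.le, ← Real.rpow_mul hx.le, ← Real.rpow_mul hx.le]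
    norm_num
  have h1 : √(1 / √(D.δ n)) ≤ (D.N n : ℝ) ^ (-(1 / 8) : ℝ) + (D.T n : ℝ) ^ (-(1 / 8) : ℝ) := by
    rcases min_choice (√(D.N n : ℝ)) (√(D.T n : ℝ)) with h | h
    · rw [δ, h, hsq _ hN]
      linarith [Real.rpow_nonneg hT.le (-(1 / 8) : ℝ)]
    · rw [δ, h, hsq _ hT]
      linarith [Real.rpow_nonneg hN.le (-(1 / 8) : ℝ)]
  have h2 : (D.T n : ℝ) ^ (1 / α) * (D.T n : ℝ) ^ (1 / α) = (D.T n : ℝ) ^ (2 / α) := by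
    rw [← Real.rpow_add hT]; congr 1; ring
  have h3 : (D.T n : ℝ) ^ (2 / α) * (D.N n : ℝ) ^ (-(1 / 8) : ℝ) =
      ((D.T n : ℝ) ^ (16 / α) / D.N n) ^ (1 / 8 : ℝ) := by
    rw [Real.div_rpow (by positivity) hN.le, ← Real.rpow_mul hT.le, Real.rpow_neg hN.le]
    rw [div_eq_mul_inv]
    congr 2; ring
  have h4 : (D.T n : ℝ) ^ (2 / α) * (D.T n : ℝ) ^ (-(1 / 8) : ℝ) = (D.T n : ℝ) ^ (2 / α - 1 / 8) := by
    rw [← Real.rpow_add hT]; congr 1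
  have h5 : (D.T n : ℝ) ^ (1 / α) * ((D.T n : ℝ) ^ (1 / β) / √(D.N n)) =
      √((D.T n : ℝ) ^ (2 / α + 2 / β) / D.N n) := by
    rw [Real.sqrt_div (by positivity), Real.sqrt_eq_rpow ((D.T n : ℝ) ^ (2 / α + 2 / β)),
      ← Real.rpow_mul hT.le, mul_div_assoc', ← Real.rpow_add hT]
    congr 2; ring
  calc _ = (D.T n : ℝ) ^ (1 / α) * (D.T n : ℝ) ^ (1 / α) * √(1 / √(D.δ n)) +
        (D.T n : ℝ) ^ (1 / α) * ((D.T n : ℝ) ^ (1 / β) / √(D.N n)) := by ring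
    _ ≤ (D.T n : ℝ) ^ (2 / α) * ((D.N n : ℝ) ^ (-(1 / 8) : ℝ) + (D.T n : ℝ) ^ (-(1 / 8) : ℝ)) +
        √((D.T n : ℝ) ^ (2 / α + 2 / β) / D.N n) := by
        rw [h2, h5]
        gcongr
    _ = _ := by rw [mul_add, h3, h4]

/-! ### Consistency of the loading spaces and of the smoothed probabilities -/

section
variable [Nonempty (Fin J)] [IsProbabilityMeasure P]

theorem often_estim (hL : D.IsMLE θ L s2) (hα : 2 ≤ α) (hs2 : BoundedAwayInProb P s2)
    (hF : D.FactorAssumption P q α SigF) (hΛ : D.LoadingAssumption SigL)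
    (he : D.ErrorAssumption P α) (hz : D.StateAssumption P q)
    (hid : D.IdentificationAssumption P) : Often P fun l => D.Estim L s2 P q SigF l :=
  (often_basic (Fin.pos_iff_nonempty.2 inferInstance) hα hs2 hF he hz).mono fun _ hl h =>
    h.estim hz.pos hL hΛ (separated_of_identification hid hl)

theorem Estim.eventually_relabel {l : Filter (ℕ × Ω)} (h : D.Estim L s2 P q SigF l)
    (hL : D.IsMLE θ L s2) :
    ∀ᶠ p : ℕ × Ω in l, ∀ j, (relabel hL).perm p.1 p.2 j = D.slot L s2 p.1 p.2 j := by
  filter_upwards [h.matched] with p hp j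
  exact slotPerm_apply hp j

theorem isBigOp_slot (hL : D.IsMLE θ L s2) (hα : 2 ≤ α) (hs2 : BoundedAwayInProb P s2)
    (hF : D.FactorAssumption P q α SigF) (hΛ : D.LoadingAssumption SigL)
    (he : D.ErrorAssumption P α) (hz : D.StateAssumption P q)
    {κ : ℕ → Ω → Fin J → Fin J}
    (hκ : ∀ᶠ p : ℕ × Ω in whp P, ∀ j, κ p.1 p.2 j = D.slot L s2 p.1 p.2 j) (j : Fin J) :
    IsBigOp P (fun n ω => (1 / (D.N n : ℝ)) * frobSq (annihilator (L n ω (κ n ω j)) * D.L0 n j))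
      (fun n => 1 / √(D.δ n)) := by
  refine IsBigOp.of_often (fun n => by positivity)
    ((often_basic (Fin.pos_iff_nonempty.2 inferInstance) hα hs2 hF he hz).mono fun l hl h => ?_)
  obtain ⟨C, -, h1⟩ := h.exists_slot_bound hz.pos hL hΛ
  refine ⟨C, ?_⟩
  filter_upwards [h1, hl hκ, h.eventually_N_pos] with p hp hk hN
  rw [hk j, frobSq_eq, abs_of_nonneg (by positivity), one_div, inv_mul_le_iff₀ hN]
  exact (hp j).trans (le_of_eq (by ring))

theorem eventually_abs_prob_sub_ind_le (hL : D.IsMLE θ L s2) (hα : 2 ≤ α) (hβ : 2 ≤ β)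
    (hs2 : BoundedAwayInProb P s2)
    (hF : D.FactorAssumption P q α SigF) (hΛ : D.LoadingAssumption SigL)
    (he : D.ErrorAssumption P α) (hz : D.StateAssumption P q)
    (hid : D.IdentificationAssumption P) (hA : D.LoadingErrorMoment P β)
    {S : ℕ → Finset ℕ} (hS : ∀ n, S n ⊆ Finset.range (D.T n))
    (hne : ∀ᶠ n in atTop, (S n).Nonempty)
    (hrate : Tendsto (fun n => ((S n).card : ℝ) ^ (1 / α) * (√(1 / √(D.δ n)) *
      ((S n).card : ℝ) ^ (1 / α) + ((S n).card : ℝ) ^ (1 / β) / √(D.N n))) atTop (𝓝 0))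
    (η : ℝ) {c : ℝ} (hc : 0 < c) :
    ∀ᶠ p : ℕ × Ω in whp P, ∀ t ∈ S p.1, ∀ j,
      |D.prob θ L s2 p.1 t p.2 ((relabel hL).perm p.1 p.2 j) - D.ind p.1 j t p.2| ≤
        c * (1 / (D.N p.1 : ℝ) ^ η) := by
  refine eventually_whp_of_often (((often_estim hL hα hs2 hF hΛ he hz hid).and
    (often_dateBound hα hβ hF he hA hS hne)).mono ?_)
  rintro l hl ⟨h, hb⟩
  have hcard : ∀ a : ℝ, 0 ≤ a → ∀ᶠ n in atTop, 1 ≤ ((S n).card : ℝ) ^ a := fun a ha => by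
    filter_upwards [hne] with n hn
    exact Real.one_le_rpow (by exact_mod_cast hn.card_pos) ha
  obtain ⟨a, C, ha, hC, h1⟩ := h.exists_prob_bound hL hΛ hS (hcard _ (by positivity))
    (hcard _ (by positivity)) hb hrate
  have h2 := ((tendsto_rpow_mul_exp_neg_mul_atTop_nhds_zero η a ha).const_mul C).comp
    D.tendsto_N_real
  rw [mul_zero] at h2
  filter_upwards [h1, h.eventually_relabel hL, h.eventually_N_pos,
    eventually_fst hl (h2.eventually_le_const hc)] with p h3 h4 hN h5 t ht j
  rw [h4 j]
  refine (h3 t ht j).trans ?_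
  have h6 : 0 < (D.N p.1 : ℝ) ^ η := Real.rpow_pos_of_pos hN _
  rw [mul_one_div, le_div_iff₀ h6]
  simp only [Function.comp, neg_mul] at h5
  linarith

theorem isLittleOp_prob (hL : D.IsMLE θ L s2) (hα : 2 ≤ α) (hβ : 2 ≤ β)
    (hs2 : BoundedAwayInProb P s2)
    (hF : D.FactorAssumption P q α SigF) (hΛ : D.LoadingAssumption SigL)
    (he : D.ErrorAssumption P α) (hz : D.StateAssumption P q)
    (hid : D.IdentificationAssumption P) (hA : D.LoadingErrorMoment P β)
    (j : Fin J) (η : ℝ) (t : ℕ) :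
    IsLittleOp P (fun n ω => D.prob θ L s2 n t ω ((relabel hL).perm n ω j) - D.ind n j t ω)
      (fun n => 1 / (D.N n : ℝ) ^ η) := by
  rw [isLittleOp_iff_whp]
  intro c hc
  have h1 : ∀ᶠ n in atTop, {t} ∩ Finset.range (D.T n) = {t} := by
    filter_upwards [D.tendsto_T.eventually_gt_atTop t] with n hn
    simpa using hn
  have h2 := eventually_abs_prob_sub_ind_le hL hα hβ hs2 hF hΛ he hz hid hA
    (S := fun n => {t} ∩ Finset.range (D.T n)) (fun n => Finset.inter_subset_right)
    (h1.mono fun n hn => by rw [hn]; exact Finset.singleton_nonempty t)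
    (rate_of_card_eq_one (h1.mono fun n hn => by rw [hn, Finset.card_singleton]) _ _) η hc
  filter_upwards [h2, tendsto_fst_whp.eventually h1] with p h3 h4
  exact h3 t (by rw [h4]; exact Finset.mem_singleton_self t) j

theorem eventually_abs_prob_sub_ind_le_range (hL : D.IsMLE θ L s2) (hα : 16 < α) (hβ : 2 ≤ β)
    (hs2 : BoundedAwayInProb P s2)
    (hF : D.FactorAssumption P q α SigF) (hΛ : D.LoadingAssumption SigL)
    (he : D.ErrorAssumption P α) (hz : D.StateAssumption P q)
    (hid : D.IdentificationAssumption P) (hA : D.LoadingErrorMoment P β)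
    (hR : D.RateCondition α β) (η : ℝ) {c : ℝ} (hc : 0 < c) :
    ∀ᶠ p : ℕ × Ω in whp P, ∀ t < D.T p.1, ∀ j,
      |D.prob θ L s2 p.1 t p.2 ((relabel hL).perm p.1 p.2 j) - D.ind p.1 j t p.2| ≤
        c * (1 / (D.N p.1 : ℝ) ^ η) := by
  have h2 := eventually_abs_prob_sub_ind_le hL (by linarith) hβ hs2 hF hΛ he hz hid hA
    (S := fun n => Finset.range (D.T n)) (fun n => Finset.Subset.refl _)
    ((D.tendsto_T.eventually_gt_atTop 0).mono fun n hn => Finset.nonempty_range_iff.2 hn.ne')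
    (by simpa only [Finset.card_range] using rate_of_rateCondition hα hβ hR) η hc
  filter_upwards [h2] with p h3 t ht
  exact h3 t (Finset.mem_range.2 ht)

theorem isLittleOp_iSup_prob (hL : D.IsMLE θ L s2) (hα : 16 < α) (hβ : 2 ≤ β)
    (hs2 : BoundedAwayInProb P s2)
    (hF : D.FactorAssumption P q α SigF) (hΛ : D.LoadingAssumption SigL)
    (he : D.ErrorAssumption P α) (hz : D.StateAssumption P q)
    (hid : D.IdentificationAssumption P) (hA : D.LoadingErrorMoment P β)
    (hR : D.RateCondition α β) (j : Fin J) (η : ℝ) :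
    IsLittleOp P (fun n ω => ⨆ t : Fin (D.T n),
        |D.prob θ L s2 n t ω ((relabel hL).perm n ω j) - D.ind n j t ω|)
      (fun n => 1 / (D.N n : ℝ) ^ η) := by
  rw [isLittleOp_iff_whp]
  intro c hc
  filter_upwards [eventually_abs_prob_sub_ind_le_range hL hα hβ hs2 hF hΛ he hz hid hA hR η hc,
    tendsto_fst_whp.eventually (D.tendsto_T.eventually_gt_atTop 0)] with p hp hT
  have : Nonempty (Fin (D.T p.1)) := Fin.pos_iff_nonempty.1 hT
  rw [abs_of_nonneg (Real.iSup_nonneg fun t => abs_nonneg _)]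
  exact ciSup_le fun t => hp t t.2 j

theorem eventually_abs_prob_sub_ind_le_inv_sq (hL : D.IsMLE θ L s2) (hα : 16 < α) (hβ : 2 ≤ β)
    (hs2 : BoundedAwayInProb P s2)
    (hF : D.FactorAssumption P q α SigF) (hΛ : D.LoadingAssumption SigL)
    (he : D.ErrorAssumption P α) (hz : D.StateAssumption P q)
    (hid : D.IdentificationAssumption P) (hA : D.LoadingErrorMoment P β)
    (hR : D.RateCondition α β) :
    ∀ᶠ p : ℕ × Ω in whp P, ∀ t < D.T p.1, ∀ j,
      |D.prob θ L s2 p.1 t p.2 ((relabel hL).perm p.1 p.2 j) - D.ind p.1 j t p.2| ≤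
        1 / (D.N p.1 * D.T p.1 : ℝ) ^ 2 := by
  have hα0 : 0 < α := by linarith
  filter_upwards [eventually_abs_prob_sub_ind_le_range hL hα hβ hs2 hF hΛ he hz hid hA hR
    (2 + α / 8) one_pos, tendsto_fst_whp.eventually (D.eventually_T_pos),
    tendsto_fst_whp.eventually (D.eventually_N_pos),
    tendsto_fst_whp.eventually (hR.1.eventually_le_const one_pos)] with p hp hT hN hr t ht j
  refine (hp t ht j).trans ?_
  rw [one_mul]
  refine one_div_le_one_div_of_le (by positivity) ?_
  rw [div_le_one hN] at hr
  have h1 : ((D.T p.1 : ℝ) ^ (16 / α)) ^ (α / 8) ≤ (D.N p.1 : ℝ) ^ (α / 8) :=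
    Real.rpow_le_rpow (by positivity) hr (by positivity)
  rw [← Real.rpow_mul hT.le, show 16 / α * (α / 8) = 2 by field_simp; norm_num] at h1
  rw [Real.rpow_two] at h1
  rw [Real.rpow_add hN, mul_pow, Real.rpow_two]
  exact mul_le_mul_of_nonneg_left h1 (by positivity)

end

end Panel

/-! ### Perturbation of the eigenvector equation -/

/-- The eigenvector equation of the estimated loadings `At` of a regime, in normalized form, and
bounds on its terms. `A` are the true loadings, `G` stands for `E F`, `H` is the rotation, `V` the
inverse of the matrix of eigenvalues, `S` a small perturbation. -/
structure Perturbed {N T k : ℕ} (A At G : Matrix (Fin N) (Fin k) ℝ) (E : Matrix (Fin N) (Fin T) ℝ)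
    (S : Matrix (Fin N) (Fin N) ℝ) (H V : Matrix (Fin k) (Fin k) ℝ) (C ε ν : ℝ) : Prop where
  eq : At - A * H = (A * Gᵀ + G * Aᵀ + E * Eᵀ + S) * At * V
  one_le : 1 ≤ C
  pos : 0 < ν
  le_ε : ν ≤ ε
  ε_le : ε ≤ 1
  A_le : fn A ≤ C
  At_le : fn At ≤ C
  H_le : fn H ≤ C
  V_le : fn V ≤ C
  G_le : fn G ≤ C * ε
  E_le : fn (E * Eᵀ) ≤ C * ε
  S_le : fn S ≤ C * (ε ^ 2 * ν)
  AE_le : fn (Aᵀ * E) ≤ C * ν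

theorem fn_mul_le_of_le {m k l : ℕ} {A : Matrix (Fin m) (Fin k) ℝ} {B : Matrix (Fin k) (Fin l) ℝ}
    {a b : ℝ} (hA : fn A ≤ a) (hB : fn B ≤ b) : fn (A * B) ≤ a * b :=
  (fn_mul_le A B).trans (mul_le_mul hA hB (fn_nonneg _) ((fn_nonneg _).trans hA))

theorem vn_mulVec_le_of_le {m k : ℕ} {A : Matrix (Fin m) (Fin k) ℝ} {v : Fin k → ℝ}
    {a b : ℝ} (hA : fn A ≤ a) (hv : vn v ≤ b) : vn (A *ᵥ v) ≤ a * b :=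
  (vn_mulVec_le A v).trans (mul_le_mul hA hv (vn_nonneg _) ((fn_nonneg _).trans hA))

namespace Perturbed

variable {N T k : ℕ} {A At G : Matrix (Fin N) (Fin k) ℝ} {E : Matrix (Fin N) (Fin T) ℝ}
  {S : Matrix (Fin N) (Fin N) ℝ} {H V : Matrix (Fin k) (Fin k) ℝ} {C ε ν : ℝ}

theorem ε_pos (h : Perturbed A At G E S H V C ε ν) : 0 < ε := h.pos.trans_le h.le_ε

theorem C_pos (h : Perturbed A At G E S H V C ε ν) : 0 < C := one_pos.trans_le h.one_le

theorem fn_sub_le (h : Perturbed A At G E S H V C ε ν) : fn (At - A * H) ≤ 4 * C ^ 4 * ε := by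
  have hC := h.C_pos
  have hε := h.ε_pos
  have hν := h.pos
  have h1 : fn (A * Gᵀ) ≤ C * (C * ε) := fn_mul_le_of_le h.A_le (by rw [fn_transpose]; exact h.G_le)
  have h2 : fn (G * Aᵀ) ≤ C * ε * C := fn_mul_le_of_le h.G_le (by rw [fn_transpose]; exact h.A_le)
  have h5 : C * ε ≤ C ^ 2 * ε := mul_le_mul_of_nonneg_right (by nlinarith [h.one_le]) hε.le
  have h6 : C * (ε ^ 2 * ν) ≤ C * ε := by
    refine mul_le_mul_of_nonneg_left ?_ hC.le
    have h7 : ε * ν ≤ 1 := mul_le_one₀ h.ε_le hν.le (h.le_ε.trans h.ε_le)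
    calc ε ^ 2 * ν = ε * (ε * ν) := by ring
      _ ≤ ε * 1 := mul_le_mul_of_nonneg_left h7 hε.le
      _ = ε := mul_one _
  have h3 : fn (A * Gᵀ + G * Aᵀ + E * Eᵀ + S) ≤ 4 * (C ^ 2 * ε) :=
    calc _ ≤ fn (A * Gᵀ) + fn (G * Aᵀ) + fn (E * Eᵀ) + fn S :=
          (fn_add_le _ _).trans (by
            gcongr; exact (fn_add_le _ _).trans (by gcongr; exact fn_add_le _ _))
      _ ≤ _ := by linarith [h.E_le, h.S_le, h1, h2]
  rw [h.eq]
  refine (fn_mul_le_of_le (fn_mul_le_of_le h3 h.At_le) h.V_le).trans (le_of_eq (by ring))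

theorem fn_G_mul_le (h : Perturbed A At G E S H V C ε ν) (hAG : fn (Aᵀ * G) ≤ C * ε ^ 2) :
    fn (Gᵀ * At) ≤ 5 * C ^ 5 * ε ^ 2 := by
  have hC := h.C_pos
  have h0 : Gᵀ * At = (Gᵀ * A) * H + Gᵀ * (At - A * H) := by
    rw [Matrix.mul_sub, Matrix.mul_assoc]; abel
  have h1 : fn (Gᵀ * A) ≤ C * ε ^ 2 := by
    rw [← fn_transpose, Matrix.transpose_mul, Matrix.transpose_transpose]; exact hAG
  have h2 : C ^ 2 * ε ^ 2 ≤ C ^ 5 * ε ^ 2 :=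
    mul_le_mul_of_nonneg_right (pow_le_pow_right₀ h.one_le (by norm_num)) (sq_nonneg _)
  rw [h0]
  calc _ ≤ fn (Gᵀ * A * H) + fn (Gᵀ * (At - A * H)) := fn_add_le _ _
    _ ≤ C * ε ^ 2 * C + C * ε * (4 * C ^ 4 * ε) := add_le_add (fn_mul_le_of_le h1 h.H_le)
        (fn_mul_le_of_le (by rw [fn_transpose]; exact h.G_le) h.fn_sub_le)
    _ = C ^ 2 * ε ^ 2 + 4 * (C ^ 5 * ε ^ 2) := by ring
    _ ≤ _ := by linarith

theorem fn_E_mul_le (h : Perturbed A At G E S H V C ε ν) :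
    fn (Eᵀ * At) ≤ 5 * C ^ 5 * (ν + ε * √ε) := by
  have hC := h.C_pos
  have hε := h.ε_pos
  have h0 : Eᵀ * At = (Eᵀ * A) * H + Eᵀ * (At - A * H) := by
    rw [Matrix.mul_sub, Matrix.mul_assoc]; abel
  have h1 : fn (Eᵀ * A) ≤ C * ν := by
    rw [← fn_transpose, Matrix.transpose_mul, Matrix.transpose_transpose]; exact h.AE_le
  have h3 : fn (Eᵀ * (At - A * H)) ≤ 4 * C ^ 5 * (ε * √ε) := by
    refine abs_le_of_sq_le_sq' ?_ (by positivity) |>.2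
    refine (fn_mul_sq_le _ _).trans ?_
    rw [Matrix.transpose_transpose]
    calc fn (E * Eᵀ) * fn (At - A * H) ^ 2 ≤ (C * ε) * (4 * C ^ 4 * ε) ^ 2 :=
          mul_le_mul h.E_le (pow_le_pow_left₀ (fn_nonneg _) h.fn_sub_le 2) (by positivity)
            (by positivity)
      _ = 16 * C ^ 9 * ε ^ 3 := by ring
      _ ≤ 16 * C ^ 10 * ε ^ 3 := by
          have := pow_le_pow_right₀ h.one_le (show 9 ≤ 10 by norm_num)
          have : 0 ≤ ε ^ 3 := by positivity
          nlinarith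
      _ = (4 * C ^ 5 * (ε * √ε)) ^ 2 := by
          rw [mul_pow, mul_pow, mul_pow, Real.sq_sqrt hε.le]; ring
  have h2 : C ^ 2 * ν ≤ C ^ 5 * ν :=
    mul_le_mul_of_nonneg_right (pow_le_pow_right₀ h.one_le (by norm_num)) h.pos.le
  have h4 : 0 ≤ C ^ 5 * (ε * √ε) := by positivity
  have h5 : 0 ≤ C ^ 5 * ν := mul_nonneg (by positivity) h.pos.le
  rw [h0]
  calc _ ≤ fn (Eᵀ * A * H) + fn (Eᵀ * (At - A * H)) := fn_add_le _ _
    _ ≤ C * ν * C + 4 * C ^ 5 * (ε * √ε) := add_le_add (fn_mul_le_of_le h1 h.H_le) h3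
    _ = C ^ 2 * ν + 4 * (C ^ 5 * (ε * √ε)) := by ring
    _ ≤ _ := by linarith

theorem S_le_sq (h : Perturbed A At G E S H V C ε ν) : fn S ≤ C * ε ^ 2 :=
  h.S_le.trans (mul_le_mul_of_nonneg_left
    (mul_le_of_le_one_right (sq_nonneg _) (h.le_ε.trans h.ε_le)) h.C_pos.le)

/-- The scalar product of the perturbation with a vector. -/
theorem vn_sub_mulVec_le (h : Perturbed A At G E S H V C ε ν) (hAG : fn (Aᵀ * G) ≤ C * ε ^ 2)
    {e : Fin N → ℝ} (he : vn e ≤ C) (hAe : vn (Aᵀ *ᵥ e) ≤ C * ν) (hGe : vn (Gᵀ *ᵥ e) ≤ C * ε ^ 2) :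
    vn ((At - A * H)ᵀ *ᵥ e) ≤ 13 * C ^ 8 * (√ε * ν + ε ^ 2) := by
  have hC := h.C_pos
  have hε := h.ε_pos
  have hν := h.pos
  have hpow : ∀ {a b : ℕ} {x : ℝ}, a ≤ b → 0 ≤ x → C ^ a * x ≤ C ^ b * x := fun hab hx =>
    mul_le_mul_of_nonneg_right (pow_le_pow_right₀ h.one_le hab) hx
  have h0 : (At - A * H)ᵀ *ᵥ e = Vᵀ *ᵥ ((Gᵀ * At)ᵀ *ᵥ (Aᵀ *ᵥ e) + (Atᵀ * A) *ᵥ (Gᵀ *ᵥ e) +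
      (Eᵀ * At)ᵀ *ᵥ (Eᵀ *ᵥ e) + Atᵀ *ᵥ (Sᵀ *ᵥ e)) := by
    rw [h.eq]
    simp only [Matrix.transpose_mul, Matrix.transpose_add, Matrix.transpose_transpose,
      Matrix.mulVec_mulVec, ← Matrix.add_mulVec, Matrix.mul_assoc, Matrix.mul_add]
  have e1 : vn ((Gᵀ * At)ᵀ *ᵥ (Aᵀ *ᵥ e)) ≤ 5 * C ^ 5 * ε ^ 2 * (C * ν) :=
    vn_mulVec_le_of_le (by rw [fn_transpose]; exact h.fn_G_mul_le hAG) hAe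
  have e2 : vn ((Atᵀ * A) *ᵥ (Gᵀ *ᵥ e)) ≤ C * C * (C * ε ^ 2) :=
    vn_mulVec_le_of_le (fn_mul_le_of_le (by rw [fn_transpose]; exact h.At_le) h.A_le) hGe
  have e3' : vn (Eᵀ *ᵥ e) ≤ C ^ 2 * √ε := by
    refine abs_le_of_sq_le_sq' ?_ (by positivity) |>.2
    refine (vn_mulVec_sq_le _ _).trans ?_
    rw [Matrix.transpose_transpose, mul_pow, Real.sq_sqrt hε.le]
    calc fn (E * Eᵀ) * vn e ^ 2 ≤ C * ε * C ^ 2 :=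
          mul_le_mul h.E_le (pow_le_pow_left₀ (vn_nonneg _) he 2) (by positivity) (by positivity)
      _ = C ^ 3 * ε := by ring
      _ ≤ C ^ 4 * ε := hpow (by norm_num) hε.le
      _ = _ := by ring
  have e3 : vn ((Eᵀ * At)ᵀ *ᵥ (Eᵀ *ᵥ e)) ≤ 5 * C ^ 5 * (ν + ε * √ε) * (C ^ 2 * √ε) :=
    vn_mulVec_le_of_le (by rw [fn_transpose]; exact h.fn_E_mul_le) e3'
  have e4 : vn (Atᵀ *ᵥ (Sᵀ *ᵥ e)) ≤ C * (C * ε ^ 2 * C) :=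
    vn_mulVec_le_of_le (by rw [fn_transpose]; exact h.At_le)
      (vn_mulVec_le_of_le (by rw [fn_transpose]; exact h.S_le_sq) he)
  have hsum : vn ((Gᵀ * At)ᵀ *ᵥ (Aᵀ *ᵥ e) + (Atᵀ * A) *ᵥ (Gᵀ *ᵥ e) +
      (Eᵀ * At)ᵀ *ᵥ (Eᵀ *ᵥ e) + Atᵀ *ᵥ (Sᵀ *ᵥ e)) ≤ 13 * C ^ 7 * (√ε * ν + ε ^ 2) := by
    refine (vn_add_le _ _).trans ?_
    refine (add_le_add ((vn_add_le _ _).trans (add_le_add (vn_add_le _ _) le_rfl)) le_rfl).trans ?_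
    have hs : √ε * √ε = ε := Real.mul_self_sqrt hε.le
    have g1 : 5 * C ^ 5 * ε ^ 2 * (C * ν) ≤ 5 * (C ^ 7 * ε ^ 2) := by
      have : C ^ 6 * (ε ^ 2 * ν) ≤ C ^ 7 * (ε ^ 2 * ν) := hpow (by norm_num) (by positivity)
      have h2 : C ^ 7 * (ε ^ 2 * ν) ≤ C ^ 7 * ε ^ 2 := mul_le_mul_of_nonneg_left
        (mul_le_of_le_one_right (sq_nonneg _) (h.le_ε.trans h.ε_le)) (by positivity)
      linarith
    have g2 : C * C * (C * ε ^ 2) ≤ C ^ 7 * ε ^ 2 := by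
      have := hpow (show 3 ≤ 7 by norm_num) (sq_nonneg ε)
      linarith
    have g3 : 5 * C ^ 5 * (ν + ε * √ε) * (C ^ 2 * √ε) = 5 * (C ^ 7 * (√ε * ν)) + 5 * (C ^ 7 * ε ^ 2) := by
      linear_combination (5 * C ^ 7 * ε) * hs
    have g4 : C * (C * ε ^ 2 * C) ≤ C ^ 7 * ε ^ 2 := by
      have := hpow (show 3 ≤ 7 by norm_num) (sq_nonneg ε)
      linarith
    have g5 : 0 ≤ C ^ 7 * (√ε * ν) := by positivity
    have g6 : 0 ≤ C ^ 7 * ε ^ 2 := by positivity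
    linarith
  rw [h0]
  refine (vn_mulVec_le_of_le (a := C) (by rw [fn_transpose]; exact h.V_le) hsum).trans (le_of_eq (by ring))

theorem fn_mul_sub_le (h : Perturbed A At G E S H V C ε ν) (hAG : fn (Aᵀ * G) ≤ C * ε ^ 2) :
    fn (Atᵀ * (At - A * H)) ≤ 120 * C ^ 11 * ε ^ 2 := by
  have hC := h.C_pos
  have hε := h.ε_pos
  have hν := h.pos
  have hpow : ∀ {a b : ℕ} {x : ℝ}, a ≤ b → 0 ≤ x → C ^ a * x ≤ C ^ b * x := fun hab hx =>
    mul_le_mul_of_nonneg_right (pow_le_pow_right₀ h.one_le hab) hx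
  have h0 : Atᵀ * (At - A * H) = ((Atᵀ * A) * (Gᵀ * At) + (Gᵀ * At)ᵀ * (Aᵀ * At) +
      (Eᵀ * At)ᵀ * (Eᵀ * At) + Atᵀ * (S * At)) * V := by
    rw [h.eq]
    simp only [Matrix.transpose_mul, Matrix.transpose_transpose, Matrix.mul_assoc, Matrix.mul_add,
      Matrix.add_mul]
  have hAt : fn Atᵀ ≤ C := by rw [fn_transpose]; exact h.At_le
  have hAT : fn Aᵀ ≤ C := by rw [fn_transpose]; exact h.A_le
  have e1 := fn_mul_le_of_le (fn_mul_le_of_le hAt h.A_le) (h.fn_G_mul_le hAG)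
  have e2 : fn ((Gᵀ * At)ᵀ * (Aᵀ * At)) ≤ 5 * C ^ 5 * ε ^ 2 * (C * C) :=
    fn_mul_le_of_le (by rw [fn_transpose]; exact h.fn_G_mul_le hAG) (fn_mul_le_of_le hAT h.At_le)
  have hE : fn (Eᵀ * At) ≤ 10 * C ^ 5 * ε := by
    refine h.fn_E_mul_le.trans ?_
    have hs : √ε ≤ 1 := Real.sqrt_le_one.2 h.ε_le
    have h1 : ε * √ε ≤ ε := mul_le_of_le_one_right hε.le hs
    have h2 : 0 ≤ C ^ 5 := by positivity
    nlinarith [h.le_ε, mul_le_mul_of_nonneg_left (add_le_add h.le_ε h1) h2]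
  have e3 : fn ((Eᵀ * At)ᵀ * (Eᵀ * At)) ≤ 10 * C ^ 5 * ε * (10 * C ^ 5 * ε) :=
    fn_mul_le_of_le (by rw [fn_transpose]; exact hE) hE
  have e4 := fn_mul_le_of_le hAt (fn_mul_le_of_le h.S_le_sq h.At_le)
  have hsum : fn ((Atᵀ * A) * (Gᵀ * At) + (Gᵀ * At)ᵀ * (Aᵀ * At) +
      (Eᵀ * At)ᵀ * (Eᵀ * At) + Atᵀ * (S * At)) ≤ 120 * C ^ 10 * ε ^ 2 := by
    refine (fn_add_le _ _).trans ?_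
    refine (add_le_add ((fn_add_le _ _).trans (add_le_add (fn_add_le _ _) le_rfl)) le_rfl).trans ?_
    have g1 := hpow (show 7 ≤ 10 by norm_num) (sq_nonneg ε)
    have g2 := hpow (show 3 ≤ 10 by norm_num) (sq_nonneg ε)
    have g3 : 0 ≤ C ^ 10 * ε ^ 2 := by positivity
    calc _ ≤ C * C * (5 * C ^ 5 * ε ^ 2) + 5 * C ^ 5 * ε ^ 2 * (C * C) +
          10 * C ^ 5 * ε * (10 * C ^ 5 * ε) + C * (C * ε ^ 2 * C) := by gcongr
      _ = 10 * (C ^ 7 * ε ^ 2) + 100 * (C ^ 10 * ε ^ 2) + C ^ 3 * ε ^ 2 := by ring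
      _ ≤ _ := by linarith
  rw [h0]
  exact (fn_mul_le_of_le hsum h.V_le).trans (le_of_eq (by ring))

/-- A row of the perturbation, up to its main term. -/
theorem vn_row_sub_le (h : Perturbed A At G E S H V C ε ν) (hAG : fn (Aᵀ * G) ≤ C * ε ^ 2)
    {i : Fin N} (hA : vn (A i) ≤ C * ν) (hEA : vn ((E * Eᵀ * A) i) ≤ C * (ε ^ 2 * ν))
    (hE : vn ((E * Eᵀ) i) ≤ C * (ε * ν)) :
    vn ((At - A * H) i - (G * (Aᵀ * At * V)) i) ≤ 12 * C ^ 7 * (ε ^ 2 * ν) := by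
  have hC := h.C_pos
  have hε := h.ε_pos
  have hν := h.pos
  have hpow : ∀ {a b : ℕ} {x : ℝ}, a ≤ b → 0 ≤ x → C ^ a * x ≤ C ^ b * x := fun hab hx =>
    mul_le_mul_of_nonneg_right (pow_le_pow_right₀ h.one_le hab) hx
  have hrow : ∀ {a b : ℕ} (X : Matrix (Fin N) (Fin a) ℝ) (Y : Matrix (Fin a) (Fin b) ℝ),
      (X * Y) i = Yᵀ *ᵥ (X i) := fun X Y => by
    rw [Matrix.mulVec_transpose]; rfl
  have h0 : (At - A * H) i - (G * (Aᵀ * At * V)) i =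
      Vᵀ *ᵥ ((Gᵀ * At)ᵀ *ᵥ (A i) + (Hᵀ *ᵥ (E * Eᵀ * A) i + (At - A * H)ᵀ *ᵥ ((E * Eᵀ) i)) +
        Atᵀ *ᵥ (S i)) := by
    have h1 : At - A * H - G * (Aᵀ * At * V) = (A * (Gᵀ * At) + (E * Eᵀ * A * H +
        (E * Eᵀ) * (At - A * H)) + S * At) * V := by
      rw [h.eq]
      have h2 : E * Eᵀ * A * H + E * Eᵀ * (At - A * H) = E * Eᵀ * At := by
        rw [Matrix.mul_sub, ← Matrix.mul_assoc (E * Eᵀ)]; abel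
      rw [← h.eq, h2, h.eq]
      simp only [Matrix.add_mul, Matrix.mul_assoc]
      abel
    have h2 := congrFun h1 i
    rw [hrow] at h2
    rw [← hrow, ← hrow, ← hrow, ← hrow]
    exact h2
  have e1 : vn ((Gᵀ * At)ᵀ *ᵥ (A i)) ≤ 5 * C ^ 5 * ε ^ 2 * (C * ν) :=
    vn_mulVec_le_of_le (by rw [fn_transpose]; exact h.fn_G_mul_le hAG) hA
  have e2 : vn (Hᵀ *ᵥ (E * Eᵀ * A) i) ≤ C * (C * (ε ^ 2 * ν)) :=
    vn_mulVec_le_of_le (by rw [fn_transpose]; exact h.H_le) hEA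
  have e3 : vn ((At - A * H)ᵀ *ᵥ ((E * Eᵀ) i)) ≤ 4 * C ^ 4 * ε * (C * (ε * ν)) :=
    vn_mulVec_le_of_le (by rw [fn_transpose]; exact h.fn_sub_le) hE
  have hSi : vn (S i) ≤ C * (ε ^ 2 * ν) := by
    refine le_trans ?_ h.S_le
    refine abs_le_of_sq_le_sq' ?_ (fn_nonneg _) |>.2
    rw [fn_sq_eq_sum_row]
    exact Finset.single_le_sum (f := fun i => vn (S i) ^ 2) (fun i _ => sq_nonneg _)
      (Finset.mem_univ i)
  have e4 : vn (Atᵀ *ᵥ (S i)) ≤ C * (C * (ε ^ 2 * ν)) :=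
    vn_mulVec_le_of_le (by rw [fn_transpose]; exact h.At_le) hSi
  have hsum : vn ((Gᵀ * At)ᵀ *ᵥ (A i) + (Hᵀ *ᵥ (E * Eᵀ * A) i +
      (At - A * H)ᵀ *ᵥ ((E * Eᵀ) i)) + Atᵀ *ᵥ (S i)) ≤ 12 * C ^ 6 * (ε ^ 2 * ν) := by
    refine (vn_add_le _ _).trans ?_
    refine (add_le_add ((vn_add_le _ _).trans (add_le_add le_rfl (vn_add_le _ _))) le_rfl).trans ?_
    have g0 : 0 ≤ ε ^ 2 * ν := by positivity
    have g1 := hpow (show 2 ≤ 6 by norm_num) g0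
    have g2 := hpow (show 5 ≤ 6 by norm_num) g0
    have g3 : 0 ≤ C ^ 6 * (ε ^ 2 * ν) := by positivity
    calc _ ≤ 5 * C ^ 5 * ε ^ 2 * (C * ν) + (C * (C * (ε ^ 2 * ν)) +
          4 * C ^ 4 * ε * (C * (ε * ν))) + C * (C * (ε ^ 2 * ν)) := by gcongr
      _ = 5 * (C ^ 6 * (ε ^ 2 * ν)) + 2 * (C ^ 2 * (ε ^ 2 * ν)) + 4 * (C ^ 5 * (ε ^ 2 * ν)) := by ring
      _ ≤ _ := by linarith
  rw [h0]
  exact (vn_mulVec_le_of_le (a := C) (by rw [fn_transpose]; exact h.V_le) hsum).trans (le_of_eq (by ring))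

end Perturbed

theorem fn_inv_le_of_isDiag {k : ℕ} {M : Matrix (Fin k) (Fin k) ℝ} (hM : M.IsDiag) {c : ℝ}
    (hc : 0 < c) (h : ∀ i, c ≤ M i i) : IsUnit M.det ∧ fn M⁻¹ ≤ k * c⁻¹ := by
  have h1 : M = diagonal fun i => M i i := (hM.diagonal_diag).symm
  have hne : ∀ i, M i i ≠ 0 := fun i => (hc.trans_le (h i)).ne'
  have h2 : M⁻¹ = diagonal fun i => (M i i)⁻¹ := by
    refine Matrix.inv_eq_right_inv ?_
    conv_lhs => rw [h1]
    rw [diagonal_mul_diagonal]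
    simp [hne]
  refine ⟨?_, ?_⟩
  · rw [h1, det_diagonal]
    exact (Finset.prod_ne_zero_iff.2 fun i _ => hne i).isUnit
  · rw [h2]
    refine (fn_le_sum_abs _).trans ?_
    have h3 : ∀ i, ∑ l, |diagonal (fun i => (M i i)⁻¹) i l| = (M i i)⁻¹ := fun i => by
      rw [Finset.sum_eq_single i]
      · rw [diagonal_apply_eq, abs_of_nonneg (inv_nonneg.2 (hc.le.trans (h i)))]
      · intro b _ hb; rw [diagonal_apply_ne' _ hb, abs_zero]
      · simp
    simp only [h3]
    calc _ ≤ ∑ _i : Fin k, c⁻¹ := Finset.sum_le_sum fun i _ => inv_anti₀ hc (h i)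
      _ = _ := by simp

namespace Panel

/-- Estimated loadings `L` and probabilities `p`, labelled by the true regimes. -/
structure Fitted (D : Panel Ω r)
    (L : (n : ℕ) → Ω → (j : Fin J) → Matrix (Fin (D.N n)) (Fin (r j)) ℝ) (s2 : ℕ → Ω → ℝ)
    (p : ℕ → ℕ → Ω → Fin J → ℝ)
    (P : Measure Ω) (q : Fin J → ℝ) (SigF : (j : Fin J) → Matrix (Fin (r j)) (Fin (r j)) ℝ)
    (l : Filter (ℕ × Ω)) : Prop extends D.Basic s2 P q SigF l where
  prob : ∀ᶠ x : ℕ × Ω in l, ∀ t < D.T x.1, ∀ j,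
    |p x.1 t x.2 j - D.ind x.1 j t x.2| ≤ 1 / (D.N x.1 * D.T x.1 : ℝ) ^ 2
  foc : ∀ n ω j, ∑ t : Fin (D.T n), p n t ω j • (vecMulVec (D.x n t ω) (D.x n t ω) * L n ω j) =
    (∑ t : Fin (D.T n), p n t ω j) • (L n ω j * ((L n ω j)ᵀ * L n ω j + s2 n ω • 1))
  isDiag : ∀ n ω j, ((L n ω j)ᵀ * L n ω j).IsDiag
  sorted : ∀ n ω j, Antitone fun i => ((L n ω j)ᵀ * L n ω j) i i
  diag : ∃ c C, 0 < c ∧ ∀ᶠ x : ℕ × Ω in l, ∀ j i,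
    c * D.N x.1 ≤ ((L x.1 x.2 j)ᵀ * L x.1 x.2 j) i i ∧
    ((L x.1 x.2 j)ᵀ * L x.1 x.2 j) i i ≤ C * D.N x.1
  EF : ∃ C, 0 ≤ C ∧ ∀ᶠ x : ℕ × Ω in l, ∀ j,
    fn (D.EM x.1 j x.2 * D.FM x.1 j x.2) ^ 2 ≤ C * (D.N x.1 * D.T x.1)
  loadingErr : ∃ C, 0 ≤ C ∧ ∀ᶠ x : ℕ × Ω in l, ∀ j,
    ∑ t ∈ Finset.range (D.T x.1), vn ((D.L0 x.1 j)ᵀ *ᵥ D.err x.1 t x.2) ^ 2 ≤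
      C * (D.N x.1 * D.T x.1)

/-- `X Xᵀ` over the dates of a regime, with the smoothed probabilities as weights, minus the same
with the true indicators. -/
def misfit (D : Panel Ω r) (p : ℕ → ℕ → Ω → Fin J → ℝ) (n : ℕ) (j : Fin J) (ω : Ω) :
    Matrix (Fin (D.N n)) (Fin (D.N n)) ℝ :=
  ∑ t : Fin (D.T n), (p n t ω j - D.ind n j t ω) • vecMulVec (D.x n t ω) (D.x n t ω)

theorem sum_prob_smul_vecMulVec (n : ℕ) (j : Fin J) (ω : Ω) :
    ∑ t : Fin (D.T n), p n t ω j • vecMulVec (D.x n t ω) (D.x n t ω) =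
      D.L0 n j * ((D.FM n j ω)ᵀ * D.FM n j ω) * (D.L0 n j)ᵀ +
      D.L0 n j * (D.EM n j ω * D.FM n j ω)ᵀ + D.EM n j ω * D.FM n j ω * (D.L0 n j)ᵀ +
      D.EM n j ω * (D.EM n j ω)ᵀ + D.misfit p n j ω := by
  set X := D.L0 n j * (D.FM n j ω)ᵀ + D.EM n j ω with hX
  have h1 : X * Xᵀ = D.L0 n j * ((D.FM n j ω)ᵀ * D.FM n j ω) * (D.L0 n j)ᵀ +
      D.L0 n j * (D.EM n j ω * D.FM n j ω)ᵀ + D.EM n j ω * D.FM n j ω * (D.L0 n j)ᵀ +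
      D.EM n j ω * (D.EM n j ω)ᵀ := by
    rw [hX]
    simp only [Matrix.transpose_add, Matrix.transpose_mul, Matrix.transpose_transpose,
      Matrix.add_mul, Matrix.mul_add, Matrix.mul_assoc]
    abel
  have h2 : ∀ a (t : Fin (D.T n)), X a t = D.ind n j t ω * D.x n t ω a := fun a t => by
    by_cases h : D.state n t ω = j
    · subst h
      simp only [hX, Matrix.add_apply, x, EM, Matrix.of_apply, ind, if_true, mul_one, one_mul]
      congr 1
      rw [Matrix.mul_apply]
      simp [FM, mulVec, dotProduct, ind]
    · simp [hX, FM, EM, ind, h, Matrix.mul_apply]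
  have h3 : X * Xᵀ = ∑ t : Fin (D.T n), D.ind n j t ω • vecMulVec (D.x n t ω) (D.x n t ω) := by
    ext a b
    rw [Matrix.mul_apply, Matrix.sum_apply]
    refine Finset.sum_congr rfl fun t _ => ?_
    rw [Matrix.transpose_apply, h2, h2, Matrix.smul_apply, vecMulVec_apply, smul_eq_mul,
      mul_mul_mul_comm, ind_mul_self]
  rw [← h1, h3, misfit, ← Finset.sum_add_distrib]
  refine Finset.sum_congr rfl fun t _ => ?_
  rw [← add_smul]
  congr 1
  ring

theorem gram_eq (n : ℕ) (j : Fin J) (ω : Ω) :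
    ∑ t ∈ Finset.range (D.T n), D.ind n j t ω •
      vecMulVec (D.factor n j t ω).ofLp (D.factor n j t ω).ofLp = (D.FM n j ω)ᵀ * D.FM n j ω := by
  ext a b
  rw [FM_transpose_mul_apply, Matrix.sum_apply]
  refine Finset.sum_congr rfl fun t _ => ?_
  rw [Matrix.smul_apply, vecMulVec_apply, smul_eq_mul]
  ring

theorem vecMulVec_self_fn {k : ℕ} (v : Fin k → ℝ) : fn (vecMulVec v v) = vn v ^ 2 := by
  have h : fn (vecMulVec v v) ^ 2 = (vn v ^ 2) ^ 2 := by
    rw [fn_sq_eq_sum_row, vn_sq]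
    have : ∀ i, vn (vecMulVec v v i) ^ 2 = v i ^ 2 * vn v ^ 2 := fun i => by
      have : vecMulVec v v i = v i • v := by ext b; simp [vecMulVec_apply]
      rw [this, vn_smul, mul_pow, sq_abs]
    simp only [this, ← Finset.sum_mul]
    rw [vn_sq]
    simp only [dotProduct, sq]
  exact (sq_eq_sq₀ (fn_nonneg _) (sq_nonneg _)).1 h

namespace Fitted

variable (h : D.Fitted L s2 p P q SigF l)
include h

theorem tendsto_mean_prob (j : Fin J) :
    Tendsto (fun x : ℕ × Ω => (1 / (D.T x.1 : ℝ)) * ∑ t ∈ Finset.range (D.T x.1), p x.1 t x.2 j) l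
      (𝓝 (q j)) := by
  have h0 : Tendsto (fun x : ℕ × Ω => (1 / (D.T x.1 : ℝ)) *
      ∑ t ∈ Finset.range (D.T x.1), (p x.1 t x.2 j - D.ind x.1 j t x.2)) l (𝓝 0) := by
    have hN : Tendsto (fun n => 1 / (D.N n : ℝ)) atTop (𝓝 0) :=
      (D.tendsto_N_real.inv_tendsto_atTop).congr fun n => by simp
    refine squeeze_zero_norm' ?_ (hN.comp (tendsto_fst_whp.mono_left h.le))
    filter_upwards [h.prob, h.eventually_N_pos, h.eventually_T_pos] with x hx hN hT
    have hN1 : (1 : ℝ) ≤ D.N x.1 := by exact_mod_cast hN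
    have hT1 : (1 : ℝ) ≤ D.T x.1 := by exact_mod_cast hT
    rw [Real.norm_eq_abs, abs_mul, abs_of_nonneg (by positivity : (0 : ℝ) ≤ 1 / D.T x.1)]
    calc _ ≤ 1 / (D.T x.1 : ℝ) * ∑ t ∈ Finset.range (D.T x.1), 1 / (D.N x.1 * D.T x.1 : ℝ) ^ 2 := by
          gcongr
          exact (Finset.abs_sum_le_sum_abs _ _).trans
            (Finset.sum_le_sum fun t ht => hx t (Finset.mem_range.1 ht) j)
      _ = 1 / (D.N x.1 * D.T x.1 : ℝ) ^ 2 := by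
          rw [Finset.sum_const, Finset.card_range, nsmul_eq_mul]; field_simp
      _ ≤ 1 / (D.N x.1 : ℝ) := by
          refine one_div_le_one_div_of_le hN ?_
          have : (1 : ℝ) ≤ D.N x.1 * D.T x.1 := one_le_mul_of_one_le_of_one_le hN1 hT1
          nlinarith
  refine (by simpa using (h.freq j).add h0 : Tendsto _ l _).congr fun x => ?_
  ring

theorem W_isDiag (n : ℕ) (ω : Ω) (j : Fin J) : (D.W L s2 p n ω j).IsDiag := by
  intro a b hab
  simp only [W, Matrix.smul_apply, Matrix.add_apply, h.isDiag n ω j hab, Matrix.one_apply_ne hab]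
  simp

theorem exists_W_bounds (hq : ∀ j, 0 < q j) :
    ∃ c C, 0 < c ∧ 0 ≤ C ∧ ∀ᶠ x : ℕ × Ω in l, ∀ j i,
      c ≤ D.W L s2 p x.1 x.2 j i i ∧ D.W L s2 p x.1 x.2 j i i ≤ C := by
  obtain ⟨q0, hq0, hq1⟩ := exists_pos_le_of_finite hq
  obtain ⟨c1, C1, hc1, h1⟩ := h.diag
  obtain ⟨c2, C2, hc2, h2⟩ := h.s2_bdd
  have h3 : ∀ᶠ x : ℕ × Ω in l, ∀ j, q j / 2 ≤ (1 / (D.T x.1 : ℝ)) *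
      ∑ t ∈ Finset.range (D.T x.1), p x.1 t x.2 j ∧ (1 / (D.T x.1 : ℝ)) *
      ∑ t ∈ Finset.range (D.T x.1), p x.1 t x.2 j ≤ q j + 1 :=
    eventually_all.2 fun j => ((h.tendsto_mean_prob j).eventually_const_le (half_lt_self (hq j))).and
      ((h.tendsto_mean_prob j).eventually_le_const (by linarith))
  refine ⟨q0 / 2 * c1, (∑ j, q j + 1) * (|C1| + |C2|), by positivity,
    mul_nonneg (add_nonneg (Finset.sum_nonneg fun j _ => (hq j).le) zero_le_one) (by positivity), ?_⟩
  filter_upwards [h1, h2, h3, h.eventually_N_pos] with x g1 g2 g3 hN j i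
  have hN1 : (1 : ℝ) ≤ D.N x.1 := by exact_mod_cast hN
  have e : D.W L s2 p x.1 x.2 j i i = ((1 / (D.T x.1 : ℝ)) *
      ∑ t ∈ Finset.range (D.T x.1), p x.1 t x.2 j) *
      (((L x.1 x.2 j)ᵀ * L x.1 x.2 j) i i / D.N x.1 + s2 x.1 x.2 / D.N x.1) := by
    simp only [W, Matrix.smul_apply, Matrix.add_apply, Matrix.one_apply_eq, smul_eq_mul]
    ring
  have e1 : c1 ≤ ((L x.1 x.2 j)ᵀ * L x.1 x.2 j) i i / D.N x.1 := (le_div_iff₀ hN).2 (g1 j i).1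
  have e2 : ((L x.1 x.2 j)ᵀ * L x.1 x.2 j) i i / D.N x.1 ≤ C1 := (div_le_iff₀ hN).2 (g1 j i).2
  have e3 : 0 ≤ s2 x.1 x.2 / D.N x.1 := div_nonneg (hc2.le.trans g2.1) hN.le
  have e4 : s2 x.1 x.2 / D.N x.1 ≤ |C2| := (div_le_iff₀ hN).2
    ((g2.2.trans (le_abs_self _)).trans (le_mul_of_one_le_right (abs_nonneg _) hN1))
  have e5 : q j ≤ ∑ j, q j := Finset.single_le_sum (fun j _ => (hq j).le) (Finset.mem_univ j)
  have e6 := hq1 j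
  rw [e]
  exact ⟨mul_le_mul (by linarith [(g3 j).1]) (by linarith) hc1.le (by linarith [(g3 j).1]),
    mul_le_mul (by linarith [(g3 j).2]) (by linarith [le_abs_self C1]) (by linarith)
      (by linarith)⟩

theorem exists_W_inv_bound (hq : ∀ j, 0 < q j) :
    ∃ C, 0 ≤ C ∧ ∀ᶠ x : ℕ × Ω in l, ∀ j, IsUnit (D.W L s2 p x.1 x.2 j).det ∧
      fn (D.W L s2 p x.1 x.2 j)⁻¹ ≤ C := by
  obtain ⟨c, C, hc, -, h1⟩ := h.exists_W_bounds hq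
  refine ⟨maxRank r * c⁻¹, by positivity, h1.mono fun x hx j => ?_⟩
  obtain ⟨h2, h3⟩ := fn_inv_le_of_isDiag (h.W_isDiag x.1 x.2 j) hc fun i => (hx j i).1
  refine ⟨h2, h3.trans ?_⟩
  have : (r j : ℝ) ≤ maxRank r := by exact_mod_cast Finset.le_sup (f := r) (Finset.mem_univ j)
  gcongr

theorem exists_fn_L_le : ∃ C, 0 ≤ C ∧ ∀ᶠ x : ℕ × Ω in l, ∀ j,
    fn (L x.1 x.2 j) ^ 2 ≤ C * D.N x.1 := by
  obtain ⟨c1, C1, hc1, h1⟩ := h.diag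
  refine ⟨maxRank r * |C1|, by positivity, ?_⟩
  filter_upwards [h1] with x hx j
  rw [fn_sq_eq_trace, Matrix.trace]
  have h0 : (0 : ℝ) ≤ |C1| * D.N x.1 := by positivity
  calc _ ≤ ∑ _i : Fin (r j), |C1| * D.N x.1 := Finset.sum_le_sum fun i _ => (hx j i).2.trans
        (mul_le_mul_of_nonneg_right (le_abs_self _) (Nat.cast_nonneg _))
    _ = r j * (|C1| * D.N x.1) := by simp
    _ ≤ maxRank r * (|C1| * D.N x.1) := mul_le_mul_of_nonneg_right
        (by exact_mod_cast Finset.le_sup (f := r) (Finset.mem_univ j)) h0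
    _ = _ := by ring

theorem exists_fn_misfit_le [Nonempty (Fin J)] (hΛ : D.LoadingAssumption SigL) :
    ∃ C, 0 ≤ C ∧ ∀ᶠ x : ℕ × Ω in l, ∀ j,
      fn (D.misfit p x.1 j x.2) ≤ C / (D.N x.1 * D.T x.1) := by
  obtain ⟨C, hC, h1⟩ := h.exists_sum_x_le hΛ
  refine ⟨C, hC, ?_⟩
  filter_upwards [h1, h.prob, h.eventually_N_pos, h.eventually_T_pos] with x g1 g2 hN hT j
  unfold misfit
  refine (fn_sum_le _ _).trans ?_
  calc _ ≤ ∑ t : Fin (D.T x.1), 1 / (D.N x.1 * D.T x.1 : ℝ) ^ 2 * vn (D.x x.1 t x.2) ^ 2 := by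
        refine Finset.sum_le_sum fun t _ => ?_
        rw [fn_smul, vecMulVec_self_fn]
        exact mul_le_mul_of_nonneg_right (g2 t t.2 j) (sq_nonneg _)
    _ ≤ 1 / (D.N x.1 * D.T x.1 : ℝ) ^ 2 * (C * (D.N x.1 * D.T x.1)) := by
        rw [← Finset.mul_sum]; gcongr
    _ = _ := by field_simp

theorem sub_eq (hq : ∀ j, 0 < q j) : ∀ᶠ x : ℕ × Ω in l, ∀ j,
    L x.1 x.2 j - D.L0 x.1 j * D.H L s2 p x.1 x.2 j = (1 / (D.N x.1 * D.T x.1 : ℝ)) •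
      ((D.L0 x.1 j * (D.EM x.1 j x.2 * D.FM x.1 j x.2)ᵀ +
        D.EM x.1 j x.2 * D.FM x.1 j x.2 * (D.L0 x.1 j)ᵀ +
        D.EM x.1 j x.2 * (D.EM x.1 j x.2)ᵀ + D.misfit p x.1 j x.2) * L x.1 x.2 j *
        (D.W L s2 p x.1 x.2 j)⁻¹) := by
  obtain ⟨C, -, h1⟩ := h.exists_W_inv_bound hq
  filter_upwards [h1, h.eventually_N_pos, h.eventually_T_pos] with x g1 hN hT j
  have hW := (g1 j).1
  have e1 : (D.N x.1 * D.T x.1 : ℝ) • (L x.1 x.2 j * D.W L s2 p x.1 x.2 j) =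
      (∑ t : Fin (D.T x.1), p x.1 t x.2 j • vecMulVec (D.x x.1 t x.2) (D.x x.1 t x.2)) *
        L x.1 x.2 j := by
    rw [Matrix.sum_mul]
    simp only [Matrix.smul_mul]
    have h2 : (D.N x.1 * D.T x.1 : ℝ) • D.W L s2 p x.1 x.2 j = (∑ t : Fin (D.T x.1), p x.1 t x.2 j) •
        ((L x.1 x.2 j)ᵀ * L x.1 x.2 j + s2 x.1 x.2 • 1) := by
      rw [← Finset.sum_range fun t => p x.1 t x.2 j]
      ext a b
      simp only [W, Matrix.smul_apply, Matrix.add_apply, smul_eq_mul]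
      field_simp
    rw [h.foc x.1 x.2 j, ← Matrix.mul_smul, h2, Matrix.mul_smul]
  have e2 : (D.N x.1 * D.T x.1 : ℝ) • (D.H L s2 p x.1 x.2 j * D.W L s2 p x.1 x.2 j) =
      ((D.FM x.1 j x.2)ᵀ * D.FM x.1 j x.2) * ((D.L0 x.1 j)ᵀ * L x.1 x.2 j) := by
    rw [H, gram_eq, Matrix.nonsing_inv_mul_cancel_right _ _ hW, Matrix.smul_mul, Matrix.mul_smul,
      smul_smul, smul_smul]
    rw [show (D.N x.1 * D.T x.1 * (1 / D.T x.1) * (1 / D.N x.1) : ℝ) = 1 by field_simp, one_smul]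
  have e3 : (D.N x.1 * D.T x.1 : ℝ) • ((L x.1 x.2 j - D.L0 x.1 j * D.H L s2 p x.1 x.2 j) *
      D.W L s2 p x.1 x.2 j) = (D.L0 x.1 j * (D.EM x.1 j x.2 * D.FM x.1 j x.2)ᵀ +
        D.EM x.1 j x.2 * D.FM x.1 j x.2 * (D.L0 x.1 j)ᵀ +
        D.EM x.1 j x.2 * (D.EM x.1 j x.2)ᵀ + D.misfit p x.1 j x.2) * L x.1 x.2 j := by
    rw [Matrix.sub_mul, smul_sub, e1, Matrix.mul_assoc, ← Matrix.mul_smul, e2,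
      sum_prob_smul_vecMulVec]
    simp only [Matrix.add_mul, Matrix.mul_assoc]
    abel
  rw [← e3, Matrix.smul_mul, Matrix.mul_nonsing_inv_cancel_right _ _ hW, smul_smul]
  rw [show (1 / (D.N x.1 * D.T x.1) * (D.N x.1 * D.T x.1) : ℝ) = 1 by field_simp, one_smul]

end Fitted

theorem fn_le_of_sq_le {m k : ℕ} {A : Matrix (Fin m) (Fin k) ℝ} {C a : ℝ} (hC : 0 ≤ C)
    (h : fn A ^ 2 ≤ C * a) : fn A ≤ √C * √a := by
  rw [← Real.sqrt_mul hC]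
  exact Real.le_sqrt_of_sq_le h

/-- The normalized product of errors and factors. -/
def scaledEF (D : Panel Ω r) (n : ℕ) (j : Fin J) (ω : Ω) : Matrix (Fin (D.N n)) (Fin (r j)) ℝ :=
  (1 / (√(D.N n : ℝ) * D.T n)) • (D.EM n j ω * D.FM n j ω)

/-- The normalized errors. -/
def scaledE (D : Panel Ω r) (n : ℕ) (j : Fin J) (ω : Ω) : Matrix (Fin (D.N n)) (Fin (D.T n)) ℝ :=
  (1 / (√(D.N n : ℝ) * √(D.T n : ℝ))) • D.EM n j ω

theorem one_div_sqrt_T_le {n : ℕ} (h : 0 < D.δ n) : 1 / √(D.T n : ℝ) ≤ 1 / D.δ n :=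
  one_div_le_one_div_of_le h (min_le_right _ _)

theorem one_div_sqrt_N_le {n : ℕ} (h : 0 < D.δ n) : 1 / √(D.N n : ℝ) ≤ 1 / D.δ n :=
  one_div_le_one_div_of_le h (min_le_left _ _)

theorem scaledE_mul_transpose (n : ℕ) (j : Fin J) (ω : Ω) :
    D.scaledE n j ω * (D.scaledE n j ω)ᵀ =
      (1 / (D.N n * D.T n : ℝ)) • (D.EM n j ω * (D.EM n j ω)ᵀ) := by
  unfold scaledE
  rw [Matrix.transpose_smul, Matrix.smul_mul, Matrix.mul_smul, smul_smul]
  congr 1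
  rw [div_mul_div_comm, mul_mul_mul_comm, Real.mul_self_sqrt (Nat.cast_nonneg _),
    Real.mul_self_sqrt (Nat.cast_nonneg _), one_mul]

theorem fn_transpose_mul_EM_sq (n : ℕ) (j : Fin J) (ω : Ω) {k : ℕ}
    (A : Matrix (Fin (D.N n)) (Fin k) ℝ) :
    fn (Aᵀ * D.EM n j ω) ^ 2 ≤ ∑ t ∈ Finset.range (D.T n), vn (Aᵀ *ᵥ D.err n t ω) ^ 2 := by
  rw [fn_sq_eq_sum_col, Finset.sum_range]
  refine Finset.sum_le_sum fun t _ => ?_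
  have : (fun i => (Aᵀ * D.EM n j ω) i t) = D.ind n j t ω • (Aᵀ *ᵥ D.err n t ω) := by
    ext i
    simp only [Matrix.mul_apply, EM, Matrix.of_apply, Pi.smul_apply, smul_eq_mul, mulVec,
      dotProduct, err, Finset.mul_sum]
    exact Finset.sum_congr rfl fun a _ => by ring
  rw [this, vn_smul, mul_pow, sq_abs]
  refine mul_le_of_le_one_left (sq_nonneg _) ?_
  exact pow_le_one₀ (D.ind_nonneg _ _ _ _) (D.ind_le_one _ _ _ _)

theorem fn_scaledEF_le {n : ℕ} {j : Fin J} {ω : Ω} {C : ℝ} (hC : 0 ≤ C) (hN : 0 < (D.N n : ℝ))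
    (hT : 0 < (D.T n : ℝ)) (h : fn (D.EM n j ω * D.FM n j ω) ^ 2 ≤ C * (D.N n * D.T n)) :
    fn (D.scaledEF n j ω) ≤ √C * (1 / √(D.T n : ℝ)) := by
  have hsN := Real.sqrt_pos.2 hN
  have hsT := Real.sqrt_pos.2 hT
  rw [scaledEF, fn_smul, abs_of_pos (by positivity)]
  refine (mul_le_mul_of_nonneg_left (fn_le_of_sq_le hC h) (by positivity)).trans (le_of_eq ?_)
  rw [Real.sqrt_mul hN.le]
  nth_rw 1 [← Real.mul_self_sqrt hT.le]
  field_simp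

theorem fn_loading_scaledEF_le {n : ℕ} {j : Fin J} {ω : Ω} {C : ℝ} (hC : 0 ≤ C)
    (hδ : 0 < D.δ n) (hN : 0 < (D.N n : ℝ)) (hT : 0 < (D.T n : ℝ))
    (h : fn ((D.L0 n j)ᵀ * (D.EM n j ω * D.FM n j ω)) ^ 2 ≤ C * (D.N n * D.T n)) :
    fn (((1 / √(D.N n : ℝ)) • D.L0 n j)ᵀ * D.scaledEF n j ω) ≤ √C * (1 / D.δ n) ^ 2 := by
  have hsN := Real.sqrt_pos.2 hN
  have hsT := Real.sqrt_pos.2 hT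
  rw [scaledEF, Matrix.transpose_smul, Matrix.smul_mul, Matrix.mul_smul, smul_smul, fn_smul,
    abs_of_pos (by positivity)]
  refine (mul_le_mul_of_nonneg_left (fn_le_of_sq_le hC h) (by positivity)).trans ?_
  have e : 1 / √(D.N n : ℝ) * (1 / (√(D.N n : ℝ) * D.T n)) * (√C * √(D.N n * D.T n : ℝ)) =
      √C * (1 / √(D.N n : ℝ) * (1 / √(D.T n : ℝ))) := by
    rw [Real.sqrt_mul hN.le]
    nth_rw 1 [← Real.mul_self_sqrt hT.le]
    field_simp
  rw [e, sq]
  have h1 := one_div_sqrt_N_le hδ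
  have h2 := one_div_sqrt_T_le hδ
  gcongr

namespace Fitted

theorem exists_perturbed [Nonempty (Fin J)] (h : D.Fitted L s2 p P q SigF l) (hq : ∀ j, 0 < q j)
    (hΛ : D.LoadingAssumption SigL) :
    ∃ C, 0 ≤ C ∧ ∀ᶠ x : ℕ × Ω in l, ∀ j, ∀ K, C ≤ K →
      Perturbed ((1 / √(D.N x.1 : ℝ)) • D.L0 x.1 j) ((1 / √(D.N x.1 : ℝ)) • L x.1 x.2 j)
        (D.scaledEF x.1 j x.2) (D.scaledE x.1 j x.2)
        ((1 / (D.N x.1 * D.T x.1 : ℝ)) • D.misfit p x.1 j x.2)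
        (D.H L s2 p x.1 x.2 j) (D.W L s2 p x.1 x.2 j)⁻¹ K (1 / D.δ x.1)
        (1 / √(D.N x.1 : ℝ)) := by
  obtain ⟨C1, hC1, h1⟩ := exists_fn_L0_le hΛ
  obtain ⟨C2, hC2, h2⟩ := h.exists_fn_L_le
  obtain ⟨C3, hC3, h3⟩ := h.exists_W_inv_bound hq
  obtain ⟨C4, hC4, h4⟩ := h.EF
  obtain ⟨C5, hC5, h5⟩ := h.EE
  obtain ⟨C6, hC6, h6⟩ := h.exists_fn_misfit_le hΛ
  obtain ⟨C7, hC7, h7⟩ := h.loadingErr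
  obtain ⟨C8, hC8, h8⟩ : ∃ C, 0 ≤ C ∧ ∀ᶠ x : ℕ × Ω in l, ∀ j, fn ((1 / (D.T x.1 : ℝ)) •
      ((D.FM x.1 j x.2)ᵀ * D.FM x.1 j x.2)) ≤ C * 1 := by
    refine exists_bound_forall (Eventually.of_forall fun _ => zero_le_one) fun j => ?_
    have hc : Continuous fun A : Matrix (Fin (r j)) (Fin (r j)) ℝ => fn A := by
      unfold fn; fun_prop
    have := (hc.tendsto _).comp (h.gramF j)
    refine ⟨fn (q j • SigF j) + 1, add_nonneg (fn_nonneg _) zero_le_one, ?_⟩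
    filter_upwards [this.eventually_le_const (lt_add_one _)] with x hx
    simpa using hx
  have hC0 : 0 ≤ C8 * (√C1 * √C2) * C3 := by positivity
  refine ⟨1 + √C1 + √C2 + C3 + √C4 + C5 + C6 + √C7 + C8 * (√C1 * √C2) * C3, by positivity, ?_⟩
  filter_upwards [h2, h3, h4, h5, h6, h7, h8, h.sub_eq hq, h.eventually_δ, h.eventually_N_pos,
    h.eventually_T_pos] with x g2 g3 g4 g5 g6 g7 g8 g9 hδ1 hN hT j K hK
  have hsN := Real.sqrt_pos.2 hN
  have hsT := Real.sqrt_pos.2 hT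
  have hδ : 0 < D.δ x.1 := one_pos.trans_le hδ1
  have n1 := Real.sqrt_nonneg C1
  have n2 := Real.sqrt_nonneg C2
  have n4 := Real.sqrt_nonneg C4
  have n7 := Real.sqrt_nonneg C7
  have hN1 : (1 : ℝ) ≤ D.N x.1 := by exact_mod_cast hN
  have hT1 : (1 : ℝ) ≤ D.T x.1 := by exact_mod_cast hT
  have hscale : ∀ {C : ℝ} {A : Matrix (Fin (D.N x.1)) (Fin (r j)) ℝ}, 0 ≤ C →
      fn A ^ 2 ≤ C * D.N x.1 → fn ((1 / √(D.N x.1 : ℝ)) • A) ≤ √C := fun hC hA => by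
    rw [fn_smul, abs_of_pos (by positivity), one_div, inv_mul_le_iff₀ hsN]
    exact (fn_le_of_sq_le hC hA).trans (le_of_eq (mul_comm _ _))
  have bA := hscale hC1 (h1 x.1 j)
  have bL := hscale hC2 (g2 j)
  refine
    { eq := ?_
      one_le := by linarith
      pos := by positivity
      le_ε := one_div_sqrt_N_le hδ
      ε_le := (div_le_one hδ).2 hδ1
      A_le := bA.trans (by linarith)
      At_le := bL.trans (by linarith)
      H_le := ?_
      V_le := (g3 j).2.trans (by linarith)
      G_le := ?_
      E_le := ?_
      S_le := ?_
      AE_le := ?_ }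
  · rw [Matrix.smul_mul, ← smul_sub, g9 j, scaledE_mul_transpose, scaledEF]
    simp only [Matrix.transpose_smul, Matrix.smul_mul, Matrix.mul_smul, smul_smul]
    rw [show ((1 / √(D.N x.1 : ℝ)) * (1 / (√(D.N x.1 : ℝ) * D.T x.1)) : ℝ) =
        1 / (D.N x.1 * D.T x.1) by
      rw [div_mul_div_comm, ← mul_assoc, Real.mul_self_sqrt hN.le, one_mul]]
    rw [mul_comm (1 / (√(D.N x.1 : ℝ) * D.T x.1)),
      show ((1 / √(D.N x.1 : ℝ)) * (1 / (√(D.N x.1 : ℝ) * D.T x.1)) : ℝ) =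
        1 / (D.N x.1 * D.T x.1) by
      rw [div_mul_div_comm, ← mul_assoc, Real.mul_self_sqrt hN.le, one_mul]]
    simp only [← smul_add, Matrix.smul_mul, smul_smul]
  · have e : D.H L s2 p x.1 x.2 j = ((1 / (D.T x.1 : ℝ)) • ((D.FM x.1 j x.2)ᵀ * D.FM x.1 j x.2)) *
        (((1 / √(D.N x.1 : ℝ)) • D.L0 x.1 j)ᵀ * ((1 / √(D.N x.1 : ℝ)) • L x.1 x.2 j)) *
        (D.W L s2 p x.1 x.2 j)⁻¹ := by
      rw [H, gram_eq]
      congr 2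
      rw [Matrix.transpose_smul, Matrix.smul_mul, Matrix.mul_smul, smul_smul, div_mul_div_comm,
        Real.mul_self_sqrt hN.le, one_mul]
    rw [e]
    refine (fn_mul_le_of_le (fn_mul_le_of_le ((g8 j).trans (le_of_eq (mul_one _)))
      (fn_mul_le_of_le (a := √C1) (by rw [fn_transpose]; exact bA) bL)) (g3 j).2).trans (by linarith)
  · refine (fn_scaledEF_le hC4 hN hT (g4 j)).trans ?_
    exact mul_le_mul (by linarith) (one_div_sqrt_T_le hδ) (by positivity) (by linarith)
  · rw [scaledE_mul_transpose, fn_smul, abs_of_pos (by positivity)]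
    refine (mul_le_mul_of_nonneg_left (g5 j) (by positivity)).trans ?_
    rw [show 1 / (D.N x.1 * D.T x.1 : ℝ) * (C5 * (D.N x.1 * D.T x.1 / D.δ x.1)) =
      C5 * (1 / D.δ x.1) by field_simp]
    exact mul_le_mul_of_nonneg_right (by linarith) (by positivity)
  · rw [fn_smul, abs_of_pos (by positivity)]
    refine (mul_le_mul_of_nonneg_left (g6 j) (by positivity)).trans ?_
    rw [show 1 / (D.N x.1 * D.T x.1 : ℝ) * (C6 / (D.N x.1 * D.T x.1)) =
      C6 * (1 / (D.N x.1 * D.T x.1 : ℝ) ^ 2) by field_simp]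
    refine mul_le_mul (by linarith) ?_ (by positivity) (by linarith)
    rw [_root_.one_div_pow, div_mul_div_comm, one_mul]
    refine one_div_le_one_div_of_le (by positivity) ?_
    have e1 := D.δ_sq_le_N x.1
    have e2 : √(D.N x.1 : ℝ) ≤ D.N x.1 := Real.sqrt_le_iff.2 ⟨hN.le, by nlinarith⟩
    calc D.δ x.1 ^ 2 * √(D.N x.1 : ℝ) ≤ D.N x.1 * D.N x.1 := by gcongr
      _ ≤ (D.N x.1 * D.T x.1) * (D.N x.1 * D.T x.1) := by
          have : (D.N x.1 : ℝ) ≤ D.N x.1 * D.T x.1 := le_mul_of_one_le_right hN.le hT1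
          gcongr
      _ = _ := by ring
  · rw [scaledE, Matrix.transpose_smul, Matrix.smul_mul, Matrix.mul_smul, smul_smul, fn_smul,
      abs_of_pos (by positivity)]
    refine (mul_le_mul_of_nonneg_left (fn_le_of_sq_le hC7
      ((fn_transpose_mul_EM_sq x.1 j x.2 (D.L0 x.1 j)).trans (g7 j))) (by positivity)).trans ?_
    rw [Real.sqrt_mul hN.le, show 1 / √(D.N x.1 : ℝ) * (1 / (√(D.N x.1 : ℝ) * √(D.T x.1 : ℝ))) *
      (√C7 * (√(D.N x.1 : ℝ) * √(D.T x.1 : ℝ))) = √C7 * (1 / √(D.N x.1 : ℝ)) by field_simp]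
    exact mul_le_mul_of_nonneg_right (by linarith) (by positivity)

end Fitted

end Panel

/-! ### Limits of the eigenvalues and of the rotations -/

theorem exists_tendsto_of_fn_le {α : Type*} {u : Ultrafilter α} {m k : ℕ}
    {X : α → Matrix (Fin m) (Fin k) ℝ} {C : ℝ} (h : ∀ᶠ x in (u : Filter α), fn (X x) ≤ C) :
    ∃ M, Tendsto X u (𝓝 M) := by
  have h1 : ∀ i j, ∃ c, Tendsto (fun x => X x i j) u (𝓝 c) := fun i j => by
    have h2 : (↑(u.map fun x => X x i j) : Filter ℝ) ≤ 𝓟 (Set.Icc (-C) C) := by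
      refine le_principal_iff.2 ?_
      change ∀ᶠ x in (u : Filter α), X x i j ∈ Set.Icc (-C) C
      filter_upwards [h] with x hx
      exact abs_le.1 ((abs_le_fn _ _ _).trans hx)
    obtain ⟨c, -, hc⟩ := isCompact_Icc.ultrafilter_le_nhds _ h2
    exact ⟨c, hc⟩
  choose M hM using h1
  exact ⟨M, tendsto_pi_nhds.2 fun i => tendsto_pi_nhds.2 fun j => hM i j⟩

theorem tendsto_zero_of_fn_le {α : Type*} {l : Filter α} {m k : ℕ}
    {X : α → Matrix (Fin m) (Fin k) ℝ} {a : α → ℝ} (h : ∀ᶠ x in l, fn (X x) ≤ a x)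
    (ha : Tendsto a l (𝓝 0)) : Tendsto X l (𝓝 0) :=
  tendsto_pi_nhds.2 fun i => tendsto_pi_nhds.2 fun j =>
    squeeze_zero_norm' (h.mono fun _ hx => (abs_le_fn _ i j).trans hx) ha

theorem tendsto_matrix_inv {α : Type*} {l : Filter α} {k : ℕ} {X : α → Matrix (Fin k) (Fin k) ℝ}
    {M : Matrix (Fin k) (Fin k) ℝ} (h : Tendsto X l (𝓝 M)) (hM : IsUnit M.det) :
    Tendsto (fun x => (X x)⁻¹) l (𝓝 M⁻¹) := by
  simp only [Matrix.inv_def, Ring.inverse_eq_inv']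
  exact (((continuous_id.matrix_det.tendsto M).comp h).inv₀ hM.ne_zero).smul
    ((continuous_id.matrix_adjugate.tendsto M).comp h)

namespace EigenData

variable {J : ℕ} {r : Fin J → ℕ} {SigF SigL : (j : Fin J) → Matrix (Fin (r j)) (Fin (r j)) ℝ}
  (E : EigenData SigF SigL) (j : Fin J)

theorem root_transpose : (E.root j)ᵀ = E.root j := by
  have := (E.root_posDef j).1
  rwa [Matrix.IsHermitian, conjTranspose_eq_transpose_of_trivial] at this

theorem isUnit_det_root : IsUnit (E.root j).det := (E.root_posDef j).det_pos.ne'.isUnit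

theorem Υ_mul_transpose : E.Υ j * (E.Υ j)ᵀ = 1 := mul_eq_one_comm.1 (E.orthonormal j)

include E in
theorem diagonal_eq : Matrix.diagonal (E.v j) =
    (E.root j * E.Υ j)ᵀ * SigF j * (E.root j * E.Υ j) := by
  have h := congrArg (fun X => (E.Υ j)ᵀ * X * E.Υ j) (E.spectral j)
  simp only [Matrix.mul_assoc] at h
  rw [E.orthonormal j, Matrix.mul_one, ← Matrix.mul_assoc (E.Υ j)ᵀ (E.Υ j), E.orthonormal j,
    Matrix.one_mul] at h
  rw [← h, Matrix.transpose_mul, E.root_transpose]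
  simp only [Matrix.mul_assoc]

theorem isUnit_det_root_mul : IsUnit (E.root j * E.Υ j).det := by
  rw [det_mul]
  refine (E.isUnit_det_root j).mul ?_
  have := congrArg det (E.orthonormal j)
  rw [det_mul, det_one] at this
  exact .of_mul_eq_one_right _ this

theorem v_pos (hF : (SigF j).PosDef) (i : Fin (r j)) : 0 < E.v j i := by
  have h : (Matrix.diagonal (E.v j)).PosDef := by
    rw [E.diagonal_eq, ← conjTranspose_eq_transpose_of_trivial]
    exact hF.conjTranspose_mul_mul_same
      (Matrix.mulVec_injective_iff_isUnit.2 ((Matrix.isUnit_iff_isUnit_det _).2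
        (E.isUnit_det_root_mul j)))
  exact Matrix.posDef_diagonal_iff.1 h i

theorem limitH_eq {V : Matrix (Fin (r j)) (Fin (r j)) ℝ} {A : Matrix (Fin (r j)) (Fin (r j)) ℝ}
    {c : ℝ} (hc : 0 < c) (h1 : A * V = c • (SigF j * (SigL j * A)))
    (h2 : V = c • ((SigL j * A)ᵀ * A)) (hd : V.IsDiag) (ha : Antitone fun i => V i i)
    (hpos : ∀ i, 0 < V i i) (hs : ∀ i, 0 ≤ ((E.Υ j)ᵀ * (E.root j)⁻¹ * (SigL j * A)) i i) :
    V = c • Matrix.diagonal (E.v j) ∧ A = E.limitH j := by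
  set R := E.root j with hR
  set U := E.Υ j with hU
  have hRu := E.isUnit_det_root j
  have hRt : Rᵀ = R := E.root_transpose j
  have hUU : U * Uᵀ = 1 := E.Υ_mul_transpose j
  have hUU' : Uᵀ * U = 1 := E.orthonormal j
  set M := Uᵀ * R * A with hM
  have hS : SigL j = R * R := (E.root_sq j).symm
  have hA : A = R⁻¹ * U * M := by
    rw [hM]
    calc A = R⁻¹ * R * A := by rw [Matrix.nonsing_inv_mul _ hRu, Matrix.one_mul]
      _ = R⁻¹ * (U * Uᵀ) * R * A := by rw [hUU, Matrix.mul_one]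
      _ = _ := by simp only [Matrix.mul_assoc]
  have hMV : M * V = c • (Matrix.diagonal (E.v j) * M) := by
    calc M * V = Uᵀ * R * (A * V) := by rw [hM, Matrix.mul_assoc]
      _ = c • (Uᵀ * (R * SigF j * R) * (R * A)) := by
          rw [h1, hS, Matrix.mul_smul]; simp only [Matrix.mul_assoc]
      _ = c • ((Uᵀ * U) * Matrix.diagonal (E.v j) * (Uᵀ * R * A)) := by
          rw [E.spectral j]; simp only [Matrix.mul_assoc, hU]
      _ = _ := by rw [hUU', Matrix.one_mul]
  have hMM : V = c • (Mᵀ * M) := by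
    rw [h2, hM, hS]
    congr 1
    simp only [Matrix.transpose_mul, Matrix.transpose_transpose, hRt]
    calc _ = Aᵀ * R * 1 * R * A := by simp only [Matrix.mul_assoc, Matrix.one_mul]
      _ = _ := by rw [← hUU]; simp only [Matrix.mul_assoc]
  have hsM : ∀ i, 0 ≤ M i i := fun i => by
    have e : Uᵀ * R⁻¹ * (SigL j * A) = M := by
      rw [hM, hS]
      calc _ = Uᵀ * (R⁻¹ * R) * R * A := by simp only [Matrix.mul_assoc]
        _ = _ := by rw [Matrix.nonsing_inv_mul _ hRu, Matrix.mul_one]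
    have := hs i
    rwa [e] at this
  have hVd : V = Matrix.diagonal fun i => V i i := hd.diagonal_diag.symm
  have hab : ∀ a b, M a b ≠ 0 → V b b = c * E.v j a := fun a b hne => by
    have := congrFun (congrFun hMV a) b
    rw [hVd, Matrix.mul_diagonal, Matrix.smul_apply, Matrix.diagonal_mul, smul_eq_mul] at this
    have h3 : M a b * (V b b - c * E.v j a) = 0 := by linear_combination this
    linarith [(mul_eq_zero.1 h3).resolve_left hne]
  have hbb : ∀ b b', V b b' = c * ∑ a, M a b * M a b' := fun b b' => by
    conv_lhs => rw [hMM]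
    simp [Matrix.mul_apply]
  have hex : ∀ b, ∃ a, M a b ≠ 0 := fun b => by
    by_contra! h
    have := hpos b
    rw [hbb] at this
    simp [h] at this
  choose f hf using hex
  have huniq : ∀ a b, a ≠ f b → M a b = 0 := fun a b hne => by
    by_contra h
    have h3 := hab a b h
    rw [hab _ b (hf b)] at h3
    exact hne ((E.v_strictAnti j).injective (mul_left_cancel₀ hc.ne' h3)).symm
  have hinj : Function.Injective f := fun b b' he => by
    by_contra hne
    have h3 := hbb b b'
    rw [hd hne, Finset.sum_eq_single (f b)] at h3
    · have h4 := hf b'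
      rw [← he] at h4
      exact mul_ne_zero hc.ne' (mul_ne_zero (hf b) h4) h3.symm
    · intro a _ ha; rw [huniq a b ha, zero_mul]
    · simp
  have hmono : Monotone f := fun b b' hb => by
    have h3 := ha hb
    simp only [hab _ _ (hf b), hab _ _ (hf b')] at h3
    exact (E.v_strictAnti j).le_iff_ge.1 (le_of_mul_le_mul_left h3 hc)
  have hid : f = id := by
    exact (hmono.strictMono_of_injective hinj).eq_id
  have hV : ∀ b, V b b = c * E.v j b := fun b => by
    have := hab _ b (hf b)
    rwa [hid] at this
  have hoff : ∀ a b, a ≠ b → M a b = 0 := fun a b hne => huniq a b (by rw [hid]; exact hne)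
  have hMd : M = Matrix.diagonal fun l => √(E.v j l) := by
    ext a b
    by_cases h : a = b
    · subst h
      rw [Matrix.diagonal_apply_eq]
      have h3 := hbb a a
      rw [Finset.sum_eq_single a (fun x _ hx => by rw [hoff x a hx, zero_mul]) (by simp), hV] at h3
      rw [mul_left_cancel₀ hc.ne' h3, Real.sqrt_mul_self (hsM a)]
    · rw [Matrix.diagonal_apply_ne _ h, hoff a b h]
  refine ⟨?_, ?_⟩
  · rw [hVd]
    ext a b
    by_cases h : a = b
    · subst h; simp [hV]
    · simp [h]
  · rw [limitH, ← hMd]; exact hA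

theorem isUnit_det_limitH (hF : (SigF j).PosDef) : IsUnit (E.limitH j).det := by
  have h1 := E.isUnit_det_root_mul j
  rw [det_mul] at h1
  rw [limitH, det_mul, det_mul, det_diagonal]
  refine (((Matrix.isUnit_nonsing_inv_det_iff).2 (E.isUnit_det_root j)).mul
    (isUnit_of_mul_isUnit_right h1)).mul ?_
  exact (Finset.prod_ne_zero_iff.2 fun i _ => (Real.sqrt_pos.2 (E.v_pos j hF i)).ne').isUnit

end EigenData

namespace Panel

namespace Fitted

variable [Nonempty (Fin J)] (h : D.Fitted L s2 p P q SigF l) (hq : ∀ j, 0 < q j)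
  (hΛ : D.LoadingAssumption SigL)
include h hq hΛ

theorem exists_fn_sub_le : ∃ C, 0 ≤ C ∧ ∀ᶠ x : ℕ × Ω in l, ∀ j,
    fn (L x.1 x.2 j - D.L0 x.1 j * D.H L s2 p x.1 x.2 j) ≤
      C * (√(D.N x.1 : ℝ) * (1 / D.δ x.1)) := by
  obtain ⟨C, hC, h1⟩ := h.exists_perturbed hq hΛ
  refine ⟨4 * C ^ 4, by positivity, ?_⟩
  filter_upwards [h1, h.eventually_N_pos] with x hx hN j
  have h2 := (hx j C le_rfl).fn_sub_le
  have hs := Real.sqrt_pos.2 hN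
  rw [Matrix.smul_mul, ← smul_sub, fn_smul, abs_of_pos (by positivity), one_div,
    inv_mul_le_iff₀ hs] at h2
  exact h2.trans (le_of_eq (by ring))

theorem tendsto_gram_sub (j : Fin J) :
    Tendsto (fun x : ℕ × Ω => (1 / (D.N x.1 : ℝ)) • ((D.L0 x.1 j)ᵀ *
      (L x.1 x.2 j - D.L0 x.1 j * D.H L s2 p x.1 x.2 j))) l (𝓝 0) ∧
    Tendsto (fun x : ℕ × Ω => (1 / (D.N x.1 : ℝ)) • ((L x.1 x.2 j)ᵀ *
      (L x.1 x.2 j - D.L0 x.1 j * D.H L s2 p x.1 x.2 j))) l (𝓝 0) := by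
  obtain ⟨C, hC, h1⟩ := h.exists_fn_sub_le hq hΛ
  obtain ⟨C1, hC1, h2⟩ := exists_fn_L0_le hΛ
  obtain ⟨C2, hC2, h3⟩ := h.exists_fn_L_le
  have hδ := D.tendsto_inv_δ.comp (tendsto_fst_whp.mono_left h.le)
  have key : ∀ {K : ℝ} {X : ℕ × Ω → Matrix (Fin (r j)) (Fin (r j)) ℝ}, 0 ≤ K →
      (∀ᶠ x in l, fn (X x) ≤ √K * √(D.N x.1 : ℝ) * (C * (√(D.N x.1 : ℝ) * (1 / D.δ x.1)))) →
      Tendsto (fun x : ℕ × Ω => (1 / (D.N x.1 : ℝ)) • X x) l (𝓝 0) := fun {K X} _ hX => by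
    refine tendsto_zero_of_fn_le (a := fun x => √K * C * (1 / D.δ x.1)) ?_
      (by simpa using hδ.const_mul (√K * C))
    filter_upwards [hX, h.eventually_N_pos] with x hx hN
    rw [fn_smul, abs_of_pos (by positivity), one_div, inv_mul_le_iff₀ hN]
    refine hx.trans (le_of_eq ?_)
    linear_combination (√K * C * (1 / D.δ x.1)) * Real.mul_self_sqrt hN.le
  refine ⟨key hC1 ?_, key hC2 ?_⟩
  · filter_upwards [h1] with x hx
    exact fn_mul_le_of_le (by rw [fn_transpose]; exact fn_le_of_sq_le hC1 (h2 x.1 j)) (hx j)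
  · filter_upwards [h1, h3] with x hx h3
    exact fn_mul_le_of_le (by rw [fn_transpose]; exact fn_le_of_sq_le hC2 (h3 j)) (hx j)

theorem tendsto_cross {j : Fin J} {u : Filter (ℕ × Ω)} (hul : u ≤ l)
    {A : Matrix (Fin (r j)) (Fin (r j)) ℝ}
    (hA : Tendsto (fun x : ℕ × Ω => D.H L s2 p x.1 x.2 j) u (𝓝 A)) :
    Tendsto (fun x : ℕ × Ω => (1 / (D.N x.1 : ℝ)) • ((D.L0 x.1 j)ᵀ * L x.1 x.2 j)) u
      (𝓝 (SigL j * A)) ∧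
    Tendsto (fun x : ℕ × Ω => (1 / (D.N x.1 : ℝ)) • ((L x.1 x.2 j)ᵀ * L x.1 x.2 j)) u
      (𝓝 ((SigL j * A)ᵀ * A)) := by
  have hgL : Tendsto (fun x : ℕ × Ω => (1 / (D.N x.1 : ℝ)) • ((D.L0 x.1 j)ᵀ * D.L0 x.1 j)) u
    (𝓝 (SigL j)) := (tendsto_gramL hΛ j).comp ((tendsto_fst_whp.mono_left h.le).mono_left hul)
  have hLL : Tendsto (fun x : ℕ × Ω => (1 / (D.N x.1 : ℝ)) • ((D.L0 x.1 j)ᵀ * L x.1 x.2 j)) u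
      (𝓝 (SigL j * A)) := by
    have := ((h.tendsto_gram_sub hq hΛ j).1.mono_left hul).add (hgL.mul hA)
    rw [zero_add] at this
    refine this.congr fun x => ?_
    rw [Matrix.smul_mul, ← smul_add, Matrix.mul_assoc, ← Matrix.mul_add, sub_add_cancel]
  have hGG : Tendsto (fun x : ℕ × Ω => (1 / (D.N x.1 : ℝ)) • ((L x.1 x.2 j)ᵀ * L x.1 x.2 j)) u
      (𝓝 ((SigL j * A)ᵀ * A)) := by
    have := ((h.tendsto_gram_sub hq hΛ j).2.mono_left hul).add
      (((continuous_id.matrix_transpose.tendsto _).comp hLL).mul hA)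
    rw [zero_add] at this
    refine this.congr fun x => ?_
    simp only [Function.comp, id, Matrix.transpose_smul, Matrix.transpose_mul,
      Matrix.transpose_transpose]
    rw [Matrix.smul_mul, ← smul_add, Matrix.mul_assoc, ← Matrix.mul_add, sub_add_cancel]
  exact ⟨hLL, hGG⟩

theorem tendsto_W_H (E : EigenData SigF SigL)
    (hs : ∀ᶠ x : ℕ × Ω in l, ∀ j i, 0 ≤ ((E.Υ j)ᵀ * (E.root j)⁻¹ *
      ((D.L0 x.1 j)ᵀ * L x.1 x.2 j)) i i) (j : Fin J) :
    Tendsto (fun x : ℕ × Ω => D.W L s2 p x.1 x.2 j) l (𝓝 (q j • Matrix.diagonal (E.v j))) ∧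
    Tendsto (fun x : ℕ × Ω => D.H L s2 p x.1 x.2 j) l (𝓝 (E.limitH j)) := by
  obtain ⟨C, hC, h1⟩ := h.exists_perturbed hq hΛ
  obtain ⟨c1, C1, hc1, hC1, h2⟩ := h.exists_W_bounds hq
  obtain ⟨C3, hC3, h3⟩ := h.exists_W_inv_bound hq
  obtain ⟨c2, C2, hc2, h4⟩ := h.s2_bdd
  have hfst := tendsto_fst_whp.mono_left h.le
  have hWb : ∀ᶠ x : ℕ × Ω in l, fn (D.W L s2 p x.1 x.2 j) ≤ ∑ _i : Fin (r j), C1 := by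
    filter_upwards [h2] with x hx
    refine (fn_le_sum_abs _).trans (Finset.sum_le_sum fun i _ => ?_)
    rw [Finset.sum_eq_single i, abs_of_nonneg (hc1.le.trans (hx j i).1)]
    · exact (hx j i).2
    · intro b _ hb; rw [h.W_isDiag x.1 x.2 j hb.symm, abs_zero]
    · simp
  suffices hu : ∀ u : Ultrafilter (ℕ × Ω), ↑u ≤ l →
      Tendsto (fun x : ℕ × Ω => D.W L s2 p x.1 x.2 j) u (𝓝 (q j • Matrix.diagonal (E.v j))) ∧
      Tendsto (fun x : ℕ × Ω => D.H L s2 p x.1 x.2 j) u (𝓝 (E.limitH j)) from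
    ⟨tendsto_iff_ultrafilter _ _ _ |>.2 fun u hul => (hu u hul).1,
      tendsto_iff_ultrafilter _ _ _ |>.2 fun u hul => (hu u hul).2⟩
  intro u hul
  obtain ⟨V, hV⟩ := exists_tendsto_of_fn_le (hul hWb)
  obtain ⟨A, hA⟩ := exists_tendsto_of_fn_le (u := u) (C := C)
    (X := fun x => D.H L s2 p x.1 x.2 j) (hul (h1.mono fun x hx => (hx j C le_rfl).H_le))
  obtain ⟨hLL, hGG⟩ := h.tendsto_cross hq hΛ hul hA
  have hs2 : Tendsto (fun x : ℕ × Ω => (s2 x.1 x.2 / D.N x.1) •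
      (1 : Matrix (Fin (r j)) (Fin (r j)) ℝ)) u (𝓝 0) := by
    have h0 : Tendsto (fun x : ℕ × Ω => s2 x.1 x.2 / D.N x.1) u (𝓝 0) := by
      have hN : Tendsto (fun n => 1 / (D.N n : ℝ)) atTop (𝓝 0) :=
        (D.tendsto_N_real.inv_tendsto_atTop).congr fun n => by simp
      have := (hN.comp (hfst.mono_left hul)).const_mul C2
      rw [mul_zero] at this
      refine squeeze_zero_norm' (hul ?_) this
      filter_upwards [h4, h.eventually_N_pos] with x hx hN
      rw [Real.norm_eq_abs, abs_of_nonneg (div_nonneg (hc2.le.trans hx.1) hN.le)]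
      rw [div_eq_mul_one_div]
      exact mul_le_mul_of_nonneg_right hx.2 (by positivity)
    simpa using h0.smul_const (1 : Matrix (Fin (r j)) (Fin (r j)) ℝ)
  have e2 : V = q j • ((SigL j * A)ᵀ * A) := by
    refine tendsto_nhds_unique hV ?_
    have := ((h.tendsto_mean_prob j).mono_left hul).smul (hGG.add hs2)
    rw [add_zero] at this
    exact this
  have e1 : A * V = q j • (SigF j * (SigL j * A)) := by
    refine tendsto_nhds_unique (hA.mul hV) ?_
    have := ((h.gramF j).mono_left hul).mul hLL
    rw [Matrix.smul_mul] at this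
    refine this.congr' (hul ?_)
    filter_upwards [h3] with x hx
    rw [H, gram_eq, Matrix.nonsing_inv_mul_cancel_right _ _ (hx j).1]
  have hentry : ∀ a b, Tendsto (fun x : ℕ × Ω => D.W L s2 p x.1 x.2 j a b) u (𝓝 (V a b)) :=
    fun a b => tendsto_pi_nhds.1 (tendsto_pi_nhds.1 hV a) b
  have e3 : V.IsDiag := fun a b hab => tendsto_nhds_unique (hentry a b)
    (tendsto_const_nhds.congr fun x => (h.W_isDiag x.1 x.2 j hab).symm)
  have e4 : Antitone fun i => V i i := fun a b hab => by
    refine le_of_tendsto_of_tendsto (hentry b b) (hentry a a) (hul ?_)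
    filter_upwards [h2, (h.tendsto_mean_prob j).eventually_const_le (hq j)] with x _ hx
    simp only [W, Matrix.smul_apply, Matrix.add_apply, Matrix.one_apply_eq, smul_eq_mul]
    have := h.sorted x.1 x.2 j hab
    simp only at this
    gcongr
  have e5 : ∀ i, 0 < V i i := fun i => hc1.trans_le
    (ge_of_tendsto (hentry i i) (hul (h2.mono fun x hx => (hx j i).1)))
  have e6 : ∀ i, 0 ≤ ((E.Υ j)ᵀ * (E.root j)⁻¹ * (SigL j * A)) i i := fun i => by
    have h5 := tendsto_pi_nhds.1 (tendsto_pi_nhds.1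
      ((tendsto_const_nhds (x := (E.Υ j)ᵀ * (E.root j)⁻¹)).mul hLL) i) i
    refine ge_of_tendsto h5 (hul ?_)
    filter_upwards [hs] with x hx
    rw [Matrix.mul_smul, Matrix.smul_apply, smul_eq_mul]
    exact mul_nonneg (by positivity) (hx j i)
  obtain ⟨g1, g2⟩ := E.limitH_eq j (hq j) e1 e2 e3 e4 e5 e6
  rw [← g1, ← g2]
  exact ⟨hV, hA⟩

end Fitted

end Panel

/-! ### Relabelling and choice of signs -/

section AlignMatrix

variable {m k k' : ℕ}

/-- Reindexed columns with signs. -/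
def alignMatrix (h : k = k') (s : Fin k → ℝ) (A : Matrix (Fin m) (Fin k') ℝ) :
    Matrix (Fin m) (Fin k) ℝ :=
  Matrix.of fun i l => s l * A i (Fin.cast h l)

theorem alignMatrix_eq (h : k = k') (s : Fin k → ℝ) (A : Matrix (Fin m) (Fin k') ℝ) :
    alignMatrix h s A = alignMatrix h (fun _ => 1) A * diagonal s := by
  ext i l
  simp [alignMatrix, mul_comm]

theorem alignMatrix_gram_apply (h : k = k') (s : Fin k → ℝ) (A : Matrix (Fin m) (Fin k') ℝ)
    (a b : Fin k) : ((alignMatrix h s A)ᵀ * alignMatrix h s A) a b =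
      s a * s b * (Aᵀ * A) (Fin.cast h a) (Fin.cast h b) := by
  simp only [Matrix.mul_apply, Matrix.transpose_apply, alignMatrix, Matrix.of_apply, Finset.mul_sum]
  exact Finset.sum_congr rfl fun i _ => by ring

theorem sign_mul_self {s : ℝ} (h : s = 1 ∨ s = -1) : s * s = 1 := by
  rcases h with rfl | rfl <;> norm_num

theorem alignMatrix_foc {T : ℕ} (h : k = k') {s : Fin k → ℝ} (hs : ∀ i, s i = 1 ∨ s i = -1)
    {A : Matrix (Fin m) (Fin k') ℝ} {p : Fin T → ℝ} {S : Fin T → Matrix (Fin m) (Fin m) ℝ} {v : ℝ}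
    (hA : ∑ t, p t • (S t * A) = (∑ t, p t) • (A * (Aᵀ * A + v • 1))) :
    ∑ t, p t • (S t * alignMatrix h s A) = (∑ t, p t) •
      (alignMatrix h s A * ((alignMatrix h s A)ᵀ * alignMatrix h s A + v • 1)) := by
  subst h
  have hss : diagonal s * diagonal s = 1 := by
    rw [diagonal_mul_diagonal, ← diagonal_one]
    congr 1
    exact funext fun i => sign_mul_self (hs i)
  have e : alignMatrix rfl s A = A * diagonal s := by
    ext i l
    simp [alignMatrix, mul_comm]
  rw [e]
  have e1 : ∑ t, p t • (S t * (A * diagonal s)) = (∑ t, p t • (S t * A)) * diagonal s := by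
    rw [Matrix.sum_mul]
    simp only [Matrix.smul_mul, Matrix.mul_assoc]
  rw [e1, hA, Matrix.smul_mul]
  congr 1
  rw [Matrix.transpose_mul, Matrix.mul_assoc, Matrix.mul_assoc, Matrix.mul_add, Matrix.add_mul,
    diagonal_transpose]
  congr 1
  have e2 : diagonal s * (diagonal s * Aᵀ * (A * diagonal s)) =
      (diagonal s * diagonal s) * (Aᵀ * A * diagonal s) := by
    simp only [Matrix.mul_assoc]
  rw [e2, hss, Matrix.one_mul, Matrix.mul_smul, Matrix.mul_one, Matrix.smul_mul,
    Matrix.one_mul]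

end AlignMatrix

namespace Panel

theorem aligned_eq (π : Relabelling Ω r) (ς : Signs Ω r) (n : ℕ) (ω : Ω) (j : Fin J) :
    D.aligned π ς L n ω j =
      alignMatrix (π.rank_eq n ω j).symm (ς.sign n ω j) (L n ω (π.perm n ω j)) := rfl

theorem measurable_at_perm {n : ℕ} (π : Relabelling Ω r) (j : Fin J) {g : Fin J → Ω → ℝ}
    (hg : ∀ k, Measurable (g k)) : Measurable fun ω => g (π.perm n ω j) ω := by
  have h : ∀ ω, g (π.perm n ω j) ω = ∑ k, if π.perm n ω j = k then g k ω else 0 := fun ω => by simp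
  simp only [h]
  exact Finset.measurable_sum _ fun k _ => Measurable.ite
    (π.measurable_perm n j (measurableSet_singleton k)) (hg k) measurable_const

theorem measurable_aligned (π : Relabelling Ω r) (ς : Signs Ω r)
    (hL : ∀ n j i a, Measurable fun ω => L n ω j i a) (n : ℕ) (j : Fin J) (i : Fin (D.N n))
    (a : Fin (r j)) : Measurable fun ω => D.aligned π ς L n ω j i a := by
  have h1 : ∀ k, Measurable fun ω => if h : r j = r k then L n ω k i (Fin.cast h a) else 0 :=
    fun k => by
      by_cases h : r j = r k
      · simpa [h] using hL n k i _
      · simp [h]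
  have h2 : ∀ ω, D.aligned π ς L n ω j i a = ς.sign n ω j a *
      (if h : r j = r (π.perm n ω j) then L n ω (π.perm n ω j) i (Fin.cast h a) else 0) := fun ω => by
    simp [aligned, (π.rank_eq n ω j).symm]
  simp only [h2]
  exact (ς.measurable_sign n j a).mul (measurable_at_perm π j h1)

/-- All signs positive. -/
def posSigns (Ω : Type*) [MeasurableSpace Ω] {J : ℕ} (r : Fin J → ℕ) : Signs Ω r where
  sign _ _ _ _ := 1
  measurable_sign _ _ _ := measurable_const
  eq_one_or _ _ _ _ := Or.inl rfl

/-- Choice of signs that makes the columns of the rotated loadings point in the directions of the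
eigenvectors of the limit. -/
def eigenSigns (D : Panel Ω r) (E : EigenData SigF SigL) (π : Relabelling Ω r)
    (L : (n : ℕ) → Ω → (j : Fin J) → Matrix (Fin (D.N n)) (Fin (r j)) ℝ)
    (hL : ∀ n j i a, Measurable fun ω => L n ω j i a) : Signs Ω r where
  sign n ω j a := if 0 ≤ ((E.Υ j)ᵀ * (E.root j)⁻¹ *
    ((D.L0 n j)ᵀ * D.aligned π (posSigns Ω r) L n ω j)) a a then 1 else -1
  measurable_sign n j a := by
    refine Measurable.ite (measurableSet_le measurable_const ?_) measurable_const measurable_const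
    exact measurable_matrix_mul (A := fun _ => (E.Υ j)ᵀ * (E.root j)⁻¹)
      (fun _ _ => measurable_const) (measurable_matrix_mul (A := fun _ => (D.L0 n j)ᵀ)
        (fun _ _ => measurable_const) (measurable_aligned π _ hL n j)) a a
  eq_one_or n ω j a := by split_ifs <;> simp

theorem eigenSigns_nonneg (E : EigenData SigF SigL) (π : Relabelling Ω r)
    (hL : ∀ n j i a, Measurable fun ω => L n ω j i a) (n : ℕ) (ω : Ω) (j : Fin J) (a : Fin (r j)) :
    0 ≤ ((E.Υ j)ᵀ * (E.root j)⁻¹ *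
      ((D.L0 n j)ᵀ * D.aligned π (D.eigenSigns E π L hL) L n ω j)) a a := by
  have h1 : D.aligned π (D.eigenSigns E π L hL) L n ω j =
      D.aligned π (posSigns Ω r) L n ω j * diagonal ((D.eigenSigns E π L hL).sign n ω j) := by
    rw [aligned_eq, alignMatrix_eq]; rfl
  rw [h1, ← Matrix.mul_assoc, ← Matrix.mul_assoc, Matrix.mul_diagonal]
  simp only [eigenSigns]
  rw [Matrix.mul_assoc]
  split_ifs with h
  · simpa using h
  · rw [mul_neg_one, neg_nonneg]; exact (not_le.1 h).le

theorem Estim.fitted [Nonempty (Fin J)] [IsProbabilityMeasure P] (h : D.Estim L s2 P q SigF l)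
    (hL : D.IsMLE θ L s2) (ς : Signs Ω r)
    (hp : ∀ᶠ x : ℕ × Ω in l, ∀ t < D.T x.1, ∀ j,
      |D.prob θ L s2 x.1 t x.2 ((relabel hL).perm x.1 x.2 j) - D.ind x.1 j t x.2| ≤
        1 / (D.N x.1 * D.T x.1 : ℝ) ^ 2)
    (hEF : ∀ j, ∃ C : ℝ, 0 ≤ C ∧ ∀ᶠ x : ℕ × Ω in l,
      fn (D.EM x.1 j x.2 * D.FM x.1 j x.2) ^ 2 ≤ C * (D.N x.1 * D.T x.1))
    (hLE : ∀ j, ∃ C : ℝ, 0 ≤ C ∧ ∀ᶠ x : ℕ × Ω in l,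
      ∑ t ∈ Finset.range (D.T x.1), vn ((D.L0 x.1 j)ᵀ *ᵥ D.err x.1 t x.2) ^ 2 ≤
        C * (D.N x.1 * D.T x.1)) :
    D.Fitted (D.aligned (relabel hL) ς L) s2
      (fun n t ω j => D.prob θ L s2 n t ω ((relabel hL).perm n ω j)) P q SigF l where
  toBasic := h.toBasic
  prob := hp
  foc n ω j := alignMatrix_foc _ (ς.eq_one_or n ω j) (hL.foc n ω ((relabel hL).perm n ω j))
  isDiag n ω j := fun a b hab => by
    beta_reduce
    rw [aligned_eq, alignMatrix_gram_apply, hL.diagonal n ω _ (by simpa using hab), mul_zero]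
  sorted n ω j := fun a b hab => by
    simp only [aligned_eq, alignMatrix_gram_apply, sign_mul_self (ς.eq_one_or n ω j _), one_mul]
    exact hL.sorted n ω _ hab
  diag := by
    obtain ⟨c, C, hc, h1⟩ := h.diag
    refine ⟨c, C, hc, ?_⟩
    filter_upwards [h1, h.eventually_relabel hL] with x hx hk j i
    have h2 := hx j
    rw [← hk j] at h2
    rw [aligned_eq, alignMatrix_gram_apply, sign_mul_self (ς.eq_one_or x.1 x.2 j _), one_mul]
    exact h2 _
  EF := exists_bound_forall (Eventually.of_forall fun _ => by positivity) hEF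
  loadingErr := exists_bound_forall (Eventually.of_forall fun _ => by positivity) hLE

/-! ### Measurability -/

section Measurability

variable (hL : ∀ n j i a, Measurable fun ω => L n ω j i a) (hs : ∀ n, Measurable (s2 n))
  (hp : ∀ n t j, Measurable fun ω => p n t ω j)
include hL hs hp

theorem measurable_W (n : ℕ) (j : Fin J) (a b : Fin (r j)) :
    Measurable fun ω => D.W L s2 p n ω j a b := by
  simp only [W, Matrix.smul_apply, Matrix.add_apply, smul_eq_mul]
  refine ((Finset.measurable_sum _ fun t _ => hp n t j).const_mul _).mul
    (((measurable_matrix_mul (A := fun ω => (L n ω j)ᵀ) (fun a b => hL n j b a)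
      (hL n j) a b).const_mul _).add (((hs n).div_const _).mul_const _))

theorem measurable_H (n : ℕ) (j : Fin J) (a b : Fin (r j)) :
    Measurable fun ω => D.H L s2 p n ω j a b := by
  unfold H
  refine measurable_matrix_mul (measurable_matrix_mul (fun a b => ?_) fun a b => ?_)
    (measurable_inv_apply (measurable_W hL hs hp n j)) a b
  · simp only [Matrix.smul_apply, Matrix.sum_apply, smul_eq_mul, vecMulVec_apply]
    exact (Finset.measurable_sum _ fun t _ => (D.measurable_ind n j t).mul
      ((D.measurable_factor_apply n j t a).mul (D.measurable_factor_apply n j t b))).const_mul _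
  · simp only [Matrix.smul_apply, smul_eq_mul]
    exact (measurable_matrix_mul (A := fun _ => (D.L0 n j)ᵀ) (fun _ _ => measurable_const)
      (hL n j) a b).const_mul _

theorem measurable_loadingError (n : ℕ) (j : Fin J) (i : ℕ) :
    Measurable (D.loadingError L s2 p n j i) := by
  unfold loadingError
  split_ifs with h
  · refine (WithLp.measurable_toLp _ _).comp (measurable_pi_iff.2 fun a => ?_)
    simp only [Pi.sub_apply]
    exact (hL n j ⟨i, h⟩ a).sub (measurable_mulVec (A := fun ω => (D.H L s2 p n ω j)ᵀ)
      (v := fun _ => (D.loading n j i).ofLp)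
      (fun a b => measurable_H hL hs hp n j b a) (fun _ => measurable_const) a)
  · exact measurable_const

omit hL hs hp in
theorem measurable_pad {k : ℕ} (m : ℕ) {v : Ω → Fin k → ℝ} (hv : ∀ i, Measurable fun ω => v ω i) :
    Measurable fun ω => pad m (v ω) := by
  refine (WithLp.measurable_toLp _ _).comp (measurable_pi_iff.2 fun a => ?_)
  by_cases h : a.val < k
  · simpa [h] using hv _
  · simp [h]

theorem measurable_factorError (n t : ℕ) : Measurable (D.factorError L s2 p n t) := by
  have h1 : ∀ ω, D.factorError L s2 p n t ω = D.estFactor L s2 p n t ω -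
      ∑ j, D.ind n j t ω • pad (maxRank r)
        ((D.H L s2 p n ω j)⁻¹ *ᵥ (D.factor n j t ω).ofLp) := fun ω => by
    simp [factorError, ind]
  have h2 : D.factorError L s2 p n t = fun ω => D.estFactor L s2 p n t ω -
      ∑ j, D.ind n j t ω • pad (maxRank r)
        ((D.H L s2 p n ω j)⁻¹ *ᵥ (D.factor n j t ω).ofLp) := funext h1
  rw [h2]
  refine Measurable.sub ?_ (Finset.measurable_sum _ fun j _ => (D.measurable_ind n j t).smul
    (measurable_pad _ (measurable_mulVec (measurable_inv_apply (measurable_H hL hs hp n j))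
      (D.measurable_factor_apply n j t))))
  unfold estFactor
  refine Finset.measurable_sum _ fun j _ => (hp n t j).smul (measurable_pad _
    (measurable_mulVec (A := fun ω => (L n ω j)ᵀ) (fun a b => hL n j b a)
      (measurable_mulVec (measurable_inv_apply (measurable_sigmaMat_apply (hL n j) (hs n)))
        (D.measurable_x n t))))

end Measurability

end Panel

/-! ### Convergence in distribution -/

theorem inner_toLp_mulVec {m k : ℕ} (B : Matrix (Fin m) (Fin k) ℝ) (y : EuclideanSpace ℝ (Fin k))
    (t : EuclideanSpace ℝ (Fin m)) :
    inner ℝ (WithLp.toLp 2 (B *ᵥ y.ofLp) : EuclideanSpace ℝ (Fin m)) t =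
      inner ℝ y (WithLp.toLp 2 (Bᵀ *ᵥ t.ofLp) : EuclideanSpace ℝ (Fin k)) := by
  rw [inner_eq_dotProduct, inner_eq_dotProduct]
  simp only [Matrix.mulVec_transpose]
  rw [dotProduct_comm, Matrix.dotProduct_mulVec, dotProduct_comm]

theorem continuous_toLp_mulVec {m k : ℕ} (B : Matrix (Fin m) (Fin k) ℝ) :
    Continuous fun y : EuclideanSpace ℝ (Fin k) =>
      (WithLp.toLp 2 (B *ᵥ y.ofLp) : EuclideanSpace ℝ (Fin m)) := by
  fun_prop

theorem map_multivariateGaussian {m k : ℕ} {S : Matrix (Fin k) (Fin k) ℝ} (hS : S.PosSemidef)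
    (B : Matrix (Fin m) (Fin k) ℝ) :
    (multivariateGaussian 0 S).map (fun y => (WithLp.toLp 2 (B *ᵥ y.ofLp) :
      EuclideanSpace ℝ (Fin m))) = multivariateGaussian 0 (B * S * Bᵀ) := by
  have hm := (continuous_toLp_mulVec B).measurable
  have := Measure.isProbabilityMeasure_map (μ := multivariateGaussian 0 S) hm.aemeasurable
  have hB : (B * S * Bᵀ).PosSemidef := by
    have := hS.mul_mul_conjTranspose_same B
    rwa [conjTranspose_eq_transpose_of_trivial] at this
  refine Measure.ext_of_charFun (funext fun t => ?_)
  have h1 : charFun ((multivariateGaussian 0 S).map (fun y => (WithLp.toLp 2 (B *ᵥ y.ofLp) :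
      EuclideanSpace ℝ (Fin m)))) t =
      charFun (multivariateGaussian 0 S) (WithLp.toLp 2 (Bᵀ *ᵥ t.ofLp)) := by
    rw [charFun_apply, charFun_apply, integral_map hm.aemeasurable (by fun_prop)]
    simp only [inner_toLp_mulVec]
  rw [h1, charFun_multivariateGaussian hS, charFun_multivariateGaussian hB]
  simp only [inner_zero_right]
  congr 4
  rw [← Matrix.mulVec_mulVec, ← Matrix.mulVec_mulVec, Matrix.dotProduct_mulVec t.ofLp,
    Matrix.mulVec_transpose]

section

variable {Ω Ω' : Type*} [MeasurableSpace Ω] [MeasurableSpace Ω'] {P : Measure Ω}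
  [IsProbabilityMeasure P] {μ : Measure Ω'} [IsProbabilityMeasure μ]

theorem tendstoInDistribution_id_of_map_eq {E : Type*} [TopologicalSpace E] [MeasurableSpace E]
    [OpensMeasurableSpace E] {X : ℕ → Ω → E} {Z : Ω' → E} {ν : Measure E} [IsProbabilityMeasure ν]
    (h : TendstoInDistribution X atTop Z (fun _ => P) μ) (hν : μ.map Z = ν) :
    TendstoInDistribution X atTop id (fun _ => P) ν := by
  subst hν
  refine ⟨h.forall_aemeasurable, aemeasurable_id, ?_⟩
  convert h.tendsto using 2
  ext1
  simp

theorem tendstoInDistribution_mulVec_add {m k : ℕ} {S : Matrix (Fin k) (Fin k) ℝ}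
    (hS : S.PosSemidef) {X : ℕ → Ω → EuclideanSpace ℝ (Fin k)}
    (hX : TendstoInDistribution X atTop id (fun _ => P) (multivariateGaussian 0 S))
    {A : ℕ → Ω → Matrix (Fin m) (Fin k) ℝ} (hA : ∀ n a b, Measurable fun ω => A n ω a b)
    {B : Matrix (Fin m) (Fin k) ℝ}
    (hAB : Tendsto (fun x : ℕ × Ω => A x.1 x.2) (whp P) (𝓝 B))
    {Y : ℕ → Ω → EuclideanSpace ℝ (Fin m)} (hY : ∀ n, Measurable (Y n))
    (h : Tendsto (fun x : ℕ × Ω => Y x.1 x.2 - WithLp.toLp 2 (A x.1 x.2 *ᵥ (X x.1 x.2).ofLp))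
      (whp P) (𝓝 0)) :
    TendstoInDistribution Y atTop id (fun _ => P) (multivariateGaussian 0 (B * S * Bᵀ)) := by
  have hg : Continuous fun z : EuclideanSpace ℝ (Fin k) × (Fin m → Fin k → ℝ) =>
      (WithLp.toLp 2 ((z.2 : Matrix (Fin m) (Fin k) ℝ) *ᵥ z.1.ofLp) :
        EuclideanSpace ℝ (Fin m)) := by
    refine (PiLp.continuous_toLp 2 _).comp ?_
    exact Continuous.matrix_mulVec (A := fun z : EuclideanSpace ℝ (Fin k) × (Fin m → Fin k → ℝ) =>
      (z.2 : Matrix (Fin m) (Fin k) ℝ)) continuous_snd (by fun_prop)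
  have h1 := hX.continuous_comp_prodMk_of_tendstoInMeasure_const hg
    (Y := fun n ω => (A n ω : Fin m → Fin k → ℝ)) (c := B)
    (tendstoInMeasure_iff_whp.2 hAB)
    (fun n => (measurable_pi_iff.2 fun a => measurable_pi_iff.2 fun b => hA n a b).aemeasurable)
  have h2 := tendstoInDistribution_of_tendstoInMeasure_sub Y _ h1
    (tendstoInMeasure_iff_whp.2 h) fun n => (hY n).aemeasurable
  exact tendstoInDistribution_id_of_map_eq h2 (map_multivariateGaussian hS B)

end

namespace EigenData

variable {J : ℕ} {r : Fin J → ℕ} {SigF SigL : (j : Fin J) → Matrix (Fin (r j)) (Fin (r j)) ℝ}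
  (E : EigenData SigF SigL) (j : Fin J)

theorem SigL_mul_limitH : SigL j * E.limitH j =
    E.root j * E.Υ j * Matrix.diagonal fun l => √(E.v j l) := by
  rw [limitH, ← E.root_sq j]
  calc _ = E.root j * (E.root j * (E.root j)⁻¹) * E.Υ j * Matrix.diagonal fun l => √(E.v j l) := by
        simp only [Matrix.mul_assoc]
    _ = _ := by rw [Matrix.mul_nonsing_inv _ (E.isUnit_det_root j), Matrix.mul_one]

theorem inv_smul_diagonal (hF : (SigF j).PosDef) {c : ℝ} (hc : c ≠ 0) :
    (c • Matrix.diagonal (E.v j))⁻¹ = c⁻¹ • Matrix.diagonal fun l => (E.v j l)⁻¹ := by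
  refine Matrix.inv_eq_right_inv ?_
  rw [Matrix.smul_mul, Matrix.mul_smul, smul_smul, mul_inv_cancel₀ hc, one_smul,
    diagonal_mul_diagonal]
  simp [(E.v_pos j hF _).ne']

theorem diagonal_sqrt_mul_inv (hF : (SigF j).PosDef) :
    (Matrix.diagonal fun l => √(E.v j l)) * (Matrix.diagonal fun l => (E.v j l)⁻¹) =
      Matrix.diagonal fun l => (√(E.v j l))⁻¹ := by
  rw [diagonal_mul_diagonal]
  congr 1
  funext l
  have h := E.v_pos j hF l
  have hs := Real.sqrt_pos.2 h
  nth_rw 2 [← Real.mul_self_sqrt h.le]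
  field_simp

/-- The limit of the coefficients of the main term of the loading error. -/
theorem loadingCov_eq (Φ : Matrix (Fin (r j)) (Fin (r j)) ℝ) :
    E.loadingCov j Φ =
      (Matrix.diagonal (fun l => (√(E.v j l))⁻¹) * (E.Υ j)ᵀ * E.root j) * Φ *
        (Matrix.diagonal (fun l => (√(E.v j l))⁻¹) * (E.Υ j)ᵀ * E.root j)ᵀ := by
  rw [loadingCov]
  simp only [Matrix.transpose_mul, Matrix.transpose_transpose, E.root_transpose,
    diagonal_transpose, Matrix.mul_assoc]

end EigenData

namespace Panel

theorem one_div_δ_sq_le {n : ℕ} (hN : 0 < (D.N n : ℝ)) (hT : 0 < (D.T n : ℝ)) :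
    (1 / D.δ n) ^ 2 ≤ 1 / D.N n + 1 / D.T n := by
  have h1 : (0 : ℝ) ≤ 1 / D.N n := by positivity
  have h2 : (0 : ℝ) ≤ 1 / D.T n := by positivity
  rcases min_choice (√(D.N n : ℝ)) (√(D.T n : ℝ)) with h | h <;>
    rw [δ, h, _root_.one_div_pow, Real.sq_sqrt (Nat.cast_nonneg _)] <;> linarith

theorem sqrt_add_sq_div_le {n : ℕ} (hδ : 0 < D.δ n) (hN : 0 < (D.N n : ℝ))
    (hT : 0 < (D.T n : ℝ)) : 1 / (D.N n * D.T n : ℝ) * √(D.N n * D.T n + D.T n ^ 2 : ℝ) ≤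
      2 * (1 / D.δ n * (1 / √(D.N n : ℝ))) := by
  have hsN := Real.sqrt_pos.2 hN
  have hsT := Real.sqrt_pos.2 hT
  have h1 : √(D.N n * D.T n + D.T n ^ 2 : ℝ) ≤ √(D.N n : ℝ) * √(D.T n : ℝ) + D.T n := by
    refine Real.sqrt_le_iff.2 ⟨by positivity, ?_⟩
    have e : (√(D.N n : ℝ) * √(D.T n : ℝ)) ^ 2 = D.N n * D.T n := by
      rw [mul_pow, Real.sq_sqrt hN.le, Real.sq_sqrt hT.le]
    have : 0 ≤ √(D.N n : ℝ) * √(D.T n : ℝ) * D.T n := by positivity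
    linarith [add_sq (√(D.N n : ℝ) * √(D.T n : ℝ)) (D.T n : ℝ)]
  have h2 := one_div_sqrt_N_le hδ
  have h3 := one_div_sqrt_T_le hδ
  calc _ ≤ 1 / (D.N n * D.T n : ℝ) * (√(D.N n : ℝ) * √(D.T n : ℝ) + D.T n) := by gcongr
    _ = 1 / √(D.T n : ℝ) * (1 / √(D.N n : ℝ)) + 1 / √(D.N n : ℝ) * (1 / √(D.N n : ℝ)) := by
        rw [mul_add]
        congr 1
        · nth_rw 1 [← Real.mul_self_sqrt hN.le, ← Real.mul_self_sqrt hT.le]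
          field_simp
        · rw [div_mul_div_comm, Real.mul_self_sqrt hN.le]
          field_simp
    _ ≤ _ := by
        rw [two_mul]
        gcongr

theorem EM_mul_FM_apply (n : ℕ) (j : Fin J) (ω : Ω) (i : Fin (D.N n)) :
    (∑ t ∈ Finset.range (D.T n), (D.error n i t ω * D.ind n j t ω) • D.factor n j t ω).ofLp =
      (D.EM n j ω * D.FM n j ω) i := by
  ext l
  rw [Finset.sum_range, Matrix.mul_apply]
  simp only [WithLp.ofLp_sum, Finset.sum_apply, WithLp.ofLp_smul, Pi.smul_apply, smul_eq_mul, EM, FM,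
    Matrix.of_apply]
  refine Finset.sum_congr rfl fun t _ => ?_
  rw [mul_mul_mul_comm, ind_mul_self]
  ring

theorem EM_mul_transpose_mul_L0_apply (n : ℕ) (j : Fin J) (ω : Ω) (i : Fin (D.N n)) :
    (D.EM n j ω * (D.EM n j ω)ᵀ * D.L0 n j) i =
      (∑ k ∈ Finset.range (D.N n), ∑ t ∈ Finset.range (D.T n),
        (D.error n i t ω * D.error n k t ω * D.ind n j t ω) • D.loading n j k).ofLp := by
  ext l
  rw [Finset.sum_range, Matrix.mul_apply]
  simp only [WithLp.ofLp_sum, Finset.sum_apply, WithLp.ofLp_smul, Pi.smul_apply, smul_eq_mul,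
    EM_mul_transpose_apply, ← Finset.sum_mul]
  rfl

theorem loadingError_eq {n : ℕ} {i : ℕ} (hi : i < D.N n) (j : Fin J) (ω : Ω) :
    D.loadingError L s2 p n j i ω =
      WithLp.toLp 2 ((L n ω j - D.L0 n j * D.H L s2 p n ω j) ⟨i, hi⟩) := by
  rw [loadingError, dif_pos hi, Matrix.mulVec_transpose]
  rfl

theorem mul_one_div_sqrt_eq {a T q : ℝ} (ha : 0 < a) (hT : 0 < T) (hq : 0 < q) :
    q * (1 / √(T * q)) = √(T * q) * a * (1 / (a * T)) := by
  have h1 : 0 < T * q := mul_pos hT hq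
  have h2 := Real.sqrt_pos.2 h1
  have h3 := Real.mul_self_sqrt h1.le
  rw [mul_one_div, mul_one_div, div_eq_div_iff h2.ne' (mul_pos ha hT).ne']
  linear_combination (-a) * h3

namespace Fitted

set_option maxHeartbeats 1000000 in
theorem tendsto_loadingError_sub [Nonempty (Fin J)] (h : D.Fitted L s2 p P q SigF l)
    (hq : ∀ j, 0 < q j) (hΛ : D.LoadingAssumption SigL) (j : Fin J) (i : ℕ)
    (hLF : ∃ C : ℝ, 0 ≤ C ∧ ∀ᶠ x : ℕ × Ω in l,
      fn ((D.L0 x.1 j)ᵀ * (D.EM x.1 j x.2 * D.FM x.1 j x.2)) ^ 2 ≤ C * (D.N x.1 * D.T x.1))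
    (hrow : ∃ C : ℝ, 0 ≤ C ∧ ∀ᶠ x : ℕ × Ω in l,
      ∑ k ∈ Finset.range (D.N x.1), (∑ t ∈ Finset.range (D.T x.1),
        D.error x.1 i t x.2 * D.error x.1 k t x.2 * D.ind x.1 j t x.2) ^ 2 ≤
      C * (D.N x.1 * D.T x.1 + D.T x.1 ^ 2))
    (hrowL : ∃ C : ℝ, 0 ≤ C ∧ ∀ᶠ x : ℕ × Ω in l,
      ‖∑ k ∈ Finset.range (D.N x.1), ∑ t ∈ Finset.range (D.T x.1),
        (D.error x.1 i t x.2 * D.error x.1 k t x.2 * D.ind x.1 j t x.2) • D.loading x.1 j k‖ ^ 2 ≤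
        C * (D.N x.1 * D.T x.1 + D.T x.1 ^ 2))
    (hr : Tendsto (fun n => √(D.T n : ℝ) / D.N n) atTop (𝓝 0)) :
    Tendsto (fun x : ℕ × Ω => √(D.T x.1 * q j) • D.loadingError L s2 p x.1 j i x.2 -
      WithLp.toLp 2 ((q j • ((1 / (D.N x.1 : ℝ)) • ((D.L0 x.1 j)ᵀ * L x.1 x.2 j) *
        (D.W L s2 p x.1 x.2 j)⁻¹)ᵀ) *ᵥ ((1 / √(D.T x.1 * q j)) • ∑ t ∈ Finset.range (D.T x.1),
          (D.error x.1 i t x.2 * D.ind x.1 j t x.2) • D.factor x.1 j t x.2).ofLp)) l (𝓝 0) := by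
  obtain ⟨C0, hC0, h0⟩ := h.exists_perturbed hq hΛ
  obtain ⟨C1, hC1, h1⟩ := hLF
  obtain ⟨C2, hC2, h2⟩ := hrow
  obtain ⟨C3, hC3, h3⟩ := hrowL
  obtain ⟨M, hM⟩ := hΛ.bounded
  set K := C0 + √C1 + 2 * √C2 + 2 * √C3 + |M| with hK
  have hK0 : 0 ≤ K := by positivity
  have hlim : Tendsto (fun n => √(q j) * (12 * K ^ 7) * (√(D.T n : ℝ) / D.N n + 1 / √(D.T n : ℝ)))
      atTop (𝓝 0) := by
    have e2 : Tendsto (fun n => 1 / √(D.T n : ℝ)) atTop (𝓝 0) :=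
      ((Real.tendsto_sqrt_atTop.comp D.tendsto_T_real).inv_tendsto_atTop).congr fun n => by simp
    simpa using (hr.add e2).const_mul (√(q j) * (12 * K ^ 7))
  refine squeeze_zero_norm' ?_ (hlim.comp (tendsto_fst_whp.mono_left h.le))
  filter_upwards [h0, h1, h2, h3, h.eventually_δ, h.eventually_N_pos, h.eventually_T_pos,
    eventually_fst h.le (D.tendsto_N.eventually_gt_atTop i)] with x g0 g1 g2 g3 hδ1 hN hT hi
  have hsN := Real.sqrt_pos.2 hN
  have hsT := Real.sqrt_pos.2 hT
  have hδ : 0 < D.δ x.1 := one_pos.trans_le hδ1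
  have n1 := Real.sqrt_nonneg C1
  have n2 := Real.sqrt_nonneg C2
  have n3 := Real.sqrt_nonneg C3
  have n4 := abs_nonneg M
  have hT1 : (1 : ℝ) ≤ D.T x.1 := by exact_mod_cast hT
  have hp := g0 j K (by linarith)
  have hrate := sqrt_add_sq_div_le hδ hN hT
  have b1 : fn (((1 / √(D.N x.1 : ℝ)) • D.L0 x.1 j)ᵀ * D.scaledEF x.1 j x.2) ≤
      K * (1 / D.δ x.1) ^ 2 := (fn_loading_scaledEF_le hC1 hδ hN hT g1).trans
    (mul_le_mul_of_nonneg_right (by linarith) (sq_nonneg _))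
  have b2 : vn (((1 / √(D.N x.1 : ℝ)) • D.L0 x.1 j) ⟨i, hi⟩) ≤ K * (1 / √(D.N x.1 : ℝ)) := by
    have e : ((1 / √(D.N x.1 : ℝ)) • D.L0 x.1 j) ⟨i, hi⟩ =
      (1 / √(D.N x.1 : ℝ)) • (D.loading x.1 j i).ofLp := rfl
    rw [e, vn_smul, abs_of_pos (by positivity), mul_comm, vn_eq_norm]
    exact mul_le_mul_of_nonneg_right (((hM x.1 j i hi).trans (le_abs_self M)).trans (by linarith))
      (by positivity)
  have b3 : vn ((D.scaledE x.1 j x.2 * (D.scaledE x.1 j x.2)ᵀ) ⟨i, hi⟩) ≤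
      K * (1 / D.δ x.1 * (1 / √(D.N x.1 : ℝ))) := by
    rw [scaledE_mul_transpose]
    have e : ((1 / (D.N x.1 * D.T x.1 : ℝ)) • (D.EM x.1 j x.2 * (D.EM x.1 j x.2)ᵀ)) ⟨i, hi⟩ =
      (1 / (D.N x.1 * D.T x.1 : ℝ)) • (D.EM x.1 j x.2 * (D.EM x.1 j x.2)ᵀ) ⟨i, hi⟩ := rfl
    have e2 : vn ((D.EM x.1 j x.2 * (D.EM x.1 j x.2)ᵀ) ⟨i, hi⟩) ≤
        √C2 * √(D.N x.1 * D.T x.1 + D.T x.1 ^ 2 : ℝ) := by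
      rw [← Real.sqrt_mul hC2]
      refine Real.le_sqrt_of_sq_le ?_
      rw [vn_sq, dotProduct]
      simp only [EM_mul_transpose_apply, ← sq]
      rw [Finset.sum_range] at g2
      exact g2
    rw [e, vn_smul, abs_of_pos (by positivity)]
    calc _ ≤ 1 / (D.N x.1 * D.T x.1 : ℝ) * (√C2 * √(D.N x.1 * D.T x.1 + D.T x.1 ^ 2 : ℝ)) := by gcongr
      _ = √C2 * (1 / (D.N x.1 * D.T x.1 : ℝ) * √(D.N x.1 * D.T x.1 + D.T x.1 ^ 2 : ℝ)) := by ring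
      _ ≤ √C2 * (2 * (1 / D.δ x.1 * (1 / √(D.N x.1 : ℝ)))) := by gcongr
      _ = 2 * √C2 * (1 / D.δ x.1 * (1 / √(D.N x.1 : ℝ))) := by ring
      _ ≤ _ := mul_le_mul_of_nonneg_right (by linarith) (by positivity)
  have b4 : vn ((D.scaledE x.1 j x.2 * (D.scaledE x.1 j x.2)ᵀ *
      ((1 / √(D.N x.1 : ℝ)) • D.L0 x.1 j)) ⟨i, hi⟩) ≤
      K * ((1 / D.δ x.1) ^ 2 * (1 / √(D.N x.1 : ℝ))) := by
    rw [scaledE_mul_transpose, Matrix.smul_mul, Matrix.mul_smul, smul_smul]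
    have e : ((1 / (D.N x.1 * D.T x.1 : ℝ) * (1 / √(D.N x.1 : ℝ))) •
        (D.EM x.1 j x.2 * (D.EM x.1 j x.2)ᵀ * D.L0 x.1 j)) ⟨i, hi⟩ =
      (1 / (D.N x.1 * D.T x.1 : ℝ) * (1 / √(D.N x.1 : ℝ))) •
        (D.EM x.1 j x.2 * (D.EM x.1 j x.2)ᵀ * D.L0 x.1 j) ⟨i, hi⟩ := rfl
    have e2 : vn ((D.EM x.1 j x.2 * (D.EM x.1 j x.2)ᵀ * D.L0 x.1 j) ⟨i, hi⟩) ≤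
        √C3 * √(D.N x.1 * D.T x.1 + D.T x.1 ^ 2 : ℝ) := by
      rw [← Real.sqrt_mul hC3]
      refine Real.le_sqrt_of_sq_le ?_
      rw [EM_mul_transpose_mul_L0_apply, vn_eq_norm]
      exact g3
    have e3 := one_div_sqrt_N_le hδ
    rw [e, vn_smul, abs_of_pos (by positivity)]
    calc _ ≤ 1 / (D.N x.1 * D.T x.1 : ℝ) * (1 / √(D.N x.1 : ℝ)) *
          (√C3 * √(D.N x.1 * D.T x.1 + D.T x.1 ^ 2 : ℝ)) := by gcongr
      _ = √C3 * (1 / √(D.N x.1 : ℝ)) *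
          (1 / (D.N x.1 * D.T x.1 : ℝ) * √(D.N x.1 * D.T x.1 + D.T x.1 ^ 2 : ℝ)) := by ring
      _ ≤ √C3 * (1 / √(D.N x.1 : ℝ)) * (2 * (1 / D.δ x.1 * (1 / D.δ x.1))) := by
          refine mul_le_mul_of_nonneg_left (hrate.trans ?_) (by positivity)
          gcongr
      _ = 2 * √C3 * ((1 / D.δ x.1) ^ 2 * (1 / √(D.N x.1 : ℝ))) := by ring
      _ ≤ _ := mul_le_mul_of_nonneg_right (by linarith) (by positivity)
  have hmain := hp.vn_row_sub_le b1 b2 b4 b3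
  have hqs := Real.sqrt_pos.2 (hq j)
  have hsq : √(D.T x.1 * q j) = √(D.T x.1 : ℝ) * √(q j) := Real.sqrt_mul hT.le _
  have hTT := Real.mul_self_sqrt hT.le
  have hqq := Real.mul_self_sqrt (hq j).le
  have key : √(D.T x.1 * q j) • D.loadingError L s2 p x.1 j i x.2 -
      WithLp.toLp 2 ((q j • ((1 / (D.N x.1 : ℝ)) • ((D.L0 x.1 j)ᵀ * L x.1 x.2 j) *
        (D.W L s2 p x.1 x.2 j)⁻¹)ᵀ) *ᵥ ((1 / √(D.T x.1 * q j)) • ∑ t ∈ Finset.range (D.T x.1),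
          (D.error x.1 i t x.2 * D.ind x.1 j t x.2) • D.factor x.1 j t x.2).ofLp) =
      WithLp.toLp 2 ((√(D.T x.1 * q j) * √(D.N x.1 : ℝ)) •
        ((((1 / √(D.N x.1 : ℝ)) • L x.1 x.2 j) - ((1 / √(D.N x.1 : ℝ)) • D.L0 x.1 j) *
          D.H L s2 p x.1 x.2 j) ⟨i, hi⟩ - (D.scaledEF x.1 j x.2 *
          (((1 / √(D.N x.1 : ℝ)) • D.L0 x.1 j)ᵀ * ((1 / √(D.N x.1 : ℝ)) • L x.1 x.2 j) *
            (D.W L s2 p x.1 x.2 j)⁻¹)) ⟨i, hi⟩)) := by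
    rw [loadingError_eq hi, WithLp.ofLp_smul, EM_mul_FM_apply x.1 j x.2 ⟨i, hi⟩]
    have e1 : (((1 / √(D.N x.1 : ℝ)) • L x.1 x.2 j) - ((1 / √(D.N x.1 : ℝ)) • D.L0 x.1 j) *
          D.H L s2 p x.1 x.2 j) = (1 / √(D.N x.1 : ℝ)) •
          (L x.1 x.2 j - D.L0 x.1 j * D.H L s2 p x.1 x.2 j) := by
      rw [Matrix.smul_mul, smul_sub]
    have e2 : ((1 / √(D.N x.1 : ℝ)) • D.L0 x.1 j)ᵀ * ((1 / √(D.N x.1 : ℝ)) • L x.1 x.2 j) =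
        (1 / (D.N x.1 : ℝ)) • ((D.L0 x.1 j)ᵀ * L x.1 x.2 j) := by
      rw [Matrix.transpose_smul, Matrix.smul_mul, Matrix.mul_smul, smul_smul, div_mul_div_comm,
        Real.mul_self_sqrt hN.le, one_mul]
    rw [e1, e2]
    generalize (1 / (D.N x.1 : ℝ)) • ((D.L0 x.1 j)ᵀ * L x.1 x.2 j) * (D.W L s2 p x.1 x.2 j)⁻¹ = B
    have e3 : (D.scaledEF x.1 j x.2 * B) ⟨i, hi⟩ = (1 / (√(D.N x.1 : ℝ) * D.T x.1)) •
        (Bᵀ *ᵥ (D.EM x.1 j x.2 * D.FM x.1 j x.2) ⟨i, hi⟩) := by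
      rw [scaledEF, Matrix.smul_mul, Matrix.mulVec_transpose]; rfl
    rw [e3]
    have e4 : ((1 / √(D.N x.1 : ℝ)) • (L x.1 x.2 j - D.L0 x.1 j * D.H L s2 p x.1 x.2 j)) ⟨i, hi⟩ =
      (1 / √(D.N x.1 : ℝ)) • (L x.1 x.2 j - D.L0 x.1 j * D.H L s2 p x.1 x.2 j) ⟨i, hi⟩ := rfl
    rw [e4, smul_sub, smul_smul, smul_smul, Matrix.smul_mulVec, Matrix.mulVec_smul, smul_smul,
      WithLp.toLp_sub, WithLp.toLp_smul, WithLp.toLp_smul, WithLp.toLp_smul]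
    congr 2
    · rw [mul_assoc, mul_one_div_cancel hsN.ne', mul_one]
    · exact mul_one_div_sqrt_eq hsN hT (hq j)
  rw [key, ← vn_eq_norm, vn_smul, abs_of_nonneg (by positivity)]
  calc _ ≤ √(D.T x.1 * q j) * √(D.N x.1 : ℝ) *
        (12 * K ^ 7 * ((1 / D.δ x.1) ^ 2 * (1 / √(D.N x.1 : ℝ)))) :=
        mul_le_mul_of_nonneg_left hmain (by positivity)
    _ = √(q j) * (12 * K ^ 7) * (√(D.T x.1 : ℝ) * (1 / D.δ x.1) ^ 2) := by
        rw [hsq]; field_simp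
    _ ≤ √(q j) * (12 * K ^ 7) * (√(D.T x.1 : ℝ) * (1 / D.N x.1 + 1 / D.T x.1)) := by
        have := one_div_δ_sq_le hN hT
        gcongr
    _ = _ := by
        simp only [Function.comp]
        rw [mul_add, mul_one_div, mul_one_div]
        congr 2
        rw [div_eq_div_iff hT.ne' hsT.ne', hTT, one_mul]

end Fitted

end Panel

/-! ### The error of the estimated factors -/

/-- Padding as a matrix. -/
def padOp (m k : ℕ) : Matrix (Fin m) (Fin k) ℝ := Matrix.of fun a b => if a.val = b.val then 1 else 0

theorem pad_eq {k : ℕ} (m : ℕ) (v : Fin k → ℝ) : pad m v = WithLp.toLp 2 (padOp m k *ᵥ v) := by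
  unfold pad
  congr 1
  ext a
  simp only [mulVec, dotProduct, padOp, Matrix.of_apply, ite_mul, one_mul, zero_mul]
  split_ifs with h
  · rw [Finset.sum_eq_single ⟨a.val, h⟩]
    · simp
    · intro b _ hb
      rw [if_neg fun e => hb (Fin.ext e.symm)]
    · simp
  · refine (Finset.sum_eq_zero fun b _ => if_neg fun e => h ?_).symm
    rw [e]; exact b.2

theorem padMatrix_eq {k : ℕ} (m : ℕ) (A : Matrix (Fin k) (Fin k) ℝ) :
    padMatrix m A = padOp m k * A * (padOp m k)ᵀ := by
  have h : ∀ (B : Matrix (Fin k) (Fin k) ℝ) (a : Fin m) (b : Fin k),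
      (padOp m k * B) a b = if h : a.val < k then B ⟨a.val, h⟩ b else 0 := fun B a b => by
    have := congrArg (fun v => v.ofLp a) (pad_eq m fun c => B c b)
    simp only [pad] at this
    exact this.symm
  ext a b
  have h2 : (padOp m k * A * (padOp m k)ᵀ) a b = (padOp m k * (padOp m k * A)ᵀ) b a := by
    have : padOp m k * A * (padOp m k)ᵀ = (padOp m k * (padOp m k * A)ᵀ)ᵀ := by
      rw [Matrix.transpose_mul, Matrix.transpose_transpose]
    rw [this]; rfl
  have h3 : (padOp m k * (padOp m k * A)ᵀ) b a =
      if h : b.val < k then (padOp m k * A) a ⟨b.val, h⟩ else 0 := by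
    have := congrArg (fun v => v.ofLp b) (pad_eq m fun c => (padOp m k * A)ᵀ c a)
    simp only [pad] at this
    exact this.symm
  rw [h2, h3]
  simp only [padMatrix, Matrix.of_apply, h]
  by_cases h4 : a.val < k <;> by_cases h5 : b.val < k <;> simp [h4, h5]

theorem norm_pad_le {k : ℕ} (m : ℕ) (v : Fin k → ℝ) : ‖pad m v‖ ≤ fn (padOp m k) * vn v := by
  rw [pad_eq, ← vn_eq_norm]
  exact vn_mulVec_le _ _

theorem pad_sub {k : ℕ} (m : ℕ) (v w : Fin k → ℝ) : pad m (v - w) = pad m v - pad m w := by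
  simp only [pad_eq, Matrix.mulVec_sub, WithLp.toLp_sub]

theorem sub_mulVec_eq {N k : ℕ} {A At : Matrix (Fin N) (Fin k) ℝ} {H G B B' : Matrix (Fin k) (Fin k) ℝ}
    {c : ℝ} (hG : H * G = 1) (hB : B' * B = 1) (h : B = Atᵀ * At + c • 1) (f : Fin k → ℝ)
    (e : Fin N → ℝ) :
    B' *ᵥ (Atᵀ *ᵥ (A *ᵥ f + e)) - G *ᵥ f - B' *ᵥ (Hᵀ *ᵥ (Aᵀ *ᵥ e)) =
      B' *ᵥ ((At - A * H)ᵀ *ᵥ e - (Atᵀ * (At - A * H)) *ᵥ (G *ᵥ f) - c • (G *ᵥ f)) := by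
  have h1 : G *ᵥ f = B' *ᵥ (B *ᵥ (G *ᵥ f)) := by
    rw [Matrix.mulVec_mulVec, hB, Matrix.one_mulVec]
  have h2 : A *ᵥ f = (A * H) *ᵥ (G *ᵥ f) := by
    rw [Matrix.mulVec_mulVec, Matrix.mul_assoc, hG, Matrix.mul_one]
  have h3 : B *ᵥ (G *ᵥ f) = Atᵀ *ᵥ (At *ᵥ (G *ᵥ f)) + c • (G *ᵥ f) := by
    rw [h, Matrix.add_mulVec, Matrix.smul_mulVec, Matrix.one_mulVec, ← Matrix.mulVec_mulVec]
  rw [h2]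
  generalize G *ᵥ f = g at *
  have h4 : B' *ᵥ (Atᵀ *ᵥ ((A * H) *ᵥ g + e)) - B' *ᵥ (B *ᵥ g) - B' *ᵥ (Hᵀ *ᵥ (Aᵀ *ᵥ e)) =
      B' *ᵥ ((At - A * H)ᵀ *ᵥ e - (Atᵀ * (At - A * H)) *ᵥ g - c • g) := by
    rw [← Matrix.mulVec_sub, ← Matrix.mulVec_sub, h3]
    congr 1
    simp only [Matrix.transpose_sub, Matrix.transpose_mul, Matrix.sub_mulVec, Matrix.mul_sub,
      Matrix.mulVec_add, ← Matrix.mulVec_mulVec]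
    abel
  rwa [← h1] at h4

namespace Panel

theorem Fitted.tendsto_loadingError_coeff [Nonempty (Fin J)] (h : D.Fitted L s2 p P q SigF l)
    (hq : ∀ j, 0 < q j) (hF : ∀ j, (SigF j).PosDef) (hΛ : D.LoadingAssumption SigL)
    (E : EigenData SigF SigL) (j : Fin J)
    (hW : Tendsto (fun x : ℕ × Ω => D.W L s2 p x.1 x.2 j) l (𝓝 (q j • Matrix.diagonal (E.v j))))
    (hH : Tendsto (fun x : ℕ × Ω => D.H L s2 p x.1 x.2 j) l (𝓝 (E.limitH j))) :
    Tendsto (fun x : ℕ × Ω => q j • ((1 / (D.N x.1 : ℝ)) • ((D.L0 x.1 j)ᵀ * L x.1 x.2 j) *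
      (D.W L s2 p x.1 x.2 j)⁻¹)ᵀ) l
      (𝓝 (Matrix.diagonal (fun l => (√(E.v j l))⁻¹) * (E.Υ j)ᵀ * E.root j)) := by
  have hu : IsUnit (q j • Matrix.diagonal (E.v j)).det := by
    rw [det_smul, det_diagonal]
    exact (mul_ne_zero (pow_ne_zero _ (hq j).ne') (Finset.prod_ne_zero_iff.2 fun a _ =>
      (E.v_pos j (hF j) a).ne')).isUnit
  have h1 := (h.tendsto_cross hq hΛ le_rfl hH).1.mul (tendsto_matrix_inv hW hu)
  have e : q j • (SigL j * E.limitH j * (q j • Matrix.diagonal (E.v j))⁻¹)ᵀ =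
      Matrix.diagonal (fun l => (√(E.v j l))⁻¹) * (E.Υ j)ᵀ * E.root j := by
    rw [E.inv_smul_diagonal j (hF j) (hq j).ne', E.SigL_mul_limitH, Matrix.mul_smul,
      Matrix.mul_assoc, E.diagonal_sqrt_mul_inv j (hF j), Matrix.transpose_smul, smul_smul,
      mul_inv_cancel₀ (hq j).ne', one_smul, Matrix.transpose_mul, Matrix.transpose_mul,
      E.root_transpose, diagonal_transpose, Matrix.mul_assoc]
  rw [← e]
  exact ((continuous_id.matrix_transpose.tendsto _).comp h1).const_smul (q j)

theorem measurable_loadingError_coeff (hmL : ∀ n j i a, Measurable fun ω => L n ω j i a)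
    (hms : ∀ n, Measurable (s2 n)) (hmp : ∀ n t j, Measurable fun ω => p n t ω j) (j : Fin J) (n : ℕ)
    (a b : Fin (r j)) : Measurable fun ω => (q j • ((1 / (D.N n : ℝ)) • ((D.L0 n j)ᵀ * L n ω j) *
      (D.W L s2 p n ω j)⁻¹)ᵀ) a b := by
  simp only [Matrix.smul_apply, Matrix.transpose_apply, smul_eq_mul]
  refine (measurable_matrix_mul (fun a b => ?_)
    (measurable_inv_apply (measurable_W hmL hms hmp n j)) b a).const_mul _
  simp only [Matrix.smul_apply, smul_eq_mul]
  exact (measurable_matrix_mul (A := fun _ => (D.L0 n j)ᵀ) (fun _ _ => measurable_const)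
    (hmL n j) a b).const_mul _

theorem tendstoInDistribution_loadingError [Nonempty (Fin J)] [IsProbabilityMeasure P]
    (h : Often P fun l => D.Fitted L s2 p P q SigF l) (hq : ∀ j, 0 < q j)
    (hF : D.FactorAssumption P q α SigF) (hΛ : D.LoadingAssumption SigL)
    (he : D.ErrorAssumption P α) (hA : D.LimitAssumption P q Φ Γ) (E : EigenData SigF SigL)
    (hmL : ∀ n j i a, Measurable fun ω => L n ω j i a) (hms : ∀ n, Measurable (s2 n))
    (hmp : ∀ n t j, Measurable fun ω => p n t ω j) (j : Fin J) (i : ℕ)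
    (hW : Tendsto (fun x : ℕ × Ω => D.W L s2 p x.1 x.2 j) (whp P)
      (𝓝 (q j • Matrix.diagonal (E.v j))))
    (hH : Tendsto (fun x : ℕ × Ω => D.H L s2 p x.1 x.2 j) (whp P) (𝓝 (E.limitH j)))
    (hr : Tendsto (fun n => √(D.T n : ℝ) / D.N n) atTop (𝓝 0)) :
    TendstoInDistribution (fun n ω => √(D.T n * q j) • D.loadingError L s2 p n j i ω) atTop id
      (fun _ => P) (multivariateGaussian 0 (E.loadingCov j (Φ j i))) := by
  have hlim := tendsto_whp_of_often (h.mono fun l hl h =>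
    h.tendsto_loadingError_coeff hq hF.posDef hΛ E j (hW.mono_left hl) (hH.mono_left hl))
  have hm : ∀ n, Measurable fun ω => √(D.T n * q j) • D.loadingError L s2 p n j i ω := fun n =>
    (measurable_loadingError hmL hms hmp n j i).const_smul (√(D.T n * q j))
  have hY := tendsto_whp_of_often ((((h.and (often_loadingFactor hA j)).and
      (often_row_products he j i)).and (often_loading_row hΛ he hA j i)).mono fun l hl h =>
    h.1.1.1.tendsto_loadingError_sub hq hΛ j i h.1.1.2 h.1.2 h.2 hr)
  have hm2 := measurable_loadingError_coeff (q := q) hmL hms hmp j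
  have hX := hA.cltTime j i
  rw [E.loadingCov_eq]
  exact tendstoInDistribution_mulVec_add (hA.Φ_posSemidef j i) hX hm2 hlim hm hY

/-- The normalized Gram matrix of the estimated loadings that enters the estimated factors. -/
def fitGram (D : Panel Ω r) (L : (n : ℕ) → Ω → (j : Fin J) → Matrix (Fin (D.N n)) (Fin (r j)) ℝ)
    (s2 : ℕ → Ω → ℝ) (n : ℕ) (ω : Ω) (j : Fin J) : Matrix (Fin (r j)) (Fin (r j)) ℝ :=
  (1 / (D.N n : ℝ)) • ((L n ω j)ᵀ * L n ω j) + (s2 n ω / D.N n) • 1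

namespace Fitted

variable [Nonempty (Fin J)] (h : D.Fitted L s2 p P q SigF l) (hq : ∀ j, 0 < q j)
  (hΛ : D.LoadingAssumption SigL)
include h hq hΛ

omit hq hΛ [Nonempty (Fin J)] in
theorem exists_fitGram_inv_bound : ∃ C, 0 ≤ C ∧ ∀ᶠ x : ℕ × Ω in l, ∀ j,
    IsUnit (D.fitGram L s2 x.1 x.2 j).det ∧ fn (D.fitGram L s2 x.1 x.2 j)⁻¹ ≤ C := by
  obtain ⟨c1, C1, hc1, h1⟩ := h.diag
  obtain ⟨c2, C2, hc2, h2⟩ := h.s2_bdd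
  refine ⟨maxRank r * c1⁻¹, by positivity, ?_⟩
  filter_upwards [h1, h2, h.eventually_N_pos] with x g1 g2 hN j
  obtain ⟨h3, h4⟩ := fn_inv_le_of_isDiag (M := D.fitGram L s2 x.1 x.2 j) (fun a b hab => by
        simp only [fitGram, Matrix.smul_apply, Matrix.add_apply, h.isDiag x.1 x.2 j hab,
          Matrix.one_apply_ne hab]
        simp) hc1 fun i => by
        simp only [fitGram, Matrix.smul_apply, Matrix.add_apply, Matrix.one_apply_eq, smul_eq_mul]
        have e1 : c1 ≤ 1 / D.N x.1 * ((L x.1 x.2 j)ᵀ * L x.1 x.2 j) i i := by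
          rw [one_div, inv_mul_eq_div]; exact (le_div_iff₀ hN).2 (g1 j i).1
        have e3 : 0 ≤ s2 x.1 x.2 / D.N x.1 := div_nonneg (hc2.le.trans g2.1) hN.le
        linarith
  refine ⟨h3, h4.trans ?_⟩
  have : (r j : ℝ) ≤ maxRank r := by exact_mod_cast Finset.le_sup (f := r) (Finset.mem_univ j)
  gcongr

end Fitted

end Panel

theorem fit_eq {m k : ℕ} {A : Matrix (Fin m) (Fin k) ℝ} {s2 N : ℝ} (hs : 0 < s2) (hN : 0 < N)
    (hu : IsUnit ((1 / N) • (Aᵀ * A) + (s2 / N) • (1 : Matrix (Fin k) (Fin k) ℝ)).det)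
    (x : Fin m → ℝ) :
    fit A s2 x = ((1 / N) • (Aᵀ * A) + (s2 / N) • (1 : Matrix (Fin k) (Fin k) ℝ))⁻¹ *ᵥ
      (((1 / √N) • A)ᵀ *ᵥ ((1 / √N) • x)) := by
  have h1 : ((1 / N) • (Aᵀ * A) + (s2 / N) • (1 : Matrix (Fin k) (Fin k) ℝ)) *ᵥ fit A s2 x =
      (1 / N) • (Aᵀ *ᵥ x) := by
    have e : (1 / N) • (Aᵀ * A) + (s2 / N) • (1 : Matrix (Fin k) (Fin k) ℝ) =
        (1 / N) • (Aᵀ * A + s2 • (1 : Matrix (Fin k) (Fin k) ℝ)) := by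
      rw [smul_add, smul_smul, one_div_mul_eq_div]
    rw [e, fit, Matrix.mulVec_mulVec, Matrix.mulVec_mulVec, Matrix.smul_mul, Matrix.smul_mul,
      Matrix.mul_assoc, transpose_mul_sigmaMat_inv A hs, Matrix.smul_mulVec]
  have h2 : ((1 / √N) • A)ᵀ *ᵥ ((1 / √N) • x) = (1 / N) • (Aᵀ *ᵥ x) := by
    rw [Matrix.transpose_smul, Matrix.smul_mulVec, Matrix.mulVec_smul, smul_smul, div_mul_div_comm,
      Real.mul_self_sqrt hN.le, one_mul]
  rw [h2, ← h1, Matrix.mulVec_mulVec, Matrix.nonsing_inv_mul _ hu, Matrix.one_mulVec]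

theorem le_of_sum_fin_le {T : ℕ} {f : ℕ → ℝ} (hf : ∀ t, 0 ≤ f t) {B : ℝ}
    (h : ∑ t : Fin T, f t ≤ B) {t : ℕ} (ht : t < T) : f t ≤ B :=
  (Finset.single_le_sum (f := fun t : Fin T => f t) (fun _ _ => hf _)
    (Finset.mem_univ (⟨t, ht⟩ : Fin T))).trans h

theorem exists_fn_padOp_le {J : ℕ} (r : Fin J → ℕ) :
    ∃ C, 0 ≤ C ∧ ∀ k, fn (padOp (maxRank r) (r k)) ≤ C :=
  ⟨∑ k, fn (padOp (maxRank r) (r k)), Finset.sum_nonneg fun k _ => fn_nonneg _, fun k =>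
    Finset.single_le_sum (f := fun k => fn (padOp (maxRank r) (r k))) (fun k _ => fn_nonneg _)
      (Finset.mem_univ k)⟩

namespace Panel

/-- The coefficients of the main term of the factor error. -/
def factorCoeff (D : Panel Ω r)
    (L : (n : ℕ) → Ω → (j : Fin J) → Matrix (Fin (D.N n)) (Fin (r j)) ℝ) (s2 : ℕ → Ω → ℝ)
    (p : ℕ → ℕ → Ω → Fin J → ℝ) (n : ℕ) (ω : Ω) (j : Fin J) :
    Matrix (Fin (maxRank r)) (Fin (r j)) ℝ :=
  padOp (maxRank r) (r j) * ((D.fitGram L s2 n ω j)⁻¹ * (D.H L s2 p n ω j)ᵀ)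

theorem estFactor_eq (n t : ℕ) (ω : Ω) : D.estFactor L s2 p n t ω =
    pad (maxRank r) (fit (L n ω (D.state n t ω)) (s2 n ω) (D.x n t ω)) +
    ∑ j, (p n t ω j - D.ind n j t ω) • pad (maxRank r) (fit (L n ω j) (s2 n ω) (D.x n t ω)) := by
  simp only [sub_smul, Finset.sum_sub_distrib]
  have : ∑ j, D.ind n j t ω • pad (maxRank r) (fit (L n ω j) (s2 n ω) (D.x n t ω)) =
      pad (maxRank r) (fit (L n ω (D.state n t ω)) (s2 n ω) (D.x n t ω)) := by
    simp [ind]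
  rw [this, add_sub_cancel]
  rfl

theorem factorError_sub_eq {n t : ℕ} {ω : Ω} {k : Fin J} (hk : D.state n t ω = k)
    (v : EuclideanSpace ℝ (Fin (maxRank r))) : D.factorError L s2 p n t ω - v =
    (pad (maxRank r) (fit (L n ω k) (s2 n ω) (D.x n t ω)) -
      pad (maxRank r) ((D.H L s2 p n ω k)⁻¹ *ᵥ (D.factor n k t ω).ofLp) - v) +
    ∑ j, (p n t ω j - D.ind n j t ω) • pad (maxRank r) (fit (L n ω j) (s2 n ω) (D.x n t ω)) := by
  subst hk
  rw [factorError, estFactor_eq]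
  abel

theorem norm_pad_fit_sub_le {n t : ℕ} {ω : Ω} (hs : 0 < s2 n ω) (hN : 0 < (D.N n : ℝ)) {k : Fin J}
    (hk : D.state n t ω = k) {Cp CB CG S : ℝ} (hCp : fn (padOp (maxRank r) (r k)) ≤ Cp)
    (hB : IsUnit (D.fitGram L s2 n ω k).det) (hCB : fn (D.fitGram L s2 n ω k)⁻¹ ≤ CB)
    (hH : IsUnit (D.H L s2 p n ω k).det) (hCG : fn (D.H L s2 p n ω k)⁻¹ ≤ CG) (hS : s2 n ω ≤ S) :
    ‖pad (maxRank r) (fit (L n ω k) (s2 n ω) (D.x n t ω)) -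
        pad (maxRank r) ((D.H L s2 p n ω k)⁻¹ *ᵥ (D.factor n k t ω).ofLp) -
        WithLp.toLp 2 (D.factorCoeff L s2 p n ω k *ᵥ
          ((1 / (D.N n : ℝ)) • ((D.L0 n k)ᵀ *ᵥ D.err n t ω)))‖ ≤
      Cp * (CB * (vn ((((1 / √(D.N n : ℝ)) • L n ω k) - ((1 / √(D.N n : ℝ)) • D.L0 n k) *
          D.H L s2 p n ω k)ᵀ *ᵥ ((1 / √(D.N n : ℝ)) • D.err n t ω)) +
        (fn (((1 / √(D.N n : ℝ)) • L n ω k)ᵀ * (((1 / √(D.N n : ℝ)) • L n ω k) -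
          ((1 / √(D.N n : ℝ)) • D.L0 n k) * D.H L s2 p n ω k)) + S * (1 / D.N n)) *
          (CG * D.fnorm n t ω))) := by
  subst hk
  set k := D.state n t ω with hk
  have hx : (1 / √(D.N n : ℝ)) • D.x n t ω = ((1 / √(D.N n : ℝ)) • D.L0 n k) *ᵥ
      (D.factor n k t ω).ofLp + (1 / √(D.N n : ℝ)) • D.err n t ω := by
    rw [x_eq, smul_add, Matrix.smul_mulVec]; rfl
  have hg : D.fitGram L s2 n ω k = ((1 / √(D.N n : ℝ)) • L n ω k)ᵀ * ((1 / √(D.N n : ℝ)) • L n ω k) +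
      (s2 n ω / D.N n) • 1 := by
    rw [fitGram, Matrix.transpose_smul, Matrix.smul_mul, Matrix.mul_smul, smul_smul,
      div_mul_div_comm, Real.mul_self_sqrt hN.le, one_mul]
  have hAe : (1 / (D.N n : ℝ)) • ((D.L0 n k)ᵀ *ᵥ D.err n t ω) =
      ((1 / √(D.N n : ℝ)) • D.L0 n k)ᵀ *ᵥ ((1 / √(D.N n : ℝ)) • D.err n t ω) := by
    rw [Matrix.transpose_smul, Matrix.smul_mulVec, Matrix.mulVec_smul, smul_smul, div_mul_div_comm,
      Real.mul_self_sqrt hN.le, one_mul]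
  have key := sub_mulVec_eq (Matrix.mul_nonsing_inv _ hH) (Matrix.nonsing_inv_mul _ hB) hg
    (A := (1 / √(D.N n : ℝ)) • D.L0 n k) (D.factor n k t ω).ofLp ((1 / √(D.N n : ℝ)) • D.err n t ω)
  have hf : vn ((D.H L s2 p n ω k)⁻¹ *ᵥ (D.factor n k t ω).ofLp) ≤ CG * D.fnorm n t ω :=
    vn_mulVec_le_of_le hCG (D.vn_fac n t ω).le
  have hpad : WithLp.toLp 2 (D.factorCoeff L s2 p n ω k *ᵥ
      ((1 / (D.N n : ℝ)) • ((D.L0 n k)ᵀ *ᵥ D.err n t ω))) = pad (maxRank r)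
      ((D.fitGram L s2 n ω k)⁻¹ *ᵥ ((D.H L s2 p n ω k)ᵀ *ᵥ (((1 / √(D.N n : ℝ)) • D.L0 n k)ᵀ *ᵥ
        ((1 / √(D.N n : ℝ)) • D.err n t ω)))) := by
    rw [pad_eq, factorCoeff, hAe, ← Matrix.mulVec_mulVec, ← Matrix.mulVec_mulVec]
  rw [hpad, fit_eq hs hN hB, hx, ← pad_sub, ← pad_sub]
  refine (norm_pad_le _ _).trans (mul_le_mul hCp ?_ (vn_nonneg _) ((fn_nonneg _).trans hCp))
  refine le_of_eq_of_le (congrArg vn key) (vn_mulVec_le_of_le hCB ?_)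
  generalize (D.H L s2 p n ω k)⁻¹ *ᵥ (D.factor n k t ω).ofLp = g at hf ⊢
  refine (vn_sub_le _ _).trans ?_
  rw [add_mul, ← add_assoc]
  refine add_le_add ((vn_sub_le _ _).trans (add_le_add le_rfl (vn_mulVec_le_of_le le_rfl hf))) ?_
  have hSN : 0 ≤ s2 n ω / D.N n := div_nonneg hs.le hN.le
  rw [vn_smul, abs_of_nonneg hSN, mul_one_div]
  exact mul_le_mul (div_le_div_of_nonneg_right hS hN.le) hf (vn_nonneg _)
    (div_nonneg (hs.le.trans hS) hN.le)

theorem norm_sum_pad_fit_le {n t : ℕ} {ω : Ω} (hs : 0 < s2 n ω) (hN : 1 ≤ (D.N n : ℝ))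
    (hT : 1 ≤ (D.T n : ℝ))
    {Cp CB CL CX : ℝ} (hCL : 0 ≤ CL) (hCX : 0 ≤ CX) (hCp : ∀ k, fn (padOp (maxRank r) (r k)) ≤ Cp)
    (hB : ∀ k, IsUnit (D.fitGram L s2 n ω k).det) (hCB : ∀ k, fn (D.fitGram L s2 n ω k)⁻¹ ≤ CB)
    (hL : ∀ k, fn (L n ω k) ^ 2 ≤ CL * D.N n) (hX : vn (D.x n t ω) ^ 2 ≤ CX * (D.N n * D.T n))
    (hp : ∀ j, |p n t ω j - D.ind n j t ω| ≤ 1 / (D.N n * D.T n : ℝ) ^ 2) :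
    ‖∑ j, (p n t ω j - D.ind n j t ω) • pad (maxRank r) (fit (L n ω j) (s2 n ω) (D.x n t ω))‖ ≤
      J * (Cp * (CB * (√CL * √CX))) * (1 / D.N n) := by
  have hN0 : (0 : ℝ) < D.N n := one_pos.trans_le hN
  have hT0 : (0 : ℝ) < D.T n := one_pos.trans_le hT
  have hsN := Real.sqrt_pos.2 hN0
  have hx : vn ((1 / √(D.N n : ℝ)) • D.x n t ω) ≤ √CX * √(D.T n : ℝ) := by
    rw [vn_smul, abs_of_pos (by positivity), one_div, inv_mul_le_iff₀ hsN]
    have : vn (D.x n t ω) ≤ √(CX * (D.N n * D.T n)) := Real.le_sqrt_of_sq_le hX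
    rw [Real.sqrt_mul hCX, Real.sqrt_mul hN0.le] at this
    exact this.trans (le_of_eq (by ring))
  have hLn : ∀ k, fn ((1 / √(D.N n : ℝ)) • L n ω k)ᵀ ≤ √CL := fun k => by
    rw [fn_transpose, fn_smul, abs_of_pos (by positivity), one_div, inv_mul_le_iff₀ hsN, mul_comm]
    exact fn_le_of_sq_le hCL (hL k)
  have h1 : ∀ j, ‖pad (maxRank r) (fit (L n ω j) (s2 n ω) (D.x n t ω))‖ ≤
      Cp * (CB * (√CL * (√CX * √(D.T n : ℝ)))) := fun j => by
    rw [fit_eq hs hN0 (hB j)]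
    exact (norm_pad_le _ _).trans (mul_le_mul (hCp j) (vn_mulVec_le_of_le (hCB j)
      (vn_mulVec_le_of_le (hLn j) hx)) (vn_nonneg _) ((fn_nonneg _).trans (hCp j)))
  have h3 : 1 / (D.N n * D.T n : ℝ) ^ 2 * √(D.T n : ℝ) ≤ 1 / D.N n := by
    have : √(D.T n : ℝ) ≤ D.T n := Real.sqrt_le_iff.2 ⟨hT0.le, by nlinarith⟩
    rw [one_div_mul_eq_div, div_le_div_iff₀ (by positivity) hN0]
    nlinarith [mul_le_mul this (le_refl (D.N n : ℝ)) hN0.le hT0.le,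
      mul_le_mul_of_nonneg_left (one_le_mul_of_one_le_of_one_le hN hT) (mul_pos hN0 hT0).le]
  refine (norm_sum_le _ _).trans ?_
  have h2 : ∀ j ∈ Finset.univ, ‖(p n t ω j - D.ind n j t ω) •
      pad (maxRank r) (fit (L n ω j) (s2 n ω) (D.x n t ω))‖ ≤
      Cp * (CB * (√CL * √CX)) * (1 / D.N n) := fun j _ => by
    have g1 := (norm_nonneg _).trans (h1 j)
    have g2 : 0 ≤ Cp * (CB * (√CL * √CX)) := mul_nonneg ((fn_nonneg _).trans (hCp j))
      (mul_nonneg ((fn_nonneg _).trans (hCB j)) (by positivity))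
    rw [norm_smul, Real.norm_eq_abs]
    calc _ ≤ 1 / (D.N n * D.T n : ℝ) ^ 2 * (Cp * (CB * (√CL * (√CX * √(D.T n : ℝ))))) :=
          mul_le_mul (hp j) (h1 j) (norm_nonneg _) (by positivity)
      _ = Cp * (CB * (√CL * √CX)) * (1 / (D.N n * D.T n : ℝ) ^ 2 * √(D.T n : ℝ)) := by ring
      _ ≤ _ := mul_le_mul_of_nonneg_left h3 g2
  refine (Finset.sum_le_sum h2).trans (le_of_eq ?_)
  simp
  ring

theorem factor_bound_arith {Cp CB CG S R u F f ν : ℝ} (hCp : 0 ≤ Cp) (hCB : 0 ≤ CB) (hCG : 0 ≤ CG)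
    (hS : 0 ≤ S) (hR : 0 ≤ R) (hu : 0 ≤ u) (hF : 0 ≤ F) (hf : 0 ≤ f) (hν : 0 ≤ ν) :
    Cp * (CB * (u + (F + S * ν) * (CG * f))) + R * ν ≤
      (Cp * CB * (1 + CG + S * CG) + R) * (u + (F + ν) * f + ν) := by
  have h1 : u + (F + S * ν) * (CG * f) ≤ (1 + CG + S * CG) * (u + (F + ν) * f + ν) := by
    have e : (1 + CG + S * CG) * (u + (F + ν) * f + ν) = u + (F + S * ν) * (CG * f) +
      ((CG + S * CG) * u + (F + ν) * f + CG * ν * f + S * CG * F * f + (1 + CG + S * CG) * ν) := by ring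
    rw [e]
    exact le_add_of_nonneg_right (by positivity)
  have h2 : R * ν ≤ R * (u + (F + ν) * f + ν) :=
    mul_le_mul_of_nonneg_left (le_add_of_nonneg_left (by positivity)) hR
  calc _ ≤ Cp * (CB * ((1 + CG + S * CG) * (u + (F + ν) * f + ν))) +
      R * (u + (F + ν) * f + ν) := by gcongr
    _ = _ := by ring

namespace Fitted

variable [Nonempty (Fin J)] (h : D.Fitted L s2 p P q SigF l) (hq : ∀ j, 0 < q j)
  (hΛ : D.LoadingAssumption SigL)
  (hH : ∃ C, 0 ≤ C ∧ ∀ᶠ x : ℕ × Ω in l, ∀ j, IsUnit (D.H L s2 p x.1 x.2 j).det ∧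
    fn (D.H L s2 p x.1 x.2 j)⁻¹ ≤ C)
include h hΛ hH

set_option maxHeartbeats 1000000 in
omit [Nonempty (Fin J)] in
theorem exists_norm_factorError_sub_le : ∃ C, 0 ≤ C ∧ ∀ᶠ x : ℕ × Ω in l, ∀ t < D.T x.1, ∀ k,
    D.state x.1 t x.2 = k →
    ‖D.factorError L s2 p x.1 t x.2 - WithLp.toLp 2 (D.factorCoeff L s2 p x.1 x.2 k *ᵥ
      ((1 / (D.N x.1 : ℝ)) • ((D.L0 x.1 k)ᵀ *ᵥ D.err x.1 t x.2)))‖ ≤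
    C * (vn ((((1 / √(D.N x.1 : ℝ)) • L x.1 x.2 k) - ((1 / √(D.N x.1 : ℝ)) • D.L0 x.1 k) *
          D.H L s2 p x.1 x.2 k)ᵀ *ᵥ ((1 / √(D.N x.1 : ℝ)) • D.err x.1 t x.2)) +
        (fn (((1 / √(D.N x.1 : ℝ)) • L x.1 x.2 k)ᵀ * (((1 / √(D.N x.1 : ℝ)) • L x.1 x.2 k) -
          ((1 / √(D.N x.1 : ℝ)) • D.L0 x.1 k) * D.H L s2 p x.1 x.2 k)) + 1 / D.N x.1) *
          D.fnorm x.1 t x.2 + 1 / D.N x.1) := by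
  obtain ⟨CB, hCB, h1⟩ := h.exists_fitGram_inv_bound
  obtain ⟨CG, hCG, h2⟩ := hH
  obtain ⟨CL, hCL, h3⟩ := h.exists_fn_L_le
  obtain ⟨CX, hCX, h4⟩ := h.exists_sum_x_le hΛ
  obtain ⟨c, S, hc, h5⟩ := h.s2_bdd
  obtain ⟨Cp, hCp0, hCp⟩ := exists_fn_padOp_le r
  refine ⟨Cp * CB * (1 + CG + |S| * CG) + J * (Cp * (CB * (√CL * √CX))), by positivity, ?_⟩
  filter_upwards [h1, h2, h3, h4, h5, h.prob, h.eventually_N_pos, h.eventually_T_pos]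
    with x g1 g2 g3 g4 g5 g6 hN hT t ht k hk
  have hs := hc.trans_le g5.1
  have hN1 : (1 : ℝ) ≤ D.N x.1 := by exact_mod_cast hN
  have hT1 : (1 : ℝ) ≤ D.T x.1 := by exact_mod_cast hT
  have hX := le_of_sum_fin_le (f := fun t => vn (D.x x.1 t x.2) ^ 2) (fun _ => sq_nonneg _) g4 ht
  beta_reduce at hX
  have b1 := norm_pad_fit_sub_le hs hN hk (hCp k) (g1 k).1 (g1 k).2 (g2 k).1 (g2 k).2
    (g5.2.trans (le_abs_self S))
  have b2 := norm_sum_pad_fit_le hs hN1 hT1 hCL hCX hCp (fun k => (g1 k).1) (fun k => (g1 k).2) g3 hX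
    (g6 t ht)
  refine le_trans ?_ (factor_bound_arith hCp0 hCB hCG (abs_nonneg S) (by positivity) (vn_nonneg _)
    (fn_nonneg _) (D.fnorm_nonneg _ _ _) (by positivity))
  rw [factorError_sub_eq hk]
  exact (norm_add_le _ _).trans (add_le_add b1 b2)

end Fitted

end Panel

theorem continuous_fn {m n : Type*} [Fintype m] [Fintype n] :
    Continuous (fn : Matrix m n ℝ → ℝ) := by
  unfold fn
  exact Real.continuous_sqrt.comp (continuous_finsetSum _ fun i _ => continuous_finsetSum _ fun j _ =>
    (continuous_id.matrix_elem i j).pow 2)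

theorem add_sq_le_four (a b c d : ℝ) :
    (a + b + c + d) ^ 2 ≤ 4 * (a ^ 2 + b ^ 2 + c ^ 2 + d ^ 2) := by
  nlinarith [sq_nonneg (a - b), sq_nonneg (a - c), sq_nonneg (a - d), sq_nonneg (b - c),
    sq_nonneg (b - d), sq_nonneg (c - d)]

namespace Panel

theorem exists_H_inv_bound (hF : ∀ j, (SigF j).PosDef) (E : EigenData SigF SigL)
    (hH : ∀ j, Tendsto (fun x : ℕ × Ω => D.H L s2 p x.1 x.2 j) l (𝓝 (E.limitH j))) :
    ∃ C, 0 ≤ C ∧ ∀ᶠ x : ℕ × Ω in l, ∀ j, IsUnit (D.H L s2 p x.1 x.2 j).det ∧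
      fn (D.H L s2 p x.1 x.2 j)⁻¹ ≤ C := by
  have h1 : ∀ᶠ x : ℕ × Ω in l, ∀ j, IsUnit (D.H L s2 p x.1 x.2 j).det := eventually_all.2 fun j =>
    (((continuous_id.matrix_det.tendsto _).comp (hH j)).eventually_ne
      (E.isUnit_det_limitH j (hF j)).ne_zero).mono fun x hx => hx.isUnit
  obtain ⟨C, hC, h2⟩ := exists_bound_forall (l := l)
    (X := fun (j : Fin J) (x : ℕ × Ω) => fn (D.H L s2 p x.1 x.2 j)⁻¹) (a := fun _ => 1)
    (Eventually.of_forall fun _ => zero_le_one) fun j => ⟨fn (E.limitH j)⁻¹ + 1,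
      add_nonneg (fn_nonneg _) zero_le_one, by
        have := (continuous_fn.tendsto _).comp
          (tendsto_matrix_inv (hH j) (E.isUnit_det_limitH j (hF j)))
        filter_upwards [this.eventually_lt_const (lt_add_one _)] with x hx
        rw [mul_one]
        exact hx.le⟩
  refine ⟨C, hC, ?_⟩
  filter_upwards [h1, h2] with x g1 g2 j
  exact ⟨g1 j, (g2 j).trans (mul_one C).le⟩

theorem norm_factorCoeff_mulVec_le {n : ℕ} {ω : Ω} {k : Fin J} {Cp CB CH : ℝ}
    (hCp : fn (padOp (maxRank r) (r k)) ≤ Cp) (hCB : fn (D.fitGram L s2 n ω k)⁻¹ ≤ CB)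
    (hCH : fn (D.H L s2 p n ω k) ≤ CH) (v : Fin (r k) → ℝ) :
    ‖WithLp.toLp 2 (D.factorCoeff L s2 p n ω k *ᵥ v)‖ ≤ Cp * (CB * CH) * vn v := by
  rw [← vn_eq_norm]
  exact vn_mulVec_le_of_le (fn_mul_le_of_le hCp (fn_mul_le_of_le hCB (by rwa [fn_transpose]))) le_rfl

theorem one_div_N_le {n : ℕ} (hδ : 0 < D.δ n) : 1 / (D.N n : ℝ) ≤ (1 / D.δ n) ^ 2 := by
  rw [_root_.one_div_pow]
  exact one_div_le_one_div_of_le (by positivity) (D.δ_sq_le_N n)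

theorem factor_rate_arith {K C a u e F f ν ε A B : ℝ} (hC : 0 ≤ C) (hA : 0 ≤ A) (hB : 0 ≤ B)
    (ha : 0 ≤ a) (he : 0 ≤ e) (hf : 0 ≤ f) (hε : 0 ≤ ε) (hK : 0 ≤ K)
    (h1 : u ≤ A * ε * e) (h2 : F ≤ B * ε) (h3 : ν ≤ ε) :
    K * a + C * (u + (F + ν) * f + ν) ≤ (K + C * (1 + A + B)) * (a + ε * e + ε * f + ε) := by
  have h4 : u + (F + ν) * f + ν ≤ (1 + A + B) * (a + ε * e + ε * f + ε) := by
    have e1 : (1 + A + B) * (a + ε * e + ε * f + ε) = A * ε * e + (B * ε + ε) * f + ε +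
      ((1 + A + B) * a + (1 + B) * (ε * e) + A * (ε * f) + (A + B) * ε) := by ring
    rw [e1]
    refine le_trans ?_ (le_add_of_nonneg_right (by positivity))
    gcongr
  have h5 : a ≤ a + ε * e + ε * f + ε := by
    have : 0 ≤ ε * e + ε * f + ε := by positivity
    linarith
  calc _ ≤ K * (a + ε * e + ε * f + ε) + C * ((1 + A + B) * (a + ε * e + ε * f + ε)) := by gcongr
    _ = _ := by ring

namespace Fitted

variable [Nonempty (Fin J)] (h : D.Fitted L s2 p P q SigF l) (hq : ∀ j, 0 < q j)
  (hΛ : D.LoadingAssumption SigL)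
  (hH : ∃ C, 0 ≤ C ∧ ∀ᶠ x : ℕ × Ω in l, ∀ j, IsUnit (D.H L s2 p x.1 x.2 j).det ∧
    fn (D.H L s2 p x.1 x.2 j)⁻¹ ≤ C)
include h hq hΛ hH

set_option maxHeartbeats 1000000 in
theorem exists_norm_factorError_le : ∃ C, 0 ≤ C ∧ ∀ᶠ x : ℕ × Ω in l, ∀ t < D.T x.1,
    ‖D.factorError L s2 p x.1 t x.2‖ ≤
      C * (1 / D.N x.1 * vn ((D.L0 x.1 (D.state x.1 t x.2))ᵀ *ᵥ D.err x.1 t x.2) +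
        1 / D.δ x.1 * (1 / √(D.N x.1 : ℝ) * vn (D.err x.1 t x.2)) +
        1 / D.δ x.1 * D.fnorm x.1 t x.2 + 1 / D.δ x.1) := by
  obtain ⟨C1, hC1, h1⟩ := h.exists_norm_factorError_sub_le hΛ hH
  obtain ⟨K, hK, h2⟩ := h.exists_perturbed hq hΛ
  obtain ⟨CB, hCB, h3⟩ := h.exists_fitGram_inv_bound
  obtain ⟨Cp, hCp0, hCp⟩ := exists_fn_padOp_le r
  refine ⟨Cp * (CB * K) + C1 * (1 + 4 * K ^ 4 + K * (4 * K ^ 4)), by positivity, ?_⟩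
  filter_upwards [h1, h2, h3, h.eventually_δ, h.eventually_N_pos] with x g1 g2 g3 hδ1 hN t ht
  have hδ : 0 < D.δ x.1 := one_pos.trans_le hδ1
  have hε : 0 ≤ 1 / D.δ x.1 := by positivity
  have hν : 1 / (D.N x.1 : ℝ) ≤ 1 / D.δ x.1 := by
    refine (one_div_N_le hδ).trans ?_
    rw [sq]
    exact mul_le_of_le_one_left hε ((div_le_one hδ).2 hδ1)
  have b1 := g1 t ht _ rfl
  set k := D.state x.1 t x.2 with hk
  have hp := g2 k K le_rfl
  have b2 := norm_factorCoeff_mulVec_le (hCp k) (g3 k).2 hp.H_le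
    ((1 / (D.N x.1 : ℝ)) • ((D.L0 x.1 k)ᵀ *ᵥ D.err x.1 t x.2))
  rw [vn_smul, abs_of_nonneg (by positivity)] at b2
  have b3 := vn_mulVec_le_of_le (v := (1 / √(D.N x.1 : ℝ)) • D.err x.1 t x.2)
    ((fn_transpose _).le.trans hp.fn_sub_le) le_rfl
  rw [vn_smul (1 / √(D.N x.1 : ℝ)), abs_of_nonneg (by positivity)] at b3
  have b4 := fn_mul_le_of_le ((fn_transpose _).le.trans hp.At_le) hp.fn_sub_le
  rw [← mul_assoc] at b4
  refine le_trans ?_ (factor_rate_arith hC1 (by positivity) (by positivity)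
    (mul_nonneg (by positivity) (vn_nonneg _)) (mul_nonneg (by positivity) (vn_nonneg _))
    (D.fnorm_nonneg _ _ _) hε (by positivity) b3 b4 hν)
  refine le_trans ?_ (add_le_add b2 b1)
  rw [add_comm]
  exact norm_le_norm_sub_add _ _

set_option maxHeartbeats 1000000 in
theorem exists_mean_sq_factorError_le : ∃ C, 0 ≤ C ∧ ∀ᶠ x : ℕ × Ω in l,
    1 / (D.T x.1 : ℝ) * ∑ t ∈ Finset.range (D.T x.1), ‖D.factorError L s2 p x.1 t x.2‖ ^ 2 ≤
      C * (1 / D.δ x.1 ^ 2) := by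
  obtain ⟨C, hC, h1⟩ := h.exists_norm_factorError_le hq hΛ hH
  obtain ⟨C2, hC2, h2⟩ := h.loadingErr
  obtain ⟨C3, hC3, h3⟩ := h.err
  obtain ⟨C4, hC4, h4⟩ := h.exists_sum_fnorm_le
  refine ⟨4 * C ^ 2 * (J * C2 + C3 + C4 + 1), by positivity, ?_⟩
  filter_upwards [h1, h2, h3, h4, h.eventually_δ, h.eventually_N_pos, h.eventually_T_pos]
    with x g1 g2 g3 g4 hδ1 hN hT
  have hδ : 0 < D.δ x.1 := one_pos.trans_le hδ1
  rw [← Finset.sum_range (f := fun t => D.fnorm x.1 t x.2 ^ 2)] at g4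
  have hν := one_div_N_le hδ
  rw [_root_.one_div_pow] at hν
  have b1 : ∀ t ∈ Finset.range (D.T x.1), ‖D.factorError L s2 p x.1 t x.2‖ ^ 2 ≤
      4 * C ^ 2 * ((1 / (D.N x.1 : ℝ)) ^ 2 * ∑ j, vn ((D.L0 x.1 j)ᵀ *ᵥ D.err x.1 t x.2) ^ 2 +
        1 / D.δ x.1 ^ 2 * (1 / D.N x.1 * vn (D.err x.1 t x.2) ^ 2) +
        1 / D.δ x.1 ^ 2 * D.fnorm x.1 t x.2 ^ 2 + 1 / D.δ x.1 ^ 2) := fun t ht => by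
    refine (pow_le_pow_left₀ (norm_nonneg _) (g1 t (Finset.mem_range.1 ht)) 2).trans ?_
    rw [mul_pow, mul_comm 4, mul_assoc]
    refine mul_le_mul_of_nonneg_left ((add_sq_le_four _ _ _ _).trans ?_) (sq_nonneg _)
    simp only [mul_pow, _root_.one_div_pow, Real.sq_sqrt hN.le]
    have := Finset.single_le_sum (f := fun j => vn ((D.L0 x.1 j)ᵀ *ᵥ D.err x.1 t x.2) ^ 2)
      (fun j _ => sq_nonneg _) (Finset.mem_univ (D.state x.1 t x.2))
    gcongr
  have b2 : ∑ t ∈ Finset.range (D.T x.1), ∑ j, vn ((D.L0 x.1 j)ᵀ *ᵥ D.err x.1 t x.2) ^ 2 ≤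
      J * (C2 * (D.N x.1 * D.T x.1)) := by
    rw [Finset.sum_comm]
    exact (Finset.sum_le_sum fun j _ => g2 j).trans (by simp)
  have b3 := Finset.sum_le_sum b1
  simp only [← Finset.mul_sum, Finset.sum_add_distrib, Finset.sum_const, Finset.card_range,
    nsmul_eq_mul] at b3
  have hd : 0 ≤ 1 / D.δ x.1 ^ 2 := by positivity
  calc _ ≤ 1 / (D.T x.1 : ℝ) * (4 * C ^ 2 * ((1 / (D.N x.1 : ℝ)) ^ 2 * (J * (C2 * (D.N x.1 * D.T x.1))) +
        1 / D.δ x.1 ^ 2 * (1 / D.N x.1 * (C3 * (D.N x.1 * D.T x.1))) +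
        1 / D.δ x.1 ^ 2 * (C4 * D.T x.1) + D.T x.1 * (1 / D.δ x.1 ^ 2))) := by
        refine mul_le_mul_of_nonneg_left (b3.trans ?_) (by positivity)
        gcongr
    _ = 4 * C ^ 2 * (J * C2 * (1 / D.N x.1) + (C3 + C4 + 1) * (1 / D.δ x.1 ^ 2)) := by
        field_simp
        ring
    _ ≤ 4 * C ^ 2 * (J * C2 * (1 / D.δ x.1 ^ 2) + (C3 + C4 + 1) * (1 / D.δ x.1 ^ 2)) := by gcongr
    _ = _ := by ring

end Fitted

theorem often_bound_at_date [IsProbabilityMeasure P] (hα : 2 ≤ α) (hβ : 2 ≤ β)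
    (hF : D.FactorAssumption P q α SigF) (he : D.ErrorAssumption P α)
    (hA : D.LoadingErrorMoment P β) (t : ℕ) :
    Often P fun l => ∃ C, 0 ≤ C ∧ ∀ᶠ x : ℕ × Ω in l, D.fnorm x.1 t x.2 ≤ C ∧
      vn (D.err x.1 t x.2) ≤ C * √(D.N x.1 : ℝ) ∧
      ∀ j, vn ((D.L0 x.1 j)ᵀ *ᵥ D.err x.1 t x.2) ≤ C * √(D.N x.1 : ℝ) := by
  have hS : ∀ᶠ n in atTop, ({t} : Finset ℕ) ∩ Finset.range (D.T n) = {t} :=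
    (D.tendsto_T.eventually_gt_atTop t).mono fun n hn => Finset.inter_eq_left.2
      (Finset.singleton_subset_iff.2 (Finset.mem_range.2 hn))
  refine (often_dateBound hα hβ hF he hA (S := fun n => {t} ∩ Finset.range (D.T n))
    (fun n => Finset.inter_subset_right) (hS.mono fun n hn => by simp [hn])).mono ?_
  rintro l hl ⟨⟨C1, hC1, h1⟩, ⟨C2, hC2, h2⟩, ⟨C3, hC3, h3⟩⟩
  refine ⟨C1 + C2 + C3, by positivity, ?_⟩
  filter_upwards [h1, h2, h3, eventually_fst hl hS] with x g1 g2 g3 g4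
  have hmem : t ∈ ({t} : Finset ℕ) ∩ Finset.range (D.T x.1) := by rw [g4]; simp
  have k1 := g1 t hmem
  have k2 := g2 t hmem
  have k3 := g3 t hmem
  simp only [g4, Finset.card_singleton, Nat.cast_one, Real.one_rpow, mul_one] at k1 k2 k3
  have hs := Real.sqrt_nonneg (D.N x.1 : ℝ)
  exact ⟨by linarith, k2.trans (mul_le_mul_of_nonneg_right (by linarith) hs),
    fun j => (k3 j).trans (mul_le_mul_of_nonneg_right (by linarith) hs)⟩

theorem transpose_EM_mul_FM_mulVec_err (n : ℕ) (j : Fin J) (s : ℕ) (ω : Ω) :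
    (D.EM n j ω * D.FM n j ω)ᵀ *ᵥ D.err n s ω =
      (∑ t ∈ Finset.range (D.T n), ((∑ i ∈ Finset.range (D.N n),
        D.error n i t ω * D.error n i s ω) * D.ind n j t ω) • D.factor n j t ω).ofLp := by
  ext l
  rw [Finset.sum_range]
  simp only [Finset.sum_range (n := D.N n), WithLp.ofLp_sum, Finset.sum_apply, WithLp.ofLp_smul,
    Pi.smul_apply, smul_eq_mul, mulVec, dotProduct, Matrix.transpose_apply, Matrix.mul_apply, EM, FM,
    Matrix.of_apply, err, Finset.sum_mul]
  rw [Finset.sum_comm]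
  refine Finset.sum_congr rfl fun t _ => Finset.sum_congr rfl fun i _ => ?_
  linear_combination (D.error n i t ω * D.factor n j t ω l * D.error n i s ω) *
    D.ind_mul_self n j t ω

theorem loading_mulVec_err (n : ℕ) (j : Fin J) (t : ℕ) (ω : Ω) :
    (D.L0 n j)ᵀ *ᵥ D.err n t ω =
      (∑ i ∈ Finset.range (D.N n), D.error n i t ω • D.loading n j i).ofLp := by
  ext l
  rw [Finset.sum_range]
  simp [Matrix.mulVec, dotProduct, L0, err, mul_comm]

theorem vn_scaledEF_mulVec_le {n : ℕ} {k : Fin J} {ω : Ω} {t : ℕ} {C : ℝ} (hC : 0 ≤ C)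
    (hδ : 0 < D.δ n) (hN : 0 < (D.N n : ℝ)) (hT : 0 < (D.T n : ℝ))
    (h : ‖∑ s ∈ Finset.range (D.T n), ((∑ i ∈ Finset.range (D.N n),
        D.error n i s ω * D.error n i t ω) * D.ind n k s ω) • D.factor n k s ω‖ ≤
        C * (√(D.N n * D.T n) + D.N n)) :
    vn ((D.scaledEF n k ω)ᵀ *ᵥ ((1 / √(D.N n : ℝ)) • D.err n t ω)) ≤
      2 * C * (1 / D.δ n) ^ 2 := by
  have hsN := Real.sqrt_pos.2 hN
  have hsT := Real.sqrt_pos.2 hT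
  have e : (D.scaledEF n k ω)ᵀ *ᵥ ((1 / √(D.N n : ℝ)) • D.err n t ω) =
      (1 / (D.N n * D.T n : ℝ)) • ((D.EM n k ω * D.FM n k ω)ᵀ *ᵥ D.err n t ω) := by
    rw [scaledEF, Matrix.transpose_smul, Matrix.smul_mulVec, Matrix.mulVec_smul, smul_smul,
      div_mul_div_comm, one_mul, mul_right_comm, Real.mul_self_sqrt hN.le]
  rw [e, vn_smul, abs_of_pos (by positivity), transpose_EM_mul_FM_mulVec_err, vn_eq_norm]
  have h2 := one_div_sqrt_N_le hδ
  have h3 := one_div_sqrt_T_le hδ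
  calc _ ≤ 1 / (D.N n * D.T n : ℝ) * (C * (√(D.N n * D.T n) + D.N n)) := by
        refine mul_le_mul_of_nonneg_left h (by positivity)
    _ = C * (1 / √(D.N n : ℝ) * (1 / √(D.T n : ℝ)) + 1 / √(D.T n : ℝ) * (1 / √(D.T n : ℝ))) := by
        have e2 : ∀ a b : ℝ, 0 < a → 0 < b → 1 / (a * a * (b * b)) * (C * (a * b + a * a)) =
            C * (1 / a * (1 / b) + 1 / b * (1 / b)) := fun a b ha hb => by field_simp
        have e3 := e2 _ _ hsN hsT
        rwa [Real.mul_self_sqrt hN.le, Real.mul_self_sqrt hT.le, ← Real.sqrt_mul hN.le] at e3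
    _ ≤ C * (1 / D.δ n * (1 / D.δ n) + 1 / D.δ n * (1 / D.δ n)) := by gcongr
    _ = _ := by ring

theorem factor_date_arith {C K R sN s ε ν f : ℝ} (hC : 0 ≤ C) (hK : 0 ≤ K) (hs : 0 ≤ s)
    (hsN : sN * ν = 1) (hν : 0 < ν) (hε : ν ≤ ε) (hf : f ≤ K) (hf0 : 0 ≤ f)
    (hR : ε ^ 2 ≤ R) :
    sN * (C * (13 * K ^ 8 * (s * ν + ε ^ 2) + (120 * K ^ 11 * ε ^ 2 + ν ^ 2) * f + ν ^ 2)) ≤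
      C * (13 * K ^ 8 + 120 * K ^ 12 + K + 1) * (s + sN * R) := by
  have hsN0 : 0 < sN := by
    rcases lt_or_ge 0 sN with h | h
    · exact h
    · nlinarith
  have h1 : ν ^ 2 ≤ ε ^ 2 := pow_le_pow_left₀ hν.le hε 2
  have h2 : 13 * K ^ 8 * (s * ν + ε ^ 2) + (120 * K ^ 11 * ε ^ 2 + ν ^ 2) * f + ν ^ 2 ≤
      13 * K ^ 8 * (s * ν + R) + (120 * K ^ 11 * R + R) * K + R := by
    have h3 := h1.trans hR
    have hR0 : 0 ≤ R := (sq_nonneg _).trans hR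
    gcongr
  have hR0 : 0 ≤ R := (sq_nonneg _).trans hR
  calc _ ≤ sN * (C * (13 * K ^ 8 * (s * ν + R) + (120 * K ^ 11 * R + R) * K + R)) := by gcongr
    _ = C * (13 * K ^ 8 * (s * (sN * ν)) + (13 * K ^ 8 + 120 * K ^ 12 + K + 1) * (sN * R)) := by ring
    _ = C * (13 * K ^ 8 * s + (13 * K ^ 8 + 120 * K ^ 12 + K + 1) * (sN * R)) := by rw [hsN, mul_one]
    _ ≤ C * ((13 * K ^ 8 + 120 * K ^ 12 + K + 1) * s +
        (13 * K ^ 8 + 120 * K ^ 12 + K + 1) * (sN * R)) := by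
        have : 0 ≤ (120 * K ^ 12 + K + 1) * s := by positivity
        refine mul_le_mul_of_nonneg_left ?_ hC
        linarith
    _ = _ := by ring

namespace Fitted

variable [Nonempty (Fin J)] (h : D.Fitted L s2 p P q SigF l) (hq : ∀ j, 0 < q j)
  (hΛ : D.LoadingAssumption SigL)
  (hH : ∃ C, 0 ≤ C ∧ ∀ᶠ x : ℕ × Ω in l, ∀ j, IsUnit (D.H L s2 p x.1 x.2 j).det ∧
    fn (D.H L s2 p x.1 x.2 j)⁻¹ ≤ C)
include h hq hΛ hH

set_option maxHeartbeats 1000000 in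
theorem tendsto_factorError_sub (k : Fin J) (t : ℕ)
    (hLF : ∃ C : ℝ, 0 ≤ C ∧ ∀ᶠ x : ℕ × Ω in l,
      fn ((D.L0 x.1 k)ᵀ * (D.EM x.1 k x.2 * D.FM x.1 k x.2)) ^ 2 ≤ C * (D.N x.1 * D.T x.1))
    (hFP : ∃ C : ℝ, 0 ≤ C ∧ ∀ᶠ x : ℕ × Ω in l,
      ‖∑ s ∈ Finset.range (D.T x.1), ((∑ i ∈ Finset.range (D.N x.1),
        D.error x.1 i s x.2 * D.error x.1 i t x.2) * D.ind x.1 k s x.2) • D.factor x.1 k s x.2‖ ≤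
        C * (√(D.N x.1 * D.T x.1) + D.N x.1))
    (hB : ∃ C, 0 ≤ C ∧ ∀ᶠ x : ℕ × Ω in l, D.fnorm x.1 t x.2 ≤ C ∧
      vn (D.err x.1 t x.2) ≤ C * √(D.N x.1 : ℝ) ∧
      ∀ j, vn ((D.L0 x.1 j)ᵀ *ᵥ D.err x.1 t x.2) ≤ C * √(D.N x.1 : ℝ))
    (hr : Tendsto (fun n => √(D.N n : ℝ) / D.T n) atTop (𝓝 0)) :
    Tendsto (fun x : ℕ × Ω => D.ind x.1 k t x.2 • (√(D.N x.1 : ℝ) • D.factorError L s2 p x.1 t x.2 -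
      WithLp.toLp 2 (D.factorCoeff L s2 p x.1 x.2 k *ᵥ ((1 / √(D.N x.1 : ℝ)) •
        ∑ i ∈ Finset.range (D.N x.1), D.error x.1 i t x.2 • D.loading x.1 k i).ofLp))) l (𝓝 0) := by
  obtain ⟨C, hC, h0⟩ := h.exists_norm_factorError_sub_le hΛ hH
  obtain ⟨C0, hC0, h1⟩ := h.exists_perturbed hq hΛ
  obtain ⟨C1, hC1, h2⟩ := hLF
  obtain ⟨C2, hC2, h3⟩ := hFP
  obtain ⟨C3, hC3, h4⟩ := hB
  set K := C0 + √C1 + 2 * C2 + C3 with hK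
  have hK0 : 0 ≤ K := by positivity
  have hlim : Tendsto (fun n => C * (13 * K ^ 8 + 120 * K ^ 12 + K + 1) *
      (√(1 / D.δ n) + √(D.N n : ℝ) * (1 / D.N n + 1 / D.T n))) atTop (𝓝 0) := by
    have e1 := (Real.continuous_sqrt.tendsto 0).comp D.tendsto_inv_δ
    have e2 : Tendsto (fun n => 1 / √(D.N n : ℝ)) atTop (𝓝 0) :=
      ((Real.tendsto_sqrt_atTop.comp D.tendsto_N_real).inv_tendsto_atTop).congr fun n => by simp
    rw [Real.sqrt_zero] at e1
    have e3 := (e1.add (e2.add hr)).const_mul (C * (13 * K ^ 8 + 120 * K ^ 12 + K + 1))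
    simp only [add_zero, mul_zero] at e3
    refine e3.congr fun n => ?_
    rw [mul_add (√(D.N n : ℝ)), mul_one_div, mul_one_div, Real.sqrt_div_self']
    rfl
  refine squeeze_zero_norm' ?_ (hlim.comp (tendsto_fst_whp.mono_left h.le))
  filter_upwards [h0, h1, h2, h3, h4, h.eventually_δ, h.eventually_N_pos, h.eventually_T_pos,
    eventually_fst h.le (D.tendsto_T.eventually_gt_atTop t)] with x g0 g1 g2 g3 g4 hδ1 hN hT ht
  have hδ : 0 < D.δ x.1 := one_pos.trans_le hδ1
  have hsN := Real.sqrt_pos.2 hN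
  have hR := one_div_δ_sq_le hN hT
  have n1 := Real.sqrt_nonneg C1
  simp only [Function.comp]
  by_cases hk : D.state x.1 t x.2 = k
  swap
  · rw [ind, if_neg hk, zero_smul, norm_zero]
    positivity
  have hp := g1 k K (by linarith)
  have b0 := g0 t ht k hk
  have b1 : fn (((1 / √(D.N x.1 : ℝ)) • D.L0 x.1 k)ᵀ * D.scaledEF x.1 k x.2) ≤
      K * (1 / D.δ x.1) ^ 2 := (fn_loading_scaledEF_le hC1 hδ hN hT g2).trans
    (mul_le_mul_of_nonneg_right (by linarith) (sq_nonneg _))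
  have b2 : vn ((1 / √(D.N x.1 : ℝ)) • D.err x.1 t x.2) ≤ K := by
    rw [vn_smul, abs_of_pos (by positivity), one_div, inv_mul_le_iff₀ hsN, mul_comm]
    exact g4.2.1.trans (mul_le_mul_of_nonneg_right (by linarith) hsN.le)
  have b3 : vn (((1 / √(D.N x.1 : ℝ)) • D.L0 x.1 k)ᵀ *ᵥ ((1 / √(D.N x.1 : ℝ)) • D.err x.1 t x.2)) ≤
      K * (1 / √(D.N x.1 : ℝ)) := by
    rw [Matrix.transpose_smul, Matrix.smul_mulVec, Matrix.mulVec_smul, smul_smul, vn_smul,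
      abs_of_pos (by positivity), mul_assoc, mul_comm]
    refine mul_le_mul_of_nonneg_right ?_ (by positivity)
    rw [one_div, inv_mul_le_iff₀ hsN, mul_comm]
    exact (g4.2.2 k).trans (mul_le_mul_of_nonneg_right (by linarith) hsN.le)
  have b4 : vn ((D.scaledEF x.1 k x.2)ᵀ *ᵥ ((1 / √(D.N x.1 : ℝ)) • D.err x.1 t x.2)) ≤
      K * (1 / D.δ x.1) ^ 2 := (vn_scaledEF_mulVec_le hC2 hδ hN hT g3).trans
    (mul_le_mul_of_nonneg_right (by linarith) (sq_nonneg _))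
  have b5 := hp.vn_sub_mulVec_le b1 b2 b3 b4
  have b6 := hp.fn_mul_sub_le b1
  have hν : 1 / (D.N x.1 : ℝ) = (1 / √(D.N x.1 : ℝ)) ^ 2 := by
    rw [_root_.one_div_pow, Real.sq_sqrt hN.le]
  have key : D.ind x.1 k t x.2 • (√(D.N x.1 : ℝ) • D.factorError L s2 p x.1 t x.2 -
      WithLp.toLp 2 (D.factorCoeff L s2 p x.1 x.2 k *ᵥ ((1 / √(D.N x.1 : ℝ)) •
        ∑ i ∈ Finset.range (D.N x.1), D.error x.1 i t x.2 • D.loading x.1 k i).ofLp)) =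
      √(D.N x.1 : ℝ) • (D.factorError L s2 p x.1 t x.2 -
        WithLp.toLp 2 (D.factorCoeff L s2 p x.1 x.2 k *ᵥ
          ((1 / (D.N x.1 : ℝ)) • ((D.L0 x.1 k)ᵀ *ᵥ D.err x.1 t x.2)))) := by
    have e (v : Fin (r k) → ℝ) : (1 / √(D.N x.1 : ℝ)) • v = √(D.N x.1 : ℝ) • ((1 / (D.N x.1 : ℝ)) • v) := by
      rw [smul_smul, mul_one_div, Real.sqrt_div_self']
    rw [ind, if_pos hk, one_smul, smul_sub, WithLp.ofLp_smul, ← loading_mulVec_err, e,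
      Matrix.mulVec_smul, WithLp.toLp_smul]
  rw [key, norm_smul, Real.norm_eq_abs, abs_of_pos hsN]
  refine (mul_le_mul_of_nonneg_left b0 hsN.le).trans ?_
  rw [hν]
  rw [hν] at hR
  refine le_trans ?_ (factor_date_arith hC hK0 (Real.sqrt_nonneg (1 / D.δ x.1))
    (mul_one_div_cancel hsN.ne') (by positivity) hp.le_ε (g4.1.trans (by linarith))
    (D.fnorm_nonneg _ _ _) hR)
  have := D.fnorm_nonneg x.1 t x.2
  gcongr

end Fitted

end Panel

theorem tendsto_integral_of_tendstoInDistribution {Ω E : Type*} [MeasurableSpace Ω]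
    {P : Measure Ω} [IsProbabilityMeasure P] [TopologicalSpace E] [MeasurableSpace E]
    [OpensMeasurableSpace E] {X : ℕ → Ω → E} {ν : Measure E} [IsProbabilityMeasure ν]
    (h : TendstoInDistribution X atTop id (fun _ => P) ν) (g : E →ᵇ ℝ) :
    Tendsto (fun n => ∫ ω, g (X n ω) ∂P) atTop (𝓝 (∫ y, g y ∂ν)) := by
  have h1 := ProbabilityMeasure.tendsto_iff_forall_integral_tendsto.1 h.tendsto g
  simp only [ProbabilityMeasure.coe_mk, Measure.map_id] at h1
  refine h1.congr fun n => ?_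
  exact integral_map (h.forall_aemeasurable n) g.continuous.measurable.aestronglyMeasurable

theorem tendsto_ite_of_tendsto {α E : Type*} [TopologicalSpace E] {l : Filter α} {X : α → E} {c : E}
    (h : Tendsto X l (𝓝 c)) (p : α → Prop) [DecidablePred p] :
    Tendsto (fun x => if p x then X x else c) l (𝓝 c) := by
  intro U hU
  have h1 : X ⁻¹' U ∈ l := h hU
  rw [mem_map]
  filter_upwards [h1] with x hx
  rw [Set.mem_preimage]
  split_ifs
  · exact hx
  · exact mem_of_mem_nhds hU

theorem tendstoMixedNormal_of_indepFun {Ω : Type*} [MeasurableSpace Ω] {P : Measure Ω}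
    [IsProbabilityMeasure P] {J m : ℕ} {r : Fin J → ℕ} {z : ℕ → Ω → Fin J}
    (hz : ∀ n, Measurable (z n))
    {X : (n : ℕ) → (k : Fin J) → Ω → EuclideanSpace ℝ (Fin (r k))}
    (hzX : ∀ n k, IndepFun (z n) (X n k) P) {S : (k : Fin J) → Matrix (Fin (r k)) (Fin (r k)) ℝ}
    (hS : ∀ k, (S k).PosSemidef) (hX : ∀ k, TendstoInDistribution (fun n => X n k) atTop id
      (fun _ => P) (multivariateGaussian 0 (S k)))
    {A : (n : ℕ) → Ω → (k : Fin J) → Matrix (Fin m) (Fin (r k)) ℝ}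
    (hA : ∀ n k a b, Measurable fun ω => A n ω k a b) {B : (k : Fin J) → Matrix (Fin m) (Fin (r k)) ℝ}
    (hAB : ∀ k, Tendsto (fun x : ℕ × Ω => A x.1 x.2 k) (whp P) (𝓝 (B k)))
    {Y : ℕ → Ω → EuclideanSpace ℝ (Fin m)} (hY : ∀ n, Measurable (Y n))
    (hXm : ∀ n k, Measurable (X n k))
    (h : ∀ k, Tendsto (fun x : ℕ × Ω => (if z x.1 x.2 = k then (1 : ℝ) else 0) • (Y x.1 x.2 -
      WithLp.toLp 2 (A x.1 x.2 k *ᵥ (X x.1 k x.2).ofLp))) (whp P) (𝓝 0)) :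
    TendstoMixedNormal P Y z fun k => B k * S k * (B k)ᵀ := by
  classical
  refine ⟨fun n => (hY n).aemeasurable, fun k g => ?_⟩
  have hzk : ∀ n, MeasurableSet {ω | z n ω = k} := fun n => hz n (measurableSet_singleton k)
  set V : ℕ → Ω → EuclideanSpace ℝ (Fin m) := fun n ω => WithLp.toLp 2 (B k *ᵥ (X n k ω).ofLp) with hV
  have hVm : ∀ n, Measurable (V n) := fun n => (continuous_toLp_mulVec (B k)).measurable.comp (hXm n k)
  have dV : TendstoInDistribution V atTop id (fun _ => P)
      (multivariateGaussian 0 (B k * S k * (B k)ᵀ)) :=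
    tendstoInDistribution_mulVec_add (hS k) (hX k) (A := fun _ _ => B k)
      (fun _ _ _ => measurable_const) tendsto_const_nhds hVm (by simpa only [hV, sub_self] using tendsto_const_nhds)
  have hA' := tendsto_ite_of_tendsto (hAB k) fun x : ℕ × Ω => z x.1 x.2 = k
  have dY : TendstoInDistribution (fun n ω => if z n ω = k then Y n ω else V n ω) atTop id
      (fun _ => P) (multivariateGaussian 0 (B k * S k * (B k)ᵀ)) := by
    refine tendstoInDistribution_mulVec_add (hS k) (hX k)
      (A := fun n ω => if z n ω = k then A n ω k else B k) (fun n a b => ?_) hA'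
      (fun n => Measurable.ite (hzk n) (hY n) (hVm n)) ((h k).congr fun x => ?_)
    · have : (fun ω => (if z n ω = k then A n ω k else B k) a b) =
          fun ω => if z n ω = k then A n ω k a b else B k a b := by
        funext ω; split_ifs <;> rfl
      rw [this]
      exact Measurable.ite (hzk n) (hA n k a b) measurable_const
    · by_cases hk : z x.1 x.2 = k <;> simp [hk, hV]
  have iY := tendsto_integral_of_tendstoInDistribution dY g
  have iV := tendsto_integral_of_tendstoInDistribution dV g
  set G := ∫ y, g y ∂(multivariateGaussian 0 (B k * S k * (B k)ᵀ)) with hG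
  have hbg : ∀ {Z : Ω → EuclideanSpace ℝ (Fin m)}, Measurable Z → Integrable (fun ω => g (Z ω)) P :=
    fun hZ => Integrable.of_bound (g.continuous.measurable.comp hZ).aestronglyMeasurable ‖g‖
      (Eventually.of_forall fun ω => g.norm_coe_le_norm _)
  have hind : ∀ n, ∫ ω in {ω | z n ω = k}, g (V n ω) ∂P =
      P.real {ω | z n ω = k} * ∫ ω, g (V n ω) ∂P := fun n => by
    have e := (hzX n k).integral_fun_comp_mul_comp (hz n).aemeasurable (hXm n k).aemeasurable
      (f := fun j => if j = k then (1 : ℝ) else 0)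
      (g := fun y : EuclideanSpace ℝ (Fin (r k)) => g (WithLp.toLp 2 (B k *ᵥ y.ofLp)))
      (measurable_of_finite _).aestronglyMeasurable
      (g.continuous.comp (continuous_toLp_mulVec (B k))).measurable.aestronglyMeasurable
    have e1 : ∫ ω, (if z n ω = k then (1 : ℝ) else 0) ∂P = P.real {ω | z n ω = k} := by
      have : (fun ω => if z n ω = k then (1 : ℝ) else 0) =
          Set.indicator {ω | z n ω = k} fun _ => (1 : ℝ) := by
        funext ω; simp [Set.indicator_apply]
      rw [this, integral_indicator_const _ (hzk n), smul_eq_mul, mul_one]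
    rw [e1] at e
    rw [← e, ← integral_indicator (hzk n)]
    congr 1
    funext ω
    simp [Set.indicator_apply, hV]
  have hsplit : ∀ n, ∫ ω, g (if z n ω = k then Y n ω else V n ω) ∂P - ∫ ω, g (V n ω) ∂P =
      ∫ ω in {ω | z n ω = k}, g (Y n ω) ∂P - ∫ ω in {ω | z n ω = k}, g (V n ω) ∂P := fun n => by
    rw [← integral_sub (hbg (Measurable.ite (hzk n) (hY n) (hVm n))) (hbg (hVm n)),
      ← integral_sub (hbg (hY n)).integrableOn (hbg (hVm n)).integrableOn,
      ← integral_indicator (hzk n)]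
    congr 1
    funext ω
    by_cases hk : z n ω = k <;> simp [hk]
  have hprob : ∀ n, ‖P.real {ω | z n ω = k}‖ ≤ 1 := fun n => by
    rw [Real.norm_of_nonneg measureReal_nonneg]; exact measureReal_le_one
  have l1 : Tendsto (fun n => P.real {ω | z n ω = k} * (∫ ω, g (V n ω) ∂P - G)) atTop (𝓝 0) := by
    have e : Tendsto (fun n => ∫ ω, g (V n ω) ∂P - G) atTop (𝓝 0) := by
      simpa using iV.sub_const G
    have e2 := e.norm
    rw [norm_zero] at e2
    refine squeeze_zero_norm (fun n => ?_) e2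
    rw [norm_mul]
    exact mul_le_of_le_one_left (norm_nonneg _) (hprob n)
  have l2 := (iY.sub iV).add l1
  simp only [sub_self, add_zero] at l2
  refine l2.congr fun n => ?_
  rw [hsplit, hind]
  ring

namespace EigenData

variable {J : ℕ} {r : Fin J → ℕ} {SigF SigL : (j : Fin J) → Matrix (Fin (r j)) (Fin (r j)) ℝ}
  (E : EigenData SigF SigL) (j : Fin J)

theorem root_inv_transpose : ((E.root j)⁻¹)ᵀ = (E.root j)⁻¹ := by
  rw [Matrix.transpose_nonsing_inv, E.root_transpose]

theorem inv_diagonal_mul_limitH_transpose (hF : (SigF j).PosDef) :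
    (Matrix.diagonal (E.v j))⁻¹ * (E.limitH j)ᵀ =
      Matrix.diagonal (fun l => (√(E.v j l))⁻¹) * (E.Υ j)ᵀ * (E.root j)⁻¹ := by
  have h1 := E.inv_smul_diagonal j hF one_ne_zero
  rw [one_smul, inv_one, one_smul] at h1
  have h2 := congrArg Matrix.transpose (E.diagonal_sqrt_mul_inv j hF)
  rw [Matrix.transpose_mul, diagonal_transpose, diagonal_transpose, diagonal_transpose] at h2
  rw [h1, limitH, Matrix.transpose_mul, Matrix.transpose_mul, E.root_inv_transpose,
    diagonal_transpose, ← Matrix.mul_assoc, h2, Matrix.mul_assoc]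

theorem padMatrix_factorCov_eq (m : ℕ) (Γ : Matrix (Fin (r j)) (Fin (r j)) ℝ) :
    padMatrix m (E.factorCov j Γ) =
      (padOp m (r j) * (Matrix.diagonal (fun l => (√(E.v j l))⁻¹) * (E.Υ j)ᵀ * (E.root j)⁻¹)) * Γ *
      (padOp m (r j) * (Matrix.diagonal (fun l => (√(E.v j l))⁻¹) * (E.Υ j)ᵀ * (E.root j)⁻¹))ᵀ := by
  rw [padMatrix_eq, factorCov]
  simp only [Matrix.transpose_mul, Matrix.transpose_transpose, E.root_inv_transpose,
    diagonal_transpose, Matrix.mul_assoc]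

end EigenData

namespace Panel

theorem Fitted.tendsto_factorCoeff (h : D.Fitted L s2 p P q SigF l) (hq : ∀ j, 0 < q j)
    (hF : ∀ j, (SigF j).PosDef) (E : EigenData SigF SigL) (j : Fin J)
    (hW : Tendsto (fun x : ℕ × Ω => D.W L s2 p x.1 x.2 j) l (𝓝 (q j • Matrix.diagonal (E.v j))))
    (hH : Tendsto (fun x : ℕ × Ω => D.H L s2 p x.1 x.2 j) l (𝓝 (E.limitH j))) :
    Tendsto (fun x : ℕ × Ω => D.factorCoeff L s2 p x.1 x.2 j) l (𝓝 (padOp (maxRank r) (r j) *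
      (Matrix.diagonal (fun l => (√(E.v j l))⁻¹) * (E.Υ j)ᵀ * (E.root j)⁻¹))) := by
  have hm := h.tendsto_mean_prob j
  have hg : Tendsto (fun x : ℕ × Ω => D.fitGram L s2 x.1 x.2 j) l
      (𝓝 (Matrix.diagonal (E.v j))) := by
    have h1 := (hm.inv₀ (hq j).ne').smul hW
    rw [smul_smul, inv_mul_cancel₀ (hq j).ne', one_smul] at h1
    refine h1.congr' ?_
    filter_upwards [hm.eventually_ne (hq j).ne'] with x hx
    rw [W, smul_smul, inv_mul_cancel₀ hx, one_smul, fitGram]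
  have hu : IsUnit (Matrix.diagonal (E.v j)).det := by
    rw [det_diagonal]
    exact (Finset.prod_ne_zero_iff.2 fun a _ => (E.v_pos j (hF j) a).ne').isUnit
  have h2 := (tendsto_matrix_inv hg hu).mul ((continuous_id.matrix_transpose.tendsto _).comp hH)
  have h3 : Tendsto (fun x : ℕ × Ω => (D.fitGram L s2 x.1 x.2 j)⁻¹ * (D.H L s2 p x.1 x.2 j)ᵀ) l
      (𝓝 (Matrix.diagonal (fun l => (√(E.v j l))⁻¹) * (E.Υ j)ᵀ * (E.root j)⁻¹)) := by
    rw [← E.inv_diagonal_mul_limitH_transpose j (hF j)]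
    exact h2
  exact ((continuous_const.matrix_mul continuous_id).tendsto _).comp h3

theorem measurable_factorCoeff (hmL : ∀ n j i a, Measurable fun ω => L n ω j i a)
    (hms : ∀ n, Measurable (s2 n)) (hmp : ∀ n t j, Measurable fun ω => p n t ω j) (n : ℕ) (j : Fin J)
    (a : Fin (maxRank r)) (b : Fin (r j)) : Measurable fun ω => D.factorCoeff L s2 p n ω j a b := by
  refine measurable_matrix_mul (A := fun _ => padOp (maxRank r) (r j)) (fun _ _ => measurable_const)
    (measurable_matrix_mul (measurable_inv_apply fun a b => ?_)
      fun a b => measurable_H hmL hms hmp n j b a) a b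
  simp only [fitGram, Matrix.add_apply, Matrix.smul_apply, smul_eq_mul]
  exact ((measurable_matrix_mul (A := fun ω => (L n ω j)ᵀ) (fun a b => hmL n j b a)
    (hmL n j) a b).const_mul _).add (((hms n).div_const _).mul_const _)

/-- The main term of the factor error. -/
def loadingMean (D : Panel Ω r) (t n : ℕ) (k : Fin J) (ω : Ω) : EuclideanSpace ℝ (Fin (r k)) :=
  (1 / √(D.N n : ℝ)) • ∑ i ∈ Finset.range (D.N n), D.error n i t ω • D.loading n k i

theorem measurable_loadingMean (t n : ℕ) (k : Fin J) : Measurable (D.loadingMean t n k) :=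
  (Finset.measurable_sum _ fun i _ => (D.measurable_error n i t).smul_const _).const_smul
    (1 / √(D.N n : ℝ))

theorem StateIndepError.indepFun_loadingMean (h : D.StateIndepError P) (t n : ℕ) (k : Fin J) :
    IndepFun (D.state n t) (D.loadingMean t n k) P :=
  (h n).comp (φ := fun z : ℕ → Fin J => z t) (ψ := fun e : ℕ → ℕ → ℝ => (1 / √(D.N n : ℝ)) •
    ∑ i ∈ Finset.range (D.N n), e i t • D.loading n k i) (measurable_pi_apply t)
    ((Finset.measurable_sum _ fun i _ => ((measurable_pi_apply t).comp
      (measurable_pi_apply i)).smul_const _).const_smul (1 / √(D.N n : ℝ)))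

theorem tendstoMixedNormal_factorError [Nonempty (Fin J)] [IsProbabilityMeasure P]
    (h : Often P fun l => D.Fitted L s2 p P q SigF l) (hq : ∀ j, 0 < q j) (hα : 2 ≤ α) (hβ : 2 ≤ β)
    (hind : D.StateIndepError P)
    (hF : D.FactorAssumption P q α SigF) (hΛ : D.LoadingAssumption SigL)
    (he : D.ErrorAssumption P α) (hLE : D.LoadingErrorMoment P β) (hA : D.LimitAssumption P q Φ Γ)
    (E : EigenData SigF SigL)
    (hmL : ∀ n j i a, Measurable fun ω => L n ω j i a) (hms : ∀ n, Measurable (s2 n))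
    (hmp : ∀ n t j, Measurable fun ω => p n t ω j)
    (hW : ∀ j, Tendsto (fun x : ℕ × Ω => D.W L s2 p x.1 x.2 j) (whp P)
      (𝓝 (q j • Matrix.diagonal (E.v j))))
    (hH : ∀ j, Tendsto (fun x : ℕ × Ω => D.H L s2 p x.1 x.2 j) (whp P) (𝓝 (E.limitH j)))
    (hr : Tendsto (fun n => √(D.N n : ℝ) / D.T n) atTop (𝓝 0)) (t : ℕ) :
    TendstoMixedNormal P (fun n ω => √(D.N n : ℝ) • D.factorError L s2 p n t ω)
      (fun n => D.state n t) (fun k => padMatrix (maxRank r) (E.factorCov k (Γ k t))) := by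
  have hlim := fun k => tendsto_whp_of_often (h.mono fun l hl h =>
    h.tendsto_factorCoeff hq hF.posDef E k ((hW k).mono_left hl) ((hH k).mono_left hl))
  have hm : ∀ n, Measurable fun ω => √(D.N n : ℝ) • D.factorError L s2 p n t ω := fun n =>
    (measurable_factorError hmL hms hmp n t).const_smul (√(D.N n : ℝ))
  have hY := fun k => tendsto_whp_of_often ((((h.and (often_loadingFactor hA k)).and
      (often_factor_products hα hF he hA k t)).and (often_bound_at_date hα hβ hF he hLE t)).mono
      fun l hl h => h.1.1.1.tendsto_factorError_sub hq hΛ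
        (exists_H_inv_bound hF.posDef E fun j => (hH j).mono_left hl) k t h.1.1.2 h.1.2 h.2 hr)
  have hmA := measurable_factorCoeff (D := D) hmL hms hmp
  have hX : ∀ k, TendstoInDistribution (fun n => D.loadingMean t n k) atTop id (fun _ => P)
    (multivariateGaussian 0 (Γ k t)) := fun k => hA.cltCross k t
  simp only [E.padMatrix_factorCov_eq]
  exact tendstoMixedNormal_of_indepFun (fun n => D.measurable_state n t)
    (fun n k => hind.indepFun_loadingMean t n k) (fun k => hA.Γ_posSemidef k t) hX
    hmA hlim hm (fun n k => measurable_loadingMean t n k) hY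

end Panel

/-! ### The estimator with relabelled regimes and aligned signs -/

theorem tendstoInMeasure_apply {Ω : Type*} [MeasurableSpace Ω] {P : Measure Ω} {m k : ℕ}
    {X : ℕ → Ω → Matrix (Fin m) (Fin k) ℝ} {M : Matrix (Fin m) (Fin k) ℝ}
    (h : Tendsto (fun x : ℕ × Ω => X x.1 x.2) (whp P) (𝓝 M)) (a : Fin m) (b : Fin k) :
    TendstoInMeasure P (fun n ω => X n ω a b) atTop fun _ => M a b :=
  tendstoInMeasure_iff_whp.2 (((continuous_id.matrix_elem a b).tendsto M).comp h)

namespace Panel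

variable [IsProbabilityMeasure P]

theorem often_fitted [Nonempty (Fin J)] (hL : D.IsMLE θ L s2) (hα : 16 < α) (hβ : 2 ≤ β)
    (hs2 : BoundedAwayInProb P s2)
    (hF : D.FactorAssumption P q α SigF) (hΛ : D.LoadingAssumption SigL)
    (he : D.ErrorAssumption P α) (hz : D.StateAssumption P q)
    (hid : D.IdentificationAssumption P) (hA : D.LoadingErrorMoment P β)
    (hB : D.FactorErrorMoment P) (hR : D.RateCondition α β) (ς : Signs Ω r) :
    Often P fun l => D.Fitted (D.aligned (relabel hL) ς L) s2
      (fun n t ω j => D.prob θ L s2 n t ω ((relabel hL).perm n ω j)) P q SigF l := by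
  have hp := eventually_abs_prob_sub_ind_le_inv_sq hL hα hβ hs2 hF hΛ he hz hid hA hR
  exact (((often_estim hL (by linarith) hs2 hF hΛ he hz hid).and
    (Often.forall_fin fun j => often_EF hB j)).and
    (Often.forall_fin fun j => often_loading_errors hβ hA j)).mono fun l hl h =>
      h.1.1.fitted hL ς (hl hp) h.1.2 h.2

theorem isBigOp_loadings [Nonempty (Fin J)] (h : Often P fun l => D.Fitted L s2 p P q SigF l)
    (hq : ∀ j, 0 < q j) (hΛ : D.LoadingAssumption SigL) (j : Fin J) :
    IsBigOp P (fun n ω => (1 / (D.N n : ℝ)) * frobSq (L n ω j - D.L0 n j * D.H L s2 p n ω j))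
      (fun n => 1 / D.δ n ^ 2) := by
  refine IsBigOp.of_often (fun n => by positivity) (h.mono fun l hl h => ?_)
  obtain ⟨C, hC, h1⟩ := h.exists_fn_sub_le hq hΛ
  refine ⟨C ^ 2, ?_⟩
  filter_upwards [h1, h.eventually_N_pos] with x hx hN
  rw [frobSq_eq, abs_of_nonneg (by positivity), one_div, inv_mul_le_iff₀ hN]
  refine (pow_le_pow_left₀ (fn_nonneg _) (hx j) 2).trans (le_of_eq ?_)
  rw [mul_pow, mul_pow, Real.sq_sqrt hN.le, _root_.one_div_pow]
  ring

theorem isBigOp_factors [Nonempty (Fin J)] (h : Often P fun l => D.Fitted L s2 p P q SigF l)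
    (hq : ∀ j, 0 < q j) (hF : ∀ j, (SigF j).PosDef) (hΛ : D.LoadingAssumption SigL)
    (E : EigenData SigF SigL)
    (hH : ∀ j, Tendsto (fun x : ℕ × Ω => D.H L s2 p x.1 x.2 j) (whp P) (𝓝 (E.limitH j))) :
    IsBigOp P (fun n ω => (1 / (D.T n : ℝ)) * ∑ t ∈ Finset.range (D.T n),
      ‖D.factorError L s2 p n t ω‖ ^ 2) (fun n => 1 / D.δ n ^ 2) := by
  refine IsBigOp.of_often (fun n => by positivity) (h.mono fun l hl h => ?_)
  obtain ⟨C, hC, h1⟩ := h.exists_mean_sq_factorError_le hq hΛ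
    (exists_H_inv_bound hF E fun j => (hH j).mono_left hl)
  refine ⟨C, ?_⟩
  filter_upwards [h1] with x hx
  rwa [abs_of_nonneg (by positivity)]

theorem asymptotics_of_often_fitted [Nonempty (Fin J)]
    (h : Often P fun l => D.Fitted L s2 p P q SigF l) (hq : ∀ j, 0 < q j) (hα : 2 ≤ α) (hβ : 2 ≤ β)
    (hind : D.StateIndepError P) (hF : D.FactorAssumption P q α SigF)
    (hΛ : D.LoadingAssumption SigL) (he : D.ErrorAssumption P α) (hA : D.LoadingErrorMoment P β)
    (E : EigenData SigF SigL)
    (hmL : ∀ n j i a, Measurable fun ω => L n ω j i a) (hms : ∀ n, Measurable (s2 n))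
    (hmp : ∀ n t j, Measurable fun ω => p n t ω j)
    (hs : ∀ n ω j a, 0 ≤ ((E.Υ j)ᵀ * (E.root j)⁻¹ * ((D.L0 n j)ᵀ * L n ω j)) a a) :
    (∀ j a b, TendstoInMeasure P (fun n ω => D.W L s2 p n ω j a b) atTop
      (fun _ => q j * Matrix.diagonal (E.v j) a b)) ∧
    (∀ j a b, TendstoInMeasure P (fun n ω => D.H L s2 p n ω j a b) atTop
      (fun _ => E.limitH j a b)) ∧
    (∀ j, IsBigOp P
      (fun n ω => (1 / (D.N n : ℝ)) * frobSq (L n ω j - D.L0 n j * D.H L s2 p n ω j))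
      (fun n => 1 / D.δ n ^ 2)) ∧
    ∀ Φ Γ : (j : Fin J) → ℕ → Matrix (Fin (r j)) (Fin (r j)) ℝ, D.LimitAssumption P q Φ Γ →
      (Tendsto (fun n => √(D.T n : ℝ) / D.N n) atTop (𝓝 0) → ∀ j (i : ℕ),
        TendstoInDistribution (fun n ω => √(D.T n * q j) • D.loadingError L s2 p n j i ω)
          atTop id (fun _ => P) (multivariateGaussian 0 (E.loadingCov j (Φ j i)))) ∧
      (Tendsto (fun n => √(D.N n : ℝ) / D.T n) atTop (𝓝 0) →
        IsBigOp P (fun n ω => (1 / (D.T n : ℝ)) * ∑ t ∈ Finset.range (D.T n),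
          ‖D.factorError L s2 p n t ω‖ ^ 2) (fun n => 1 / D.δ n ^ 2) ∧
        ∀ t : ℕ, TendstoMixedNormal P (fun n ω => √(D.N n : ℝ) • D.factorError L s2 p n t ω)
          (fun n => D.state n t) (fun k => padMatrix (maxRank r) (E.factorCov k (Γ k t)))) := by
  have hW : ∀ j, Tendsto (fun x : ℕ × Ω => D.W L s2 p x.1 x.2 j) (whp P)
      (𝓝 (q j • Matrix.diagonal (E.v j))) := fun j => tendsto_whp_of_often (h.mono fun l _ h =>
    (h.tendsto_W_H hq hΛ E (Eventually.of_forall fun x => hs x.1 x.2) j).1)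
  have hH : ∀ j, Tendsto (fun x : ℕ × Ω => D.H L s2 p x.1 x.2 j) (whp P) (𝓝 (E.limitH j)) :=
    fun j => tendsto_whp_of_often (h.mono fun l _ h =>
      (h.tendsto_W_H hq hΛ E (Eventually.of_forall fun x => hs x.1 x.2) j).2)
  have h3 : ∀ j a b, TendstoInMeasure P (fun n ω => D.W L s2 p n ω j a b) atTop
      (fun _ => q j * Matrix.diagonal (E.v j) a b) := fun j a b => 
    tendstoInMeasure_apply (X := fun n ω => D.W L s2 p n ω j) (hW j) a b
  have h4 : ∀ j a b, TendstoInMeasure P (fun n ω => D.H L s2 p n ω j a b) atTop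
      (fun _ => E.limitH j a b) := fun j a b => 
    tendstoInMeasure_apply (X := fun n ω => D.H L s2 p n ω j) (hH j) a b
  refine ⟨h3, h4, isBigOp_loadings h hq hΛ, fun Φ Γ hLA => ⟨fun hr j i => ?_, fun hr => ⟨?_, fun t => ?_⟩⟩⟩
  · exact tendstoInDistribution_loadingError h hq hF hΛ he hLA E hmL hms hmp j i (hW j) (hH j) hr
  · exact isBigOp_factors h hq hF.posDef hΛ E hH
  · exact tendstoMixedNormal_factorError h hq hα hβ hind hF hΛ he hA hLA E hmL hms hmp hW hH hr t

end Panel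

end RegimeSwitching

end

theorem theorem6 {Ω : Type*} [MeasurableSpace Ω] (P : Measure Ω) [IsProbabilityMeasure P]
    {J : ℕ} {r : Fin J → ℕ} (D : Panel Ω r) (hind : D.StateIndepError P)
    (α β : ℝ) (hα : 16 < α) (hβ : 2 ≤ β) (q : Fin J → ℝ)
    (SigF SigL : (j : Fin J) → Matrix (Fin (r j)) (Fin (r j)) ℝ)
    (θ : MarkovParam J)
    (L : (n : ℕ) → Ω → (j : Fin J) → Matrix (Fin (D.N n)) (Fin (r j)) ℝ) (s2 : ℕ → Ω → ℝ)
    (hL : D.IsMLE θ L s2) (hs2 : BoundedAwayInProb P s2)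
    (hF : D.FactorAssumption P q α SigF) (hΛ : D.LoadingAssumption SigL)
    (he : D.ErrorAssumption P α) (hz : D.StateAssumption P q) :
    -- (i) without identification of the regimes, each true loading space is estimated by some slot
    (∃ κ : ℕ → Ω → Fin J → Fin J, (∀ n j, Measurable fun ω => κ n ω j) ∧
      ∀ j, IsBigOp P
        (fun n ω => (1 / (D.N n : ℝ)) * frobSq (annihilator (L n ω (κ n ω j)) * D.L0 n j))
        (fun n => 1 / √(D.δ n))) ∧
    (D.IdentificationAssumption P → ∃ π : Relabelling Ω r,
      -- (i) with identification, for one relabelling of the regimes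
      (∀ j, IsBigOp P
        (fun n ω => (1 / (D.N n : ℝ)) * frobSq (annihilator (L n ω (π.perm n ω j)) * D.L0 n j))
        (fun n => 1 / √(D.δ n))) ∧
      -- (ii)
      (D.LoadingErrorMoment P β → ∀ j, ∀ η : ℝ, 0 < η →
        (∀ t : ℕ, IsLittleOp P
          (fun n ω => D.prob θ L s2 n t ω (π.perm n ω j) - D.ind n j t ω)
          (fun n => 1 / (D.N n : ℝ) ^ η)) ∧
        (D.RateCondition α β → IsLittleOp P
          (fun n ω => ⨆ t : Fin (D.T n), |D.prob θ L s2 n t ω (π.perm n ω j) - D.ind n j t ω|)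
          (fun n => 1 / (D.N n : ℝ) ^ η))) ∧
      (D.LoadingErrorMoment P β → D.FactorErrorMoment P → D.RateCondition α β →
        ∀ E : EigenData SigF SigL, ∃ ς : Signs Ω r,
          let Lt := D.aligned π ς L
          let p := fun n t ω j => D.prob θ L s2 n t ω (π.perm n ω j)
          -- (iii)
          (∀ j a b, TendstoInMeasure P (fun n ω => D.W Lt s2 p n ω j a b) atTop
            (fun _ => q j * Matrix.diagonal (E.v j) a b)) ∧
          (∀ j a b, TendstoInMeasure P (fun n ω => D.H Lt s2 p n ω j a b) atTop
            (fun _ => E.limitH j a b)) ∧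
          -- (iv)
          (∀ j, IsBigOp P
            (fun n ω => (1 / (D.N n : ℝ)) * frobSq (Lt n ω j - D.L0 n j * D.H Lt s2 p n ω j))
            (fun n => 1 / D.δ n ^ 2)) ∧
          ∀ Φ Γ : (j : Fin J) → ℕ → Matrix (Fin (r j)) (Fin (r j)) ℝ,
            D.LimitAssumption P q Φ Γ →
            -- (v)
            (Tendsto (fun n => √(D.T n : ℝ) / D.N n) atTop (𝓝 0) → ∀ j (i : ℕ),
              TendstoInDistribution
                (fun n ω => √(D.T n * q j) • D.loadingError Lt s2 p n j i ω)
                atTop id (fun _ => P) (multivariateGaussian 0 (E.loadingCov j (Φ j i)))) ∧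
            -- (vi)
            (Tendsto (fun n => √(D.N n : ℝ) / D.T n) atTop (𝓝 0) →
              IsBigOp P
                (fun n ω => (1 / (D.T n : ℝ)) * ∑ t ∈ Finset.range (D.T n),
                  ‖D.factorError Lt s2 p n t ω‖ ^ 2)
                (fun n => 1 / D.δ n ^ 2) ∧
              ∀ t : ℕ, TendstoMixedNormal P
                (fun n ω => √(D.N n : ℝ) • D.factorError Lt s2 p n t ω)
                (fun n => D.state n t)
                (fun k => padMatrix (maxRank r) (E.factorCov k (Γ k t)))))) := by
  have hJ : Nonempty (Fin J) := by
    obtain ⟨ω⟩ := P.nonempty_of_neZero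
    exact ⟨D.state 0 0 ω⟩
  have hα2 : 2 ≤ α := by linarith
  refine ⟨⟨D.slot L s2, Panel.measurable_slot hL,
    Panel.isBigOp_slot hL hα2 hs2 hF hΛ he hz (Eventually.of_forall fun _ _ => rfl)⟩,
    fun hid => ⟨Panel.relabel hL, ?_, ?_, ?_⟩⟩
  · exact Panel.isBigOp_slot hL hα2 hs2 hF hΛ he hz (κ := fun n ω => (Panel.relabel hL).perm n ω)
      (eventually_whp_of_often ((Panel.often_estim hL hα2 hs2 hF hΛ he hz hid).mono fun l _ h =>
        h.eventually_relabel hL))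
  · exact fun hA j η _ => ⟨Panel.isLittleOp_prob hL hα2 hβ hs2 hF hΛ he hz hid hA j η,
      fun hR => Panel.isLittleOp_iSup_prob hL hα hβ hs2 hF hΛ he hz hid hA hR j η⟩
  intro hA hB hR E
  have hm := hL.measurable_loading
  refine ⟨D.eigenSigns E (Panel.relabel hL) L hm, ?_⟩
  have hfit := Panel.often_fitted hL hα hβ hs2 hF hΛ he hz hid hA hB hR (D.eigenSigns E (Panel.relabel hL) L hm)
  have hmL := Panel.measurable_aligned (Panel.relabel hL) (D.eigenSigns E (Panel.relabel hL) L hm) hm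
  have hmp : ∀ n t j, Measurable fun ω => D.prob θ L s2 n t ω ((Panel.relabel hL).perm n ω j) :=
    fun n t j => Panel.measurable_at_perm (Panel.relabel hL) j fun k => Panel.measurable_prob hL n t k
  exact Panel.asymptotics_of_often_fitted hfit hz.pos hα2 hβ hind hF hΛ he hA E hmL hL.measurable_s2 hmp
    (Panel.eigenSigns_nonneg E (Panel.relabel hL) hm)
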